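/- **Conventions.** Let $G$ be a compact connected Lie group with Lie algebra $\mathfrak g$, $B$ an $\operatorname{Ad}$-invariant inner product on $\mathfrak g$, $T\subseteq G$ a maximal torus with Lie algebra $\mathfrak t$, and $\Lambda=\ker(\exp\colon\mathfrak t\to T)$. Let $\theta,\overline\theta$ be the left and right Maurer–Cartan forms and $\eta=\frac1{12}B(\theta,[\theta,\theta])$. Generating vector fields are $\xi_M=\frac{d}{d\tau}\big|_{0}\exp(-\tau\xi)\cdot m$. A *group-valued Hamiltonian $G$-space* $(M,\omega,\Phi)$ is a compact $G$-manifold $M$ with an invariant 2-form $\omega$ and an equivariant smooth map $\Phi\colon M\to G$ (for conjugation) such that $d\omega=\Phi^*\eta$, $\iota(\xi_M)\omega=\frac12\Phi^*B(\theta+\overline\theta,\xi)$ for all $\xi\in\mathfrak g$, and $\ker\omega_m=\{\xi_M(m)\mid \operatorname{Ad}_{\Phi(m)}\xi=-\xi\}$ for all $m$. Fix a Sobolev level $f>1$. Let $S^1=\mathbb R/\mathbb Z$, let $LG$ be the Banach Lie group of loops $S^1\to G$ of Sobolev class $f+\frac12$, $L\mathfrak g$ its Lie algebra, $\Omega G=\{g\in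 LG: g(0)=e\}$, and let $L\mathfrak g^*\cong\Omega^1(S^1,\mathfrak g)$ (using $B$) be the space of $\mathfrak g$-valued 1-forms of Sobolev class $f-\frac12$, on which $LG$ acts by $g\cdot\mu=\operatorname{Ad}_g\mu-g^*\overline\theta$. Let $\operatorname{Hol}_s(\mu)=h(s)$, where $h^{-1}h'=\mu$, $h(0)=e$, let $\operatorname{Hol}=\operatorname{Hol}_1$, and let $\varpi=\frac12\int_0^1B(\operatorname{Hol}_s^*\overline\theta,\partial_s\operatorname{Hol}_s^*\overline\theta)\,ds$. A *Hamiltonian $LG$-manifold* $(\widehat M,\widehat\omega,\widehat\Phi)$ is a Banach manifold with a smooth $LG$-action, an invariant weakly symplectic (closed, with trivial kernel) 2-form $\widehat\omega$ and an equivariant smooth map $\widehat\Phi\colon\widehat M\to L\mathfrak g^*$ with $\iota(\xi_{\widehat M})\widehat\omega=d\langle\widehat\Phi,\xi\rangle$ for $\xi\in L\mathfrak g$. If $\widehat\Phi$ is proper, $(M,\omega,\Phi)$ is its *holonomy manifold* if $M=\widehat M/\Omega G$ with the induced action of $G=LG/\Omega G$, with quotient map $\pi$ (a surjective submersion), $\Phi\circ\pi=\operatorname{Hol}\circ\widehat\Phi$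 and $\widehat\omega-\widehat\Phi^*\varpi=\pi^*\omega$. The same definitions are used for $T$ with the inner product $B|_{\mathfrak t}$. The space $\mathfrak t$ is embedded in $L\mathfrak t^*\subseteq L\mathfrak g^*$ by $\xi\mapsto\xi\,ds$, and $\Lambda$ is embedded in $LT\subseteq LG$ by $\xi\mapsto(s\mapsto\exp(-s\xi))$. **Proposition 4.3.** Let $(M,\omega,\Phi)$ be a group-valued Hamiltonian $G$-space and $(\widehat M,\widehat\omega,\widehat\Phi)$ the corresponding Hamiltonian $LG$-manifold, i.e. the one with proper moment map whose holonomy manifold is $(M,\omega,\Phi)$. Let $t\in T$ be regular, i.e. its centralizer in $G$ is $T$, and let $F$ be a connected component of the fixed point set $M^t$. Let $\widehat F$ be the pre-image of $F$ under $\widehat M^t\to M^t$, and $\widetilde F=\widehat F\cap\widehat\Phi^{-1}(\mathfrak t)$. Then: (a) $F$ is a $T$-invariant embedded submanifold of $M$, $\Phi(F)\subseteq T$, and $F$ with the pull-backs $\omega_F,\Phi_F$ of $\omega,\Phi$ is a group-valued Hamiltonian $T$-space. (b) $\widehat F$ is an $LT$-invariant embedded (possibly disconnected) Banach submanifold of $\widehat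 M$, $\widehat\Phi(\widehat F)\subseteq L\mathfrak t^*$, and $\widehat F$ with the pull-backs of $\widehat\omega,\widehat\Phi$ is a Hamiltonian $LT$-manifold with proper moment map. Its holonomy manifold is $(F,\omega_F,\Phi_F)$, with the quotient map being the restriction of $\pi$. (c) $\widetilde F$ is a $T$-invariant finite-dimensional embedded submanifold of $\widehat M$ and, with the pull-backs of $\widehat\omega,\widehat\Phi$, is a Hamiltonian $T$-manifold. The lattice $\Lambda\subseteq LT$ preserves $\widetilde F$ and acts on it freely, smoothly and symplectically, commuting with $T$. One has $F=\widetilde F/\Lambda$ as a symplectic $T$-manifold: $\pi$ restricts to a surjective, $T$-equivariant local diffeomorphism $\widetilde F\to F$ whose fibres are the $\Lambda$-orbits and which pulls $\omega_F$ back to the 2-form of $\widetilde F$. Moreover $\widetilde F=\widehat F/\Omega_0T$, where $\Omega_0T$ is the identity component of $\Omega T$: there is a smooth submersion $\widehat F\to\widetilde F$ which is the identity on $\widetilde F$ and whose fibres are the $\Omega_0T$-orbits. -/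

import Mathlib

open scoped Manifold ContDiff Topology
open Set MeasureTheory

universe u

noncomputable section

namespace LoopGeometry

/-! ### Differential forms on (Banach) manifolds without boundary -/

section Forms

variable {E : Type*} [NormedAddCommGroup E] [NormedSpace ℝ E]
  {M : Type*} [TopologicalSpace M] [ChartedSpace E M]
  {E' : Type*} [NormedAddCommGroup E'] [NormedSpace ℝ E']
  {N : Type*} [TopologicalSpace N] [ChartedSpace E' N]

/-- Real `k`-forms (not necessarily smooth) on a manifold `M` modelled on `E`. -/
abbrev Form (E : Type*) [NormedAddCommGroup E] [NormedSpace ℝ E]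
    (M : Type*) [TopologicalSpace M] [ChartedSpace E M] (k : ℕ) : Type _ :=
  (m : M) → TangentSpace 𝓘(ℝ, E) m [⋀^Fin k]→L[ℝ] ℝ

/-- The pull-back `φ^* σ` of a form along a map. -/
def Form.pullback {k : ℕ} (φ : N → M) (σ : Form E M k) : Form E' N k := fun x =>
  (σ (φ x)).compContinuousLinearMap (mfderiv 𝓘(ℝ, E') 𝓘(ℝ, E) φ x)

/-- The pull-back of a form to a subset `S` that is a manifold modelled on `E'`. -/
def Form.restrict {k : ℕ} (σ : Form E M k) (E' : Type*) [NormedAddCommGroup E']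
    [NormedSpace ℝ E'] (S : Set M) [ChartedSpace E' S] : Form E' S k :=
  Form.pullback (Subtype.val : S → M) σ

/-- The form `σ` written in the preferred chart around `m₀`. -/
def Form.inChart {k : ℕ} (σ : Form E M k) (m₀ : M) : E → E [⋀^Fin k]→L[ℝ] ℝ := fun y =>
  (σ ((extChartAt 𝓘(ℝ, E) m₀).symm y)).compContinuousLinearMap
    (mfderiv 𝓘(ℝ, E) 𝓘(ℝ, E) (extChartAt 𝓘(ℝ, E) m₀).symm y)

/-- A form is smooth if it is smooth in the charts of the atlas. -/
def Form.IsSmooth {k : ℕ} (σ : Form E M k) : Prop :=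
  ∀ m₀ : M, ContDiffOn ℝ ∞ (σ.inChart m₀) (extChartAt 𝓘(ℝ, E) m₀).target

/-- The exterior derivative. At `m` it is computed in the preferred chart at `m`, whose
differential at `m` is the identification of `T_m M` with `E`. -/
def Form.d {k : ℕ} (σ : Form E M k) : Form E M (k + 1) := fun m =>
  (extDeriv (σ.inChart m) (extChartAt 𝓘(ℝ, E) m m) : E [⋀^Fin (k + 1)]→L[ℝ] ℝ)

end Forms

/-! ### Sobolev spaces of functions on the circle `ℝ / ℤ` -/

section Sobolev

variable {V : Type*} [NormedAddCommGroup V] [NormedSpace ℝ V]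

/-- The real trigonometric system `cos (2 π n s)` (`n ≥ 0`), `sin (2 π n s)` (`n < 0`). -/
def harmonic (n : ℤ) (s : ℝ) : ℝ :=
  if 0 ≤ n then Real.cos (2 * Real.pi * n * s) else Real.sin (2 * Real.pi * n * s)

lemma continuous_harmonic (n : ℤ) : Continuous (harmonic n) := by
  unfold harmonic
  split_ifs <;> fun_prop

/-- The real Fourier coefficients of a vector-valued function on the circle. -/
def realCoeff (u : C(UnitAddCircle, V)) (n : ℤ) : V :=
  ∫ s in (0 : ℝ)..1, harmonic n s • u (s : UnitAddCircle)

lemma continuous_harmonic_smul (u : C(UnitAddCircle, V)) (n : ℤ) :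
    Continuous fun s : ℝ => harmonic n s • u (s : UnitAddCircle) :=
  (continuous_harmonic n).smul (u.continuous.comp (AddCircle.continuous_mk' 1))

lemma realCoeff_add (u v : C(UnitAddCircle, V)) (n : ℤ) :
    realCoeff (u + v) n = realCoeff u n + realCoeff v n := by
  simp only [realCoeff, ContinuousMap.add_apply, smul_add]
  exact intervalIntegral.integral_add ((continuous_harmonic_smul u n).intervalIntegrable _ _)
    ((continuous_harmonic_smul v n).intervalIntegrable _ _)

lemma realCoeff_smul (c : ℝ) (u : C(UnitAddCircle, V)) (n : ℤ) :
    realCoeff (c • u) n = c • realCoeff u n := by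
  simp only [realCoeff, ContinuousMap.smul_apply, smul_comm _ c]
  exact intervalIntegral.integral_smul c _

/-- The Fourier coefficients weighted by `(1 + n²)^(r/2)`. -/
def weightedCoeff (r : ℝ) (u : C(UnitAddCircle, V)) (n : ℤ) : V :=
  ((1 + (n : ℝ) ^ 2) ^ (r / 2)) • realCoeff u n

lemma weightedCoeff_add (r : ℝ) (u v : C(UnitAddCircle, V)) :
    weightedCoeff r (u + v) = weightedCoeff r u + weightedCoeff r v := by
  funext n
  simp [weightedCoeff, realCoeff_add]

lemma weightedCoeff_smul (r c : ℝ) (u : C(UnitAddCircle, V)) :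
    weightedCoeff r (c • u) = c • weightedCoeff r u := by
  funext n
  simp [weightedCoeff, realCoeff_smul, smul_comm c]

/-- The functions of Sobolev class `r`: those with `∑ (1 + n²)^r ‖û(n)‖² < ∞`. It is only used
for `r > 1 / 2`, where all functions of Sobolev class `r` are continuous. -/
def sobolevSubmodule (r : ℝ) (V : Type*) [NormedAddCommGroup V] [NormedSpace ℝ V] :
    Submodule ℝ C(UnitAddCircle, V) where
  carrier := {u | Memℓp (weightedCoeff r u) 2}
  add_mem' {u v} hu hv := by
    change Memℓp (weightedCoeff r (u + v)) 2
    rw [weightedCoeff_add]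
    exact Memℓp.add hu hv
  zero_mem' := by
    change Memℓp (weightedCoeff r 0) 2
    have h : weightedCoeff r (0 : C(UnitAddCircle, V)) = 0 := by
      have := weightedCoeff_smul r 0 (0 : C(UnitAddCircle, V))
      simpa using this
    rw [h]
    exact zero_memℓp
  smul_mem' c u hu := by
    change Memℓp (weightedCoeff r (c • u)) 2
    rw [weightedCoeff_smul]
    exact Memℓp.const_smul hu c

/-- The Sobolev space `H^r(ℝ/ℤ, V)`, normed by `‖u‖² = ∑ (1 + n²)^r ‖û(n)‖²`. -/
def Sobolev (r : ℝ) (V : Type*) [NormedAddCommGroup V] [NormedSpace ℝ V] : Type _ :=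
  sobolevSubmodule r V

instance (r : ℝ) : AddCommGroup (Sobolev r V) :=
  inferInstanceAs (AddCommGroup (sobolevSubmodule r V))

instance (r : ℝ) : Module ℝ (Sobolev r V) :=
  inferInstanceAs (Module ℝ (sobolevSubmodule r V))

/-- Elements of the Sobolev space are functions on the circle. -/
instance (r : ℝ) : CoeFun (Sobolev r V) (fun _ => UnitAddCircle → V) where
  coe u := u.1

/-- The weighted Fourier coefficients as an element of `ℓ²`. -/
def Sobolev.coeffs (r : ℝ) (V : Type*) [NormedAddCommGroup V] [NormedSpace ℝ V] :
    Sobolev r V →ₗ[ℝ] lp (fun _ : ℤ => V) 2 where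
  toFun u := ⟨weightedCoeff r u.1, u.2⟩
  map_add' u v := Subtype.ext (weightedCoeff_add r u.1 v.1)
  map_smul' c u := Subtype.ext (weightedCoeff_smul r c u.1)

lemma eq_zero_of_realCoeff [CompleteSpace V] (u : C(UnitAddCircle, V))
    (hu : ∀ n, realCoeff u n = 0) : u = 0 := by
  ext z
  simp only [ContinuousMap.zero_apply]
  refine (SeparatingDual.eq_zero_iff_forall_dual_eq_zero (R := ℝ) _).2 fun φ => ?_
  have hφ : ∀ n, ∫ s in (0 : ℝ)..1, harmonic n s * φ (u (s : UnitAddCircle)) = 0 := by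
    intro n
    have h := φ.intervalIntegral_comp_comm
      ((continuous_harmonic_smul u n).intervalIntegrable (μ := volume) 0 1)
    rw [show (∫ s in (0 : ℝ)..1, harmonic n s • u (s : UnitAddCircle)) = 0 from hu n] at h
    simpa using h
  have hcos : ∀ n : ℤ, ∫ s in (0 : ℝ)..1,
      Real.cos (2 * Real.pi * n * s) * φ (u (s : UnitAddCircle)) = 0 := by
    intro n
    rcases le_total 0 n with h | h
    · simpa [harmonic, h] using hφ n
    · have h' : (0 : ℤ) ≤ -n := by omega
      have := hφ (-n)
      simp only [harmonic, h', if_true] at this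
      refine Eq.trans (congrArg (fun v : ℝ → ℝ => ∫ s in (0 : ℝ)..1, v s) (funext fun s => ?_)) this
      rw [← Real.cos_neg]
      push_cast
      ring_nf
  have hsin : ∀ n : ℤ, ∫ s in (0 : ℝ)..1,
      Real.sin (2 * Real.pi * n * s) * φ (u (s : UnitAddCircle)) = 0 := by
    intro n
    rcases lt_trichotomy n 0 with h | h | h
    · simpa [harmonic, not_le.2 h] using hφ n
    · simp [h]
    · have h' : ¬ (0 : ℤ) ≤ -n := by omega
      have := hφ (-n)
      simp only [harmonic, h', if_false] at this
      rw [← neg_eq_zero, ← intervalIntegral.integral_neg]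
      refine Eq.trans (congrArg (fun v : ℝ → ℝ => ∫ s in (0 : ℝ)..1, v s) (funext fun s => ?_)) this
      rw [← neg_mul, ← Real.sin_neg]
      push_cast
      ring_nf
  let w : C(UnitAddCircle, ℂ) := ⟨fun x => ((φ (u x) : ℝ) : ℂ), by fun_prop⟩
  have hw : ∀ n, fourierCoeff w n = 0 := by
    intro n
    rw [fourierCoeff_eq_intervalIntegral w n 0]
    have hcont : Continuous fun s : ℝ => φ (u (s : UnitAddCircle)) :=
      φ.continuous.comp (u.continuous.comp (AddCircle.continuous_mk' 1))
    have key : ∀ s : ℝ, fourier (-n) (s : UnitAddCircle) • w (s : UnitAddCircle) =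
        ((Real.cos (2 * Real.pi * n * s) * φ (u (s : UnitAddCircle)) : ℝ) : ℂ) -
        Complex.I * ((Real.sin (2 * Real.pi * n * s) * φ (u (s : UnitAddCircle)) : ℝ) : ℂ) := by
      intro s
      rw [fourier_coe_apply]
      have : (2 * Real.pi * Complex.I * ((-n : ℤ) : ℂ) * (s : ℂ) / ((1 : ℝ) : ℂ)) =
          ((-(2 * Real.pi * n * s) : ℝ) : ℂ) * Complex.I := by
        push_cast
        ring
      rw [this, Complex.exp_mul_I, ← Complex.ofReal_cos, ← Complex.ofReal_sin, Real.cos_neg,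
        Real.sin_neg]
      simp only [w, ContinuousMap.coe_mk, smul_eq_mul]
      push_cast
      ring
    simp only [key, zero_add]
    rw [intervalIntegral.integral_sub, intervalIntegral.integral_const_mul,
      intervalIntegral.integral_ofReal, intervalIntegral.integral_ofReal, hcos, hsin]
    · simp
    · exact (by fun_prop : Continuous _).intervalIntegrable _ _
    · exact (by fun_prop : Continuous _).intervalIntegrable _ _
  have hsum : HasSum (fun i => fourierCoeff w i • fourier i) w :=
    hasSum_fourier_series_of_summable (by simp only [funext hw]; exact summable_zero)
  have h0 : w = 0 := by
    refine hsum.unique ?_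
    have hz : (fun i => fourierCoeff w i • fourier (T := 1) i) = fun _ => 0 := by
      funext i
      rw [hw i]
      exact zero_smul ℂ (fourier i : C(UnitAddCircle, ℂ))
    rw [hz]
    exact hasSum_zero
  have := congrArg (fun v : C(UnitAddCircle, ℂ) => v z) h0
  simpa [w] using this

lemma Sobolev.coeffs_injective [CompleteSpace V] (r : ℝ) :
    Function.Injective (Sobolev.coeffs r V) := by
  rw [injective_iff_map_eq_zero]
  intro u hu
  refine Subtype.ext (eq_zero_of_realCoeff u.1 fun n => ?_)
  have h : weightedCoeff r u.1 n = 0 := congrArg (fun a : lp (fun _ : ℤ => V) 2 => a n) hu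
  have hpos : (0 : ℝ) < (1 + (n : ℝ) ^ 2) ^ (r / 2) := by positivity
  exact (smul_eq_zero.1 h).resolve_left hpos.ne'

instance [CompleteSpace V] (r : ℝ) : NormedAddCommGroup (Sobolev r V) :=
  NormedAddCommGroup.induced (Sobolev r V) (lp (fun _ : ℤ => V) 2) (Sobolev.coeffs r V)
    (Sobolev.coeffs_injective r)

instance [CompleteSpace V] (r : ℝ) : NormedSpace ℝ (Sobolev r V) :=
  NormedSpace.induced ℝ (Sobolev r V) (lp (fun _ : ℤ => V) 2) (Sobolev.coeffs r V)

end Sobolev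

/-! ### Lie groups

`G` is a Lie group modelled on `E`. Its Lie algebra `𝔤 = T_1 G` is, by definition of the tangent
space, the space `E`. -/

section LieGroups

variable {E : Type*} [NormedAddCommGroup E] [NormedSpace ℝ E]
  {G : Type*} [TopologicalSpace G] [ChartedSpace E G] [Group G]

/-- The Lie bracket of `𝔤`. -/
def lieBracket (G : Type*) [TopologicalSpace G] [ChartedSpace E G] [Group G] (X Y : E) : E :=
  let X' : GroupLieAlgebra 𝓘(ℝ, E) G := X
  let Y' : GroupLieAlgebra 𝓘(ℝ, E) G := Y
  (⁅X', Y'⁆ : GroupLieAlgebra 𝓘(ℝ, E) G)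

/-- The adjoint action of `G` on `𝔤`. -/
def Ad (g : G) (X : E) : E :=
  mfderiv 𝓘(ℝ, E) 𝓘(ℝ, E) (fun x : G => g * x * g⁻¹) 1 X

/-- The left-invariant Maurer-Cartan form `θ`. -/
def leftMC (g : G) (v : TangentSpace 𝓘(ℝ, E) g) : E :=
  mfderiv 𝓘(ℝ, E) 𝓘(ℝ, E) (fun x : G => g⁻¹ * x) g v

/-- The right-invariant Maurer-Cartan form `θ̄`. -/
def rightMC (g : G) (v : TangentSpace 𝓘(ℝ, E) g) : E :=
  mfderiv 𝓘(ℝ, E) 𝓘(ℝ, E) (fun x : G => x * g⁻¹) g v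

/-- The vector `X g ∈ T_g G` for `X ∈ 𝔤`. -/
def rightTranslate (g : G) (X : E) : TangentSpace 𝓘(ℝ, E) g :=
  mfderiv 𝓘(ℝ, E) 𝓘(ℝ, E) (fun x : G => x * g) 1 X

/-- The vector `g X ∈ T_g G` for `X ∈ 𝔤`. -/
def leftTranslate (g : G) (X : E) : TangentSpace 𝓘(ℝ, E) g :=
  mfderiv 𝓘(ℝ, E) 𝓘(ℝ, E) (fun x : G => g * x) 1 X

/-- `h` solves the initial value problem `h(s)⁻¹ h'(s) = μ(s)`, `h(0) = 1`. -/
def IsParallel (μ : ℝ → E) (h : ℝ → G) : Prop :=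
  h 0 = 1 ∧ ∀ s : ℝ, HasMFDerivAt 𝓘(ℝ, ℝ) 𝓘(ℝ, E) h s
    (ContinuousLinearMap.smulRight (1 : ℝ →L[ℝ] ℝ) (leftTranslate (h s) (μ s)))

open Classical in
/-- The parallel transport `Hol_s(μ)`: the value at `s` of the solution of
`h⁻¹ h' = μ`, `h(0) = 1` (it exists and is unique for continuous `μ`). -/
def Hol (G : Type*) [TopologicalSpace G] [ChartedSpace E G] [Group G] (μ : ℝ → E) (s : ℝ) : G :=
  if h : ∃ h : ℝ → G, IsParallel μ h then h.choose s else 1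

/-- The exponential map `𝔤 → G`. -/
def lieExp (G : Type*) [TopologicalSpace G] [ChartedSpace E G] [Group G] (X : E) : G :=
  Hol G (fun _ => X) 1

/-- `B` is an `Ad`-invariant inner product on `𝔤`. -/
structure IsInvariantInner (G : Type*) [TopologicalSpace G] [ChartedSpace E G] [Group G]
    (B : E →L[ℝ] E →L[ℝ] ℝ) : Prop where
  symm : ∀ X Y, B X Y = B Y X
  pos : ∀ X, X ≠ 0 → 0 < B X X
  invariant : ∀ (g : G) (X Y : E), B (Ad g X) (Ad g Y) = B X Y

/-- Tori in a compact Lie group: closed connected abelian subgroups. -/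
def IsTorus (S : Subgroup G) : Prop :=
  IsClosed (S : Set G) ∧ IsConnected (S : Set G) ∧ ∀ a ∈ S, ∀ b ∈ S, a * b = b * a

/-- Maximal tori. -/
def IsMaximalTorus (T : Subgroup G) : Prop :=
  IsTorus T ∧ ∀ S : Subgroup G, IsTorus S → T ≤ S → S = T

/-- The inclusion `𝔱 → 𝔤` of the Lie algebra of a Lie subgroup `T ⊆ G`. -/
def lieInclusion {ET : Type*} [NormedAddCommGroup ET] [NormedSpace ℝ ET]
    (E : Type*) [NormedAddCommGroup E] [NormedSpace ℝ E] [ChartedSpace E G]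
    (T : Subgroup G) [ChartedSpace ET T] : ET →L[ℝ] E :=
  mfderiv 𝓘(ℝ, ET) 𝓘(ℝ, E) (Subtype.val : T → G) 1

/-- The restriction of a bilinear form on `𝔤` to `𝔱`. -/
def restrictInner (ET : Type*) [NormedAddCommGroup ET] [NormedSpace ℝ ET]
    (T : Subgroup G) [ChartedSpace ET T] (B : E →L[ℝ] E →L[ℝ] ℝ) : ET →L[ℝ] ET →L[ℝ] ℝ :=
  B.bilinearComp (lieInclusion E T) (lieInclusion E T)

/-- The integral lattice `Λ = ker exp`. -/
def integralLattice (E : Type*) [NormedAddCommGroup E] [NormedSpace ℝ E]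
    (G : Type*) [TopologicalSpace G] [ChartedSpace E G] [Group G] : Set E :=
  {X | lieExp G X = 1}

/-- For `X ∈ Λ`, the loop `s ↦ exp(-s X)`. -/
def latticeLoop (G : Type*) [TopologicalSpace G] [ChartedSpace E G] [Group G] (X : E) :
    UnitAddCircle → G :=
  fun z => lieExp G (-((AddCircle.equivIco (1 : ℝ) 0 z : ℝ) • X))

end LieGroups

/-! ### Group-valued and ordinary Hamiltonian spaces -/

section Hamiltonian

variable {E : Type*} [NormedAddCommGroup E] [NormedSpace ℝ E]
  {G : Type*} [TopologicalSpace G] [ChartedSpace E G] [Group G]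
  {E' : Type*} [NormedAddCommGroup E'] [NormedSpace ℝ E']
  {M : Type*} [TopologicalSpace M] [ChartedSpace E' M] [MulAction G M]

/-- The generating vector field `ξ_M(m) = d/dτ|₀ exp(-τ ξ) • m`. -/
def genField (G : Type*) [TopologicalSpace G] [ChartedSpace E G] [Group G] [MulAction G M]
    (ξ : E) (m : M) : TangentSpace 𝓘(ℝ, E') m :=
  mfderiv 𝓘(ℝ, E) 𝓘(ℝ, E') (fun g : G => g • m) 1 (-ξ)

/-- `(M, σ, Φ)` is a group-valued Hamiltonian `G`-space: `M` is a compact `G`-manifold, `σ` an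
invariant 2-form, `Φ : M → G` is equivariant, and `dσ = Φ^* η`, `ι(ξ_M) σ = ½ Φ^* B(θ + θ̄, ξ)`,
`ker σ_m = {ξ_M(m) | Ad_{Φ(m)} ξ = -ξ}`. The 3-form `η = (1/12) B(θ, [θ, θ])` takes the value
`½ B(θ(u), [θ(v), θ(w)])` on `u, v, w`. -/
structure IsGroupHamiltonian (B : E →L[ℝ] E →L[ℝ] ℝ) (σ : Form E' M 2) (Φ : M → G) : Prop where
  finiteDimensional : FiniteDimensional ℝ E'
  isManifold : IsManifold 𝓘(ℝ, E') ∞ M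
  t2 : T2Space M
  compact : CompactSpace M
  smooth_action : ContMDiff (𝓘(ℝ, E).prod 𝓘(ℝ, E')) 𝓘(ℝ, E') ∞ fun p : G × M => p.1 • p.2
  smooth_form : σ.IsSmooth
  invariant : ∀ g : G, Form.pullback (fun m : M => g • m) σ = σ
  smooth_moment : ContMDiff 𝓘(ℝ, E') 𝓘(ℝ, E) ∞ Φ
  equivariant : ∀ (g : G) (m : M), Φ (g • m) = g * Φ m * g⁻¹
  d_form : ∀ (m : M) (u v w : TangentSpace 𝓘(ℝ, E') m),
    σ.d m ![u, v, w] = (1 / 2 : ℝ) *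
      B (leftMC (Φ m) (mfderiv 𝓘(ℝ, E') 𝓘(ℝ, E) Φ m u))
        (lieBracket G (leftMC (Φ m) (mfderiv 𝓘(ℝ, E') 𝓘(ℝ, E) Φ m v))
          (leftMC (Φ m) (mfderiv 𝓘(ℝ, E') 𝓘(ℝ, E) Φ m w)))
  moment : ∀ (ξ : E) (m : M) (v : TangentSpace 𝓘(ℝ, E') m),
    σ m ![genField G ξ m, v] = (1 / 2 : ℝ) *
      B (leftMC (Φ m) (mfderiv 𝓘(ℝ, E') 𝓘(ℝ, E) Φ m v) +
        rightMC (Φ m) (mfderiv 𝓘(ℝ, E') 𝓘(ℝ, E) Φ m v)) ξ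
  kernel : ∀ (m : M) (v : TangentSpace 𝓘(ℝ, E') m),
    (∀ w : TangentSpace 𝓘(ℝ, E') m, σ m ![v, w] = 0) ↔
      ∃ ξ : E, Ad (Φ m) ξ = -ξ ∧ v = genField G ξ m

/-- `(M, σ, Φ)` is a finite-dimensional Hamiltonian `G`-manifold (not necessarily compact), the
moment map being regarded as `𝔤`-valued by means of `B`. -/
structure IsHamiltonian (G : Type*) [TopologicalSpace G] [ChartedSpace E G] [Group G]
    [MulAction G M] (B : E →L[ℝ] E →L[ℝ] ℝ) (σ : Form E' M 2) (Φ : M → E) : Prop where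
  finiteDimensional : FiniteDimensional ℝ E'
  isManifold : IsManifold 𝓘(ℝ, E') ∞ M
  t2 : T2Space M
  secondCountable : SecondCountableTopology M
  smooth_action : ContMDiff (𝓘(ℝ, E).prod 𝓘(ℝ, E')) 𝓘(ℝ, E') ∞ fun p : G × M => p.1 • p.2
  smooth_form : σ.IsSmooth
  closed : ∀ m, σ.d m = 0
  nondegenerate : ∀ (m : M) (v : TangentSpace 𝓘(ℝ, E') m),
    (∀ w : TangentSpace 𝓘(ℝ, E') m, σ m ![v, w] = 0) → v = 0
  invariant : ∀ g : G, Form.pullback (fun m : M => g • m) σ = σ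
  smooth_moment : ContMDiff 𝓘(ℝ, E') 𝓘(ℝ, E) ∞ Φ
  equivariant : ∀ (g : G) (m : M), Φ (g • m) = Ad g (Φ m)
  moment : ∀ (ξ : E) (m : M) (v : TangentSpace 𝓘(ℝ, E') m),
    σ m ![genField G ξ m, v] = mfderiv 𝓘(ℝ, E') 𝓘(ℝ, ℝ) (fun x => B (Φ x) ξ) m v

end Hamiltonian

/-! ### Loop groups and Hamiltonian loop group manifolds

For a Sobolev level `f > 1`, `Sobolev (f - 1/2) E` is the space of connections
`Ω¹(S¹, 𝔤) ≅ L𝔤^*` and `Sobolev (f + 1/2) E` is the Lie algebra `L𝔤` of the loop group. -/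

section Loops

variable {E : Type*} [NormedAddCommGroup E] [NormedSpace ℝ E] [CompleteSpace E]
  {G : Type*} [TopologicalSpace G] [ChartedSpace E G] [Group G]

/-- The loop `γ` is differentiable, and `γ^* θ̄ = γ' γ⁻¹` is the connection `a`. -/
def HasLogDeriv {f : ℝ} (γ : UnitAddCircle → G) (a : Sobolev (f - 1 / 2) E) : Prop :=
  ∀ s : ℝ, HasMFDerivAt 𝓘(ℝ, ℝ) 𝓘(ℝ, E) (fun s : ℝ => γ (s : UnitAddCircle)) s
    (ContinuousLinearMap.smulRight (1 : ℝ →L[ℝ] ℝ)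
      (rightTranslate (γ (s : UnitAddCircle)) (a (s : UnitAddCircle))))

/-- The loop group `LG`, a set of maps `S¹ → G` closed under pointwise products: since `f > 1`, a
loop is of Sobolev class `f + 1/2` if and only if it is `C¹` and its derivative, trivialized by
right translations, is of Sobolev class `f - 1/2`. The map `γ ↦ (γ(0), γ' γ⁻¹)` identifies the
Banach Lie group `LG` with a split closed submanifold of `G × Ω¹(S¹, 𝔤)`. -/
def loopGroup (f : ℝ) (E : Type*) [NormedAddCommGroup E] [NormedSpace ℝ E] [CompleteSpace E]
    (G : Type*) [TopologicalSpace G] [ChartedSpace E G] [Group G] : Set (UnitAddCircle → G) :=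
  {γ | ∃ a : Sobolev (f - 1 / 2) E, HasLogDeriv γ a}

/-- The based loop group `ΩG`. -/
def basedLoopGroup (f : ℝ) (E : Type*) [NormedAddCommGroup E] [NormedSpace ℝ E] [CompleteSpace E]
    (G : Type*) [TopologicalSpace G] [ChartedSpace E G] [Group G] : Set (UnitAddCircle → G) :=
  {γ | γ ∈ loopGroup f E G ∧ γ 0 = 1}

/-- The identity component `Ω₀G` of `ΩG`, the topology being that of the image of `ΩG` in
`Ω¹(S¹, 𝔤)` under `γ ↦ γ' γ⁻¹`. -/
def basedLoopGroupZero (f : ℝ) (E : Type*) [NormedAddCommGroup E] [NormedSpace ℝ E]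
    [CompleteSpace E] (G : Type*) [TopologicalSpace G] [ChartedSpace E G] [Group G] :
    Set (UnitAddCircle → G) :=
  {γ | γ 0 = 1 ∧ ∃ a : Sobolev (f - 1 / 2) E, HasLogDeriv γ a ∧
    a ∈ connectedComponentIn
      {b : Sobolev (f - 1 / 2) E | ∃ η : UnitAddCircle → G, η 0 = 1 ∧ HasLogDeriv η b} 0}

/-- `(Hol_s^* θ̄)_μ(a)` for a tangent vector `a` at the connection `μ`. -/
def holForm {f : ℝ} (G : Type*) [TopologicalSpace G] [ChartedSpace E G] [Group G]
    (μ a : Sobolev (f - 1 / 2) E) (s : ℝ) : E :=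
  rightMC (Hol G (fun r => μ (r : UnitAddCircle)) s)
    (mfderiv 𝓘(ℝ, Sobolev (f - 1 / 2) E) 𝓘(ℝ, E)
      (fun ν : Sobolev (f - 1 / 2) E => Hol G (fun r => ν (r : UnitAddCircle)) s) μ a)

/-- The 2-form `ϖ = ½ ∫₀¹ B(Hol_s^* θ̄, ∂_s Hol_s^* θ̄) ds` at `μ`, evaluated on `a, b`. -/
def varpi {f : ℝ} (G : Type*) [TopologicalSpace G] [ChartedSpace E G] [Group G]
    (B : E →L[ℝ] E →L[ℝ] ℝ) (μ a b : Sobolev (f - 1 / 2) E) : ℝ :=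
  (1 / 2 : ℝ) * ∫ s in (0 : ℝ)..1,
    (B (holForm G μ a s) (deriv (holForm G μ b) s) - B (holForm G μ b s) (deriv (holForm G μ a) s))

variable {E' : Type*} [NormedAddCommGroup E'] [NormedSpace ℝ E']
  {N : Type*} [TopologicalSpace N] [ChartedSpace E' N]

/-- The generating vector field `ξ_N(x) = d/dτ|₀ exp(-τ ξ) · x` of `ξ ∈ L𝔤`. -/
def loopGenField {f : ℝ} (act : (UnitAddCircle → G) → N → N) (ξ : Sobolev (f + 1 / 2) E) (x : N) :
    TangentSpace 𝓘(ℝ, E') x :=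
  mfderiv 𝓘(ℝ, ℝ) 𝓘(ℝ, E') (fun τ : ℝ => act (fun z => lieExp G (-(τ • ξ z))) x) 0 (1 : ℝ)

/-- `(N, σ, Φ)` is a Hamiltonian `LG`-manifold. The action is given by `act γ x` for `γ ∈ LG`;
the values of `act` on other maps `S¹ → G` are irrelevant. The gauge action of `γ` on connections
is `γ · μ = Ad_γ μ - γ^* θ̄`. Smoothness of the action refers to the submanifold `LG` of
`G × Ω¹(S¹, 𝔤)`. -/
structure IsLoopHamiltonian (f : ℝ) (B : E →L[ℝ] E →L[ℝ] ℝ)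
    (act : (UnitAddCircle → G) → N → N) (σ : Form E' N 2) (Φ : N → Sobolev (f - 1 / 2) E) :
    Prop where
  complete : CompleteSpace E'
  isManifold : IsManifold 𝓘(ℝ, E') ∞ N
  t2 : T2Space N
  act_one : ∀ x, act 1 x = x
  act_mul : ∀ γ ∈ loopGroup f E G, ∀ δ ∈ loopGroup f E G, ∀ x, act (γ * δ) x = act γ (act δ x)
  smooth_action : ∃ Ψ : (G × Sobolev (f - 1 / 2) E) × N → N,
    (∀ (γ : UnitAddCircle → G) (a : Sobolev (f - 1 / 2) E), HasLogDeriv γ a →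
      ∀ x, Ψ ((γ 0, a), x) = act γ x) ∧
    ContMDiffOn ((𝓘(ℝ, E).prod 𝓘(ℝ, Sobolev (f - 1 / 2) E)).prod 𝓘(ℝ, E')) 𝓘(ℝ, E') ∞ Ψ
      {p | ∃ γ : UnitAddCircle → G, γ 0 = p.1.1 ∧ HasLogDeriv γ p.1.2}
  smooth_form : σ.IsSmooth
  closed : ∀ x, σ.d x = 0
  nondegenerate : ∀ (x : N) (v : TangentSpace 𝓘(ℝ, E') x),
    (∀ w : TangentSpace 𝓘(ℝ, E') x, σ x ![v, w] = 0) → v = 0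
  invariant : ∀ γ ∈ loopGroup f E G, Form.pullback (act γ) σ = σ
  smooth_moment : ContMDiff 𝓘(ℝ, E') 𝓘(ℝ, Sobolev (f - 1 / 2) E) ∞ Φ
  equivariant : ∀ (γ : UnitAddCircle → G) (a : Sobolev (f - 1 / 2) E), HasLogDeriv γ a →
    ∀ (x : N) (z : UnitAddCircle), Φ (act γ x) z = Ad (γ z) (Φ x z) - a z
  moment : ∀ (ξ : Sobolev (f + 1 / 2) E) (x : N) (v : TangentSpace 𝓘(ℝ, E') x),
    σ x ![loopGenField act ξ x, v] =
      mfderiv 𝓘(ℝ, E') 𝓘(ℝ, ℝ)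
        (fun y => ∫ s in (0 : ℝ)..1, B (Φ y (s : UnitAddCircle)) (ξ (s : UnitAddCircle))) x v

variable {EM : Type*} [NormedAddCommGroup EM] [NormedSpace ℝ EM]
  {M : Type*} [TopologicalSpace M] [ChartedSpace EM M] [MulAction G M]

/-- `(M, σM, ΦM)` is the holonomy manifold of the Hamiltonian `LG`-manifold `(N, σ, Φ)` with
proper moment map: `M = N / ΩG` with quotient map `π`, the action and the moment map descend, and
`σ - Φ^* ϖ = π^* σM`. -/
structure IsHolonomyManifold (f : ℝ) (B : E →L[ℝ] E →L[ℝ] ℝ)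
    (act : (UnitAddCircle → G) → N → N) (σ : Form E' N 2) (Φ : N → Sobolev (f - 1 / 2) E)
    (π : N → M) (σM : Form EM M 2) (ΦM : M → G) : Prop where
  proper : IsProperMap Φ
  surjective : Function.Surjective π
  submersion : Manifold.IsSubmersion 𝓘(ℝ, E') 𝓘(ℝ, EM) ∞ π
  fibres : ∀ x y, π x = π y ↔ ∃ γ ∈ basedLoopGroup f E G, act γ x = y
  equivariant : ∀ γ ∈ loopGroup f E G, ∀ x, π (act γ x) = γ 0 • π x
  holonomy : ∀ x, Hol G (fun s => Φ x (s : UnitAddCircle)) 1 = ΦM (π x)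
  form : ∀ (x : N) (v w : TangentSpace 𝓘(ℝ, E') x),
    σ x ![v, w] - varpi G B (Φ x) (mfderiv 𝓘(ℝ, E') 𝓘(ℝ, Sobolev (f - 1 / 2) E) Φ x v)
        (mfderiv 𝓘(ℝ, E') 𝓘(ℝ, Sobolev (f - 1 / 2) E) Φ x w) =
      Form.pullback π σM x ![v, w]

/-! ### The fixed point manifolds -/

/-- The connected component of `m₀` in the fixed point set `M^t`. -/
def fixedComponent (t : G) (m₀ : M) : Set M := connectedComponentIn {m | t • m = m} m₀

/-- The pre-image of `F ⊆ M^t` under `N^t → M^t`. -/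
def hatSet (act : (UnitAddCircle → G) → N → N) (π : N → M) (t : G) (F : Set M) : Set N :=
  {x | act (fun _ => t) x = x ∧ π x ∈ F}

/-- The intersection of a subset of `N` with `Φ⁻¹(𝔱)`, where `𝔱` is embedded into `Ω¹(S¹, 𝔤)` as
constant connections. -/
def tildeSet {f : ℝ} (ET : Type*) [NormedAddCommGroup ET] [NormedSpace ℝ ET]
    (T : Subgroup G) [ChartedSpace ET T] (Φ : N → Sobolev (f - 1 / 2) E) (S : Set N) : Set N :=
  {x | x ∈ S ∧ ∃ ξ : ET, ∀ z, Φ x z = lieInclusion E T ξ}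

end Loops

end LoopGeometry

end

set_option linter.unusedSectionVars false
noncomputable section
namespace LoopGeometry

/-! ### Derivatives of maps between manifolds as maps between the model spaces -/

section HasD

variable {E : Type*} [NormedAddCommGroup E] [NormedSpace ℝ E]
  {H : Type*} [TopologicalSpace H] {I : ModelWithCorners ℝ E H}
  {M : Type*} [TopologicalSpace M] [ChartedSpace H M]
  {E' : Type*} [NormedAddCommGroup E'] [NormedSpace ℝ E']
  {H' : Type*} [TopologicalSpace H'] {I' : ModelWithCorners ℝ E' H'}
  {M' : Type*} [TopologicalSpace M'] [ChartedSpace H' M']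
  {E'' : Type*} [NormedAddCommGroup E''] [NormedSpace ℝ E'']
  {H'' : Type*} [TopologicalSpace H''] {I'' : ModelWithCorners ℝ E'' H''}
  {M'' : Type*} [TopologicalSpace M''] [ChartedSpace H'' M'']

/-- The derivative of a map between manifolds, read in the preferred charts. -/
def mD (I : ModelWithCorners ℝ E H) (I' : ModelWithCorners ℝ E' H') (f : M → M') (x : M) :
    E →L[ℝ] E' := mfderiv I I' f x

/-- `f` is differentiable at `x`, with derivative `L` when read in the preferred charts. -/
def HasD (I : ModelWithCorners ℝ E H) (I' : ModelWithCorners ℝ E' H') (f : M → M') (x : M)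
    (L : E →L[ℝ] E') : Prop := HasMFDerivAt I I' f x L

lemma HasD.mD_eq {f : M → M'} {x : M} {L : E →L[ℝ] E'} (h : HasD I I' f x L) :
    mD I I' f x = L := HasMFDerivAt.mfderiv h

lemma HasD.mdiff {f : M → M'} {x : M} {L : E →L[ℝ] E'} (h : HasD I I' f x L) :
    MDifferentiableAt I I' f x := HasMFDerivAt.mdifferentiableAt h

lemma _root_.MDifferentiableAt.hasD {f : M → M'} {x : M} (h : MDifferentiableAt I I' f x) :
    HasD I I' f x (mD I I' f x) := h.hasMFDerivAt

lemma _root_.ContMDiffAt.hasD {f : M → M'} {x : M} (h : ContMDiffAt I I' ∞ f x) :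
    HasD I I' f x (mD I I' f x) := (h.mdifferentiableAt (by simp)).hasD

lemma _root_.ContMDiff.hasD {f : M → M'} (h : ContMDiff I I' ∞ f) (x : M) :
    HasD I I' f x (mD I I' f x) := (h x).hasD

lemma HasD.continuousAt {f : M → M'} {x : M} {L : E →L[ℝ] E'} (h : HasD I I' f x L) :
    ContinuousAt f x := HasMFDerivAt.continuousAt h

lemma HasD.unique {f : M → M'} {x : M} {L L' : E →L[ℝ] E'} (h : HasD I I' f x L)
    (h' : HasD I I' f x L') : L = L' := hasMFDerivAt_unique h h'

lemma HasD.comp {f : M → M'} {g : M' → M''} {x : M} {y : M'} {L : E →L[ℝ] E'} {L' : E' →L[ℝ] E''}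
    (hg : HasD I' I'' g y L') (hf : HasD I I' f x L) (hy : f x = y) :
    HasD I I'' (fun z => g (f z)) x (L'.comp L) := by
  subst hy
  exact HasMFDerivAt.comp x hg hf

lemma HasD.prodMk {f : M → M'} {g : M → M''} {x : M} {L : E →L[ℝ] E'} {L' : E →L[ℝ] E''}
    (hf : HasD I I' f x L) (hg : HasD I I'' g x L') :
    HasD I (I'.prod I'') (fun z => (f z, g z)) x (L.prod L') :=
  HasMFDerivAt.prodMk hf hg

lemma HasD.congr {f g : M → M'} {x : M} {L : E →L[ℝ] E'} (h : HasD I I' f x L)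
    (hfg : g =ᶠ[𝓝 x] f) : HasD I I' g x L := HasMFDerivAt.congr_of_eventuallyEq h hfg

lemma hasD_id (x : M) : HasD I I (fun y : M => y) x (ContinuousLinearMap.id ℝ E) :=
  hasMFDerivAt_id x

lemma hasD_const (c : M') (x : M) : HasD I I' (fun _ : M => c) x 0 :=
  hasMFDerivAt_const c x

lemma hasD_iff_hasFDerivAt {f : E → E'} {x : E} {L : E →L[ℝ] E'} :
    HasD 𝓘(ℝ, E) 𝓘(ℝ, E') f x L ↔ HasFDerivAt f L x := hasMFDerivAt_iff_hasFDerivAt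

/-- The derivative of a map on a product is the sum of the partial derivatives. -/
lemma HasD.prod_eq {f : M × M' → M''} {p : M × M'} {L : E × E' →L[ℝ] E''}
    {L₁ : E →L[ℝ] E''} {L₂ : E' →L[ℝ] E''} (h : HasD (I.prod I') I'' f p L)
    (h₁ : HasD I I'' (fun x => f (x, p.2)) p.1 L₁) (h₂ : HasD I' I'' (fun y => f (p.1, y)) p.2 L₂) :
    L = L₁.coprod L₂ := by
  have e₁ := (h.comp ((hasD_id (I := I) p.1).prodMk (hasD_const (I' := I') p.2 p.1)) rfl).unique h₁
  have e₂ := (h.comp ((hasD_const (I := I') (I' := I) p.1 p.2).prodMk (hasD_id (I := I') p.2))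
    rfl).unique h₂
  ext v
  · simp [← e₁]
  · simp [← e₂]

/-- The chain rule for the two partial derivatives. -/
lemma HasD.comp₂ {E₀ : Type*} [NormedAddCommGroup E₀] [NormedSpace ℝ E₀]
    {H₀ : Type*} [TopologicalSpace H₀] {I₀ : ModelWithCorners ℝ E₀ H₀}
    {M₀ : Type*} [TopologicalSpace M₀] [ChartedSpace H₀ M₀]
    {f : M → M' → M''} {u : M₀ → M} {v : M₀ → M'} {z : M₀} {A : E₀ →L[ℝ] E} {B : E₀ →L[ℝ] E'}
    {L₁ : E →L[ℝ] E''} {L₂ : E' →L[ℝ] E''}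
    (hf : MDifferentiableAt (I.prod I') I'' (fun p : M × M' => f p.1 p.2) (u z, v z))
    (h₁ : HasD I I'' (fun x => f x (v z)) (u z) L₁) (h₂ : HasD I' I'' (fun y => f (u z) y) (v z) L₂)
    (hu : HasD I₀ I u z A) (hv : HasD I₀ I' v z B) :
    HasD I₀ I'' (fun z => f (u z) (v z)) z (L₁.comp A + L₂.comp B) := by
  have e := HasD.prod_eq hf.hasD h₁ h₂
  have hc := HasD.comp hf.hasD (hu.prodMk hv) rfl
  rw [e] at hc
  convert hc using 1
  ext w
  simp

lemma comp_smulRight_one (L : E →L[ℝ] E') (v : E) :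
    L.comp (ContinuousLinearMap.smulRight (1 : ℝ →L[ℝ] ℝ) v) =
      ContinuousLinearMap.smulRight (1 : ℝ →L[ℝ] ℝ) (L v) := by
  ext; simp

/-- The derivative of the preferred chart at its centre is the identity. -/
lemma hasD_extChartAt {M : Type*} [TopologicalSpace M] [ChartedSpace E M] [IsManifold 𝓘(ℝ, E) 1 M]
    (x : M) :
    HasD 𝓘(ℝ, E) 𝓘(ℝ, E) (extChartAt 𝓘(ℝ, E) x) x (ContinuousLinearMap.id ℝ E) := by
  refine ⟨continuousAt_extChartAt x, ?_⟩
  refine HasFDerivWithinAt.congr_of_eventuallyEq (hasFDerivWithinAt_id _ _) ?_ ?_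
  · refine mem_nhdsWithin_of_mem_nhds ?_
    filter_upwards [extChartAt_target_mem_nhds x] with y hy
    simp only [writtenInExtChartAt, Function.comp, extChartAt_model_space_eq_id]
    exact (extChartAt 𝓘(ℝ, E) x).right_inv hy
  · simp only [writtenInExtChartAt, Function.comp, extChartAt_model_space_eq_id]
    exact (extChartAt 𝓘(ℝ, E) x).right_inv (mem_extChartAt_target x)

lemma hasD_extChartAt_symm {M : Type*} [TopologicalSpace M] [ChartedSpace E M]
    [IsManifold 𝓘(ℝ, E) 1 M] (x : M) :
    HasD 𝓘(ℝ, E) 𝓘(ℝ, E) (extChartAt 𝓘(ℝ, E) x).symm (extChartAt 𝓘(ℝ, E) x x)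
      (ContinuousLinearMap.id ℝ E) := by
  have h1 : HasD 𝓘(ℝ, E) 𝓘(ℝ, E) (extChartAt 𝓘(ℝ, E) x).symm (extChartAt 𝓘(ℝ, E) x x) _ :=
    ((contMDiffOn_extChartAt_symm (n := 1) x).contMDiffAt
      (extChartAt_target_mem_nhds x)).mdifferentiableAt (by simp) |>.hasD
  have h2 := (hasD_extChartAt x).comp h1 (extChartAt_to_inv x)
  have h3 : HasD 𝓘(ℝ, E) 𝓘(ℝ, E) (fun z => extChartAt 𝓘(ℝ, E) x ((extChartAt 𝓘(ℝ, E) x).symm z))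
      (extChartAt 𝓘(ℝ, E) x x) (ContinuousLinearMap.id ℝ E) := by
    refine (hasD_id _).congr ?_
    filter_upwards [extChartAt_target_mem_nhds x] with y hy
    exact (extChartAt 𝓘(ℝ, E) x).right_inv hy
  have h4 := h2.unique h3
  rw [ContinuousLinearMap.id_comp] at h4
  rwa [h4] at h1

/-- Partial derivatives of smooth maps are smooth. -/
lemma contMDiffAt_partial_fderiv [IsManifold I 1 M] {v : M → E' → E''} {p : M × E'}
    (h : ContMDiffAt (I.prod 𝓘(ℝ, E')) 𝓘(ℝ, E'') ∞ (fun p : M × E' => v p.1 p.2) p) :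
    ContMDiffAt (I.prod 𝓘(ℝ, E')) 𝓘(ℝ, E' →L[ℝ] E'') ∞
      (fun p : M × E' => fderiv ℝ (v p.1) p.2) p := by
  have h1 : ContMDiffAt ((I.prod 𝓘(ℝ, E')).prod 𝓘(ℝ, E')) 𝓘(ℝ, E'') ∞
      (Function.uncurry fun (q : M × E') (y : E') => v q.1 y) (p, p.2) :=
    ContMDiffAt.comp (x := (p, p.2)) (f := fun q : (M × E') × E' => (q.1.1, q.2))
      (g := fun p : M × E' => v p.1 p.2) h
      ((contMDiffAt_fst.comp _ contMDiffAt_fst).prodMk contMDiffAt_snd)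
  have h2 := ContMDiffAt.mfderiv (x₀ := p) (fun (q : M × E') (y : E') => v q.1 y)
    (fun q : M × E' => q.2) h1 contMDiffAt_snd (m := ∞) (by simp)
  have h3 : ContMDiffAt (I.prod 𝓘(ℝ, E')) 𝓘(ℝ, E' →L[ℝ] E'') ∞
      (inTangentCoordinates 𝓘(ℝ, E') 𝓘(ℝ, E'') (fun q : M × E' => q.2) (fun x => v x.1 x.2)
        (fun x => fderiv ℝ (v x.1) x.2) p) p := by
    simp only [mfderiv_eq_fderiv] at h2
    exact h2
  rwa [inTangentCoordinates_model_space] at h3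

end HasD

/-! ### Calculus of curves in a Lie group -/

section LieCalculus

variable {E : Type*} [NormedAddCommGroup E] [NormedSpace ℝ E]
  {G : Type*} [TopologicalSpace G] [ChartedSpace E G] [Group G]

/-- The adjoint action as a continuous linear map. -/
def AdL (g : G) : E →L[ℝ] E := mD 𝓘(ℝ, E) 𝓘(ℝ, E) (fun x : G => g * x * g⁻¹) 1

/-- The differential at the identity of left translation by `g`. -/
def leftL (g : G) : E →L[ℝ] E := mD 𝓘(ℝ, E) 𝓘(ℝ, E) (fun x : G => g * x) 1

/-- The differential at the identity of right translation by `g`. -/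
def rightL (g : G) : E →L[ℝ] E := mD 𝓘(ℝ, E) 𝓘(ℝ, E) (fun x : G => x * g) 1

/-- The left Maurer-Cartan form as a continuous linear map. -/
def leftMCL (g : G) : E →L[ℝ] E := mD 𝓘(ℝ, E) 𝓘(ℝ, E) (fun x : G => g⁻¹ * x) g

/-- The right Maurer-Cartan form as a continuous linear map. -/
def rightMCL (g : G) : E →L[ℝ] E := mD 𝓘(ℝ, E) 𝓘(ℝ, E) (fun x : G => x * g⁻¹) g

lemma Ad_eq (g : G) (X : E) : Ad g X = AdL g X := rfl

/-- The curve `h` has left logarithmic derivative `h⁻¹ h' = X` at `s`. -/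
def HasLD (h : ℝ → G) (s : ℝ) (X : E) : Prop :=
  HasD 𝓘(ℝ, ℝ) 𝓘(ℝ, E) h s (ContinuousLinearMap.smulRight (1 : ℝ →L[ℝ] ℝ) (leftL (h s) X))

/-- The curve `h` has right logarithmic derivative `h' h⁻¹ = X` at `s`. -/
def HasRD (h : ℝ → G) (s : ℝ) (X : E) : Prop :=
  HasD 𝓘(ℝ, ℝ) 𝓘(ℝ, E) h s (ContinuousLinearMap.smulRight (1 : ℝ →L[ℝ] ℝ) (rightL (h s) X))

lemma isParallel_iff {μ : ℝ → E} {h : ℝ → G} :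
    IsParallel μ h ↔ h 0 = 1 ∧ ∀ s, HasLD h s (μ s) := Iff.rfl

lemma hasLogDeriv_iff [CompleteSpace E] {f : ℝ} {γ : UnitAddCircle → G} {a : Sobolev (f - 1 / 2) E} :
    HasLogDeriv γ a ↔ ∀ s : ℝ, HasRD (fun s : ℝ => γ (s : UnitAddCircle)) s
      (a (s : UnitAddCircle)) := Iff.rfl

lemma HasLD.continuousAt {h : ℝ → G} {s : ℝ} {X : E} (hh : HasLD h s X) : ContinuousAt h s :=
  HasD.continuousAt hh

lemma HasLD.congr {h k : ℝ → G} {s : ℝ} {X : E} (hh : HasLD h s X) (hk : k =ᶠ[𝓝 s] h) :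
    HasLD k s X := by
  have := HasD.congr hh hk
  rw [← hk.eq_of_nhds] at this
  exact this

lemma AdL_one : AdL (1 : G) = ContinuousLinearMap.id ℝ E := by
  have h : (fun x : G => 1 * x * 1⁻¹) = fun x => x := by funext x; simp
  unfold AdL
  rw [h]
  exact (hasD_id _).mD_eq

variable [LieGroup 𝓘(ℝ, E) ∞ G]

lemma hasD_mul_left (g x : G) : HasD 𝓘(ℝ, E) 𝓘(ℝ, E) (fun y : G => g * y) x
    (mD 𝓘(ℝ, E) 𝓘(ℝ, E) (fun y : G => g * y) x) :=
  (contMDiff_mul_left (n := ∞) (a := g)).hasD x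

lemma hasD_mul_right (g x : G) : HasD 𝓘(ℝ, E) 𝓘(ℝ, E) (fun y : G => y * g) x
    (mD 𝓘(ℝ, E) 𝓘(ℝ, E) (fun y : G => y * g) x) :=
  (contMDiff_mul_right (n := ∞) (a := g)).hasD x

lemma hasD_conj (g : G) : HasD 𝓘(ℝ, E) 𝓘(ℝ, E) (fun y : G => g * y * g⁻¹) 1 (AdL g) :=
  ((contMDiff_mul_right (n := ∞) (a := g⁻¹)).comp (contMDiff_mul_left (n := ∞) (a := g))).hasD 1

lemma AdL_mul (g k : G) : AdL (g * k) = (AdL g).comp (AdL (E := E) k) := by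
  have h : (fun x : G => (g * k) * x * (g * k)⁻¹) =
      fun x : G => g * (k * x * k⁻¹) * g⁻¹ := by
    funext x; simp [mul_assoc]
  unfold AdL
  rw [h]
  exact ((hasD_conj g).comp (hasD_conj k) (by simp)).mD_eq

lemma AdL_mul_apply (g k : G) (X : E) : AdL (g * k) X = AdL g (AdL k X) := by
  rw [AdL_mul]; rfl

lemma AdL_inv_apply (g : G) (X : E) : AdL g⁻¹ (AdL g X) = X := by
  rw [← AdL_mul_apply, inv_mul_cancel, AdL_one]; rfl

lemma AdL_apply_inv (g : G) (X : E) : AdL g (AdL g⁻¹ X) = X := by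
  rw [← AdL_mul_apply, mul_inv_cancel, AdL_one]; rfl

lemma mD_mul_left_comp_leftL (a b : G) :
    (mD 𝓘(ℝ, E) 𝓘(ℝ, E) (fun y : G => a * y) b).comp (leftL b) = leftL (a * b) := by
  have h : (fun y : G => a * b * y) = fun y : G => a * (b * y) := by
    funext x; simp [mul_assoc]
  unfold leftL
  rw [h]
  exact ((hasD_mul_left a b).comp (hasD_mul_left b 1) (by simp)).mD_eq.symm

lemma mD_mul_right_comp_leftL (a b : G) :
    (mD 𝓘(ℝ, E) 𝓘(ℝ, E) (fun y : G => y * b) a).comp (leftL a) =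
      (leftL (a * b)).comp (AdL (b⁻¹)) := by
  have h : (fun y : G => (a * y) * b) = fun y : G => (a * b) * (b⁻¹ * y * b⁻¹⁻¹) := by
    funext x; simp [mul_assoc]
  have h1 := (hasD_mul_right (E := E) b a).comp (hasD_mul_left a 1) (by simp)
  rw [h] at h1
  exact h1.unique ((hasD_mul_left (a * b) 1).comp (hasD_conj b⁻¹) (by simp))

lemma rightL_eq (g : G) : rightL (E := E) g = (leftL g).comp (AdL (g⁻¹)) := by
  have := mD_mul_right_comp_leftL (E := E) 1 g
  rw [one_mul] at this
  rw [← this]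
  have h1 : leftL (1 : G) = ContinuousLinearMap.id ℝ E := by
    have h : (fun y : G => 1 * y) = fun y => y := by funext x; simp
    unfold leftL
    rw [h]
    exact (hasD_id _).mD_eq
  rw [h1, ContinuousLinearMap.comp_id]
  rfl

lemma leftMCL_leftL (g : G) (X : E) : leftMCL g (leftL g X) = X := by
  have h : (fun y : G => g⁻¹ * (g * y)) = fun y => y := by funext x; simp
  have h1 := (hasD_mul_left (E := E) g⁻¹ g).comp (hasD_mul_left g 1) (by simp)
  rw [h] at h1
  exact DFunLike.congr_fun (h1.unique (hasD_id _)) X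

lemma leftL_leftMCL (g : G) (v : E) : leftL g (leftMCL g v) = v := by
  have h : (fun y : G => g * (g⁻¹ * y)) = fun y => y := by funext x; simp
  have h1 := (hasD_mul_left (E := E) g 1).comp (hasD_mul_left g⁻¹ g) (by simp)
  rw [h] at h1
  exact DFunLike.congr_fun (h1.unique (hasD_id _)) v

lemma rightMCL_rightL (g : G) (X : E) : rightMCL g (rightL g X) = X := by
  have h : (fun y : G => (y * g) * g⁻¹) = fun y => y := by funext x; simp
  have h1 := (hasD_mul_right (E := E) g⁻¹ g).comp (hasD_mul_right g 1) (by simp)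
  rw [h] at h1
  exact DFunLike.congr_fun (h1.unique (hasD_id _)) X

lemma leftL_injective (g : G) : Function.Injective (leftL (E := E) g) :=
  Function.LeftInverse.injective (g := leftMCL g) (leftMCL_leftL g)

lemma hasRD_iff {h : ℝ → G} {s : ℝ} {X : E} : HasRD h s X ↔ HasLD h s (AdL (h s)⁻¹ X) := by
  unfold HasRD HasLD
  rw [rightL_eq]
  rfl

lemma HasLD.unique {h : ℝ → G} {s : ℝ} {X Y : E} (hX : HasLD h s X) (hY : HasLD h s Y) : X = Y := by
  have := DFunLike.congr_fun (HasD.unique hX hY) 1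
  simp only [ContinuousLinearMap.smulRight_apply, one_apply_eq_self, one_smul] at this
  exact leftL_injective _ this

lemma hasLD_const (g : G) (s : ℝ) : HasLD (fun _ => g) s (0 : E) := by
  have := hasD_const (I := 𝓘(ℝ, ℝ)) (I' := 𝓘(ℝ, E)) g s
  unfold HasLD
  convert this using 1
  ext; simp

lemma mdiff_mul (p : G × G) : MDifferentiableAt (𝓘(ℝ, E).prod 𝓘(ℝ, E)) 𝓘(ℝ, E)
    (fun p : G × G => p.1 * p.2) p :=
  (contMDiff_mul 𝓘(ℝ, E) ∞).mdifferentiableAt (by simp)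

lemma HasLD.mul {h k : ℝ → G} {s : ℝ} {X Y : E} (hh : HasLD h s X) (hk : HasLD k s Y) :
    HasLD (fun s => h s * k s) s (AdL (k s)⁻¹ X + Y) := by
  have hc := HasD.comp₂ (f := fun a b : G => a * b) (mdiff_mul (h s, k s)) (hasD_mul_right _ _)
    (hasD_mul_left _ _) hh hk
  unfold HasLD
  convert hc using 1
  rw [comp_smulRight_one, comp_smulRight_one]
  have e1 := DFunLike.congr_fun (mD_mul_right_comp_leftL (h s) (k s)) X
  have e2 := DFunLike.congr_fun (mD_mul_left_comp_leftL (h s) (k s)) Y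
  simp only [ContinuousLinearMap.comp_apply] at e1 e2
  rw [e1, e2]
  ext
  simp

lemma HasLD.const_mul {k : ℝ → G} {s : ℝ} {Y : E} (g : G) (hk : HasLD k s Y) :
    HasLD (fun s => g * k s) s Y := by
  simpa using (hasLD_const (E := E) g s).mul hk

lemma HasLD.mul_const {k : ℝ → G} {s : ℝ} {Y : E} (hk : HasLD k s Y) (g : G) :
    HasLD (fun s => k s * g) s (AdL g⁻¹ Y) := by
  simpa using hk.mul (hasLD_const (E := E) g s)

lemma HasLD.conj {k : ℝ → G} {s : ℝ} {Y : E} (hk : HasLD k s Y) (g : G) :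
    HasLD (fun s => g * k s * g⁻¹) s (AdL g Y) := by
  simpa using (hk.const_mul g).mul_const g⁻¹

lemma HasLD.inv {h : ℝ → G} {s : ℝ} {X : E} (hh : HasLD h s X) :
    HasLD (fun s => (h s)⁻¹) s (-(AdL (h s) X)) := by
  have hi : HasD 𝓘(ℝ, ℝ) 𝓘(ℝ, E) (fun s => (h s)⁻¹) s _ :=
    ((contMDiff_inv 𝓘(ℝ, E) ∞).hasD (h s)).comp hh rfl
  rw [comp_smulRight_one] at hi
  set v := mD 𝓘(ℝ, E) 𝓘(ℝ, E) (fun x : G => x⁻¹) (h s) (leftL (h s) X) with hv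
  have hk : HasLD (fun s => (h s)⁻¹) s (leftMCL (h s)⁻¹ v) := by
    unfold HasLD
    rw [leftL_leftMCL]
    exact hi
  have h1 := hk.mul hh
  simp only [inv_mul_cancel] at h1
  have h2 := h1.unique (hasLD_const (E := E) 1 s)
  have h3 : AdL (h s) (AdL (h s)⁻¹ (leftMCL (h s)⁻¹ v) + X) = 0 := by rw [h2]; simp
  rw [map_add, AdL_apply_inv] at h3
  rw [← eq_neg_of_add_eq_zero_left h3]
  exact hk

/-- A curve whose logarithmic derivative vanishes on an interval is constant there. -/
lemma eq_of_hasLD_zero [T2Space G] {h : ℝ → G} {J : Set ℝ} (hJ : IsOpen J)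
    (hJ' : IsPreconnected J) (hh : ∀ s ∈ J, HasLD h s (0 : E)) {s₀ s : ℝ} (hs₀ : s₀ ∈ J)
    (hs : s ∈ J) : h s = h s₀ := by
  have hc : ContinuousOn h J := fun s hs => (hh s hs).continuousAt.continuousWithinAt
  refine hJ'.induction₂ (fun a b => h a = h b) (fun x hx => ?_)
    (fun a b c _ _ _ hab hbc => hab.trans hbc) (fun a b _ _ hab => hab.symm) hs hs₀
  have hsrc : h ⁻¹' (chartAt E (h x)).source ∈ 𝓝 x :=
    (hh x hx).continuousAt.preimage_mem_nhds ((chartAt E (h x)).open_source.mem_nhds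
      (mem_chart_source E (h x)))
  obtain ⟨ε, hε, hball⟩ := Metric.mem_nhds_iff.1 (Filter.inter_mem hsrc (hJ.mem_nhds hx))
  refine mem_nhdsWithin_of_mem_nhds (Filter.mem_of_superset (Metric.ball_mem_nhds x hε) ?_)
  intro y hy
  set e := extChartAt 𝓘(ℝ, E) (h x)
  have hd : ∀ z ∈ Metric.ball x ε, HasFDerivAt (fun z => e (h z)) (0 : ℝ →L[ℝ] E) z := by
    intro z hz
    have h1 : HasD 𝓘(ℝ, E) 𝓘(ℝ, E) e (h z) _ :=
      (mdifferentiableAt_extChartAt (by simpa using (hball hz).1)).hasD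
    have h2 := h1.comp (hh z (hball hz).2) rfl
    rw [hasD_iff_hasFDerivAt] at h2
    have e0 : (mD 𝓘(ℝ, E) 𝓘(ℝ, E) (extChartAt 𝓘(ℝ, E) (h x)) (h z)).comp
        (ContinuousLinearMap.smulRight (1 : ℝ →L[ℝ] ℝ) (leftL (h z) (0 : E))) = 0 := by
      ext; simp
    rw [e0] at h2
    exact h2
  have heq : e (h y) = e (h x) :=
    (convex_ball x ε).is_const_of_fderivWithin_eq_zero (𝕜 := ℝ)
      (fun z hz => (hd z hz).differentiableAt.differentiableWithinAt)
      (fun z hz => by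
        rw [fderivWithin_of_isOpen Metric.isOpen_ball hz]
        exact (hd z hz).fderiv) hy (Metric.mem_ball_self hε)
  have := (extChartAt 𝓘(ℝ, E) (h x)).injOn (by simpa using (hball hy).1)
    (by simpa using mem_chart_source E (h x)) heq
  exact this.symm

/-- Two curves with the same logarithmic derivative that agree at a point agree. -/
lemma eq_of_hasLD [T2Space G] {h k : ℝ → G} {μ : ℝ → E} {J : Set ℝ} (hJ : IsOpen J)
    (hJ' : IsPreconnected J) (hh : ∀ s ∈ J, HasLD h s (μ s)) (hk : ∀ s ∈ J, HasLD k s (μ s))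
    {s₀ : ℝ} (hs₀ : s₀ ∈ J) (h0 : h s₀ = k s₀) {s : ℝ} (hs : s ∈ J) : h s = k s := by
  have hd : ∀ s ∈ J, HasLD (fun s => h s * (k s)⁻¹) s (0 : E) := by
    intro s hs
    have := (hh s hs).mul (hk s hs).inv
    simpa using this
  have := eq_of_hasLD_zero hJ hJ' hd hs₀ hs
  rw [h0, mul_inv_cancel] at this
  exact mul_inv_eq_one.1 this

lemma IsParallel.eq [T2Space G] {h k : ℝ → G} {μ : ℝ → E} (hh : IsParallel μ h)
    (hk : IsParallel μ k) : h = k := by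
  funext s
  exact eq_of_hasLD isOpen_univ isPreconnected_univ (fun s _ => hh.2 s) (fun s _ => hk.2 s)
    (mem_univ 0) (hh.1.trans hk.1.symm) (mem_univ s)

lemma IsParallel.hol_eq [T2Space G] {h : ℝ → G} {μ : ℝ → E} (hh : IsParallel μ h) :
    Hol G μ = h := by
  have hex : ∃ h : ℝ → G, IsParallel μ h := ⟨h, hh⟩
  funext s
  simp only [Hol, hex, dite_true]
  exact congrFun (hex.choose_spec.eq hh) s

end LieCalculus

/-! ### Existence of parallel transport -/

section Existence

open scoped NNReal

variable {E : Type*} [NormedAddCommGroup E] [NormedSpace ℝ E]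

/-- The Picard-Lindelöf theorem, with the information that the solution stays in the ball. -/
lemma exists_solution_mem_closedBall [CompleteSpace E] {f : ℝ → E → E} {tmin tmax : ℝ}
    {t₀ : Icc tmin tmax} {x₀ : E} {a L K : ℝ≥0} (hf : IsPicardLindelof f t₀ x₀ a 0 L K) :
    ∃ α : ℝ → E, α t₀ = x₀ ∧ (∀ t, α t ∈ Metric.closedBall x₀ a) ∧
      ∀ t ∈ Icc tmin tmax, HasDerivWithinAt α (f t (α t)) (Icc tmin tmax) t := by
  have hx : x₀ ∈ Metric.closedBall x₀ ((0 : ℝ≥0) : ℝ) := Metric.mem_closedBall_self le_rfl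
  obtain ⟨α, hα⟩ := ODE.FunSpace.exists_isFixedPt_next hf hx
  refine ⟨α.compProj, by rw [ODE.FunSpace.compProj_val, ← hα, ODE.FunSpace.next_apply₀],
    fun t => α.compProj_mem_closedBall hf.mul_max_le, fun t ht => ?_⟩
  apply ODE.hasDerivWithinAt_picard_Icc t₀.2 hf.continuousOn_uncurry
    α.continuous_compProj.continuousOn (fun _ ht' => α.compProj_mem_closedBall hf.mul_max_le)
    x₀ ht |>.congr_of_mem _ ht
  intro t' ht'
  nth_rw 1 [← hα]
  rw [ODE.FunSpace.compProj_of_mem ht', ODE.FunSpace.next_apply]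

variable {G : Type*} [TopologicalSpace G] [ChartedSpace E G] [Group G]

/-- The differential at the identity of left translation by the point with coordinate `y`, in the
chart at the identity. -/
def chartLeft (G : Type*) [TopologicalSpace G] [ChartedSpace E G] [Group G] (y : E) : E →L[ℝ] E :=
  fderiv ℝ (fun z => extChartAt 𝓘(ℝ, E) (1 : G)
    ((extChartAt 𝓘(ℝ, E) (1 : G)).symm y * (extChartAt 𝓘(ℝ, E) (1 : G)).symm z))
    (extChartAt 𝓘(ℝ, E) (1 : G) 1)

variable [LieGroup 𝓘(ℝ, E) ∞ G]

lemma contMDiffAt_chartMul {y : E} (hy : y ∈ (extChartAt 𝓘(ℝ, E) (1 : G)).target) :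
    ContMDiffAt (𝓘(ℝ, E).prod 𝓘(ℝ, E)) 𝓘(ℝ, E) ∞ (fun p : E × E => extChartAt 𝓘(ℝ, E) (1 : G)
      ((extChartAt 𝓘(ℝ, E) (1 : G)).symm p.1 * (extChartAt 𝓘(ℝ, E) (1 : G)).symm p.2))
      (y, extChartAt 𝓘(ℝ, E) (1 : G) 1) := by
  have hsymm : ∀ y ∈ (extChartAt 𝓘(ℝ, E) (1 : G)).target,
      ContMDiffAt 𝓘(ℝ, E) 𝓘(ℝ, E) ∞ (extChartAt 𝓘(ℝ, E) (1 : G)).symm y := fun y hy =>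
    (contMDiffOn_extChartAt_symm (n := ∞) (1 : G)).contMDiffAt
      ((isOpen_extChartAt_target (I := 𝓘(ℝ, E)) (1 : G)).mem_nhds hy)
  have h1 : ContMDiffAt (𝓘(ℝ, E).prod 𝓘(ℝ, E)) 𝓘(ℝ, E) ∞ (fun p : E × E =>
      (extChartAt 𝓘(ℝ, E) (1 : G)).symm p.1 * (extChartAt 𝓘(ℝ, E) (1 : G)).symm p.2)
      (y, extChartAt 𝓘(ℝ, E) (1 : G) 1) :=
    ContMDiffAt.mul
      (ContMDiffAt.comp (y, extChartAt 𝓘(ℝ, E) (1 : G) 1) (hsymm y hy) contMDiffAt_fst)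
      (ContMDiffAt.comp (y, extChartAt 𝓘(ℝ, E) (1 : G) 1)
        (hsymm _ (mem_extChartAt_target (1 : G))) contMDiffAt_snd)
  refine ContMDiffAt.comp (y, extChartAt 𝓘(ℝ, E) (1 : G) 1)
    (g := extChartAt 𝓘(ℝ, E) (1 : G)) ?_ h1
  refine contMDiffAt_extChartAt' ?_
  simp only [extChartAt_to_inv, mul_one]
  rw [← extChartAt_source 𝓘(ℝ, E)]
  exact (extChartAt 𝓘(ℝ, E) (1 : G)).map_target hy

lemma contDiffAt_chartLeft {y : E} (hy : y ∈ (extChartAt 𝓘(ℝ, E) (1 : G)).target) :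
    ContDiffAt ℝ ∞ (chartLeft G) y := by
  have h := contMDiffAt_partial_fderiv (v := fun y z : E => extChartAt 𝓘(ℝ, E) (1 : G)
      ((extChartAt 𝓘(ℝ, E) (1 : G)).symm y * (extChartAt 𝓘(ℝ, E) (1 : G)).symm z))
    (contMDiffAt_chartMul hy)
  have h2 : ContMDiffAt 𝓘(ℝ, E) (𝓘(ℝ, E).prod 𝓘(ℝ, E)) ∞
    (fun y : E => (y, extChartAt 𝓘(ℝ, E) (1 : G) 1)) y := contMDiffAt_id.prodMk contMDiffAt_const
  exact (ContMDiffAt.comp y h h2).contDiffAt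

lemma symm_comp_chartLeft {y : E} (hy : y ∈ (extChartAt 𝓘(ℝ, E) (1 : G)).target) :
    (mD 𝓘(ℝ, E) 𝓘(ℝ, E) (extChartAt 𝓘(ℝ, E) (1 : G)).symm y).comp (chartLeft G y) =
      leftL ((extChartAt 𝓘(ℝ, E) (1 : G)).symm y) := by
  set e := extChartAt 𝓘(ℝ, E) (1 : G) with he
  have hs : HasD 𝓘(ℝ, E) 𝓘(ℝ, E) e.symm y (mD 𝓘(ℝ, E) 𝓘(ℝ, E) e.symm y) :=
    ((contMDiffOn_extChartAt_symm (n := ∞) (1 : G)).contMDiffAt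
      ((isOpen_extChartAt_target (I := 𝓘(ℝ, E)) (1 : G)).mem_nhds hy)).hasD
  have hm : HasD 𝓘(ℝ, E) 𝓘(ℝ, E) (fun z => e (e.symm y * e.symm z)) (e 1) (chartLeft G y) := by
    rw [hasD_iff_hasFDerivAt]
    have h1 := contMDiffAt_chartMul (G := G) hy
    have h2 : ContMDiffAt 𝓘(ℝ, E) (𝓘(ℝ, E).prod 𝓘(ℝ, E)) ∞
      (fun z : E => (y, z)) (e 1) := contMDiffAt_const.prodMk contMDiffAt_id
    exact ((ContMDiffAt.comp (e 1) h1 h2).contDiffAt.differentiableAt (by simp)).hasFDerivAt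
  have hsrc : e.symm y ∈ e.source := e.map_target hy
  have h3 := hs.comp hm (by
    simp only [he, extChartAt_to_inv, mul_one]
    exact e.right_inv hy)
  have h4 : HasD 𝓘(ℝ, E) 𝓘(ℝ, E) (fun z => e.symm y * e.symm z) (e 1)
      ((leftL (e.symm y)).comp (ContinuousLinearMap.id ℝ E)) :=
    (hasD_mul_left (e.symm y) 1).comp (hasD_extChartAt_symm (1 : G)) (extChartAt_to_inv 1)
  refine (h4.congr ?_).unique h3 |>.symm.trans (ContinuousLinearMap.comp_id _)
  have hc : ContinuousAt (fun z => e.symm y * e.symm z) (e 1) := h4.continuousAt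
  have hmem : e.source ∈ 𝓝 (e.symm y * e.symm (e 1)) := by
    rw [he, extChartAt_to_inv, mul_one]
    exact (isOpen_extChartAt_source (I := 𝓘(ℝ, E)) (1 : G)).mem_nhds hsrc
  filter_upwards [hc.preimage_mem_nhds hmem] with z hz
  exact e.left_inv hz

lemma chartLeft_one : chartLeft G (extChartAt 𝓘(ℝ, E) (1 : G) 1) = ContinuousLinearMap.id ℝ E := by
  have h := symm_comp_chartLeft (G := G) (mem_extChartAt_target (I := 𝓘(ℝ, E)) (1 : G))
  rw [(hasD_extChartAt_symm (1 : G)).mD_eq, ContinuousLinearMap.id_comp, extChartAt_to_inv] at h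
  rw [h]
  have h : (fun y : G => 1 * y) = fun y => y := by funext x; simp
  unfold leftL
  rw [h]
  exact (hasD_id _).mD_eq

/-- Solutions of the differential equation in the chart at the identity. -/
lemma hasLD_of_hasDerivAt_chart {α : ℝ → E} {s : ℝ} {X : E}
    (hα : α s ∈ (extChartAt 𝓘(ℝ, E) (1 : G)).target)
    (hd : HasDerivAt α (chartLeft G (α s) X) s) :
    HasLD (fun s => (extChartAt 𝓘(ℝ, E) (1 : G)).symm (α s)) s X := by
  have hs : HasD 𝓘(ℝ, E) 𝓘(ℝ, E) (extChartAt 𝓘(ℝ, E) (1 : G)).symm (α s) _ :=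
    ((contMDiffOn_extChartAt_symm (n := ∞) (1 : G)).contMDiffAt
      ((isOpen_extChartAt_target (I := 𝓘(ℝ, E)) (1 : G)).mem_nhds hα)).hasD
  have h1 : HasD 𝓘(ℝ, ℝ) 𝓘(ℝ, E) α s
      (ContinuousLinearMap.smulRight (1 : ℝ →L[ℝ] ℝ) (chartLeft G (α s) X)) :=
    hasD_iff_hasFDerivAt.2 hd.hasFDerivAt
  have h2 := hs.comp h1 rfl
  rw [comp_smulRight_one] at h2
  have h3 := DFunLike.congr_fun (symm_comp_chartLeft (G := G) hα) X
  rw [ContinuousLinearMap.comp_apply] at h3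
  rw [h3] at h2
  exact h2

lemma exists_chart_constants (G : Type*) [TopologicalSpace G] [ChartedSpace E G] [Group G]
    [LieGroup 𝓘(ℝ, E) ∞ G] : ∃ a C K : ℝ≥0, 0 < a ∧ 0 < C ∧
    Metric.closedBall (extChartAt 𝓘(ℝ, E) (1 : G) 1) a ⊆ (extChartAt 𝓘(ℝ, E) (1 : G)).target ∧
    LipschitzOnWith K (chartLeft G) (Metric.closedBall (extChartAt 𝓘(ℝ, E) (1 : G) 1) a) ∧
    ∀ y ∈ Metric.closedBall (extChartAt 𝓘(ℝ, E) (1 : G) 1) a, ‖chartLeft G y‖ ≤ C := by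
  set o := extChartAt 𝓘(ℝ, E) (1 : G) 1
  have ho : o ∈ (extChartAt 𝓘(ℝ, E) (1 : G)).target := mem_extChartAt_target 1
  have hcd : ContDiffAt ℝ 1 (chartLeft G) o := (contDiffAt_chartLeft (G := G) ho).of_le (by simp)
  obtain ⟨K, S, hS, hK⟩ := hcd.exists_lipschitzOnWith
  obtain ⟨a, ha, hab⟩ := Metric.mem_nhds_iff.1 (Filter.inter_mem hS
    (extChartAt_target_mem_nhds (I := 𝓘(ℝ, E)) (1 : G)))
  have ha2 : 0 < a / 2 := by positivity
  have hsub : Metric.closedBall o (a / 2) ⊆ Metric.ball o a :=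
    Metric.closedBall_subset_ball (by linarith)
  refine ⟨⟨a / 2, ha2.le⟩, ‖chartLeft G o‖₊ + K * ⟨a / 2, ha2.le⟩ + 1, K, ha2, by positivity,
    fun y hy => (hab (hsub hy)).2, hK.mono fun y hy => (hab (hsub hy)).1, fun y hy => ?_⟩
  have h1 := hK.dist_le_mul y (hab (hsub hy)).1 o (mem_of_mem_nhds hS)
  rw [dist_eq_norm] at h1
  have h2 : dist y o ≤ a / 2 := hy
  have h3 : (K : ℝ) * dist y o ≤ K * (a / 2) := by gcongr
  have h4 : ‖chartLeft G y‖ ≤ ‖chartLeft G o‖ + ‖chartLeft G y - chartLeft G o‖ := by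
    have := norm_add_le (chartLeft G o) (chartLeft G y - chartLeft G o)
    rwa [add_sub_cancel] at this
  change ‖chartLeft G y‖ ≤ ‖chartLeft G o‖ + K * (a / 2) + 1
  linarith

/-- Local solutions in the chart at the identity. -/
lemma exists_local_chart_solution [CompleteSpace E] {a C K : ℝ≥0}
    (hlip : LipschitzOnWith K (chartLeft G) (Metric.closedBall (extChartAt 𝓘(ℝ, E) (1 : G) 1) a))
    (hC : ∀ y ∈ Metric.closedBall (extChartAt 𝓘(ℝ, E) (1 : G) 1) a, ‖chartLeft G y‖ ≤ C)
    {b : ℝ → E} (hb : Continuous b) {s₀ ε : ℝ} (hε : 0 < ε) {β : ℝ≥0}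
    (hβ : ∀ s ∈ Icc (s₀ - ε) (s₀ + ε), ‖b s‖ ≤ β) (hsmall : C * β * ε ≤ a) :
    ∃ α : ℝ → E, α s₀ = extChartAt 𝓘(ℝ, E) (1 : G) 1 ∧
      (∀ s, α s ∈ Metric.closedBall (extChartAt 𝓘(ℝ, E) (1 : G) 1) a) ∧
      ∀ s ∈ Ioo (s₀ - ε) (s₀ + ε), HasDerivAt α (chartLeft G (α s) (b s)) s := by
  have hpl : IsPicardLindelof (fun s y => chartLeft G y (b s)) (tmin := s₀ - ε) (tmax := s₀ + ε)
      ⟨s₀, by constructor <;> linarith⟩ (extChartAt 𝓘(ℝ, E) (1 : G) 1) a 0 (C * β) (K * β) := by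
    refine ⟨fun s hs => ?_, fun y hy => ?_, fun s hs y hy => ?_, ?_⟩
    · refine LipschitzOnWith.of_dist_le_mul fun y hy z hz => ?_
      rw [dist_eq_norm, ← sub_apply]
      refine ((chartLeft G y - chartLeft G z).le_opNorm _).trans ?_
      have h1 := hlip.dist_le_mul y hy z hz
      rw [dist_eq_norm] at h1
      calc _ ≤ (K * dist y z) * β := by gcongr; exact hβ s hs
        _ = _ := by push_cast; ring
    · exact ((chartLeft G y).continuous.comp hb).continuousOn
    · refine ((chartLeft G y).le_opNorm _).trans ?_
      push_cast
      gcongr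
      · exact hC y hy
      · exact hβ s hs
    · simpa using hsmall
  obtain ⟨α, h0, hmem, hd⟩ := exists_solution_mem_closedBall hpl
  exact ⟨α, h0, hmem, fun s hs =>
    (hd s (Ioo_subset_Icc_self hs)).hasDerivAt (Icc_mem_nhds hs.1 hs.2)⟩

lemma exists_glue [T2Space G] {h₁ h₂ : ℝ → G} {μ : ℝ → E} {a b c d s₀ : ℝ}
    (h₁d : ∀ s ∈ Ioo a b, HasLD h₁ s (μ s)) (h₂d : ∀ s ∈ Ioo c d, HasLD h₂ s (μ s))
    (hs₁ : s₀ ∈ Ioo a b) (hs₂ : s₀ ∈ Ioo c d) (h0 : h₁ s₀ = h₂ s₀) :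
    ∃ h : ℝ → G, (∀ s ∈ Ioo a b, h s = h₁ s) ∧
      ∀ s ∈ Ioo a b ∪ Ioo c d, HasLD h s (μ s) := by
  classical
  have key : ∀ s ∈ Ioo a b ∩ Ioo c d, h₁ s = h₂ s := by
    intro s hs
    refine eq_of_hasLD (μ := μ) (isOpen_Ioo.inter isOpen_Ioo) ?_ (fun s hs => h₁d s hs.1)
      (fun s hs => h₂d s hs.2) ⟨hs₁, hs₂⟩ h0 hs
    exact (ordConnected_Ioo.inter ordConnected_Ioo).isPreconnected
  refine ⟨fun s => if s ∈ Ioo a b then h₁ s else h₂ s, fun s hs => if_pos hs, ?_⟩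
  rintro s (hs | hs)
  · refine (h₁d s hs).congr ?_
    filter_upwards [isOpen_Ioo.mem_nhds hs] with z hz
    exact if_pos hz
  · refine (h₂d s hs).congr ?_
    filter_upwards [isOpen_Ioo.mem_nhds hs] with z hz
    by_cases hz' : z ∈ Ioo a b
    · rw [if_pos hz', key z ⟨hz', hz⟩]
    · rw [if_neg hz']

lemma exists_hasLD_Ioo [CompleteSpace E] [T2Space G] {μ : ℝ → E} (hμ : Continuous μ) (R : ℝ) :
    ∃ h : ℝ → G, h 0 = 1 ∧ ∀ s ∈ Ioo (-R) R, HasLD h s (μ s) := by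
  obtain ⟨a, C, K, ha, hC, hball, hlip, hbd⟩ := exists_chart_constants (E := E) G
  set ν : ℝ → E := fun s => μ (max (-|R|) (min |R| s)) with hν
  have hνc : Continuous ν := hμ.comp (by fun_prop)
  obtain ⟨β', hβ'⟩ := (isCompact_Icc (a := -|R|) (b := |R|)).exists_bound_of_continuousOn
    hμ.continuousOn
  set β : ℝ≥0 := Real.toNNReal β' + 1
  have hβ : ∀ s, ‖ν s‖ ≤ β := by
    intro s
    have h1 : ‖ν s‖ ≤ β' := hβ' _ ⟨le_max_left _ _, max_le (by linarith [abs_nonneg R])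
      (min_le_left _ _)⟩
    have h2 : β' ≤ Real.toNNReal β' := Real.le_coe_toNNReal β'
    have h3 : ((β : ℝ≥0) : ℝ) = Real.toNNReal β' + 1 := rfl
    rw [h3]; linarith
  have hβpos : (0 : ℝ) < β := by positivity
  set η : ℝ := a / (C * β) / 2 with hη
  have hηpos : 0 < η := by
    have : (0 : ℝ) < a := ha
    have : (0 : ℝ) < C := hC
    positivity
  have hloc : ∀ s₀ : ℝ, ∃ k : ℝ → G, k s₀ = 1 ∧
      ∀ s ∈ Ioo (s₀ - 2 * η) (s₀ + 2 * η), HasLD k s (ν s) := by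
    intro s₀
    obtain ⟨α, h0, hmem, hd⟩ := exists_local_chart_solution (G := G) hlip hbd hνc (s₀ := s₀)
      (ε := 2 * η) (by positivity) (β := β) (fun s _ => hβ s) (by
        have : (0 : ℝ) < C := hC
        rw [hη]
        field_simp
        exact le_rfl)
    exact ⟨_, by rw [h0, extChartAt_to_inv], fun s hs =>
      hasLD_of_hasDerivAt_chart (hball (hmem s)) (hd s hs)⟩
  have hstep : ∀ n : ℕ, ∃ h : ℝ → G, h 0 = 1 ∧
      ∀ s ∈ Ioo (-((n + 1) * η)) ((n + 1) * η), HasLD h s (ν s) := by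
    intro n
    induction n with
    | zero =>
      obtain ⟨k, h0, hk⟩ := hloc 0
      refine ⟨k, h0, fun s hs => hk s ⟨?_, ?_⟩⟩
      · have := hs.1; push_cast at this; linarith
      · have := hs.2; push_cast at this; linarith
    | succ n ih =>
      obtain ⟨h, h0, hh⟩ := ih
      have hn : (0 : ℝ) ≤ n * η := by positivity
      have e1 : ((n : ℝ) + 1) * η = n * η + η := by ring
      have e2 : (((n + 1 : ℕ) : ℝ) + 1) * η = n * η + 2 * η := by push_cast; ring
      rw [e1] at hh
      rw [e2]
      obtain ⟨k, hk0, hk⟩ := hloc (n * η)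
      obtain ⟨h', hh', hd'⟩ := exists_glue hh (fun s hs => (hk s hs).const_mul (h (n * η)))
        (s₀ := n * η) ⟨by linarith, by linarith⟩ ⟨by linarith, by linarith⟩ (by simp [hk0])
      have hd2 : ∀ s ∈ Ioo (-(n * η + η)) (n * η + 2 * η), HasLD h' s (ν s) := by
        intro s hs
        refine hd' s ?_
        by_cases h1 : s < n * η + η
        · exact Or.inl ⟨hs.1, h1⟩
        · exact Or.inr ⟨by linarith, by linarith [hs.2]⟩
      obtain ⟨k, hk0, hk⟩ := hloc (-(n * η))
      obtain ⟨h'', hh'', hd''⟩ := exists_glue hd2 (fun s hs => (hk s hs).const_mul (h' (-(n * η))))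
        (s₀ := -(n * η)) ⟨by linarith, by linarith⟩ ⟨by linarith, by linarith⟩ (by simp [hk0])
      refine ⟨h'', ?_, fun s hs => hd'' s ?_⟩
      · rw [hh'' 0 ⟨by linarith, by linarith⟩, hh' 0 ⟨by linarith, by linarith⟩, h0]
      · by_cases h1 : -(n * η + η) < s
        · exact Or.inl ⟨h1, hs.2⟩
        · exact Or.inr ⟨by linarith [hs.1], by linarith⟩
  obtain ⟨n, hn⟩ := exists_nat_gt (R / η)
  obtain ⟨h, h0, hh⟩ := hstep n
  have hR : R < (n + 1) * η := by
    rw [div_lt_iff₀ hηpos] at hn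
    linarith
  refine ⟨h, h0, fun s hs => ?_⟩
  have h1 := hh s ⟨by linarith [hs.1], by linarith [hs.2]⟩
  have h2 : ν s = μ s := by
    have h3 : |R| = R := abs_of_pos (by linarith [hs.1, hs.2])
    simp only [hν, h3, min_eq_right hs.2.le, max_eq_right hs.1.le]
  rwa [h2] at h1

/-- Parallel transport exists for continuous connections. -/
lemma exists_isParallel [CompleteSpace E] [T2Space G] {μ : ℝ → E} (hμ : Continuous μ) :
    ∃ h : ℝ → G, IsParallel μ h := by
  choose h h0 hh using fun n : ℕ => exists_hasLD_Ioo (G := G) hμ ((n : ℝ) + 1)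
  have key : ∀ (m n : ℕ), m ≤ n → ∀ s ∈ Ioo (-((m : ℝ) + 1)) (m + 1), h n s = h m s := by
    intro m n hmn s hs
    have hmn' : (m : ℝ) ≤ n := by exact_mod_cast hmn
    have hm0 : (0 : ℝ) ≤ m := Nat.cast_nonneg m
    refine eq_of_hasLD (μ := μ) isOpen_Ioo isPreconnected_Ioo
      (fun s hs => hh n s ⟨by linarith [hs.1], by linarith [hs.2]⟩) (fun s hs => hh m s hs)
      (s₀ := 0) ⟨by linarith, by linarith⟩ (by rw [h0, h0]) hs
  refine ⟨fun s => h ⌈|s|⌉₊ s, by simp [h0], fun s => ?_⟩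
  refine HasLD.congr (hh (⌈|s|⌉₊ + 1) s ?_) ?_
  · have h1 := Nat.le_ceil |s|
    have h2 := abs_le.1 h1
    push_cast
    constructor <;> linarith [h2.1, h2.2]
  · have hnear : ∀ᶠ z in 𝓝 s, |z| < (⌈|s|⌉₊ : ℝ) + 1 :=
      (continuous_abs.continuousAt.eventually_lt continuousAt_const
        (by linarith [Nat.le_ceil |s|]))
    filter_upwards [hnear] with z hz
    refine (key _ _ ?_ z ?_).symm
    · have : ⌈|z|⌉₊ ≤ ⌈|s|⌉₊ + 1 := by
        rw [Nat.ceil_le]; push_cast; exact hz.le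
      exact this
    · have := abs_le.1 (Nat.le_ceil |z|)
      constructor <;> linarith [this.1, this.2]

lemma isParallel_hol [CompleteSpace E] [T2Space G] {μ : ℝ → E} (hμ : Continuous μ) :
    IsParallel μ (Hol G μ) := by
  obtain ⟨h, hh⟩ := exists_isParallel (G := G) hμ
  rw [hh.hol_eq]
  exact hh

/-- The first order expansion of parallel transport of small connections. -/
lemma exists_hol_estimate [CompleteSpace E] (G : Type*) [TopologicalSpace G] [ChartedSpace E G]
    [Group G] [LieGroup 𝓘(ℝ, E) ∞ G] [T2Space G] : ∃ δ D : ℝ, 0 < δ ∧ ∀ (b : ℝ → E), Continuous b →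
    ∀ β : ℝ, β ≤ δ → (∀ s ∈ Icc (-2 : ℝ) 2, ‖b s‖ ≤ β) → ∀ s ∈ Ioo (-2 : ℝ) 2,
      Hol G b s ∈ (extChartAt 𝓘(ℝ, E) (1 : G)).source ∧
      ‖extChartAt 𝓘(ℝ, E) (1 : G) (Hol G b s) - extChartAt 𝓘(ℝ, E) (1 : G) 1 -
        ∫ r in (0 : ℝ)..s, b r‖ ≤ D * β ^ 2 := by
  obtain ⟨a, C, K, ha, hC, hball, hlip, hbd⟩ := exists_chart_constants (E := E) G
  set e := extChartAt 𝓘(ℝ, E) (1 : G)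
  have ha' : (0 : ℝ) < a := ha
  have hC' : (0 : ℝ) < C := hC
  refine ⟨a / (C * 2), K * (C * 2) * 2, by positivity, fun b hb β hβδ hβ s hs => ?_⟩
  have hβ0 : 0 ≤ β := (norm_nonneg _).trans (hβ 0 ⟨by norm_num, by norm_num⟩)
  have hsm : (C : ℝ) * β * 2 ≤ a := by
    rw [le_div_iff₀ (by positivity)] at hβδ
    linarith
  obtain ⟨α, h0, hmem, hd⟩ := exists_local_chart_solution (G := G) hlip hbd hb (s₀ := 0)
    (ε := 2) (by norm_num) (β := ⟨β, hβ0⟩) (by simp only [zero_sub, zero_add]; exact hβ) hsm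
  simp only [zero_sub, zero_add] at hd
  have hhol : ∀ s ∈ Ioo (-2 : ℝ) 2, Hol G b s = e.symm (α s) := by
    intro s hs
    refine eq_of_hasLD (μ := b) isOpen_Ioo isPreconnected_Ioo (fun s _ => (isParallel_hol hb).2 s)
      (fun s hs => hasLD_of_hasDerivAt_chart (hball (hmem s)) (hd s hs)) (s₀ := 0)
      ⟨by norm_num, by norm_num⟩ ?_ hs
    rw [(isParallel_hol hb).1, h0, extChartAt_to_inv]
  have hα : ∀ s ∈ Ioo (-2 : ℝ) 2, ‖α s - e 1‖ ≤ C * β * 2 := by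
    intro s hs
    have := (convex_Ioo (-2 : ℝ) 2).norm_image_sub_le_of_norm_hasDerivWithin_le (C := C * β)
      (fun x hx => (hd x hx).hasDerivWithinAt) (fun x hx => ?_)
      (show (0 : ℝ) ∈ Ioo (-2 : ℝ) 2 from ⟨by norm_num, by norm_num⟩) hs
    · rw [h0] at this
      refine this.trans ?_
      gcongr
      rw [sub_zero]
      exact (abs_lt.2 hs).le
    · refine ((chartLeft G (α x)).le_opNorm _).trans ?_
      gcongr
      · exact hbd _ (hmem x)
      · exact hβ x (Ioo_subset_Icc_self hx)
  rw [hhol s hs]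
  refine ⟨e.map_target (hball (hmem s)), ?_⟩
  rw [e.right_inv (hball (hmem s))]
  have hd2 : ∀ x ∈ Ioo (-2 : ℝ) 2, HasDerivWithinAt (fun s => α s - ∫ r in (0 : ℝ)..s, b r)
      (chartLeft G (α x) (b x) - b x) (Ioo (-2 : ℝ) 2) x := fun x hx =>
    ((hd x hx).sub (intervalIntegral.integral_hasDerivAt_right (hb.intervalIntegrable _ _)
      (hb.stronglyMeasurableAtFilter _ _) hb.continuousAt)).hasDerivWithinAt
  have := (convex_Ioo (-2 : ℝ) 2).norm_image_sub_le_of_norm_hasDerivWithin_le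
    (C := K * (C * β * 2) * β) hd2 (fun x hx => ?_)
    (show (0 : ℝ) ∈ Ioo (-2 : ℝ) 2 from ⟨by norm_num, by norm_num⟩) hs
  · rw [h0] at this
    simp only [intervalIntegral.integral_same, sub_zero] at this
    rw [sub_right_comm] at this
    refine this.trans ?_
    calc _ ≤ K * (C * β * 2) * β * 2 := by
          gcongr
          exact (abs_lt.2 hs).le
      _ = _ := by ring
  · have h1 : chartLeft G (α x) (b x) - b x = (chartLeft G (α x) - chartLeft G (e 1)) (b x) := by
      rw [sub_apply, chartLeft_one]; rfl
    rw [h1]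
    refine (ContinuousLinearMap.le_opNorm _ _).trans ?_
    gcongr
    · have h2 := hlip.dist_le_mul (α x) (hmem x) (e 1) (Metric.mem_closedBall_self ha.le)
      rw [dist_eq_norm, dist_eq_norm] at h2
      refine h2.trans ?_
      gcongr
      exact hα x hx
    · exact hβ x (Ioo_subset_Icc_self hx)

end Existence

/-! ### The adjoint action, the exponential map and the variation of parallel transport -/

section LieConsequences

variable {E : Type*} [NormedAddCommGroup E] [NormedSpace ℝ E]
  {G : Type*} [TopologicalSpace G] [ChartedSpace E G] [Group G] [LieGroup 𝓘(ℝ, E) ∞ G]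

lemma AdL_eq_fderiv (g : G) : AdL g = fderiv ℝ (fun y => extChartAt 𝓘(ℝ, E) (1 : G)
    (g * (extChartAt 𝓘(ℝ, E) (1 : G)).symm y * g⁻¹)) (extChartAt 𝓘(ℝ, E) (1 : G) 1) := by
  have h := (hasD_extChartAt (E := E) (1 : G)).comp ((hasD_conj g).comp
    (hasD_extChartAt_symm (E := E) (1 : G)) (extChartAt_to_inv 1)) (by simp)
  rw [hasD_iff_hasFDerivAt] at h
  rw [h.fderiv]
  rfl

lemma contMDiff_AdL : ContMDiff 𝓘(ℝ, E) 𝓘(ℝ, E →L[ℝ] E) ∞ (AdL : G → E →L[ℝ] E) := by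
  intro g
  have hsymm : ContMDiffAt 𝓘(ℝ, E) 𝓘(ℝ, E) ∞ (extChartAt 𝓘(ℝ, E) (1 : G)).symm
      (extChartAt 𝓘(ℝ, E) (1 : G) 1) :=
    (contMDiffOn_extChartAt_symm (n := ∞) (1 : G)).contMDiffAt (extChartAt_target_mem_nhds 1)
  have h1 : ContMDiffAt (𝓘(ℝ, E).prod 𝓘(ℝ, E)) 𝓘(ℝ, E) ∞
      (fun p : G × E => p.1 * (extChartAt 𝓘(ℝ, E) (1 : G)).symm p.2 * p.1⁻¹)
      (g, extChartAt 𝓘(ℝ, E) (1 : G) 1) :=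
    (contMDiffAt_fst.mul (ContMDiffAt.comp (g, extChartAt 𝓘(ℝ, E) (1 : G) 1) hsymm
      contMDiffAt_snd)).mul contMDiffAt_fst.inv
  have h2 := contMDiffAt_partial_fderiv (v := fun (g : G) (y : E) => extChartAt 𝓘(ℝ, E) (1 : G)
    (g * (extChartAt 𝓘(ℝ, E) (1 : G)).symm y * g⁻¹)) (p := (g, extChartAt 𝓘(ℝ, E) (1 : G) 1))
    (ContMDiffAt.comp (g, extChartAt 𝓘(ℝ, E) (1 : G) 1) (g := extChartAt 𝓘(ℝ, E) (1 : G))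
      (contMDiffAt_extChartAt' (by simp)) h1)
  have h3 : ContMDiffAt 𝓘(ℝ, E) (𝓘(ℝ, E).prod 𝓘(ℝ, E)) ∞
    (fun g : G => (g, extChartAt 𝓘(ℝ, E) (1 : G) 1)) g := contMDiffAt_id.prodMk contMDiffAt_const
  exact (ContMDiffAt.comp g h2 h3).congr_of_eventuallyEq
    (Filter.Eventually.of_forall fun g => AdL_eq_fderiv g)

lemma continuous_AdL : Continuous (AdL : G → E →L[ℝ] E) := contMDiff_AdL.continuous

/-- The differential of the adjoint action at the identity. -/
def adL (G : Type*) [TopologicalSpace G] [ChartedSpace E G] [Group G] : E →L[ℝ] E →L[ℝ] E :=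
  mD 𝓘(ℝ, E) 𝓘(ℝ, E →L[ℝ] E) (AdL : G → E →L[ℝ] E) 1

lemma leftL_one : leftL (1 : G) = ContinuousLinearMap.id ℝ E := by
  have h : (fun y : G => 1 * y) = fun y => y := by funext x; simp
  unfold leftL
  rw [h]
  exact (hasD_id _).mD_eq

lemma rightL_one : rightL (1 : G) = ContinuousLinearMap.id ℝ E := by
  rw [rightL_eq, leftL_one, inv_one, AdL_one]
  rfl

lemma HasLD.hasDerivAt_AdL {h : ℝ → G} {s : ℝ} {X : E} (hh : HasLD h s X) :
    HasDerivAt (fun r => AdL (E := E) (h r)) ((AdL (h s)).comp (adL G X)) s := by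
  have h1 := hh.const_mul (h s)⁻¹
  have h2 : HasD 𝓘(ℝ, ℝ) 𝓘(ℝ, E) (fun r => (h s)⁻¹ * h r) s
      (ContinuousLinearMap.smulRight (1 : ℝ →L[ℝ] ℝ) X) := by
    unfold HasLD at h1
    beta_reduce at h1
    rw [inv_mul_cancel, leftL_one] at h1
    exact h1
  have h3 := (contMDiff_AdL.hasD (1 : G)).comp h2 (by simp)
  rw [comp_smulRight_one] at h3
  have h4 : HasDerivAt (fun r => AdL (E := E) ((h s)⁻¹ * h r)) (adL G X) s := by
    have h5 := hasD_iff_hasFDerivAt.1 h3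
    exact h5.hasDerivAt.congr_deriv (by simp [adL])
  have h6 := ((ContinuousLinearMap.compL ℝ E E E) (AdL (h s))).hasFDerivAt.comp_hasDerivAt s h4
  refine h6.congr_of_eventuallyEq (Filter.Eventually.of_forall fun r => ?_)
  simp only [Function.comp, ContinuousLinearMap.compL_apply, ← AdL_mul, mul_inv_cancel_left]

lemma HasLD.comp_real {h : ℝ → G} {u : ℝ → ℝ} {s c : ℝ} {X : E} (hh : HasLD h (u s) X)
    (hu : HasDerivAt u c s) : HasLD (fun r => h (u r)) s (c • X) := by
  have h1 : HasD 𝓘(ℝ, ℝ) 𝓘(ℝ, ℝ) u s (ContinuousLinearMap.smulRight (1 : ℝ →L[ℝ] ℝ) c) :=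
    hasD_iff_hasFDerivAt.2 hu.hasFDerivAt
  have h2 := HasD.comp hh h1 rfl
  unfold HasLD
  convert h2 using 1
  ext; simp

/-- Differentiability of a map into `G` at a point that is mapped to the identity. -/
lemma hasD_of_hasFDerivAt_chart {Z : Type*} [NormedAddCommGroup Z] [NormedSpace ℝ Z]
    {u : Z → G} {z : Z} {L : Z →L[ℝ] E} (hu : u z = 1)
    (hsrc : ∀ᶠ y in 𝓝 z, u y ∈ (extChartAt 𝓘(ℝ, E) (1 : G)).source)
    (hd : HasFDerivAt (fun y => extChartAt 𝓘(ℝ, E) (1 : G) (u y)) L z) :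
    HasD 𝓘(ℝ, Z) 𝓘(ℝ, E) u z L := by
  have h1 := (hasD_extChartAt_symm (E := E) (1 : G)).comp (hasD_iff_hasFDerivAt.2 hd) (by rw [hu])
  rw [ContinuousLinearMap.id_comp] at h1
  refine h1.congr ?_
  filter_upwards [hsrc] with y hy
  exact ((extChartAt 𝓘(ℝ, E) (1 : G)).left_inv hy).symm

variable [CompleteSpace E] [T2Space G]

lemma hol_add {μ ν : ℝ → E} (hμ : Continuous μ) (hν : Continuous ν) (s : ℝ) :
    Hol G (fun r => μ r + ν r) s =
      Hol G (fun r => AdL (Hol G μ r) (ν r)) s * Hol G μ s := by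
  have h := isParallel_hol (G := G) hμ
  have hc : Continuous (Hol G μ) := continuous_iff_continuousAt.2 fun r => (h.2 r).continuousAt
  have hb : Continuous fun r => AdL (Hol G μ r) (ν r) := (continuous_AdL.comp hc).clm_apply hν
  have hk := isParallel_hol (G := G) hb
  refine congrFun (IsParallel.hol_eq (h := fun s =>
    Hol G (fun r => AdL (Hol G μ r) (ν r)) s * Hol G μ s) ⟨?_, fun r => ?_⟩) s
  · simp [h.1, hk.1]
  · have h1 := HasLD.mul (hk.2 r) (h.2 r)
    rw [AdL_inv_apply, add_comm] at h1
    exact h1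

/-- Parallel transport is differentiable with respect to the connection. Here the connections are
parametrized by a normed space `Z` that maps to the continuous functions. -/
lemma hasD_hol {Z : Type*} [NormedAddCommGroup Z] [NormedSpace ℝ Z] (J : Z →ₗ[ℝ] (ℝ → E))
    (hJ : ∀ a, Continuous (J a)) {C : ℝ} (hC : ∀ a, ∀ s ∈ Icc (-2 : ℝ) 2, ‖J a s‖ ≤ C * ‖a‖)
    (μ : Z) {s : ℝ} (hs : s ∈ Ioo (-2 : ℝ) 2) {L : Z →L[ℝ] E}
    (hL : ∀ a, L a = ∫ r in (0 : ℝ)..s, AdL (Hol G (J μ) r) (J a r)) :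
    HasD 𝓘(ℝ, Z) 𝓘(ℝ, E) (fun ν => Hol G (J ν) s) μ ((rightL (Hol G (J μ) s)).comp L) := by
  have h := isParallel_hol (G := G) (hJ μ)
  have hc : Continuous (Hol G (J μ)) := continuous_iff_continuousAt.2 fun r => (h.2 r).continuousAt
  have hcA : Continuous fun r => AdL (E := E) (Hol G (J μ) r) := continuous_AdL.comp hc
  obtain ⟨C₁, hC₁⟩ := (isCompact_Icc (a := (-2 : ℝ)) (b := 2)).exists_bound_of_continuousOn
    hcA.continuousOn
  have hC₁0 : 0 ≤ C₁ := (norm_nonneg _).trans (hC₁ 0 ⟨by norm_num, by norm_num⟩)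
  obtain ⟨δ, D, hδ, hest⟩ := exists_hol_estimate (E := E) G
  set e := extChartAt 𝓘(ℝ, E) (1 : G)
  set b : Z → ℝ → E := fun a r => AdL (Hol G (J μ) r) (J a r) with hb
  have hbc : ∀ a, Continuous (b a) := fun a => hcA.clm_apply (hJ a)
  have hbb : ∀ a, ∀ r ∈ Icc (-2 : ℝ) 2, ‖b a r‖ ≤ C₁ * |C| * ‖a‖ := fun a r hr => by
    refine (ContinuousLinearMap.le_opNorm _ _).trans ?_
    rw [mul_assoc]
    gcongr
    · exact hC₁ r hr
    · exact (hC a r hr).trans (by gcongr; exact le_abs_self C)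
  have hsmall : ∀ᶠ a in 𝓝 (0 : Z), C₁ * |C| * ‖a‖ ≤ δ := by
    have : Filter.Tendsto (fun a : Z => C₁ * |C| * ‖a‖) (𝓝 0) (𝓝 (C₁ * |C| * ‖(0 : Z)‖)) :=
      (continuous_const.mul continuous_norm).tendsto 0
    rw [norm_zero, mul_zero] at this
    exact (this.eventually_lt_const hδ).mono fun _ h => h.le
  have key : HasD 𝓘(ℝ, Z) 𝓘(ℝ, E) (fun a => Hol G (b a) s) 0 L := by
    have hb0 : Hol G (b 0) s = 1 := by
      have : b 0 = fun _ => 0 := by funext r; simp [hb]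
      rw [this]
      exact congrFun (IsParallel.hol_eq (h := fun _ => (1 : G))
        ⟨rfl, fun r => hasLD_const (E := E) 1 r⟩) s
    refine hasD_of_hasFDerivAt_chart hb0 ?_ ?_
    · filter_upwards [hsmall] with a ha
      exact (hest (b a) (hbc a) _ ha (hbb a) s hs).1
    · refine .of_isLittleO ?_
      have hO : (fun a : Z => e (Hol G (b a) s) - e (Hol G (b 0) s) - L (a - 0)) =O[𝓝 0]
          fun a => ‖a‖ ^ 2 := by
        refine Asymptotics.IsBigO.of_bound (|D| * (C₁ * |C|) ^ 2) ?_
        filter_upwards [hsmall] with a ha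
        have := (hest (b a) (hbc a) _ ha (hbb a) s hs).2
        rw [hb0, sub_zero, hL]
        refine this.trans ?_
        rw [Real.norm_of_nonneg (by positivity), mul_pow, mul_assoc]
        have hD := le_abs_self D
        gcongr
      refine hO.trans_isLittleO ?_
      simp only [sub_zero]
      have := Asymptotics.isLittleO_norm_pow_id (E' := Z) (n := 2) (by norm_num)
      simpa using this
  have h1 := (hasD_mul_right (E := E) (Hol G (J μ) s) 1).comp key (by
    have : b 0 = fun _ => 0 := by funext r; simp [hb]
    rw [this]
    exact congrFun (IsParallel.hol_eq (h := fun _ => (1 : G))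
        ⟨rfl, fun r => hasLD_const (E := E) 1 r⟩) s)
  have h2 : HasD 𝓘(ℝ, Z) 𝓘(ℝ, Z) (fun ν => ν - μ) μ (ContinuousLinearMap.id ℝ Z) :=
    hasD_iff_hasFDerivAt.2 ((hasFDerivAt_id μ).sub_const μ)
  have h3 := h1.comp h2 (sub_self μ)
  rw [ContinuousLinearMap.comp_id] at h3
  refine h3.congr (Filter.Eventually.of_forall fun ν => ?_)
  have h4 := hol_add (G := G) (hJ μ) (hJ (ν - μ)) s
  have h5 : (fun r => J μ r + J (ν - μ) r) = J ν := by
    funext r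
    rw [map_sub]
    simp
  rw [h5] at h4
  exact h4

lemma hol_const (X : E) (s : ℝ) : Hol G (fun _ => X) s = lieExp G (s • X) := by
  have h := isParallel_hol (G := G) (μ := fun _ => X) continuous_const
  have : IsParallel (fun _ => s • X) (fun r => Hol G (fun _ => X) (s * r)) := by
    refine ⟨by simp [h.1], fun r => ?_⟩
    exact HasLD.comp_real (u := fun r => s * r) (h.2 (s * r))
      (by simpa using (hasDerivAt_id r).const_mul s)
  unfold lieExp
  rw [this.hol_eq]
  simp

lemma hasLD_lieExp_smul (X : E) (s : ℝ) : HasLD (fun s => lieExp G (s • X)) s X := by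
  have h := isParallel_hol (G := G) (μ := fun _ => X) continuous_const
  rw [show Hol G (fun _ => X) = fun s => lieExp G (s • X) from funext (hol_const X)] at h
  exact h.2 s

lemma lieExp_zero : lieExp G (0 : E) = 1 := by
  have h := isParallel_hol (G := G) (μ := fun _ => (0 : E)) continuous_const
  have := h.1
  rwa [hol_const, smul_zero] at this

lemma isParallel_lieExp (X : E) : IsParallel (fun _ => X) (fun s => lieExp G (s • X)) :=
  ⟨by simp [lieExp_zero], hasLD_lieExp_smul X⟩

/-- The constant connections. -/
def constPath (E : Type*) [NormedAddCommGroup E] [NormedSpace ℝ E] : E →ₗ[ℝ] (ℝ → E) where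
  toFun X := fun _ => X
  map_add' _ _ := rfl
  map_smul' _ _ := rfl

lemma hasD_lieExp_zero : HasD 𝓘(ℝ, E) 𝓘(ℝ, E) (lieExp G) (0 : E) (ContinuousLinearMap.id ℝ E) := by
  have h := hasD_hol (G := G) (constPath E) (fun a => continuous_const) (C := 1)
    (fun a s _ => by simp [constPath]) (0 : E) (s := 1) ⟨by norm_num, by norm_num⟩
    (L := ContinuousLinearMap.id ℝ E) (fun a => by
      have : ∀ r, Hol G (constPath E 0) r = 1 := fun r => by
        rw [show constPath E 0 = fun _ => (0 : E) from rfl, hol_const, smul_zero, lieExp_zero]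
      simp only [this, AdL_one]
      simp [constPath])
  have h1 : Hol G (constPath E 0) 1 = 1 := by
    rw [show constPath E 0 = fun _ => (0 : E) from rfl, hol_const, smul_zero, lieExp_zero]
  rw [h1, rightL_one, ContinuousLinearMap.id_comp] at h
  exact h

/-- The exponential map commutes with conjugation. -/
lemma conj_lieExp (g : G) (X : E) : g * lieExp G X * g⁻¹ = lieExp G (AdL g X) := by
  have h : IsParallel (fun _ => AdL g X) (fun s => g * lieExp G (s • X) * g⁻¹) :=
    ⟨by simp [lieExp_zero], fun s => (hasLD_lieExp_smul X s).conj g⟩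
  have := congrFun (h.eq (isParallel_lieExp (AdL g X))) 1
  simpa using this

/-- The gauge transformation of parallel transport. -/
lemma gauge_hol {μ ν : ℝ → E} (hμ : Continuous μ) {γ : ℝ → G} {a : ℝ → E}
    (hγ : ∀ s, HasRD γ s (a s)) (hν : ∀ s, ν s = AdL (γ s) (μ s) - a s) (s : ℝ) :
    Hol G ν s = γ 0 * Hol G μ s * (γ s)⁻¹ := by
  have h := isParallel_hol (G := G) hμ
  refine congrFun (IsParallel.hol_eq (h := fun s => γ 0 * Hol G μ s * (γ s)⁻¹)
    ⟨by simp [h.1], fun r => ?_⟩) s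
  have h1 := (HasLD.const_mul (γ 0) (h.2 r)).mul (hasRD_iff.1 (hγ r)).inv
  rw [AdL_apply_inv, inv_inv] at h1
  rw [hν, sub_eq_add_neg]
  exact h1

/-! ### Abelian groups -/

section Abelian

lemma AdL_of_comm (hab : ∀ a b : G, a * b = b * a) (g : G) : AdL g = ContinuousLinearMap.id ℝ E := by
  have h : (fun x : G => g * x * g⁻¹) = fun x => x := by
    funext x; rw [hab g x, mul_inv_cancel_right]
  unfold AdL
  rw [h]
  exact (hasD_id _).mD_eq

lemma hasRD_iff_of_comm (hab : ∀ a b : G, a * b = b * a) {h : ℝ → G} {s : ℝ} {X : E} : HasRD h s X ↔ HasLD h s X := by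
  rw [hasRD_iff, AdL_of_comm hab]
  rfl

lemma lieExp_add (hab : ∀ a b : G, a * b = b * a) (X Y : E) : lieExp G (X + Y) = lieExp G X * lieExp G Y := by
  have h : IsParallel (fun _ => X + Y) (fun s => lieExp G (s • X) * lieExp G (s • Y)) := by
    refine ⟨by simp [lieExp_zero], fun s => ?_⟩
    have := (hasLD_lieExp_smul (G := G) X s).mul (hasLD_lieExp_smul (G := G) Y s)
    rwa [AdL_of_comm hab] at this
  have := congrFun ((isParallel_lieExp (G := G) (X + Y)).eq h) 1
  simpa using this

lemma lieExp_neg (hab : ∀ a b : G, a * b = b * a) (X : E) : lieExp G (-X) = (lieExp G X)⁻¹ := by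
  have := lieExp_add hab (-X) X
  rw [neg_add_cancel, lieExp_zero] at this
  exact eq_inv_of_mul_eq_one_left this.symm

lemma hasD_lieExp (hab : ∀ a b : G, a * b = b * a) (X : E) : HasD 𝓘(ℝ, E) 𝓘(ℝ, E) (lieExp G) X (leftL (lieExp G X)) := by
  have h2 : HasD 𝓘(ℝ, E) 𝓘(ℝ, E) (fun Y => Y - X) X (ContinuousLinearMap.id ℝ E) :=
    hasD_iff_hasFDerivAt.2 ((hasFDerivAt_id X).sub_const X)
  have h3 := (hasD_mul_left (E := E) (lieExp G X) 1).comp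
    ((hasD_lieExp_zero (G := G)).comp h2 (sub_self X)) (by simp [lieExp_zero])
  refine h3.congr (Filter.Eventually.of_forall fun Y => ?_)
  beta_reduce
  rw [← lieExp_add hab, add_sub_cancel]

lemma hasLD_lieExp_comp (hab : ∀ a b : G, a * b = b * a) {u : ℝ → E} {s : ℝ} {X : E} (hu : HasDerivAt u X s) :
    HasLD (fun s => lieExp G (u s)) s X := by
  have h1 : HasD 𝓘(ℝ, ℝ) 𝓘(ℝ, E) u s (ContinuousLinearMap.smulRight (1 : ℝ →L[ℝ] ℝ) X) :=
    hasD_iff_hasFDerivAt.2 hu.hasFDerivAt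
  have h2 := (hasD_lieExp hab (u s)).comp h1 rfl
  rwa [comp_smulRight_one] at h2

/-- In an abelian group, parallel transport is the exponential of the integral. -/
lemma hol_of_comm (hab : ∀ a b : G, a * b = b * a) {μ : ℝ → E} (hμ : Continuous μ) (s : ℝ) :
    Hol G μ s = lieExp G (∫ r in (0 : ℝ)..s, μ r) := by
  refine congrFun (IsParallel.hol_eq (h := fun s => lieExp G (∫ r in (0 : ℝ)..s, μ r))
    ⟨by simp [lieExp_zero], fun r => ?_⟩) s
  exact hasLD_lieExp_comp hab (intervalIntegral.integral_hasDerivAt_right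
    (hμ.intervalIntegrable _ _) (hμ.stronglyMeasurableAtFilter _ _) hμ.continuousAt)

lemma hasStrictFDerivAt_lieExp_chart (hab : ∀ a b : G, a * b = b * a) :
    HasStrictFDerivAt (fun X : E => extChartAt 𝓘(ℝ, E) (1 : G) (lieExp G X))
      (ContinuousLinearEquiv.refl ℝ E : E →L[ℝ] E) 0 := by
  set e := extChartAt 𝓘(ℝ, E) (1 : G)
  have hc : ContinuousAt (lieExp G) (0 : E) := (hasD_lieExp_zero (G := G)).continuousAt
  have hsrc : ∀ᶠ X in 𝓝 (0 : E), lieExp G X ∈ e.source := by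
    refine hc.preimage_mem_nhds ?_
    rw [lieExp_zero]
    exact extChartAt_source_mem_nhds 1
  have hder : ∀ᶠ X in 𝓝 (0 : E), HasFDerivAt (fun X : E => e (lieExp G X))
      (chartLeft G (e (lieExp G X))) X := by
    filter_upwards [hsrc] with X hX
    have h1 : HasD 𝓘(ℝ, E) 𝓘(ℝ, E) e (lieExp G X) _ :=
      (contMDiffAt_extChartAt' (n := ∞) (by simpa [e] using hX)).hasD
    have h2 := h1.comp (hasD_lieExp hab X) rfl
    have h3 := symm_comp_chartLeft (G := G) (e.map_source hX)
    have hs : HasD 𝓘(ℝ, E) 𝓘(ℝ, E) e.symm (e (lieExp G X)) _ :=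
      ((contMDiffOn_extChartAt_symm (n := ∞) (1 : G)).contMDiffAt
        ((isOpen_extChartAt_target (I := 𝓘(ℝ, E)) (1 : G)).mem_nhds (e.map_source hX))).hasD
    have h4 := (h1.comp hs (e.left_inv hX)).unique ((hasD_id (e (lieExp G X))).congr (by
      filter_upwards [(isOpen_extChartAt_target (I := 𝓘(ℝ, E)) (1 : G)).mem_nhds
        (e.map_source hX)] with y hy using e.right_inv hy))
    rw [e.left_inv hX] at h3
    rw [← h3, ← ContinuousLinearMap.comp_assoc, h4, ContinuousLinearMap.id_comp] at h2
    exact hasD_iff_hasFDerivAt.1 h2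
  have hcont : ContinuousAt (fun X : E => chartLeft G (e (lieExp G X))) 0 := by
    refine ContinuousAt.comp (g := chartLeft G) ?_ ?_
    · rw [lieExp_zero]
      exact (contDiffAt_chartLeft (G := G) (mem_extChartAt_target 1)).continuousAt
    · refine ContinuousAt.comp (g := e) ?_ hc
      rw [lieExp_zero]
      exact continuousAt_extChartAt 1
  have h := hasStrictFDerivAt_of_hasFDerivAt_of_continuousAt hder hcont
  rw [lieExp_zero, chartLeft_one] at h
  exact h

lemma lieExp_surjective (hab : ∀ a b : G, a * b = b * a) [ConnectedSpace G] : Function.Surjective (lieExp G : E → G) := by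
  set e := extChartAt 𝓘(ℝ, E) (1 : G)
  let S : Subgroup G :=
    { carrier := range (lieExp G : E → G)
      mul_mem' := by
        rintro _ _ ⟨X, rfl⟩ ⟨Y, rfl⟩
        exact ⟨X + Y, lieExp_add hab X Y⟩
      one_mem' := ⟨0, lieExp_zero⟩
      inv_mem' := by
        rintro _ ⟨X, rfl⟩
        exact ⟨-X, lieExp_neg hab X⟩ }
  have hS : (S : Set G) ∈ 𝓝 (1 : G) := by
    have h1 := (hasStrictFDerivAt_lieExp_chart (E := E) hab).map_nhds_eq_of_equiv
    have hc : ContinuousAt (lieExp G) (0 : E) := (hasD_lieExp_zero (G := G)).continuousAt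
    have hsrc : ∀ᶠ X in 𝓝 (0 : E), lieExp G X ∈ e.source := by
      refine hc.preimage_mem_nhds ?_
      rw [lieExp_zero]
      exact extChartAt_source_mem_nhds 1
    have h2 : (fun X : E => e (lieExp G X)) '' {X | lieExp G X ∈ e.source} ∈
        𝓝 (e (lieExp G (0 : E))) := by
      rw [← h1]
      exact Filter.image_mem_map hsrc
    rw [lieExp_zero] at h2
    have h3 := (continuousAt_extChartAt (I := 𝓘(ℝ, E)) (1 : G)).preimage_mem_nhds h2
    filter_upwards [h3, extChartAt_source_mem_nhds (I := 𝓘(ℝ, E)) (1 : G)] with g hg hg'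
    obtain ⟨X, hX, hXg⟩ := hg
    exact ⟨X, e.injOn hX hg' hXg⟩
  have : IsTopologicalGroup G := topologicalGroup_of_lieGroup 𝓘(ℝ, E) ∞
  have hopen : IsOpen (S : Set G) := S.isOpen_of_mem_nhds hS
  have hclopen : IsClopen (S : Set G) := ⟨S.isClosed_of_isOpen hopen, hopen⟩
  have huniv : (S : Set G) = univ := hclopen.eq_univ ⟨1, S.one_mem⟩
  intro g
  have : g ∈ (S : Set G) := by rw [huniv]; trivial
  exact this

/-- The kernel of the exponential map is discrete. -/
lemma eventually_lieExp_eq_one (hab : ∀ a b : G, a * b = b * a) : ∀ᶠ X in 𝓝 (0 : E), lieExp G X = 1 → X = 0 := by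
  have h := (hasStrictFDerivAt_lieExp_chart (E := E) (G := G) hab).hasFDerivAt.eventually_ne
    (c := extChartAt 𝓘(ℝ, E) (1 : G) 1) ⟨1, fun x y => by simp⟩
  rw [eventually_nhdsWithin_iff] at h
  filter_upwards [h] with X hX h1
  by_contra h0
  exact hX h0 (by rw [h1])

end Abelian
end LieConsequences

/-! ### The inverse function theorem on a neighbourhood -/

/-- The inverse function theorem, with smoothness of the local inverse near the image point. -/
lemma exists_openPartialHomeomorph {E E' : Type*} [NormedAddCommGroup E] [NormedSpace ℝ E]
    [NormedAddCommGroup E'] [NormedSpace ℝ E'] [CompleteSpace E] {g : E → E'} {O : Set E}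
    (hO : IsOpen O) (hg : ContDiffOn ℝ ∞ g O) {a : E} (ha : a ∈ O) {g' : E ≃L[ℝ] E'}
    (hg' : HasFDerivAt g (g' : E →L[ℝ] E') a) :
    ∃ e : OpenPartialHomeomorph E E', a ∈ e.source ∧ e.source ⊆ O ∧ (⇑e = g) ∧
      ContDiffOn ℝ ∞ e.symm e.target := by
  have hga : ContDiffAt ℝ ∞ g a := hg.contDiffAt (hO.mem_nhds ha)
  set e₀ := hga.toOpenPartialHomeomorph g hg' (by simp) with he₀
  have hcont : ContinuousOn (fderiv ℝ g) O := hg.continuousOn_fderiv_of_isOpen hO (by simp)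
  have hmem : {z | z ∈ O ∧ ∃ L : E ≃L[ℝ] E', (L : E →L[ℝ] E') = fderiv ℝ g z} ∈ 𝓝 a := by
    have h1 : range ((↑) : (E ≃L[ℝ] E') → E →L[ℝ] E') ∈ 𝓝 (fderiv ℝ g a) := by
      rw [hg'.fderiv]; exact ContinuousLinearEquiv.nhds g'
    filter_upwards [hO.mem_nhds ha, (hcont.continuousAt (hO.mem_nhds ha)).preimage_mem_nhds h1]
      with z hz hz'
    exact ⟨hz, hz'⟩
  obtain ⟨O', hO'sub, hO', haO'⟩ := mem_nhds_iff.1 hmem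
  refine ⟨e₀.restrOpen O' hO', ⟨hga.mem_toOpenPartialHomeomorph_source hg' (by simp), haO'⟩,
    fun z hz => (hO'sub hz.2).1, rfl, ?_⟩
  intro b hb
  have hb' : b ∈ e₀.target := by
    have := (e₀.restrOpen O' hO').map_target hb
    have h2 := (e₀.restrOpen O' hO').right_inv hb
    rw [← h2]
    exact e₀.map_source this.1
  have hs : e₀.symm b ∈ O' := ((e₀.restrOpen O' hO').map_target hb).2
  obtain ⟨hz, L, hL⟩ := hO'sub hs
  have hd : ContDiffAt ℝ ∞ g (e₀.symm b) := hg.contDiffAt (hO.mem_nhds hz)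
  exact (e₀.contDiffAt_symm hb' (f₀' := L)
    (by rw [hL]; exact (hd.differentiableAt (by simp)).hasFDerivAt) hd).contDiffWithinAt

/-! ### Embeddings with local smooth retractions -/

section SplitEmbedding

variable {V : Type*} [NormedAddCommGroup V] [NormedSpace ℝ V]
  {S : Type*} [TopologicalSpace S] [ChartedSpace V S]
  {EN : Type*} [NormedAddCommGroup EN] [NormedSpace ℝ EN]
  {N : Type*} [TopologicalSpace N] [ChartedSpace EN N]
  {EX : Type*} [NormedAddCommGroup EX] [NormedSpace ℝ EX]
  {HX : Type*} [TopologicalSpace HX] {J : ModelWithCorners ℝ EX HX}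
  {X : Type*} [TopologicalSpace X] [ChartedSpace HX X]

/-- `ι` is a smooth embedding with local smooth left inverses. -/
structure IsSplitEmbedding (V EN : Type*) [NormedAddCommGroup V] [NormedSpace ℝ V]
    [NormedAddCommGroup EN] [NormedSpace ℝ EN] {S : Type*} [TopologicalSpace S] [ChartedSpace V S]
    {N : Type*} [TopologicalSpace N] [ChartedSpace EN N] (ι : S → N) : Prop where
  smooth : ContMDiff 𝓘(ℝ, V) 𝓘(ℝ, EN) ∞ ι
  isEmbedding : Topology.IsEmbedding ι
  retract : ∀ x, ∃ ρ : N → S, ContMDiffAt 𝓘(ℝ, EN) 𝓘(ℝ, V) ∞ ρ (ι x) ∧ ∀ᶠ z in 𝓝 x, ρ (ι z) = z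

namespace IsSplitEmbedding

variable {ι : S → N}

lemma injective (h : IsSplitEmbedding V EN ι) : Function.Injective ι := h.isEmbedding.injective

lemma contMDiffWithinAt (h : IsSplitEmbedding V EN ι) {g : X → S} {s : Set X} {x : X}
    (hg : ContMDiffWithinAt J 𝓘(ℝ, EN) ∞ (fun z => ι (g z)) s x) :
    ContMDiffWithinAt J 𝓘(ℝ, V) ∞ g s x := by
  obtain ⟨ρ, hρ, hρι⟩ := h.retract (g x)
  have hc : ContinuousWithinAt g s x := h.isEmbedding.continuousWithinAt_iff.2 hg.continuousWithinAt
  have h1 : ContMDiffWithinAt J 𝓘(ℝ, V) ∞ (fun z => ρ (ι (g z))) s x :=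
    ContMDiffAt.comp_contMDiffWithinAt (g := ρ) x hρ hg
  exact h1.congr_of_eventuallyEq ((hc.tendsto.eventually hρι).mono fun z hz => hz.symm)
    hρι.self_of_nhds.symm

lemma contMDiffAt (h : IsSplitEmbedding V EN ι) {g : X → S} {x : X}
    (hg : ContMDiffAt J 𝓘(ℝ, EN) ∞ (fun z => ι (g z)) x) : ContMDiffAt J 𝓘(ℝ, V) ∞ g x :=
  h.contMDiffWithinAt hg

lemma contMDiff (h : IsSplitEmbedding V EN ι) {g : X → S}
    (hg : ContMDiff J 𝓘(ℝ, EN) ∞ (fun z => ι (g z))) : ContMDiff J 𝓘(ℝ, V) ∞ g :=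
  fun x => h.contMDiffAt (hg x)

/-- A left inverse of the derivative of a split embedding. -/
lemma exists_leftInverse (h : IsSplitEmbedding V EN ι) (x : S) :
    ∃ R : EN →L[ℝ] V, R.comp (mD 𝓘(ℝ, V) 𝓘(ℝ, EN) ι x) = ContinuousLinearMap.id ℝ V := by
  obtain ⟨ρ, hρ, hρι⟩ := h.retract x
  exact ⟨_, (hρ.hasD.comp (h.smooth.hasD x) rfl).unique ((hasD_id x).congr hρι)⟩

lemma mD_injective (h : IsSplitEmbedding V EN ι) (x : S) :
    Function.Injective (mD 𝓘(ℝ, V) 𝓘(ℝ, EN) ι x) := by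
  obtain ⟨R, hR⟩ := h.exists_leftInverse x
  exact Function.LeftInverse.injective (g := R) fun v => DFunLike.congr_fun hR v

/-- The derivative of a map into a split submanifold. -/
lemma exists_hasD (h : IsSplitEmbedding V EN ι) {g : X → S} {x : X} {L : EX →L[ℝ] EN}
    (hg : HasD J 𝓘(ℝ, EN) (fun z => ι (g z)) x L) :
    ∃ L' : EX →L[ℝ] V, HasD J 𝓘(ℝ, V) g x L' ∧ (mD 𝓘(ℝ, V) 𝓘(ℝ, EN) ι (g x)).comp L' = L := by
  obtain ⟨ρ, hρ, hρι⟩ := h.retract (g x)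
  have hc : ContinuousAt g x := h.isEmbedding.continuousAt_iff.2 hg.continuousAt
  have h1 : HasD J 𝓘(ℝ, V) g x _ := (hρ.hasD.comp hg rfl).congr
    ((hc.tendsto.eventually hρι).mono fun z hz => hz.symm)
  exact ⟨_, h1, ((h.smooth.hasD (g x)).comp h1 rfl).unique hg⟩

/-- The differentials of `ι` at `x` and at `y` have isomorphic complements. -/
def SameType (V EN : Type*) [NormedAddCommGroup V] [NormedSpace ℝ V]
    [NormedAddCommGroup EN] [NormedSpace ℝ EN] {S : Type*} [TopologicalSpace S] [ChartedSpace V S]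
    {N : Type*} [TopologicalSpace N] [ChartedSpace EN N] (ι : S → N) (x y : S) : Prop :=
  ∃ (A : EN ≃L[ℝ] EN) (Q : V ≃L[ℝ] V), ∀ v,
    A (mD 𝓘(ℝ, V) 𝓘(ℝ, EN) ι x v) = mD 𝓘(ℝ, V) 𝓘(ℝ, EN) ι y (Q v)

lemma SameType.symm {x y : S} (hxy : SameType V EN ι x y) : SameType V EN ι y x := by
  obtain ⟨A, Q, hA⟩ := hxy
  refine ⟨A.symm, Q.symm, fun v => ?_⟩
  rw [ContinuousLinearEquiv.symm_apply_eq, hA, ContinuousLinearEquiv.apply_symm_apply]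

lemma SameType.trans {x y z : S} (hxy : SameType V EN ι x y) (hyz : SameType V EN ι y z) :
    SameType V EN ι x z := by
  obtain ⟨A, Q, hA⟩ := hxy
  obtain ⟨A', Q', hA'⟩ := hyz
  exact ⟨A.trans A', Q.trans Q', fun v => by simp [hA, hA']⟩

lemma _root_.LoopGeometry.exists_equiv_of_inverse {E E' : Type*} [NormedAddCommGroup E]
    [NormedSpace ℝ E] [NormedAddCommGroup E'] [NormedSpace ℝ E'] {L : E →L[ℝ] E'} {L' : E' →L[ℝ] E}
    (h : L'.comp L = ContinuousLinearMap.id ℝ E) (h' : L.comp L' = ContinuousLinearMap.id ℝ E') :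
    ∃ Q : E ≃L[ℝ] E', (Q : E →L[ℝ] E') = L :=
  ⟨ContinuousLinearEquiv.equivOfInverse L L' (fun v => DFunLike.congr_fun h v)
    fun v => DFunLike.congr_fun h' v, rfl⟩

/-- The derivative of an arbitrary chart is invertible. -/
lemma _root_.LoopGeometry.exists_equiv_hasD_extChartAt [IsManifold 𝓘(ℝ, EN) ∞ N] (x : N) :
    ∀ᶠ y in 𝓝 x, ∃ Q : EN ≃L[ℝ] EN,
      HasD 𝓘(ℝ, EN) 𝓘(ℝ, EN) (extChartAt 𝓘(ℝ, EN) x) y (Q : EN →L[ℝ] EN) := by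
  filter_upwards [extChartAt_source_mem_nhds (I := 𝓘(ℝ, EN)) x] with y hy
  have ht : extChartAt 𝓘(ℝ, EN) x y ∈ (extChartAt 𝓘(ℝ, EN) x).target :=
    (extChartAt 𝓘(ℝ, EN) x).map_source hy
  have h1 := (contMDiffAt_extChartAt' (I := 𝓘(ℝ, EN)) (n := ∞) (x := x) (x' := y)
    (by simpa using hy)).hasD
  have h2 := ((contMDiffOn_extChartAt_symm (I := 𝓘(ℝ, EN)) (n := ∞) x).contMDiffAt
    (extChartAt_target_mem_nhds' ht)).hasD
  have e1 := (h2.comp h1 rfl).unique ((hasD_id y).congr (by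
    filter_upwards [(isOpen_extChartAt_source (I := 𝓘(ℝ, EN)) x).mem_nhds hy] with z hz
    exact (extChartAt 𝓘(ℝ, EN) x).left_inv hz))
  have e2 := (h1.comp h2 ((extChartAt 𝓘(ℝ, EN) x).left_inv hy)).unique ((hasD_id _).congr (by
    filter_upwards [extChartAt_target_mem_nhds' ht] with z hz
    exact (extChartAt 𝓘(ℝ, EN) x).right_inv hz))
  obtain ⟨Q, hQ⟩ := exists_equiv_of_inverse e1 e2
  exact ⟨Q, by rw [hQ]; exact h1⟩

lemma eventually_sameType [CompleteSpace EN] [IsManifold 𝓘(ℝ, EN) ∞ N] [IsManifold 𝓘(ℝ, V) ∞ S]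
    (h : IsSplitEmbedding V EN ι) (x : S) : ∀ᶠ y in 𝓝 x, SameType V EN ι x y := by
  obtain ⟨R, hR⟩ := h.exists_leftInverse x
  set φ := extChartAt 𝓘(ℝ, V) x
  set ψ := extChartAt 𝓘(ℝ, EN) (ι x)
  set j : V → EN := fun w => ψ (ι (φ.symm w)) with hj
  have hjs : ContDiffAt ℝ ∞ j (φ x) := by
    rw [← contMDiffAt_iff_contDiffAt]
    refine ContMDiffAt.comp (g := ψ) _ ?_ (ContMDiffAt.comp (g := ι) _ (h.smooth _) ?_)
    · rw [extChartAt_to_inv]; exact contMDiffAt_extChartAt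
    · exact (contMDiffOn_extChartAt_symm x).contMDiffAt (extChartAt_target_mem_nhds x)
  have hj0 : fderiv ℝ j (φ x) = mD 𝓘(ℝ, V) 𝓘(ℝ, EN) ι x := by
    have := (hasD_extChartAt (ι x)).comp ((h.smooth.hasD x).comp (hasD_extChartAt_symm x)
      (extChartAt_to_inv x)) (by rw [extChartAt_to_inv])
    rw [ContinuousLinearMap.comp_id, ContinuousLinearMap.id_comp] at this
    exact (hasD_iff_hasFDerivAt.1 this).fderiv
  let A : V → EN →L[ℝ] EN := fun w => ContinuousLinearMap.id ℝ EN +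
    ((fderiv ℝ j w).comp R - (fderiv ℝ j (φ x)).comp R)
  have hfc : ContinuousAt (fderiv ℝ j) (φ x) :=
    (hjs.fderiv_right (m := 0) (by simp)).continuousAt
  have hA : ContinuousAt A (φ x) := by
    refine continuousAt_const.add (ContinuousAt.sub ?_ continuousAt_const)
    exact hfc.clm_comp continuousAt_const
  have hAinv : range ((↑) : (EN ≃L[ℝ] EN) → EN →L[ℝ] EN) ∈ 𝓝 (A (φ x)) := by
    have : A (φ x) = ((ContinuousLinearEquiv.refl ℝ EN : EN ≃L[ℝ] EN) : EN →L[ℝ] EN) := by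
      simp [A]
    rw [this]; exact ContinuousLinearEquiv.nhds _
  filter_upwards [exists_equiv_hasD_extChartAt (EN := V) x,
    (h.smooth x).continuousAt.tendsto.eventually
      (exists_equiv_hasD_extChartAt (EN := EN) (ι x)),
    (continuousAt_extChartAt (I := 𝓘(ℝ, V)) x).tendsto.eventually (hA.preimage_mem_nhds hAinv),
    extChartAt_source_mem_nhds (I := 𝓘(ℝ, V)) x] with y ⟨Q, hQ⟩ ⟨Q', hQ'⟩ ⟨B, hB⟩ hy
  have hd : (fderiv ℝ j (φ y)).comp (Q : V →L[ℝ] V) =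
      (Q' : EN →L[ℝ] EN).comp (mD 𝓘(ℝ, V) 𝓘(ℝ, EN) ι y) := by
    have h1 : HasD 𝓘(ℝ, V) 𝓘(ℝ, EN) (fun z => ψ (ι z)) y _ := hQ'.comp (h.smooth.hasD y) rfl
    have hjd : DifferentiableAt ℝ j (φ y) := by
      have ht : φ y ∈ φ.target := φ.map_source hy
      have h2 := ((contMDiffOn_extChartAt_symm (I := 𝓘(ℝ, V)) (n := ∞) x).contMDiffAt
        (extChartAt_target_mem_nhds' ht)).hasD
      exact (hasD_iff_hasFDerivAt.1 (hQ'.comp ((h.smooth.hasD y).comp h2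
        (φ.left_inv hy)) (by rw [φ.left_inv hy]))).differentiableAt
    have h2 : HasD 𝓘(ℝ, V) 𝓘(ℝ, EN) (fun z => ψ (ι z)) y
        ((fderiv ℝ j (φ y)).comp (Q : V →L[ℝ] V)) := by
      refine ((hasD_iff_hasFDerivAt.2 hjd.hasFDerivAt).comp hQ rfl).congr ?_
      filter_upwards [(isOpen_extChartAt_source (I := 𝓘(ℝ, V)) x).mem_nhds hy] with z hz
      simp only [hj]
      rw [φ.left_inv hz]
    exact h2.unique h1
  refine ⟨B.trans Q'.symm, Q.symm, fun v => ?_⟩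
  have hBv : B (mD 𝓘(ℝ, V) 𝓘(ℝ, EN) ι x v) = fderiv ℝ j (φ y) v := by
    have h1 : (B : EN →L[ℝ] EN) (mD 𝓘(ℝ, V) 𝓘(ℝ, EN) ι x v) = A (φ y) (mD 𝓘(ℝ, V) 𝓘(ℝ, EN) ι x v) :=
      by rw [hB]
    have h2 : R (mD 𝓘(ℝ, V) 𝓘(ℝ, EN) ι x v) = v := DFunLike.congr_fun hR v
    refine h1.trans ?_
    simp [A, h2, hj0]
  have h3 := DFunLike.congr_fun hd (Q.symm v)
  simp only [ContinuousLinearMap.comp_apply, ContinuousLinearEquiv.coe_coe,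
    ContinuousLinearEquiv.apply_symm_apply] at h3
  simp [hBv, h3]

lemma isImmersionAtOfComplement {C : Type*} [NormedAddCommGroup C] [NormedSpace ℝ C]
    [CompleteSpace EN] [IsManifold 𝓘(ℝ, EN) ∞ N] [IsManifold 𝓘(ℝ, V) ∞ S]
    (h : IsSplitEmbedding V EN ι) (x : S) (A : (V × C) ≃L[ℝ] EN)
    (hA : ∀ v, A (v, 0) = mD 𝓘(ℝ, V) 𝓘(ℝ, EN) ι x v) :
    Manifold.IsImmersionAtOfComplement C 𝓘(ℝ, V) 𝓘(ℝ, EN) ∞ ι x := by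
  set φ := extChartAt 𝓘(ℝ, V) x with hφ
  set ψ := extChartAt 𝓘(ℝ, EN) (ι x) with hψ
  set j : V → EN := fun w => ψ (ι (φ.symm w)) with hj
  have hcs : ContinuousOn φ.symm φ.target := continuousOn_extChartAt_symm x
  have hOo : IsOpen (φ.target ∩ φ.symm ⁻¹' (ι ⁻¹' ψ.source)) :=
    hcs.isOpen_inter_preimage (isOpen_extChartAt_target x)
      ((isOpen_extChartAt_source (ι x)).preimage h.smooth.continuous)
  set O := φ.target ∩ φ.symm ⁻¹' (ι ⁻¹' ψ.source) with hO
  have hxO : φ x ∈ O := by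
    refine ⟨mem_extChartAt_target x, ?_⟩
    simp only [mem_preimage, hφ, extChartAt_to_inv]
    exact mem_extChartAt_source (ι x)
  have hjs : ContDiffOn ℝ ∞ j O := by
    rw [← contMDiffOn_iff_contDiffOn]
    have h1 : ContMDiffOn 𝓘(ℝ, V) 𝓘(ℝ, V) ∞ φ.symm O :=
      (contMDiffOn_extChartAt_symm x).mono inter_subset_left
    have h2 : ContMDiffOn 𝓘(ℝ, EN) 𝓘(ℝ, EN) ∞ ψ ψ.source := by
      rw [hψ, extChartAt_source]; exact contMDiffOn_extChartAt
    exact h2.comp (h.smooth.comp_contMDiffOn h1) fun w hw => hw.2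
  have hj0 : HasFDerivAt j (mD 𝓘(ℝ, V) 𝓘(ℝ, EN) ι x) (φ x) := by
    have := (hasD_extChartAt (ι x)).comp ((h.smooth.hasD x).comp (hasD_extChartAt_symm x)
      (extChartAt_to_inv x)) (by rw [extChartAt_to_inv])
    rw [ContinuousLinearMap.comp_id, ContinuousLinearMap.id_comp] at this
    exact hasD_iff_hasFDerivAt.1 this
  let P : EN →L[ℝ] V := (ContinuousLinearMap.fst ℝ V C).comp (A.symm : EN →L[ℝ] V × C)
  let P' : EN →L[ℝ] EN := (A : V × C →L[ℝ] EN).comp ((ContinuousLinearMap.inr ℝ V C).comp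
    ((ContinuousLinearMap.snd ℝ V C).comp (A.symm : EN →L[ℝ] V × C)))
  let Θ : EN → EN := fun z => j (P z) + P' z
  have hP : ∀ v, P (A (v, 0)) = v := fun v => by simp [P]
  have hP' : ∀ v, P' (A (v, 0)) = 0 := fun v => by simp [P']
  have hΘs : ContDiffOn ℝ ∞ Θ (P ⁻¹' O) :=
    (hjs.comp P.contDiff.contDiffOn (mapsTo_preimage _ _)).add P'.contDiff.contDiffOn
  have hΘd : HasFDerivAt Θ ((ContinuousLinearEquiv.refl ℝ EN : EN ≃L[ℝ] EN) : EN →L[ℝ] EN)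
      (A (φ x, 0)) := by
    have h1 : HasFDerivAt j (mD 𝓘(ℝ, V) 𝓘(ℝ, EN) ι x) (P (A (φ x, 0))) := by rw [hP]; exact hj0
    have h2 : HasFDerivAt Θ ((mD 𝓘(ℝ, V) 𝓘(ℝ, EN) ι x).comp P + P') (A (φ x, 0)) :=
      (h1.comp _ P.hasFDerivAt).add (P'.hasFDerivAt (x := A (φ x, 0)))
    convert h2 using 1
    ext z
    obtain ⟨⟨v, c⟩, rfl⟩ := A.surjective z
    simp only [ContinuousLinearEquiv.coe_refl, ContinuousLinearMap.coe_id', id_eq,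
      add_apply, ContinuousLinearMap.comp_apply, P, P',
      ContinuousLinearEquiv.coe_coe, ContinuousLinearEquiv.symm_apply_apply,
      ContinuousLinearMap.coe_fst', ContinuousLinearMap.coe_snd', ContinuousLinearMap.inr_apply,
      ← hA, ← map_add]
    simp
  obtain ⟨e, hae, hesub, heq, hes⟩ := exists_openPartialHomeomorph
    (hOo.preimage P.continuous) hΘs (a := A (φ x, 0)) (by rw [mem_preimage, hP]; exact hxO) hΘd
  have hΘj : ∀ w, Θ (A (w, 0)) = j w := fun w => by simp only [Θ, hP, hP', add_zero]
  have hes' : ContDiffOn ℝ ∞ e e.source := by rw [heq]; exact hΘs.mono hesub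
  set cod : OpenPartialHomeomorph N EN := (chartAt EN (ι x)).trans e.symm with hcod
  set dom₀ : OpenPartialHomeomorph S V := chartAt V x with hdom₀
  have hDo : IsOpen ((fun w => A (w, (0 : C))) ⁻¹' e.source) :=
    e.open_source.preimage (A.continuous.comp (by fun_prop))
  set dom : OpenPartialHomeomorph S V :=
    (dom₀.symm.restrOpen _ hDo).symm with hdom
  have hx : x ∈ dom.source := by
    have : dom.source = dom₀.source ∩ dom₀ ⁻¹' ((fun w => A (w, (0 : C))) ⁻¹' e.source) := by
      ext y
      simp [hdom, OpenPartialHomeomorph.restrOpen]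
    rw [this]
    refine ⟨mem_chart_source V x, ?_⟩
    exact hae
  have hxcod : ι x ∈ cod.source := by
    rw [hcod, OpenPartialHomeomorph.trans_source]
    refine ⟨mem_chart_source EN (ι x), ?_⟩
    have h1 : e (A (φ x, 0)) = chartAt EN (ι x) (ι x) := by
      rw [heq, hΘj]; simp [hj, hφ, hψ]
    rw [mem_preimage, ← h1]
    exact e.map_source hae
  have hdommem : dom ∈ IsManifold.maximalAtlas 𝓘(ℝ, V) ∞ S := by
    apply OpenPartialHomeomorph.mem_maximalAtlas_of_contMDiffOn
    · refine (contMDiffOn_chart (x := x)).mono ?_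
      intro y hy
      simp only [hdom, OpenPartialHomeomorph.restrOpen, OpenPartialHomeomorph.symm_source] at hy
      simp at hy
      exact hy.1
    · exact (contMDiffOn_chart_symm (x := x)).mono fun y hy => hy.1
  have hcodmem : cod ∈ IsManifold.maximalAtlas 𝓘(ℝ, EN) ∞ N := by
    apply OpenPartialHomeomorph.mem_maximalAtlas_of_contMDiffOn
    · have h1 : ContMDiffOn 𝓘(ℝ, EN) 𝓘(ℝ, EN) ∞ e.symm e.target := hes.contMDiffOn
      refine h1.comp ((contMDiffOn_chart (x := ι x)).mono ?_) ?_
      · intro y hy; exact hy.1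
      · intro y hy; exact hy.2
    · have h1 : ContMDiffOn 𝓘(ℝ, EN) 𝓘(ℝ, EN) ∞ e e.source := hes'.contMDiffOn
      refine (contMDiffOn_chart_symm (x := ι x)).comp (h1.mono ?_) ?_
      · intro y hy
        simp only [hcod, OpenPartialHomeomorph.trans_target] at hy
        simpa using hy.1
      · intro y hy
        simp only [hcod, OpenPartialHomeomorph.trans_target] at hy
        simpa using hy.2
  refine Manifold.IsImmersionAtOfComplement.mk_of_continuousAt h.smooth.continuous.continuousAt A
    dom cod hx hxcod hdommem hcodmem ?_
  intro w hw
  have hw' : w ∈ dom₀.target ∧ A (w, 0) ∈ e.source := by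
    simpa [hdom, OpenPartialHomeomorph.restrOpen] using hw
  change e.symm (ψ (ι (φ.symm w))) = A (w, 0)
  have : e (A (w, 0)) = ψ (ι (φ.symm w)) := by rw [heq, hΘj]
  rw [← this, e.left_inv hw'.2]

/-- A split embedding is an immersion if the type of its differential is constant along the fibres
of an open map to a connected space. -/
lemma isImmersion [CompleteSpace EN] [IsManifold 𝓘(ℝ, EN) ∞ N] [IsManifold 𝓘(ℝ, V) ∞ S]
    (h : IsSplitEmbedding V EN ι) {F : Type*} [TopologicalSpace F] [PreconnectedSpace F]
    {p : S → F} (hp : IsOpenMap p) (hsurj : Function.Surjective p) (x₀ : S)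
    (hfib : ∀ x y, p x = p y → SameType V EN ι x y) :
    Manifold.IsImmersion 𝓘(ℝ, V) 𝓘(ℝ, EN) ∞ ι := by
  have hall : ∀ x, SameType V EN ι x₀ x := by
    have hopen : ∀ P : S → Prop, (∀ x y, P x → SameType V EN ι x y → P y) → IsOpen {x | P x} := by
      intro P hP
      rw [isOpen_iff_mem_nhds]
      intro x hx
      filter_upwards [h.eventually_sameType x] with y hy
      exact hP x y hx hy
    have ho1 := hp _ (hopen (fun x => SameType V EN ι x₀ x) fun x y a b => a.trans b)
    have ho2 := hp _ (hopen (fun x => ¬ SameType V EN ι x₀ x) fun x y a b c => a (c.trans b.symm))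
    have hcl : IsClopen (p '' {x | SameType V EN ι x₀ x}) := by
      refine ⟨⟨?_⟩, ho1⟩
      convert ho2 using 1
      ext y
      obtain ⟨z, rfl⟩ := hsurj y
      constructor
      · intro hz
        exact ⟨z, fun hz' => hz ⟨z, hz', rfl⟩, rfl⟩
      · rintro ⟨z', hz', hzz'⟩ ⟨w, hw, hwz⟩
        exact hz' (SameType.trans hw (hfib _ _ (hwz.trans hzz'.symm)))
    have huniv := hcl.eq_univ ⟨p x₀, x₀, ⟨ContinuousLinearEquiv.refl ℝ EN,
      ContinuousLinearEquiv.refl ℝ V, fun v => rfl⟩, rfl⟩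
    intro x
    obtain ⟨z, hz, hzx⟩ := huniv.symm.subset (mem_univ (p x))
    exact SameType.trans hz (hfib _ _ hzx)
  obtain ⟨R, hR⟩ := h.exists_leftInverse x₀
  set D := mD 𝓘(ℝ, V) 𝓘(ℝ, EN) ι x₀ with hD
  have hRD : ∀ v, R (D v) = v := fun v => DFunLike.congr_fun hR v
  let C : Submodule ℝ EN := LinearMap.ker (R : EN →ₗ[ℝ] V)
  let K : EN →L[ℝ] C := (ContinuousLinearMap.id ℝ EN - D.comp R).codRestrict C fun z => by
    simp [C, hRD]
  let A₀ : (V × C) ≃L[ℝ] EN := ContinuousLinearEquiv.equivOfInverse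
    (D.coprod C.subtypeL) (R.prod K)
    (by
      rintro ⟨v, c⟩
      have hc : R (c : EN) = 0 := c.2
      refine Prod.ext ?_ (Subtype.ext ?_)
      · simp [hRD, hc]
      · simp [K, hRD, hc])
    (by
      intro z
      simp [K])
  have hA₀ : ∀ v, A₀ (v, 0) = D v := fun v => by simp [A₀]
  refine Manifold.IsImmersionOfComplement.isImmersion (F := C) fun x => ?_
  obtain ⟨A, Q, hAQ⟩ := hall x
  refine h.isImmersionAtOfComplement x
    (((Q.symm.prodCongr (ContinuousLinearEquiv.refl ℝ C)).trans A₀).trans A) fun v => ?_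
  simp [hA₀, hD, hAQ]

end IsSplitEmbedding
end SplitEmbedding

/-! ### Submanifolds from slices -/

section Slices

variable {V : Type*} [NormedAddCommGroup V] [NormedSpace ℝ V]
  {EN : Type*} [NormedAddCommGroup EN] [NormedSpace ℝ EN]
  {N : Type*} [TopologicalSpace N] [ChartedSpace EN N]

/-- A parametrization `i` of `S` near `x` by an open subset of `V`, whose inverse extends to a
smooth map `r` on a neighbourhood of `x` in `N`. -/
structure SliceAt (V EN : Type*) [NormedAddCommGroup V] [NormedSpace ℝ V]
    [NormedAddCommGroup EN] [NormedSpace ℝ EN] {N : Type*} [TopologicalSpace N] [ChartedSpace EN N]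
    (S : Set N) (x : S) where
  r : N → V
  i : V → N
  U : Set N
  W : Set V
  isOpen_U : IsOpen U
  isOpen_W : IsOpen W
  mem_U : (x : N) ∈ U
  smooth_r : ContMDiffOn 𝓘(ℝ, EN) 𝓘(ℝ, V) ∞ r U
  smooth_i : ContMDiffOn 𝓘(ℝ, V) 𝓘(ℝ, EN) ∞ i W
  i_mem : ∀ w ∈ W, i w ∈ S
  i_mem_U : ∀ w ∈ W, i w ∈ U
  r_mem : ∀ y ∈ S, y ∈ U → r y ∈ W
  r_i : ∀ w ∈ W, r (i w) = w
  i_r : ∀ y ∈ S, y ∈ U → i (r y) = y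

/-- The constructor for slices that shrinks the neighbourhoods. -/
lemma exists_sliceAt {S : Set N} (x : S) {r : N → V} {i : V → N} {U : Set N} {W : Set V}
    (hU : IsOpen U) (hW : IsOpen W) (hx : (x : N) ∈ U) (hrx : r x ∈ W)
    (hr : ContMDiffOn 𝓘(ℝ, EN) 𝓘(ℝ, V) ∞ r U) (hi : ContMDiffOn 𝓘(ℝ, V) 𝓘(ℝ, EN) ∞ i W)
    (hiS : ∀ w ∈ W, i w ∈ U → i w ∈ S) (hri : ∀ w ∈ W, i w ∈ U → r (i w) = w)
    (hir : ∀ y ∈ S, y ∈ U → r y ∈ W → i (r y) = y) :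
    ∃ c : SliceAt V EN S x, c.r = r ∧ c.i = i ∧ c.U ⊆ U ∧ c.W ⊆ W :=
  ⟨{ r := r
     i := i
     U := U ∩ r ⁻¹' W
     W := W ∩ i ⁻¹' U
     isOpen_U := hr.continuousOn.isOpen_inter_preimage hU hW
     isOpen_W := hi.continuousOn.isOpen_inter_preimage hW hU
     mem_U := ⟨hx, hrx⟩
     smooth_r := hr.mono inter_subset_left
     smooth_i := hi.mono inter_subset_left
     i_mem := fun w hw => hiS w hw.1 hw.2
     i_mem_U := fun w hw => ⟨hw.2, by rw [mem_preimage, hri w hw.1 hw.2]; exact hw.1⟩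
     r_mem := fun y hy hyU => ⟨hyU.2, by rw [mem_preimage, hir y hy hyU.1 hyU.2]; exact hyU.1⟩
     r_i := fun w hw => hri w hw.1 hw.2
     i_r := fun y hy hyU => hir y hy hyU.1 hyU.2 }, rfl, rfl, inter_subset_left, inter_subset_left⟩

namespace SliceAt

variable {S : Set N} {x : S}

open Classical in
/-- The chart of `S` given by a slice. -/
def chart (c : SliceAt V EN S x) : OpenPartialHomeomorph S V where
  toFun y := c.r y
  invFun w := if h : w ∈ c.W then ⟨c.i w, c.i_mem w h⟩ else x
  source := Subtype.val ⁻¹' c.U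
  target := c.W
  map_source' y hy := c.r_mem y y.2 hy
  map_target' w hw := by simpa [hw] using c.i_mem_U w hw
  left_inv' y hy := by
    simp only [c.r_mem y y.2 hy, dif_pos]
    exact Subtype.ext (c.i_r y y.2 hy)
  right_inv' w hw := by simp only [hw, dif_pos]; exact c.r_i w hw
  open_source := c.isOpen_U.preimage continuous_subtype_val
  open_target := c.isOpen_W
  continuousOn_toFun := c.smooth_r.continuousOn.comp continuous_subtype_val.continuousOn
    fun _ hy => hy
  continuousOn_invFun := by
    rw [Topology.IsEmbedding.subtypeVal.continuousOn_iff]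
    refine c.smooth_i.continuousOn.congr fun w hw => ?_
    simp [Function.comp, hw]

lemma chart_apply (c : SliceAt V EN S x) (y : S) : c.chart y = c.r y := rfl

lemma coe_chart_symm (c : SliceAt V EN S x) {w : V} (hw : w ∈ c.W) :
    (c.chart.symm w : N) = c.i w := by
  have h : c.chart.symm w = ⟨c.i w, c.i_mem w hw⟩ := dif_pos hw
  rw [h]

end SliceAt

/-- The manifold structure given by slices at all points. -/
@[reducible]
def sliceChartedSpace {S : Set N} (c : ∀ x : S, SliceAt V EN S x) : ChartedSpace V S where
  atlas := range fun x => (c x).chart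
  chartAt x := (c x).chart
  mem_chart_source x := (c x).mem_U
  chart_mem_atlas x := mem_range_self x

variable {S : Set N} (c : ∀ x : S, SliceAt V EN S x)

lemma isManifold_sliceChartedSpace [IsManifold 𝓘(ℝ, EN) ∞ N] :
    letI := sliceChartedSpace c
    IsManifold 𝓘(ℝ, V) ∞ S := by
  let _ := sliceChartedSpace c
  refine isManifold_of_contDiffOn _ _ _ ?_
  rintro _ _ ⟨x, rfl⟩ ⟨y, rfl⟩
  simp only [modelWithCornersSelf_coe, modelWithCornersSelf_coe_symm, Function.comp_id,
    Function.id_comp, range_id, inter_univ, preimage_id_eq, id_eq]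
  rw [← contMDiffOn_iff_contDiffOn]
  have h1 : ContMDiffOn 𝓘(ℝ, V) 𝓘(ℝ, V) ∞ (fun w => (c y).r ((c x).i w))
      ((c x).chart.symm.trans (c y).chart).source := by
    refine (c y).smooth_r.comp ((c x).smooth_i.mono fun w hw => hw.1) fun w hw => ?_
    have h2 : ((c x).chart.symm w : N) ∈ (c y).U := hw.2
    rwa [(c x).coe_chart_symm hw.1] at h2
  refine h1.congr fun w hw => ?_
  change (c y).r ((c x).chart.symm w) = _
  rw [(c x).coe_chart_symm hw.1]

lemma isSplitEmbedding_sliceChartedSpace [IsManifold 𝓘(ℝ, EN) ∞ N] :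
    letI := sliceChartedSpace c
    IsSplitEmbedding V EN (Subtype.val : S → N) := by
  let _ := sliceChartedSpace c
  have := isManifold_sliceChartedSpace c
  refine ⟨fun x => ?_, Topology.IsEmbedding.subtypeVal, fun x => ?_⟩
  · have hx : x ∈ (c x).chart.source := (c x).mem_U
    have h1 : ContMDiffAt 𝓘(ℝ, V) 𝓘(ℝ, V) ∞ (c x).chart x :=
      contMDiffAt_of_mem_maximalAtlas (IsManifold.chart_mem_maximalAtlas x) hx
    have h2 : ContMDiffAt 𝓘(ℝ, V) 𝓘(ℝ, EN) ∞ (c x).i ((c x).chart x) :=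
      (c x).smooth_i.contMDiffAt ((c x).isOpen_W.mem_nhds ((c x).chart.map_source hx))
    refine (h2.comp x h1).congr_of_eventuallyEq ?_
    filter_upwards [(c x).chart.open_source.mem_nhds hx] with y hy
    exact ((c x).i_r y y.2 hy).symm
  · have hx : x ∈ (c x).chart.source := (c x).mem_U
    refine ⟨fun y => (c x).chart.symm ((c x).r y), ?_, ?_⟩
    · have h1 : ContMDiffAt 𝓘(ℝ, V) 𝓘(ℝ, V) ∞ (c x).chart.symm ((c x).r x) :=
        contMDiffAt_symm_of_mem_maximalAtlas (IsManifold.chart_mem_maximalAtlas x)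
          ((c x).chart.map_source hx)
      exact h1.comp (x : N) ((c x).smooth_r.contMDiffAt ((c x).isOpen_U.mem_nhds (c x).mem_U))
    · filter_upwards [(c x).chart.open_source.mem_nhds hx] with y hy
      exact (c x).chart.left_inv hy

end Slices

/-- A smooth embedding is split. -/
lemma isSplitEmbedding_of_isSmoothEmbedding {V : Type*} [NormedAddCommGroup V] [NormedSpace ℝ V]
    {EN : Type*} [NormedAddCommGroup EN] [NormedSpace ℝ EN]
    {N : Type*} [TopologicalSpace N] [ChartedSpace EN N] [IsManifold 𝓘(ℝ, EN) ∞ N]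
    {S : Type*} [TopologicalSpace S] [ChartedSpace V S] [IsManifold 𝓘(ℝ, V) ∞ S] {ι : S → N}
    (h : Manifold.IsSmoothEmbedding 𝓘(ℝ, V) 𝓘(ℝ, EN) ∞ ι) : IsSplitEmbedding V EN ι := by
  refine ⟨h.1.contMDiff, h.2, fun x => ?_⟩
  have hx := h.1.isImmersionAt x
  set dom := hx.domChart
  set cod := hx.codChart
  have hwr := hx.writtenInCharts
  set P : EN →L[ℝ] V := (ContinuousLinearMap.fst ℝ V hx.complement).comp
    (hx.equiv.symm : EN →L[ℝ] V × hx.complement)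
  have hP : ∀ z ∈ dom.source, P (cod (ι z)) = dom z := by
    intro z hz
    have hz' := hwr (x := dom z) (by simpa [dom] using dom.map_source hz)
    have : cod (ι z) = hx.equiv (dom z, 0) := by
      simpa [dom, cod, dom.left_inv hz] using hz'
    rw [this]
    simp [P]
  refine ⟨fun y => dom.symm (P (cod y)), ?_, ?_⟩
  · have h1 : ContMDiffAt 𝓘(ℝ, EN) 𝓘(ℝ, EN) ∞ cod (ι x) :=
      contMDiffAt_of_mem_maximalAtlas hx.codChart_mem_maximalAtlas hx.mem_codChart_source
    have h2 : ContMDiffAt 𝓘(ℝ, V) 𝓘(ℝ, V) ∞ dom.symm (P (cod (ι x))) := by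
      rw [hP x hx.mem_domChart_source]
      exact contMDiffAt_symm_of_mem_maximalAtlas hx.domChart_mem_maximalAtlas
        (dom.map_source hx.mem_domChart_source)
    exact h2.comp (ι x) (P.contMDiff.contMDiffAt.comp (ι x) h1)
  · filter_upwards [dom.open_source.mem_nhds hx.mem_domChart_source] with z hz
    rw [hP z hz, dom.left_inv hz]


/-! ### Integrals depending smoothly on a parameter -/

section ParametricIntegral

variable {E : Type*} [NormedAddCommGroup E] [NormedSpace ℝ E]
  {G : Type*} [TopologicalSpace G] [ChartedSpace E G]
  {K : Type*} [TopologicalSpace K] [CompactSpace K] [MeasurableSpace K] [BorelSpace K]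

lemma integrable_of_continuous_compact {F : Type*} [NormedAddCommGroup F] (μ : Measure K)
    [IsFiniteMeasure μ] {g : K → F} (hg : Continuous g) : Integrable g μ :=
  hg.integrable_of_hasCompactSupport (HasCompactSupport.of_compactSpace g)

section

variable {EX : Type*} [NormedAddCommGroup EX] [NormedSpace ℝ EX] [IsManifold 𝓘(ℝ, E) ∞ G]
  {F : Type*} [NormedAddCommGroup F] [NormedSpace ℝ F]

lemma hasFDerivAt_integral_param {j : K → G} (hj : Continuous j) (μ : Measure K)
    [IsFiniteMeasure μ] {O : Set EX} (hO : IsOpen O) {v : G → EX → F}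
    (hv : ∀ k, ∀ y ∈ O, ContMDiffAt (𝓘(ℝ, E).prod 𝓘(ℝ, EX)) 𝓘(ℝ, F) ∞
      (fun p : G × EX => v p.1 p.2) (j k, y)) {y : EX} (hy : y ∈ O) :
    HasFDerivAt (fun y => ∫ k, v (j k) y ∂μ) (∫ k, fderiv ℝ (v (j k)) y ∂μ) y := by
  have hD : ∀ k, ∀ y ∈ O, ContinuousAt (fun p : G × EX => fderiv ℝ (v p.1) p.2) (j k, y) :=
    fun k y hy => (contMDiffAt_partial_fderiv (hv k y hy)).continuousAt
  have hslice : ∀ y ∈ O, Continuous fun k => v (j k) y := fun y hy =>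
    continuous_iff_continuousAt.2 fun k => ContinuousAt.comp (x := k)
      (f := fun k => (j k, y)) (g := fun p : G × EX => v p.1 p.2) (hv k y hy).continuousAt
      (by fun_prop)
  have hslice' : ∀ y ∈ O, Continuous fun k => fderiv ℝ (v (j k)) y := fun y hy =>
    continuous_iff_continuousAt.2 fun k => ContinuousAt.comp (x := k)
      (f := fun k => (j k, y)) (g := fun p : G × EX => fderiv ℝ (v p.1) p.2) (hD k y hy)
      (by fun_prop)
  obtain ⟨C, hC⟩ : ∃ C, ∀ k, ‖fderiv ℝ (v (j k)) y‖ ≤ C := by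
    obtain ⟨C, hC⟩ := (isCompact_range (hslice' y hy)).isBounded.exists_norm_le
    exact ⟨C, fun k => hC _ (mem_range_self k)⟩
  have hbound : ∀ᶠ z in 𝓝 y, ∀ k ∈ (univ : Set K), ‖fderiv ℝ (v (j k)) z‖ ≤ C + 1 := by
    refine isCompact_univ.eventually_forall_of_forall_eventually fun k _ => ?_
    have h1 : ContinuousAt (fun p : EX × K => ‖fderiv ℝ (v (j p.2)) p.1‖) (y, k) :=
      (ContinuousAt.comp (x := (y, k)) (f := fun p : EX × K => (j p.2, p.1))
        (g := fun p : G × EX => fderiv ℝ (v p.1) p.2) (hD k y hy) (by fun_prop)).norm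
    filter_upwards [h1.eventually_lt_const (show ‖fderiv ℝ (v (j k)) y‖ < C + 1 from
      lt_of_le_of_lt (hC k) (lt_add_one C))] with p hp
    exact hp.le
  refine hasFDerivAt_integral_of_dominated_of_fderiv_le (𝕜 := ℝ) (F := fun y k => v (j k) y)
    (F' := fun y k => fderiv ℝ (v (j k)) y) (bound := fun _ => C + 1)
    (s := {z | z ∈ O ∧ ∀ k ∈ (univ : Set K), ‖fderiv ℝ (v (j k)) z‖ ≤ C + 1})
    (Filter.inter_mem (hO.mem_nhds hy) hbound) ?_ ?_ ?_ ?_ ?_ ?_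
  · filter_upwards [hO.mem_nhds hy] with z hz
    exact (integrable_of_continuous_compact μ (hslice z hz)).aestronglyMeasurable
  · exact integrable_of_continuous_compact μ (hslice y hy)
  · exact (integrable_of_continuous_compact μ (hslice' y hy)).aestronglyMeasurable
  · exact Filter.Eventually.of_forall fun k z hz => hz.2 k (mem_univ k)
  · exact integrable_const _
  · refine Filter.Eventually.of_forall fun k z hz => ?_
    have h1 : ContMDiffAt 𝓘(ℝ, EX) 𝓘(ℝ, F) ∞ (v (j k)) z :=
      ContMDiffAt.comp (x := z) (f := fun z => (j k, z)) (g := fun p : G × EX => v p.1 p.2)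
        (hv k z hz.1) (contMDiffAt_const.prodMk contMDiffAt_id)
    exact (h1.contDiffAt.differentiableAt (by simp)).hasFDerivAt

end

lemma contDiffOn_integral_nat {EX : Type u} [NormedAddCommGroup EX] [NormedSpace ℝ EX]
    [IsManifold 𝓘(ℝ, E) ∞ G] {j : K → G} (hj : Continuous j) (μ : Measure K) [IsFiniteMeasure μ]
    {O : Set EX} (hO : IsOpen O) (n : ℕ) :
    ∀ {F : Type u} [NormedAddCommGroup F] [NormedSpace ℝ F] (v : G → EX → F)
    (_ : ∀ k, ∀ y ∈ O, ContMDiffAt (𝓘(ℝ, E).prod 𝓘(ℝ, EX)) 𝓘(ℝ, F) ∞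
      (fun p : G × EX => v p.1 p.2) (j k, y)),
    ContDiffOn ℝ n (fun y => ∫ k, v (j k) y ∂μ) O := by
  induction n with
  | zero =>
    intro F _ _ v hv
    exact contDiffOn_zero.2 fun y hy =>
      (hasFDerivAt_integral_param hj μ hO hv hy).continuousAt.continuousWithinAt
  | succ n ih =>
    intro F _ _ v hv
    rw [Nat.cast_add, Nat.cast_one, contDiffOn_succ_iff_fderiv_of_isOpen hO]
    refine ⟨fun y hy => (hasFDerivAt_integral_param hj μ hO hv
      hy).differentiableAt.differentiableWithinAt, by simp, ?_⟩
    refine (ih (fun g y => fderiv ℝ (v g) y)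
      fun k y hy => contMDiffAt_partial_fderiv (hv k y hy)).congr fun y hy => ?_
    exact (hasFDerivAt_integral_param hj μ hO hv hy).fderiv

/-- Integrals over a compact space of functions depending smoothly on a parameter are smooth. -/
lemma contDiffOn_integral_param {EX : Type u} [NormedAddCommGroup EX] [NormedSpace ℝ EX]
    [IsManifold 𝓘(ℝ, E) ∞ G] {j : K → G} (hj : Continuous j) (μ : Measure K) [IsFiniteMeasure μ]
    {O : Set EX} (hO : IsOpen O) {F : Type u} [NormedAddCommGroup F] [NormedSpace ℝ F]
    {v : G → EX → F} (hv : ∀ k, ∀ y ∈ O, ContMDiffAt (𝓘(ℝ, E).prod 𝓘(ℝ, EX)) 𝓘(ℝ, F) ∞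
      (fun p : G × EX => v p.1 p.2) (j k, y)) :
    ContDiffOn ℝ ∞ (fun y => ∫ k, v (j k) y ∂μ) O :=
  contDiffOn_infty.2 fun n => contDiffOn_integral_nat hj μ hO n v hv

end ParametricIntegral

/-! ### Linearization of the action of a compact group near a fixed point -/

section Linearization

variable {E : Type*} [NormedAddCommGroup E] [NormedSpace ℝ E]
  {G : Type*} [TopologicalSpace G] [ChartedSpace E G] [Group G] [LieGroup 𝓘(ℝ, E) ∞ G]
  {EX : Type u} [NormedAddCommGroup EX] [NormedSpace ℝ EX]
  {X : Type*} [TopologicalSpace X] [ChartedSpace EX X]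

/-- A smooth action of the Lie group `G` on `X`. -/
structure IsSmoothAction (E EX : Type*) [NormedAddCommGroup E] [NormedSpace ℝ E]
    [NormedAddCommGroup EX] [NormedSpace ℝ EX] {G : Type*} [TopologicalSpace G] [ChartedSpace E G]
    [Group G] {X : Type*} [TopologicalSpace X] [ChartedSpace EX X] (a : G → X → X) : Prop where
  one : ∀ x, a 1 x = x
  mul : ∀ g h x, a (g * h) x = a g (a h x)
  smooth : ContMDiff (𝓘(ℝ, E).prod 𝓘(ℝ, EX)) 𝓘(ℝ, EX) ∞ fun p : G × X => a p.1 p.2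

namespace IsSmoothAction

variable {a : G → X → X}

lemma smooth_apply (ha : IsSmoothAction E EX a) (g : G) : ContMDiff 𝓘(ℝ, EX) 𝓘(ℝ, EX) ∞ (a g) :=
  ha.smooth.comp (contMDiff_const.prodMk contMDiff_id)

lemma inv_apply (ha : IsSmoothAction E EX a) (g : G) (x : X) : a g⁻¹ (a g x) = x := by
  rw [← ha.mul, inv_mul_cancel, ha.one]

lemma inv_fixed (ha : IsSmoothAction E EX a) {g : G} {x : X} (h : a g x = x) : a g⁻¹ x = x := by
  have h1 := ha.inv_apply g x
  rwa [h] at h1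

lemma mD_mul (ha : IsSmoothAction E EX a) {g h : G} {x : X} (hx : a h x = x) :
    mD 𝓘(ℝ, EX) 𝓘(ℝ, EX) (a (g * h)) x =
      (mD 𝓘(ℝ, EX) 𝓘(ℝ, EX) (a g) x).comp (mD 𝓘(ℝ, EX) 𝓘(ℝ, EX) (a h) x) := by
  have h1 := ((ha.smooth_apply g).hasD x).comp ((ha.smooth_apply h).hasD x) hx
  rw [← h1.mD_eq]
  congr 1
  funext z
  exact ha.mul g h z

lemma mD_one (ha : IsSmoothAction E EX a) (x : X) :
    mD 𝓘(ℝ, EX) 𝓘(ℝ, EX) (a 1) x = ContinuousLinearMap.id ℝ EX := by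
  have : a 1 = fun z => z := funext ha.one
  rw [this]
  exact (hasD_id x).mD_eq

end IsSmoothAction

variable {a : G → X → X}

lemma IsSmoothAction.contMDiffAt_chart (ha : IsSmoothAction E EX a) [IsManifold 𝓘(ℝ, EX) ∞ X]
    {x₀ : X} {g : G} {y : EX} (hy : y ∈ (extChartAt 𝓘(ℝ, EX) x₀).target)
    (hgy : a g ((extChartAt 𝓘(ℝ, EX) x₀).symm y) ∈ (extChartAt 𝓘(ℝ, EX) x₀).source) :
    ContMDiffAt (𝓘(ℝ, E).prod 𝓘(ℝ, EX)) 𝓘(ℝ, EX) ∞ (fun p : G × EX =>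
      extChartAt 𝓘(ℝ, EX) x₀ (a p.1 ((extChartAt 𝓘(ℝ, EX) x₀).symm p.2))) (g, y) := by
  have h1 : ContMDiffAt 𝓘(ℝ, EX) 𝓘(ℝ, EX) ∞ (extChartAt 𝓘(ℝ, EX) x₀).symm y :=
    (contMDiffOn_extChartAt_symm x₀).contMDiffAt (extChartAt_target_mem_nhds' hy)
  have h2 : ContMDiffAt (𝓘(ℝ, E).prod 𝓘(ℝ, EX)) 𝓘(ℝ, EX) ∞
      (fun p : G × EX => a p.1 ((extChartAt 𝓘(ℝ, EX) x₀).symm p.2)) (g, y) :=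
    ContMDiffAt.comp (g, y) (g := fun p : G × X => a p.1 p.2)
      (f := fun p : G × EX => (p.1, (extChartAt 𝓘(ℝ, EX) x₀).symm p.2)) (ha.smooth _)
      (contMDiffAt_fst.prodMk (ContMDiffAt.comp (g, y) h1 contMDiffAt_snd))
  refine ContMDiffAt.comp (g, y) (g := extChartAt 𝓘(ℝ, EX) x₀) ?_ h2
  exact contMDiffAt_extChartAt' (by simpa using hgy)

lemma IsSmoothAction.hasFDerivAt_chart (ha : IsSmoothAction E EX a) [IsManifold 𝓘(ℝ, EX) ∞ X]
    {x₀ : X} {g : G} (hg : a g x₀ = x₀) :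
    HasFDerivAt (fun y => extChartAt 𝓘(ℝ, EX) x₀ (a g ((extChartAt 𝓘(ℝ, EX) x₀).symm y)))
      (mD 𝓘(ℝ, EX) 𝓘(ℝ, EX) (a g) x₀) (extChartAt 𝓘(ℝ, EX) x₀ x₀) := by
  have := (hasD_extChartAt x₀).comp (((ha.smooth_apply g).hasD x₀).comp (hasD_extChartAt_symm x₀)
    (extChartAt_to_inv x₀)) (by rw [extChartAt_to_inv, hg])
  rw [ContinuousLinearMap.comp_id, ContinuousLinearMap.id_comp] at this
  exact hasD_iff_hasFDerivAt.1 this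

lemma IsSmoothAction.contMDiffAt_fderiv (ha : IsSmoothAction E EX a) [IsManifold 𝓘(ℝ, EX) ∞ X]
    {x₀ : X} {g : G} (hg : a g x₀ = x₀) :
    ContMDiffAt 𝓘(ℝ, E) 𝓘(ℝ, EX →L[ℝ] EX) ∞ (fun g : G => fderiv ℝ (fun y =>
      extChartAt 𝓘(ℝ, EX) x₀ (a g ((extChartAt 𝓘(ℝ, EX) x₀).symm y)))
      (extChartAt 𝓘(ℝ, EX) x₀ x₀)) g := by
  have h1 := contMDiffAt_partial_fderiv (v := fun (g : G) (y : EX) =>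
      extChartAt 𝓘(ℝ, EX) x₀ (a g ((extChartAt 𝓘(ℝ, EX) x₀).symm y))) (ha.contMDiffAt_chart (x₀ := x₀) (g := g)
    (mem_extChartAt_target x₀) (by rw [extChartAt_to_inv, hg]; exact mem_extChartAt_source x₀))
  exact ContMDiffAt.comp g (f := fun g : G => (g, extChartAt 𝓘(ℝ, EX) x₀ x₀)) h1
    (contMDiffAt_id.prodMk contMDiffAt_const)

/-- The derivative at a fixed point depends continuously on the group element. -/
lemma IsSmoothAction.continuous_mD (ha : IsSmoothAction E EX a) [IsManifold 𝓘(ℝ, EX) ∞ X] {x₀ : X}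
    {K : Subgroup G} (hK : ∀ k ∈ K, a k x₀ = x₀) :
    Continuous fun k : K => mD 𝓘(ℝ, EX) 𝓘(ℝ, EX) (a k) x₀ := by
  refine continuous_iff_continuousAt.2 fun k => ?_
  have h1 : ContinuousAt _ k := ContinuousAt.comp (x := k) (f := (Subtype.val : K → G))
    (ha.contMDiffAt_fderiv (hK k k.2)).continuousAt continuousAt_subtype_val
  refine h1.congr (Filter.Eventually.of_forall fun l => ?_)
  exact (ha.hasFDerivAt_chart (hK l l.2)).fderiv

lemma IsSmoothAction.isOpen_forall_mem (ha : IsSmoothAction E EX a) (K : Subgroup G)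
    [CompactSpace K] {U : Set X} (hU : IsOpen U) : IsOpen {x | ∀ k : K, a k x ∈ U} := by
  have hact : Continuous fun p : K × X => a p.1 p.2 :=
    ha.smooth.continuous.comp (f := fun p : K × X => ((p.1 : G), p.2)) (by fun_prop)
  have hcl : IsClosed (Prod.snd '' ((fun p : K × X => a p.1 p.2) ⁻¹' Uᶜ)) :=
    isClosedMap_snd_of_compactSpace _ (hU.isClosed_compl.preimage hact)
  convert hcl.isOpen_compl using 1
  ext x
  simp

lemma IsSmoothAction.fixed_of_mem_closure (ha : IsSmoothAction E EX a) [IsTopologicalGroup G] [T2Space X] {t : G} {x : X}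
    (hx : a t x = x) {k : G} (hk : k ∈ (Subgroup.zpowers t).topologicalClosure) : a k x = x := by
  let S : Subgroup G :=
    { carrier := {g | a g x = x}
      one_mem' := ha.one x
      mul_mem' := fun {g h} hg hh => by
        change a (g * h) x = x
        rw [ha.mul, hh, hg]
      inv_mem' := fun {g} hg => ha.inv_fixed hg }
  have hS : IsClosed (S : Set G) := by
    have hc : Continuous fun g => a g x := ha.smooth.continuous.comp
      (f := fun g : G => (g, x)) (by fun_prop)
    exact isClosed_eq hc continuous_const
  exact Subgroup.topologicalClosure_minimal _ ((Subgroup.zpowers_le (H := S)).2 hx) hS hk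

/-- Near a fixed point of `t`, the action of the closed subgroup generated by `t` is linear in a
suitable chart `e`, and `P` is the average of this linear action. -/
theorem IsSmoothAction.exists_linearization (ha : IsSmoothAction E EX a) [CompactSpace G]
    [T2Space G] [T2Space X] [IsManifold 𝓘(ℝ, EX) ∞ X] [CompleteSpace EX] {t : G} {x₀ : X} (hx₀ : a t x₀ = x₀) :
    ∃ (e : OpenPartialHomeomorph X EX) (P : EX →L[ℝ] EX), x₀ ∈ e.source ∧
      ContMDiffOn 𝓘(ℝ, EX) 𝓘(ℝ, EX) ∞ e e.source ∧
      ContMDiffOn 𝓘(ℝ, EX) 𝓘(ℝ, EX) ∞ e.symm e.target ∧ e x₀ = 0 ∧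
      HasD 𝓘(ℝ, EX) 𝓘(ℝ, EX) e x₀ (ContinuousLinearMap.id ℝ EX) ∧
      (∀ w, P (P w) = P w) ∧ (∀ x ∈ e.source, a t x = x ↔ P (e x) = e x) ∧
      ∀ (l : EX →L[ℝ] ℝ) (w : EX) (z : ℝ),
        (∀ n : ℤ, l (mD 𝓘(ℝ, EX) 𝓘(ℝ, EX) (a (t ^ n)) x₀ w) = z) → l (P w) = z := by
  have : IsTopologicalGroup G := topologicalGroup_of_lieGroup 𝓘(ℝ, E) ∞
  set K := (Subgroup.zpowers t).topologicalClosure with hKdef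
  have hKfix : ∀ x, a t x = x → ∀ k ∈ K, a k x = x := fun x hx k hk =>
    ha.fixed_of_mem_closure hx hk
  have : CompactSpace K := isCompact_iff_compactSpace.1
    (Subgroup.isClosed_topologicalClosure _).isCompact
  let _ : MeasurableSpace K := borel K
  have : BorelSpace K := ⟨rfl⟩
  let μ : Measure K := Measure.haarMeasure ⊤
  have : IsProbabilityMeasure μ := ⟨Measure.haarMeasure_self⟩
  set D : K → EX →L[ℝ] EX := fun k => mD 𝓘(ℝ, EX) 𝓘(ℝ, EX) (a k) x₀ with hD
  have hDc : Continuous D := ha.continuous_mD (hKfix x₀ hx₀)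
  have hDmul : ∀ k l : K, D (k * l) = (D k).comp (D l) := fun k l =>
    ha.mD_mul (hKfix x₀ hx₀ l l.2)
  have hDone : D 1 = ContinuousLinearMap.id ℝ EX := ha.mD_one x₀
  have hDint : Integrable D μ := integrable_of_continuous_compact μ hDc
  set P : EX →L[ℝ] EX := ∫ k, D k ∂μ with hP
  have hPapp : ∀ w, P w = ∫ k, D k w ∂μ := fun w => ContinuousLinearMap.integral_apply hDint w
  have hDw : ∀ w, Integrable (fun k => D k w) μ := fun w =>
    integrable_of_continuous_compact μ (hDc.clm_apply continuous_const)
  have hDP : ∀ k w, D k (P w) = P w := by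
    intro k w
    rw [hPapp, ← ContinuousLinearMap.integral_comp_comm _ (hDw w)]
    have : (fun l => D k (D l w)) = fun l => D (k * l) w := by
      funext l; rw [hDmul]; rfl
    rw [this]
    exact integral_mul_left_eq_self (fun l => D l w) k
  have hPfix : ∀ w, (∀ k, D k w = w) → P w = w := by
    intro w hw
    rw [hPapp]
    simp [hw]
  obtain ⟨e, hxe, hes, hes', he0, hed, heq⟩ : ∃ e : OpenPartialHomeomorph X EX, x₀ ∈ e.source ∧
      ContMDiffOn 𝓘(ℝ, EX) 𝓘(ℝ, EX) ∞ e e.source ∧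
      ContMDiffOn 𝓘(ℝ, EX) 𝓘(ℝ, EX) ∞ e.symm e.target ∧ e x₀ = 0 ∧
      HasD 𝓘(ℝ, EX) 𝓘(ℝ, EX) e x₀ (ContinuousLinearMap.id ℝ EX) ∧
      ∀ (k : K), ∀ x ∈ e.source, a k x ∈ e.source → e (a k x) = D k (e x) := by
    set φ := extChartAt 𝓘(ℝ, EX) x₀ with hφ
    set u : G → EX → EX := fun g y => φ (a g (φ.symm y)) with hu
    have hK0 := hKfix x₀ hx₀
    have hDu : ∀ k : K, fderiv ℝ (u k) (φ x₀) = D k := fun k =>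
      (ha.hasFDerivAt_chart (hK0 k k.2)).fderiv
    set v : G → EX → EX := fun g y => fderiv ℝ (u g) (φ x₀) (u g⁻¹ y - φ x₀) with hv
    set O : Set EX := φ.target ∩ φ.symm ⁻¹' {x | ∀ k : K, a k x ∈ φ.source} with hO
    have hOo : IsOpen O := (continuousOn_extChartAt_symm x₀).isOpen_inter_preimage
      (isOpen_extChartAt_target x₀) (ha.isOpen_forall_mem K (isOpen_extChartAt_source x₀))
    have hcO : φ x₀ ∈ O := by
      refine ⟨mem_extChartAt_target x₀, fun k => ?_⟩
      rw [hφ, extChartAt_to_inv, hK0 k k.2]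
      exact mem_extChartAt_source x₀
    have hvs : ∀ (k : K), ∀ y ∈ O, ContMDiffAt (𝓘(ℝ, E).prod 𝓘(ℝ, EX)) 𝓘(ℝ, EX) ∞
        (fun p : G × EX => v p.1 p.2) ((k : G), y) := by
      intro k y hy
      have h1 : ContMDiffAt (𝓘(ℝ, E).prod 𝓘(ℝ, EX)) 𝓘(ℝ, EX →L[ℝ] EX) ∞
          (fun p : G × EX => fderiv ℝ (u p.1) (φ x₀)) ((k : G), y) :=
        ContMDiffAt.comp ((k : G), y) (ha.contMDiffAt_fderiv (hK0 k k.2)) contMDiffAt_fst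
      have h2 : ContMDiffAt (𝓘(ℝ, E).prod 𝓘(ℝ, EX)) 𝓘(ℝ, EX) ∞
          (fun p : G × EX => u p.1⁻¹ p.2) ((k : G), y) :=
        ContMDiffAt.comp ((k : G), y) (f := fun p : G × EX => (p.1⁻¹, p.2))
          (ha.contMDiffAt_chart hy.1 (hy.2 k⁻¹))
          ((((contMDiff_inv 𝓘(ℝ, E) ∞).contMDiffAt).comp _ contMDiffAt_fst).prodMk contMDiffAt_snd)
      exact h1.clm_apply (h2.sub contMDiffAt_const)
    set ψ : EX → EX := fun y => ∫ k : K, v k y ∂μ with hψ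
    have hψs : ContDiffOn ℝ ∞ ψ O := contDiffOn_integral_param continuous_subtype_val μ hOo hvs
    have hψd : HasFDerivAt ψ ((ContinuousLinearEquiv.refl ℝ EX : EX ≃L[ℝ] EX) : EX →L[ℝ] EX)
        (φ x₀) := by
      have h1 := hasFDerivAt_integral_param continuous_subtype_val μ hOo hvs hcO
      convert h1 using 1
      have h2 : ∀ k : K, fderiv ℝ (v k) (φ x₀) = ContinuousLinearMap.id ℝ EX := by
        intro k
        have h3 := (ha.hasFDerivAt_chart (hK0 _ (k⁻¹).2)).sub_const (φ x₀)
        have h4 := ((D k).hasFDerivAt.comp (φ x₀) h3).fderiv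
        simp only [hv, hDu]
        refine h4.trans ?_
        have h5 := hDmul k k⁻¹
        rw [mul_inv_cancel, hDone] at h5
        exact h5.symm
      simp [h2]
    obtain ⟨e₁, hxe₁, he₁sub, he₁eq, he₁s⟩ := exists_openPartialHomeomorph hOo hψs hcO hψd
    have he₁s' : ContDiffOn ℝ ∞ e₁ e₁.source := by rw [he₁eq]; exact hψs.mono he₁sub
    have happ : ∀ x ∈ φ.source, ψ (φ x) = ∫ k : K, D k (φ (a (k⁻¹ : K) x) - φ x₀) ∂μ := by
      intro x hx
      refine integral_congr_ae (Filter.Eventually.of_forall fun k => ?_)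
      change fderiv ℝ (u k) (φ x₀) (φ (a (k : G)⁻¹ (φ.symm (φ x))) - φ x₀) = _
      rw [hDu, φ.left_inv hx]
      rfl
    refine ⟨(chartAt EX x₀).trans e₁, ⟨mem_chart_source EX x₀, hxe₁⟩, ?_, ?_, ?_, ?_, ?_⟩
    · exact he₁s'.contMDiffOn.comp ((contMDiffOn_chart (x := x₀)).mono fun x hx => hx.1)
        fun x hx => hx.2
    · have h1 : ContMDiffOn 𝓘(ℝ, EX) 𝓘(ℝ, EX) ∞ e₁.symm e₁.target := he₁s.contMDiffOn
      refine (contMDiffOn_chart_symm (x := x₀)).comp (h1.mono ?_) ?_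
      · intro y hy
        exact (by simpa [OpenPartialHomeomorph.trans_target] using hy : _ ∧ _).1
      · intro y hy
        exact (by simpa [OpenPartialHomeomorph.trans_target] using hy : _ ∧ _).2
    · change e₁ (φ x₀) = 0
      rw [he₁eq, happ x₀ (mem_extChartAt_source x₀)]
      simp only [hK0 _ (SetLike.coe_mem _), sub_self, map_zero, integral_zero]
    · have h1 : HasD 𝓘(ℝ, EX) 𝓘(ℝ, EX) ψ (φ x₀) (ContinuousLinearMap.id ℝ EX) :=
        hasD_iff_hasFDerivAt.2 hψd
      rw [← he₁eq] at h1
      exact h1.comp (hasD_extChartAt x₀) rfl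
    · intro l x hx hlx
      change e₁ (φ (a l x)) = D l (e₁ (φ x))
      have hxs : x ∈ φ.source := by rw [hφ, extChartAt_source]; exact hx.1
      have hlxs : a l x ∈ φ.source := by rw [hφ, extChartAt_source]; exact hlx.1
      have hxO : φ x ∈ O := he₁sub hx.2
      rw [he₁eq, happ _ hlxs, happ _ hxs]
      have hint : Integrable (fun k : K => D k (φ (a (k⁻¹ : K) x) - φ x₀)) μ := by
        refine integrable_of_continuous_compact μ ?_
        have hc : Continuous fun k : K => φ (a (k⁻¹ : K) x) := by
          refine (continuousOn_extChartAt x₀).comp_continuous ?_ fun k => ?_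
          · exact ha.smooth.continuous.comp (f := fun k : K => (((k⁻¹ : K) : G), x)) (by fun_prop)
          · have := hxO.2 k⁻¹
            rwa [φ.left_inv hxs] at this
        exact hDc.clm_apply (hc.sub continuous_const)
      rw [← ContinuousLinearMap.integral_comp_comm _ hint,
        ← integral_mul_left_eq_self (fun k : K => D k (φ (a (k⁻¹ : K) (a l x)) - φ x₀)) l]
      refine integral_congr_ae (Filter.Eventually.of_forall fun k => ?_)
      simp only [hDmul]
      have h1 : a ((l * k)⁻¹ : K) (a l x) = a (k⁻¹ : K) x := by
        rw [← ha.mul]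
        congr 1
        simp
      rw [h1]
      rfl
  have hopen := ha.isOpen_forall_mem K e.open_source
  set e' := e.restrOpen _ hopen with he'
  have hsrc : ∀ x ∈ e'.source, x ∈ e.source ∧ ∀ k : K, a k x ∈ e.source := fun x hx => hx
  have htgt : e'.target ⊆ e.target := by
    intro w hw
    have h1 := (e'.map_target hw).1
    rw [← e'.right_inv hw]
    exact e.map_source h1
  let tK : K := ⟨t, Subgroup.le_topologicalClosure _ (Subgroup.mem_zpowers t)⟩
  refine ⟨e', P, ⟨hxe, fun k => by rw [hKfix x₀ hx₀ k k.2]; exact hxe⟩,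
    hes.mono fun x hx => hx.1, hes'.mono htgt, he0, hed, fun w => hPfix _ fun k => hDP k w, ?_, ?_⟩
  · intro x hx
    obtain ⟨hx1, hx2⟩ := hsrc x hx
    change _ ↔ P (e x) = e x
    constructor
    · intro h
      refine hPfix _ fun k => ?_
      have hk := heq k x hx1 (hx2 k)
      rw [hKfix x h k k.2] at hk
      exact hk.symm
    · intro h
      refine e.injOn (hx2 tK) hx1 ?_
      change e (a t x) = e x
      rw [heq tK x hx1 (hx2 tK), ← h, hDP]
  · intro l w z hz
    have hcont : Continuous fun k : K => l (D k w) := by fun_prop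
    have hall : ∀ k : K, l (D k w) = z := by
      have hcl : IsClosed {k : K | l (D k w) = z} := isClosed_eq hcont continuous_const
      have himg : IsClosed (Subtype.val '' {k : K | l (D k w) = z}) :=
        (Subgroup.isClosed_topologicalClosure _).isClosedMap_subtype_val _ hcl
      have hsub : (Subgroup.zpowers t : Set G) ⊆ Subtype.val '' {k : K | l (D k w) = z} := by
        rintro _ ⟨n, rfl⟩
        exact ⟨⟨t ^ n, Subgroup.le_topologicalClosure _ ⟨n, rfl⟩⟩, hz n, rfl⟩
      intro k
      obtain ⟨k', hk', hkk⟩ := closure_minimal hsub himg k.2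
      rw [← Subtype.ext hkk]
      exact hk'
    rw [hPapp, ← ContinuousLinearMap.integral_comp_comm _ (hDw w)]
    simp [hall]

end Linearization

/-! ### Pull-backs of forms -/

section AlternatingSmooth

variable {E E' : Type*} [NormedAddCommGroup E] [NormedSpace ℝ E]
  [NormedAddCommGroup E'] [NormedSpace ℝ E']

/-- The projection of continuous multilinear maps to alternating ones, normalized so as to be the
identity on alternating maps. -/
def alternatize (E : Type*) [NormedAddCommGroup E] [NormedSpace ℝ E] (k : ℕ) :
    ContinuousMultilinearMap ℝ (fun _ : Fin k => E) ℝ →L[ℝ] E [⋀^Fin k]→L[ℝ] ℝ :=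
  LinearMap.mkContinuous
    { toFun := fun f => ((k.factorial : ℝ)⁻¹) • ContinuousMultilinearMap.alternatization f
      map_add' := fun f g => by rw [map_add, smul_add]
      map_smul' := fun c f => by
        ext v
        have h1 : (c • f).alternatization v = c * f.alternatization v := by
          rw [ContinuousMultilinearMap.alternatization_apply_apply,
            ContinuousMultilinearMap.alternatization_apply_apply, Finset.mul_sum]
          refine Finset.sum_congr rfl fun σ _ => ?_
          rw [mul_smul_comm]
          rfl
        change (k.factorial : ℝ)⁻¹ * (c • f).alternatization v =
          c * ((k.factorial : ℝ)⁻¹ * f.alternatization v)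
        rw [h1]
        ring } 1 (by
    intro f
    rw [one_mul]
    refine ContinuousAlternatingMap.opNorm_le_bound _ (norm_nonneg f) fun v => ?_
    have hk : (0 : ℝ) < k.factorial := by exact_mod_cast k.factorial_pos
    have h1 : ‖∑ σ : Equiv.Perm (Fin k), Equiv.Perm.sign σ • f (v ∘ σ)‖ ≤
        k.factorial * (‖f‖ * ∏ i, ‖v i‖) := by
      refine (norm_sum_le _ _).trans ?_
      have h2 : ∀ σ : Equiv.Perm (Fin k), ‖Equiv.Perm.sign σ • f (v ∘ σ)‖ ≤ ‖f‖ * ∏ i, ‖v i‖ := by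
        intro σ
        have h3 : ‖Equiv.Perm.sign σ • f (v ∘ σ)‖ = ‖f (v ∘ σ)‖ := by
          rcases Int.units_eq_one_or (Equiv.Perm.sign σ) with h | h <;> simp [h]
        rw [h3]
        refine (f.le_opNorm _).trans (le_of_eq ?_)
        congr 1
        exact Equiv.prod_comp σ fun i => ‖v i‖
      refine (Finset.sum_le_sum fun σ _ => h2 σ).trans (le_of_eq ?_)
      simp [Finset.card_univ, Fintype.card_perm]
    simp only [LinearMap.coe_mk, AddHom.coe_mk, ContinuousAlternatingMap.smul_apply,
      ContinuousMultilinearMap.alternatization_apply_apply, norm_smul, norm_inv, Real.norm_natCast]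
    rw [inv_mul_le_iff₀ hk]
    exact h1)

lemma alternatize_apply (k : ℕ) (f : E [⋀^Fin k]→L[ℝ] ℝ) :
    alternatize E k f.toContinuousMultilinearMap = f := by
  have hk : (k.factorial : ℝ) ≠ 0 := by exact_mod_cast k.factorial_ne_zero
  ext v
  change (k.factorial : ℝ)⁻¹ • (ContinuousMultilinearMap.alternatization
    f.toContinuousMultilinearMap) v = f v
  rw [ContinuousMultilinearMap.alternatization_apply_apply]
  have : ∀ σ : Equiv.Perm (Fin k),
      Equiv.Perm.sign σ • f.toContinuousMultilinearMap (v ∘ σ) = f v := by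
    intro σ
    change Equiv.Perm.sign σ • f.toAlternatingMap (v ∘ σ) = f.toAlternatingMap v
    rw [AlternatingMap.map_perm, smul_smul]
    simp
  rw [Finset.sum_congr rfl fun σ _ => this σ]
  simp [Finset.card_univ, Fintype.card_perm, hk]

lemma contDiffOn_compContinuousLinearMap {k : ℕ} {Z : Type*} [NormedAddCommGroup Z]
    [NormedSpace ℝ Z] {s : Set Z} {A : Z → E [⋀^Fin k]→L[ℝ] ℝ} {L : Z → E' →L[ℝ] E}
    (hA : ContDiffOn ℝ ∞ A s) (hL : ContDiffOn ℝ ∞ L s) :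
    ContDiffOn ℝ ∞ (fun z => (A z).compContinuousLinearMap (L z)) s := by
  have h1 : ContDiffOn ℝ ∞ (fun z => ContinuousMultilinearMap.compContinuousLinearMapContinuousMultilinear
      ℝ (fun _ : Fin k => E') (fun _ : Fin k => E) ℝ fun _ => L z) s :=
    (ContinuousMultilinearMap.contDiff _).comp_contDiffOn (contDiffOn_pi.2 fun _ => hL)
  have h2 : ContDiffOn ℝ ∞ (fun z => (A z).toContinuousMultilinearMap) s :=
    (ContinuousAlternatingMap.toContinuousMultilinearMapCLM (𝕜 := ℝ) (E := E) (F := ℝ)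
      (ι := Fin k) ℝ).contDiff.comp_contDiffOn hA
  have h3 := (alternatize E' k).contDiff.comp_contDiffOn (h1.clm_apply h2)
  refine h3.congr fun z _ => ?_
  rw [Function.comp_apply, ← alternatize_apply k ((A z).compContinuousLinearMap (L z))]
  rfl

end AlternatingSmooth

section Forms

variable {E : Type*} [NormedAddCommGroup E] [NormedSpace ℝ E]
  {M : Type*} [TopologicalSpace M] [ChartedSpace E M]
  {E' : Type*} [NormedAddCommGroup E'] [NormedSpace ℝ E']
  {N : Type*} [TopologicalSpace N] [ChartedSpace E' N]

/-- The values of a form, as alternating maps on the model space. -/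
def Form.val {k : ℕ} (σ : Form E M k) (m : M) : E [⋀^Fin k]→L[ℝ] ℝ := σ m

lemma Form.val_pullback {k : ℕ} (f : N → M) (σ : Form E M k) (x : N) :
    Form.val (Form.pullback f σ : Form E' N k) x =
      (σ.val (f x)).compContinuousLinearMap (mD 𝓘(ℝ, E') 𝓘(ℝ, E) f x) := rfl

lemma Form.inChart_eq {k : ℕ} (σ : Form E M k) (m₀ : M) (y : E) :
    σ.inChart m₀ y = (σ.val ((extChartAt 𝓘(ℝ, E) m₀).symm y)).compContinuousLinearMap
      (mD 𝓘(ℝ, E) 𝓘(ℝ, E) (extChartAt 𝓘(ℝ, E) m₀).symm y) := rfl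

lemma Form.inChart_pullback [IsManifold 𝓘(ℝ, E) ∞ M] [IsManifold 𝓘(ℝ, E') ∞ N] {k : ℕ} {f : N → M}
    (hf : ContMDiff 𝓘(ℝ, E') 𝓘(ℝ, E) ∞ f) (σ : Form E M k) (n₀ : N) (m₀ : M) {y : E'}
    (hy : y ∈ (extChartAt 𝓘(ℝ, E') n₀).target)
    (hfy : f ((extChartAt 𝓘(ℝ, E') n₀).symm y) ∈ (extChartAt 𝓘(ℝ, E) m₀).source) :
    (Form.pullback f σ : Form E' N k).inChart n₀ y =
      (σ.inChart m₀ (extChartAt 𝓘(ℝ, E) m₀ (f ((extChartAt 𝓘(ℝ, E') n₀).symm y)))).compContinuousLinearMap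
        (fderiv ℝ (fun z => extChartAt 𝓘(ℝ, E) m₀ (f ((extChartAt 𝓘(ℝ, E') n₀).symm z))) y) := by
  set φ := extChartAt 𝓘(ℝ, E') n₀
  set ψ := extChartAt 𝓘(ℝ, E) m₀
  have h1 : HasD 𝓘(ℝ, E') 𝓘(ℝ, E') φ.symm y _ :=
    ((contMDiffOn_extChartAt_symm (n := ∞) n₀).contMDiffAt (extChartAt_target_mem_nhds' hy)).hasD
  have h2 := (hf.hasD (φ.symm y)).comp h1 rfl
  have h3 : HasD 𝓘(ℝ, E) 𝓘(ℝ, E) ψ (f (φ.symm y)) _ :=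
    (contMDiffAt_extChartAt' (n := ∞) (by simpa [ψ] using hfy)).hasD
  have h4 := h3.comp h2 rfl
  have h5 : HasD 𝓘(ℝ, E) 𝓘(ℝ, E) ψ.symm (ψ (f (φ.symm y))) _ :=
    ((contMDiffOn_extChartAt_symm (n := ∞) m₀).contMDiffAt
      (extChartAt_target_mem_nhds' (ψ.map_source hfy))).hasD
  have h6 := (h5.comp h4 rfl).unique (h2.congr (by
    have hev : ∀ᶠ z in 𝓝 y, f (φ.symm z) ∈ ψ.source :=
      h2.continuousAt.preimage_mem_nhds ((isOpen_extChartAt_source m₀).mem_nhds hfy)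
    filter_upwards [hev] with z hz
    exact ψ.left_inv hz))
  rw [(hasD_iff_hasFDerivAt.1 h4).fderiv, Form.inChart_eq, Form.inChart_eq, Form.val_pullback,
    ψ.left_inv hfy]
  ext v
  simp only [ContinuousAlternatingMap.compContinuousLinearMap_apply]
  congr 1
  funext i
  exact (DFunLike.congr_fun h6 (v i)).symm

lemma Form.IsSmooth.pullback [IsManifold 𝓘(ℝ, E) ∞ M] [IsManifold 𝓘(ℝ, E') ∞ N] {k : ℕ}
    {f : N → M} (hf : ContMDiff 𝓘(ℝ, E') 𝓘(ℝ, E) ∞ f) {σ : Form E M k} (hσ : σ.IsSmooth) :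
    (Form.pullback f σ : Form E' N k).IsSmooth := by
  intro n₀ y hy
  set φ := extChartAt 𝓘(ℝ, E') n₀ with hφ
  set m₀ := f (φ.symm y) with hm₀
  set ψ := extChartAt 𝓘(ℝ, E) m₀ with hψ
  set O := φ.target ∩ φ.symm ⁻¹' (f ⁻¹' ψ.source) with hO
  have hOo : IsOpen O := (continuousOn_extChartAt_symm n₀).isOpen_inter_preimage
    (isOpen_extChartAt_target n₀) ((isOpen_extChartAt_source m₀).preimage hf.continuous)
  have hyO : y ∈ O := ⟨hy, mem_extChartAt_source m₀⟩
  have hg : ContDiffOn ℝ ∞ (fun z => ψ (f (φ.symm z))) O := by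
    rw [← contMDiffOn_iff_contDiffOn]
    have h1 : ContMDiffOn 𝓘(ℝ, E') 𝓘(ℝ, E') ∞ φ.symm O :=
      (contMDiffOn_extChartAt_symm n₀).mono inter_subset_left
    have h2 : ContMDiffOn 𝓘(ℝ, E) 𝓘(ℝ, E) ∞ ψ ψ.source := by
      rw [hψ, extChartAt_source]; exact contMDiffOn_extChartAt
    exact h2.comp (hf.comp_contMDiffOn h1) fun w hw => hw.2
  have h1 : ContDiffOn ℝ ∞ (fun z => (σ.inChart m₀ (ψ (f (φ.symm z)))).compContinuousLinearMap
      (fderiv ℝ (fun z => ψ (f (φ.symm z))) z)) O :=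
    contDiffOn_compContinuousLinearMap ((hσ m₀).comp hg fun z hz => ψ.map_source hz.2)
      (hg.fderiv_of_isOpen hOo (by simp))
  have h2 : ContDiffOn ℝ ∞ ((Form.pullback f σ : Form E' N k).inChart n₀) O :=
    h1.congr fun z hz => Form.inChart_pullback hf σ n₀ m₀ hz.1 hz.2
  exact (h2.contDiffAt (hOo.mem_nhds hyO)).contDiffWithinAt

lemma Form.d_pullback [IsManifold 𝓘(ℝ, E) ∞ M] [IsManifold 𝓘(ℝ, E') ∞ N] {k : ℕ}
    {f : N → M} (hf : ContMDiff 𝓘(ℝ, E') 𝓘(ℝ, E) ∞ f) {σ : Form E M k} (hσ : σ.IsSmooth) (x : N) :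
    Form.val (Form.d (Form.pullback f σ : Form E' N k)) x =
      (σ.d.val (f x)).compContinuousLinearMap (mD 𝓘(ℝ, E') 𝓘(ℝ, E) f x) := by
  set φ := extChartAt 𝓘(ℝ, E') x with hφ
  set ψ := extChartAt 𝓘(ℝ, E) (f x) with hψ
  have hg0 : ψ (f (φ.symm (φ x))) = ψ (f x) := by rw [hφ, extChartAt_to_inv]
  have hg : HasFDerivAt (fun z => ψ (f (φ.symm z))) (mD 𝓘(ℝ, E') 𝓘(ℝ, E) f x) (φ x) := by
    have := (hasD_extChartAt (f x)).comp ((hf.hasD x).comp (hasD_extChartAt_symm x)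
      (extChartAt_to_inv x)) (by rw [extChartAt_to_inv])
    rw [ContinuousLinearMap.comp_id, ContinuousLinearMap.id_comp] at this
    exact hasD_iff_hasFDerivAt.1 this
  have hgs : ContDiffAt ℝ ∞ (fun z => ψ (f (φ.symm z))) (φ x) := by
    rw [← contMDiffAt_iff_contDiffAt]
    refine ContMDiffAt.comp (g := ψ) _ ?_ (ContMDiffAt.comp (g := f) _ (hf _) ?_)
    · rw [extChartAt_to_inv]; exact contMDiffAt_extChartAt
    · exact (contMDiffOn_extChartAt_symm x).contMDiffAt (extChartAt_target_mem_nhds x)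
  have hev : ∀ᶠ z in 𝓝 (φ x), z ∈ φ.target ∧ f (φ.symm z) ∈ ψ.source := by
    have hc : ContinuousAt (fun z => f (φ.symm z)) (φ x) :=
      hf.continuous.continuousAt.comp (continuousAt_extChartAt_symm x)
    refine Filter.Eventually.and (extChartAt_target_mem_nhds x) (hc.preimage_mem_nhds ?_)
    rw [hφ, extChartAt_to_inv]
    exact extChartAt_source_mem_nhds (f x)
  have hd : DifferentiableAt ℝ (σ.inChart (f x)) (ψ (f (φ.symm (φ x)))) := by
    rw [hg0]
    exact ((hσ (f x)).contDiffAt (extChartAt_target_mem_nhds (f x))).differentiableAt (by simp)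
  have h1 := extDeriv_pullback (f := fun z => ψ (f (φ.symm z))) (x := φ x) (r := ∞) hd hgs
    (by simpa using WithTop.coe_le_coe.2 (le_top : (2 : ℕ∞) ≤ ⊤))
  change extDeriv ((Form.pullback f σ : Form E' N k).inChart x) (φ x) =
    (extDeriv (σ.inChart (f x)) (ψ (f x))).compContinuousLinearMap (mD 𝓘(ℝ, E') 𝓘(ℝ, E) f x)
  rw [← hg.fderiv, ← hg0, ← h1]
  refine Filter.EventuallyEq.extDeriv_eq ?_
  filter_upwards [hev] with z hz
  exact Form.inChart_pullback hf σ x (f x) hz.1 hz.2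

end Forms

/-! ### Sobolev spaces of scalar functions in terms of Fourier coefficients -/

section ScalarSobolev

/-- The weight `1 + n²`. -/
def wt (n : ℤ) : ℝ := 1 + (n : ℝ) ^ 2

lemma one_le_wt (n : ℤ) : 1 ≤ wt n := by unfold wt; nlinarith [sq_nonneg (n : ℝ)]

lemma wt_pos (n : ℤ) : 0 < wt n := lt_of_lt_of_le one_pos (one_le_wt n)

/-- The continuous function `w` is of Sobolev class `p`. -/
def HC (p : ℝ) (w : C(UnitAddCircle, ℂ)) : Prop :=
  Summable fun n : ℤ => wt n ^ p * ‖fourierCoeff w n‖ ^ 2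

lemma HC.mono {p q : ℝ} (hqp : q ≤ p) {w : C(UnitAddCircle, ℂ)} (h : HC p w) : HC q w := by
  refine Summable.of_nonneg_of_le (fun n => ?_) (fun n => ?_) h
  · have := wt_pos n; positivity
  · gcongr
    exact one_le_wt n

lemma hC_zero (w : C(UnitAddCircle, ℂ)) : HC 0 w := by
  have h := (hasSum_sq_fourierCoeff (ContinuousMap.toLp 2 AddCircle.haarAddCircle ℂ w)).summable
  simp only [fourierCoeff_toLp] at h
  simpa [HC] using h

lemma summable_wt {p : ℝ} (hp : 1 / 2 < p) : Summable fun n : ℤ => wt n ^ (-p) := by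
  have h := Real.summable_abs_int_rpow (b := 2 * p) (by linarith)
  refine Summable.of_norm_bounded_eventually h ?_
  have hfin : ({0} : Set ℤ).Finite := finite_singleton 0
  filter_upwards [hfin.compl_mem_cofinite] with n hn
  have hn0 : (n : ℝ) ≠ 0 := by simpa using hn
  have habs : 0 < |(n : ℝ)| := abs_pos.2 hn0
  rw [Real.norm_of_nonneg (Real.rpow_nonneg (wt_pos n).le _)]
  have h1 : |(n : ℝ)| ^ (-(2 * p)) = (|(n : ℝ)| ^ (2 : ℝ)) ^ (-p) := by
    rw [← Real.rpow_mul habs.le]; ring_nf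
  rw [h1]
  refine Real.rpow_le_rpow_of_nonpos (by positivity) ?_ (by linarith)
  rw [Real.rpow_two, sq_abs, wt]
  linarith

lemma le_wt_add (p : ℝ) (n : ℤ) (x : ℝ) : |x| ≤ wt n ^ (-p) + wt n ^ p * x ^ 2 := by
  have hw := wt_pos n
  have h1 : wt n ^ (-p) = (wt n ^ p)⁻¹ := Real.rpow_neg hw.le p
  have h2 : 0 < wt n ^ p := Real.rpow_pos_of_pos hw p
  rw [h1]
  set a := wt n ^ p
  have h3 : 0 ≤ a⁻¹ * (a * |x| - 1) ^ 2 := by positivity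
  have h4 : a⁻¹ * (a * |x| - 1) ^ 2 = a * |x| ^ 2 - 2 * |x| + a⁻¹ := by
    field_simp
    ring
  rw [← sq_abs x]
  nlinarith [abs_nonneg x]

lemma HC.summable_norm {p : ℝ} (hp : 1 / 2 < p) {w : C(UnitAddCircle, ℂ)} (h : HC p w) :
    Summable fun n => ‖fourierCoeff w n‖ :=
  Summable.of_nonneg_of_le (fun n => norm_nonneg _)
    (fun n => by simpa using le_wt_add p n ‖fourierCoeff w n‖) ((summable_wt hp).add h)

lemma HC.summable {p : ℝ} (hp : 1 / 2 < p) {w : C(UnitAddCircle, ℂ)} (h : HC p w) :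
    Summable (fourierCoeff w) := (h.summable_norm hp).of_norm

lemma HC.norm_le {p : ℝ} (hp : 1 / 2 < p) {w : C(UnitAddCircle, ℂ)} (h : HC p w)
    (z : UnitAddCircle) :
    ‖w z‖ ≤ ∑' n, wt n ^ (-p) + ∑' n, wt n ^ p * ‖fourierCoeff w n‖ ^ 2 := by
  have h1 := has_pointwise_sum_fourier_series_of_summable (h.summable hp) z
  have h2 : ∀ n, ‖fourierCoeff w n • fourier n z‖ ≤
      wt n ^ (-p) + wt n ^ p * ‖fourierCoeff w n‖ ^ 2 := by
    intro n
    have : ‖fourier n z‖ = 1 := Circle.norm_coe _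
    rw [norm_smul, this, mul_one]
    simpa using le_wt_add p n ‖fourierCoeff w n‖
  rw [← (summable_wt hp).tsum_add h, ← h1.tsum_eq]
  exact tsum_of_norm_bounded ((summable_wt hp).add h).hasSum h2

/-- Young's inequality for the convolution of an `ℓ²` and an `ℓ¹` sequence. -/
lemma summable_sq_conv {a b : ℤ → ℝ} (ha0 : ∀ n, 0 ≤ a n) (hb0 : ∀ n, 0 ≤ b n)
    (ha : Summable fun n => a n ^ 2) (hb : Summable b) :
    (∀ n, Summable fun m => a (n - m) * b m) ∧ Summable fun n => (∑' m, a (n - m) * b m) ^ 2 := by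
  have habd : ∃ C, ∀ n, a n ≤ C := by
    refine ⟨1 + ∑' n, a n ^ 2, fun n => ?_⟩
    have h1 : a n ^ 2 ≤ ∑' n, a n ^ 2 := ha.le_tsum n fun m _ => sq_nonneg _
    nlinarith [sq_nonneg (a n - 1)]
  obtain ⟨C, hC⟩ := habd
  have hs1 : ∀ n, Summable fun m => a (n - m) * b m := fun n =>
    Summable.of_nonneg_of_le (fun m => mul_nonneg (ha0 _) (hb0 m))
      (fun m => mul_le_mul_of_nonneg_right (hC _) (hb0 m)) (hb.mul_left C)
  have hs2 : ∀ n, Summable fun m => a (n - m) ^ 2 * b m := fun n =>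
    Summable.of_nonneg_of_le (fun m => mul_nonneg (sq_nonneg _) (hb0 m))
      (fun m => mul_le_mul_of_nonneg_right (pow_le_pow_left₀ (ha0 _) (hC _) 2) (hb0 m))
      (hb.mul_left (C ^ 2))
  refine ⟨hs1, ?_⟩
  have hcs : ∀ n, (∑' m, a (n - m) * b m) ^ 2 ≤ (∑' m, b m) * ∑' m, a (n - m) ^ 2 * b m := by
    intro n
    set A := ∑' m, a (n - m) ^ 2 * b m
    set S := ∑' m, a (n - m) * b m
    set B := ∑' m, b m
    -- the discriminant of the nonnegative quadratic polynomial `∑ (a(n-m) - x)² b m`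
    have hq : ∀ x : ℝ, 0 ≤ B * (x * x) + (-2 * S) * x + A := by
      intro x
      have h1 : HasSum (fun m => (a (n - m) - x) ^ 2 * b m) (A - 2 * x * S + x ^ 2 * B) := by
        have := ((hs2 n).hasSum.sub ((hs1 n).hasSum.mul_left (2 * x))).add (hb.hasSum.mul_left (x ^ 2))
        rw [show (fun m => (a (n - m) - x) ^ 2 * b m) = fun m =>
          a (n - m) ^ 2 * b m - 2 * x * (a (n - m) * b m) + x ^ 2 * b m from funext fun m => by ring]
        exact this
      have h2 := h1.nonneg fun m => mul_nonneg (sq_nonneg _) (hb0 m)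
      linarith [h2]
    have := discrim_le_zero hq
    rw [discrim] at this
    nlinarith
  have hprod : Summable fun p : ℤ × ℤ => a (p.1 - p.2) ^ 2 * b p.2 := by
    have h1 : Summable fun p : ℤ × ℤ => a p.1 ^ 2 * b p.2 :=
      ha.mul_of_nonneg hb (fun n => sq_nonneg _) hb0
    let e : ℤ × ℤ ≃ ℤ × ℤ :=
      { toFun := fun p => (p.1 - p.2, p.2)
        invFun := fun p => (p.1 + p.2, p.2)
        left_inv := fun p => by simp
        right_inv := fun p => by simp }
    exact (e.summable_iff (f := fun p : ℤ × ℤ => a p.1 ^ 2 * b p.2)).2 h1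
  exact Summable.of_nonneg_of_le (fun n => sq_nonneg _) hcs (hprod.prod.mul_left _)

lemma norm_fourierCoeff_le (w : C(UnitAddCircle, ℂ)) (n : ℤ) : ‖fourierCoeff w n‖ ≤ ‖w‖ := by
  unfold fourierCoeff
  refine (norm_integral_le_of_norm_le_const (C := ‖w‖) (Filter.Eventually.of_forall fun z => ?_)).trans ?_
  · have : ‖fourier (-n) z‖ = 1 := Circle.norm_coe _
    rw [norm_smul, this, one_mul]
    exact w.norm_coe_le_norm z
  · simp

lemma fourierCoeff_add' (v w : C(UnitAddCircle, ℂ)) (n : ℤ) :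
    fourierCoeff (v + w : C(UnitAddCircle, ℂ)) n = fourierCoeff v n + fourierCoeff w n := by
  unfold fourierCoeff
  have hi : ∀ u : C(UnitAddCircle, ℂ),
      Integrable (fun z => fourier (-n) z • u z) AddCircle.haarAddCircle := fun u =>
    integrable_of_continuous_compact _ (by fun_prop)
  rw [← integral_add (hi v) (hi w)]
  simp [mul_add]

/-- The `n`-th Fourier coefficient of `u * w` as a function of `w`. -/
def mulCoeff (u : C(UnitAddCircle, ℂ)) (n : ℤ) : C(UnitAddCircle, ℂ) →L[ℂ] ℂ :=
  LinearMap.mkContinuous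
    { toFun := fun w => fourierCoeff (u * w : C(UnitAddCircle, ℂ)) n
      map_add' := fun v w => by rw [mul_add]; exact fourierCoeff_add' _ _ n
      map_smul' := fun c w => by
        rw [mul_smul_comm]
        exact fourierCoeff.const_smul _ c n } ‖u‖ fun w =>
    (norm_fourierCoeff_le _ n).trans (norm_mul_le u w)

lemma fourierCoeff_mul_fourier (u : C(UnitAddCircle, ℂ)) (m n : ℤ) :
    fourierCoeff (u * fourier m : C(UnitAddCircle, ℂ)) n = fourierCoeff u (n - m) := by
  unfold fourierCoeff
  refine integral_congr_ae (Filter.Eventually.of_forall fun z => ?_)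
  simp only [ContinuousMap.mul_apply, smul_eq_mul]
  rw [show -(n - m) = -n + m by ring, fourier_add]
  ring

lemma HC.norm_fourierCoeff_mul_le {p : ℝ} (hp : 1 / 2 < p) (u : C(UnitAddCircle, ℂ))
    {v : C(UnitAddCircle, ℂ)} (hv : HC p v) (n : ℤ) :
    ‖fourierCoeff (u * v : C(UnitAddCircle, ℂ)) n‖ ≤
      ∑' m, ‖fourierCoeff u (n - m)‖ * ‖fourierCoeff v m‖ := by
  have h1 := (mulCoeff u n).hasSum (hasSum_fourier_series_of_summable (hv.summable hp))
  have h2 : HasSum (fun m => fourierCoeff v m * fourierCoeff u (n - m))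
      (fourierCoeff (u * v : C(UnitAddCircle, ℂ)) n) := by
    have h3 : (fun m => fourierCoeff v m * fourierCoeff u (n - m)) =
        fun m => mulCoeff u n (fourierCoeff v m • fourier m) := by
      funext m
      rw [map_smul, smul_eq_mul]
      congr 1
      exact (fourierCoeff_mul_fourier u m n).symm
    rw [h3]
    exact h1
  have hs : Summable fun m => ‖fourierCoeff u (n - m)‖ * ‖fourierCoeff v m‖ :=
    Summable.of_nonneg_of_le (fun m => by positivity)
      (fun m => mul_le_mul_of_nonneg_right (norm_fourierCoeff_le u _) (norm_nonneg _))
      ((hv.summable_norm hp).mul_left ‖u‖)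
  rw [← h2.tsum_eq]
  refine tsum_of_norm_bounded hs.hasSum fun m => ?_
  rw [norm_mul, mul_comm]

/-- Functions of Sobolev class `p > 1/2` form an algebra. -/
lemma HC.mul {p : ℝ} (hp : 1 / 2 < p) {u v : C(UnitAddCircle, ℂ)} (hu : HC p u) (hv : HC p v) :
    HC p (u * v) := by
  set W : ℤ → ℝ := fun n => wt n ^ (p / 2) with hW
  have hWpos : ∀ n, 0 < W n := fun n => Real.rpow_pos_of_pos (wt_pos n) _
  have hWsq : ∀ n, W n ^ 2 = wt n ^ p := fun n => by
    rw [← Real.rpow_two, ← Real.rpow_mul (wt_pos n).le]; ring_nf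
  set c : ℝ := 4 ^ (p / 2) with hc
  have hc0 : 0 < c := by positivity
  have hWle : ∀ n m, W n ≤ c * (W (n - m) + W m) := by
    intro n m
    have h1 : wt n ≤ 4 * max (wt (n - m)) (wt m) := by
      have h2 : wt n ≤ 2 * (wt (n - m) + wt m) := by
        simp only [wt]; push_cast; nlinarith [sq_nonneg ((n : ℝ) - 2 * m)]
      linarith [le_max_left (wt (n - m)) (wt m), le_max_right (wt (n - m)) (wt m)]
    have h2 : W n ≤ c * (max (wt (n - m)) (wt m)) ^ (p / 2) := by
      rw [hc, ← Real.mul_rpow (by norm_num) (le_max_of_le_left (wt_pos _).le)]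
      exact Real.rpow_le_rpow (wt_pos n).le h1 (by linarith)
    refine h2.trans (mul_le_mul_of_nonneg_left ?_ hc0.le)
    rcases max_cases (wt (n - m)) (wt m) with ⟨h, _⟩ | ⟨h, _⟩ <;> rw [h]
    · linarith [hWpos m]
    · linarith [hWpos (n - m)]
  have hyoung : ∀ {u v : C(UnitAddCircle, ℂ)}, HC p u → HC p v →
      (∀ n, Summable fun m => (W (n - m) * ‖fourierCoeff u (n - m)‖) * ‖fourierCoeff v m‖) ∧
      Summable fun n => (∑' m, (W (n - m) * ‖fourierCoeff u (n - m)‖) * ‖fourierCoeff v m‖) ^ 2 := by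
    intro u v hu hv
    refine summable_sq_conv (a := fun n => W n * ‖fourierCoeff u n‖) (fun n => ?_)
      (fun n => norm_nonneg _) ?_ (hv.summable_norm hp)
    · have := hWpos n; positivity
    · refine hu.congr fun n => ?_
      rw [mul_pow, hWsq]
  obtain ⟨hs1, hS1⟩ := hyoung hu hv
  obtain ⟨hs2, hS2⟩ := hyoung hv hu
  have hrefl : ∀ n, HasSum (fun m => ‖fourierCoeff u (n - m)‖ * (W m * ‖fourierCoeff v m‖))
      (∑' m, (W (n - m) * ‖fourierCoeff v (n - m)‖) * ‖fourierCoeff u m‖) := by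
    intro n
    have h1 := (Equiv.subLeft n).hasSum_iff.2 (hs2 n).hasSum
    convert h1 using 1
    funext m
    simp [mul_comm]
  refine Summable.of_nonneg_of_le (fun n => ?_) (fun n => ?_)
    ((hS1.add hS2).mul_left (2 * c ^ 2))
  · have := wt_pos n; positivity
  set x := ∑' m, (W (n - m) * ‖fourierCoeff u (n - m)‖) * ‖fourierCoeff v m‖
  set y := ∑' m, (W (n - m) * ‖fourierCoeff v (n - m)‖) * ‖fourierCoeff u m‖
  have hle : W n * ‖fourierCoeff (u * v : C(UnitAddCircle, ℂ)) n‖ ≤ c * (x + y) := by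
    have hsum := ((hs1 n).hasSum.add (hrefl n)).mul_left c
    have h0 : Summable fun m => ‖fourierCoeff u (n - m)‖ * ‖fourierCoeff v m‖ :=
      Summable.of_nonneg_of_le (fun m => by positivity)
        (fun m => mul_le_mul_of_nonneg_right (norm_fourierCoeff_le u _) (norm_nonneg _))
        ((hv.summable_norm hp).mul_left ‖u‖)
    refine (mul_le_mul_of_nonneg_left (hv.norm_fourierCoeff_mul_le hp u n) (hWpos n).le).trans ?_
    rw [← tsum_mul_left]
    refine hasSum_le (fun m => ?_) (h0.mul_left (W n)).hasSum hsum
    have h3 : 0 ≤ ‖fourierCoeff u (n - m)‖ * ‖fourierCoeff v m‖ := by positivity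
    calc W n * (‖fourierCoeff u (n - m)‖ * ‖fourierCoeff v m‖)
        ≤ (c * (W (n - m) + W m)) * (‖fourierCoeff u (n - m)‖ * ‖fourierCoeff v m‖) :=
          mul_le_mul_of_nonneg_right (hWle n m) h3
      _ = _ := by ring
  rw [← hWsq, ← mul_pow]
  have h5 : 0 ≤ W n * ‖fourierCoeff (u * v : C(UnitAddCircle, ℂ)) n‖ := by
    have := hWpos n; positivity
  calc (W n * ‖fourierCoeff (u * v : C(UnitAddCircle, ℂ)) n‖) ^ 2 ≤ (c * (x + y)) ^ 2 :=
        pow_le_pow_left₀ h5 hle 2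
    _ ≤ 2 * c ^ 2 * (x ^ 2 + y ^ 2) := by nlinarith [sq_nonneg (x - y), sq_nonneg c]

lemma fourierCoeff_deriv {w w' : C(UnitAddCircle, ℂ)}
    (h : ∀ s : ℝ, HasDerivAt (fun s : ℝ => w (s : UnitAddCircle)) (w' (s : UnitAddCircle)) s)
    (n : ℤ) (hn : n ≠ 0) :
    fourierCoeff w' n = (2 * Real.pi * Complex.I * n) * fourierCoeff w n := by
  have h1 := fourierCoeffOn_of_hasDerivAt (a := 0) (b := 1) one_pos hn (fun x _ => h x)
    ((w'.continuous.comp (AddCircle.continuous_mk' 1)).intervalIntegrable 0 1)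
  have h2 : ∀ u : C(UnitAddCircle, ℂ), fourierCoeffOn (a := 0) (b := 1) one_pos
      (fun s : ℝ => u (s : UnitAddCircle)) n = fourierCoeff u n := by
    intro u
    rw [fourierCoeffOn_eq_integral, fourierCoeff_eq_intervalIntegral _ n 0]
    simp
  rw [h2] at h1
  rw [h2 w'] at h1
  rw [h1]
  have h4 : w ((1 : ℝ) : UnitAddCircle) = w ((0 : ℝ) : UnitAddCircle) := by
    rw [show ((1 : ℝ) : UnitAddCircle) = 0 from AddCircle.coe_period (1 : ℝ)]
    simp
  have hpi : (2 * Real.pi * Complex.I * n : ℂ) ≠ 0 := by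
    simp [Real.pi_ne_zero, hn]
  rw [h4]
  field_simp
  simp

lemma norm_sq_fourierCoeff_deriv {w w' : C(UnitAddCircle, ℂ)}
    (h : ∀ s : ℝ, HasDerivAt (fun s : ℝ => w (s : UnitAddCircle)) (w' (s : UnitAddCircle)) s)
    (n : ℤ) (hn : n ≠ 0) :
    ‖fourierCoeff w' n‖ ^ 2 = 4 * Real.pi ^ 2 * n ^ 2 * ‖fourierCoeff w n‖ ^ 2 := by
  rw [fourierCoeff_deriv h n hn]
  simp only [norm_mul, Complex.norm_real, Complex.norm_I, Complex.norm_intCast, mul_pow,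
    Complex.norm_ofNat, Real.norm_eq_abs, sq_abs]
  ring

lemma HC.of_deriv {p : ℝ} {w w' : C(UnitAddCircle, ℂ)}
    (h : ∀ s : ℝ, HasDerivAt (fun s : ℝ => w (s : UnitAddCircle)) (w' (s : UnitAddCircle)) s)
    (hw' : HC p w') : HC (p + 1) w := by
  refine Summable.of_norm_bounded_eventually hw' ?_
  filter_upwards [(finite_singleton (0 : ℤ)).compl_mem_cofinite] with n hn
  have hn0 : n ≠ 0 := by simpa using hn
  have hn1 : (1 : ℝ) ≤ (n : ℝ) ^ 2 := by
    have : (1 : ℤ) ≤ n ^ 2 := by have := sq_pos_of_ne_zero hn0; omega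
    exact_mod_cast this
  have hw := wt_pos n
  rw [Real.norm_of_nonneg (by positivity), norm_sq_fourierCoeff_deriv h n hn0,
    Real.rpow_add hw, Real.rpow_one]
  have hpi : (3 : ℝ) < Real.pi := Real.pi_gt_three
  have h1 : wt n ≤ 4 * Real.pi ^ 2 * n ^ 2 := by
    have h9 : (9 : ℝ) ≤ Real.pi ^ 2 := by nlinarith
    have h10 := mul_le_mul_of_nonneg_right h9 (sq_nonneg (n : ℝ))
    unfold wt
    linarith
  calc wt n ^ p * wt n * ‖fourierCoeff w n‖ ^ 2
      = wt n ^ p * (wt n * ‖fourierCoeff w n‖ ^ 2) := by ring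
    _ ≤ wt n ^ p * (4 * Real.pi ^ 2 * n ^ 2 * ‖fourierCoeff w n‖ ^ 2) := by gcongr

lemma HC.exists_deriv {p : ℝ} (hp : 1 / 2 < p) {w : C(UnitAddCircle, ℂ)} (hw : HC (p + 1) w) :
    ∃ w' : C(UnitAddCircle, ℂ), HC p w' ∧
      ∀ s : ℝ, HasDerivAt (fun s : ℝ => w (s : UnitAddCircle)) (w' (s : UnitAddCircle)) s := by
  set c : ℤ → ℂ := fun n => (2 * Real.pi * Complex.I * n) * fourierCoeff w n with hc
  have hcsq : ∀ n, ‖c n‖ ^ 2 = 4 * Real.pi ^ 2 * n ^ 2 * ‖fourierCoeff w n‖ ^ 2 := by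
    intro n
    simp only [hc, norm_mul, Complex.norm_real, Complex.norm_I, Complex.norm_intCast, mul_pow,
      Complex.norm_ofNat, Real.norm_eq_abs, sq_abs]
    ring
  have hle : ∀ n, wt n ^ p * ‖c n‖ ^ 2 ≤
      4 * Real.pi ^ 2 * (wt n ^ (p + 1) * ‖fourierCoeff w n‖ ^ 2) := by
    intro n
    have hwn := wt_pos n
    rw [hcsq, Real.rpow_add hwn, Real.rpow_one]
    have h1 : (n : ℝ) ^ 2 ≤ wt n := by unfold wt; linarith
    calc wt n ^ p * (4 * Real.pi ^ 2 * n ^ 2 * ‖fourierCoeff w n‖ ^ 2)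
        = 4 * Real.pi ^ 2 * (wt n ^ p * (n ^ 2 * ‖fourierCoeff w n‖ ^ 2)) := by ring
      _ ≤ 4 * Real.pi ^ 2 * (wt n ^ p * (wt n * ‖fourierCoeff w n‖ ^ 2)) := by gcongr
      _ = _ := by ring
  have hcs : Summable fun n => wt n ^ p * ‖c n‖ ^ 2 :=
    Summable.of_nonneg_of_le (fun n => by have := wt_pos n; positivity) hle (hw.mul_left _)
  have hcn : Summable fun n => ‖c n‖ :=
    Summable.of_nonneg_of_le (fun n => norm_nonneg _)
      (fun n => by simpa using le_wt_add p n ‖c n‖) ((summable_wt hp).add hcs)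
  have hfn : ∀ n : ℤ, ‖(fourier n : C(UnitAddCircle, ℂ))‖ = 1 := fun n => fourier_norm n
  have hcsum : Summable fun n => c n • (fourier n : C(UnitAddCircle, ℂ)) := by
    refine Summable.of_norm ?_
    simpa [norm_smul, hfn] using hcn
  have hderiv : ∀ s : ℝ, HasDerivAt (fun s : ℝ => w (s : UnitAddCircle))
      ((∑' n, c n • (fourier n : C(UnitAddCircle, ℂ))) (s : UnitAddCircle)) s := by
    intro s
    have hpt := fun z => has_pointwise_sum_fourier_series_of_summable
      ((hw.mono (by linarith : p ≤ p + 1)).summable hp) z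
    have h1 := hasDerivAt_tsum (u := fun n => ‖c n‖)
      (g := fun n (s : ℝ) => fourierCoeff w n • fourier n (s : UnitAddCircle))
      (g' := fun n (s : ℝ) => c n • fourier n (s : UnitAddCircle)) hcn ?_ ?_
      (hpt ((0 : ℝ) : UnitAddCircle)).summable s
    · have h2 : (fun z : ℝ => ∑' n, fourierCoeff w n • fourier n (z : UnitAddCircle)) =
          fun s : ℝ => w (s : UnitAddCircle) := funext fun z => (hpt z).tsum_eq
      rw [h2] at h1
      have h3 := (ContinuousMap.evalCLM ℂ (s : UnitAddCircle)).hasSum hcsum.hasSum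
      have h4 : (∑' n, c n • (fourier n : C(UnitAddCircle, ℂ))) (s : UnitAddCircle) =
          ∑' n, c n • fourier n (s : UnitAddCircle) := h3.tsum_eq.symm
      rw [h4]
      exact h1
    · intro n y
      have h2 := (hasDerivAt_fourier 1 n y).const_mul (fourierCoeff w n)
      have h5 : c n • fourier n (y : UnitAddCircle) = fourierCoeff w n *
          (2 * Real.pi * Complex.I * n / (1 : ℝ) * fourier n (y : UnitAddCircle)) := by
        simp only [hc, smul_eq_mul]
        push_cast
        ring
      rw [h5]
      exact h2
    · intro n y
      have : ‖fourier n (y : UnitAddCircle)‖ = 1 := Circle.norm_coe _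
      rw [norm_smul, this, mul_one]
  refine ⟨_, ?_, hderiv⟩
  refine Summable.of_norm_bounded_eventually (hw.mul_left (4 * Real.pi ^ 2)) ?_
  filter_upwards [(finite_singleton (0 : ℤ)).compl_mem_cofinite] with n hn
  have hn0 : n ≠ 0 := by simpa using hn
  rw [fourierCoeff_deriv hderiv n hn0, Real.norm_of_nonneg (by have := wt_pos n; positivity)]
  exact hle n

end ScalarSobolev

/-! ### Sobolev spaces of vector-valued functions -/

section VectorSobolev

variable {V : Type*} [NormedAddCommGroup V] [NormedSpace ℝ V]
  {W : Type*} [NormedAddCommGroup W] [NormedSpace ℝ W]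
  {Z : Type*} [NormedAddCommGroup Z] [NormedSpace ℝ Z]

/-- Composition of a function on the circle with a linear map. -/
def compL (L : V →L[ℝ] W) (u : C(UnitAddCircle, V)) : C(UnitAddCircle, W) :=
  ⟨fun z => L (u z), by fun_prop⟩

lemma compL_apply (L : V →L[ℝ] W) (u : C(UnitAddCircle, V)) (z : UnitAddCircle) :
    compL L u z = L (u z) := rfl

lemma realCoeff_compL [CompleteSpace V] [CompleteSpace W] (L : V →L[ℝ] W) (u : C(UnitAddCircle, V))
    (n : ℤ) : realCoeff (compL L u) n = L (realCoeff u n) := by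
  unfold realCoeff
  rw [← L.intervalIntegral_comp_comm ((continuous_harmonic_smul u n).intervalIntegrable _ _)]
  simp [compL_apply]

lemma memℓp_two_iff {a : ℤ → V} : Memℓp a 2 ↔ Summable fun n => ‖a n‖ ^ 2 := by
  rw [memℓp_gen_iff (by simp)]
  simp

lemma norm_sq_weightedCoeff (r : ℝ) (u : C(UnitAddCircle, V)) (n : ℤ) :
    ‖weightedCoeff r u n‖ ^ 2 = wt n ^ r * ‖realCoeff u n‖ ^ 2 := by
  have hw := wt_pos n
  have h1 : (wt n ^ (r / 2)) ^ 2 = wt n ^ r := by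
    rw [← Real.rpow_two, ← Real.rpow_mul hw.le]; ring_nf
  change ‖(wt n ^ (r / 2)) • realCoeff u n‖ ^ 2 = _
  rw [norm_smul, mul_pow, Real.norm_of_nonneg (Real.rpow_nonneg hw.le _), h1]

lemma mem_sobolev_iff {r : ℝ} {u : C(UnitAddCircle, V)} :
    u ∈ sobolevSubmodule r V ↔ Summable fun n => wt n ^ r * ‖realCoeff u n‖ ^ 2 := by
  change Memℓp (weightedCoeff r u) 2 ↔ _
  rw [memℓp_two_iff]
  simp only [norm_sq_weightedCoeff]

lemma mem_sobolev_compL [CompleteSpace V] [CompleteSpace W] {r : ℝ} (L : V →L[ℝ] W)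
    {u : C(UnitAddCircle, V)} (hu : u ∈ sobolevSubmodule r V) :
    compL L u ∈ sobolevSubmodule r W := by
  rw [mem_sobolev_iff] at hu ⊢
  refine Summable.of_nonneg_of_le (fun n => ?_) (fun n => ?_) (hu.mul_left (‖L‖ ^ 2))
  · have := wt_pos n; positivity
  · rw [realCoeff_compL]
    have hw := wt_pos n
    calc wt n ^ r * ‖L (realCoeff u n)‖ ^ 2 ≤ wt n ^ r * (‖L‖ * ‖realCoeff u n‖) ^ 2 := by
          gcongr
          exact L.le_opNorm _
      _ = ‖L‖ ^ 2 * (wt n ^ r * ‖realCoeff u n‖ ^ 2) := by ring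

lemma Sobolev.norm_sq [CompleteSpace V] {r : ℝ} (u : Sobolev r V) :
    ‖u‖ ^ 2 = ∑' n, wt n ^ r * ‖realCoeff u.1 n‖ ^ 2 := by
  have h1 : ‖u‖ = ‖Sobolev.coeffs r V u‖ := rfl
  have h2 := lp.norm_rpow_eq_tsum (p := 2) (by simp) (Sobolev.coeffs r V u)
  rw [h1]
  simp only [ENNReal.toReal_ofNat, Real.rpow_two] at h2
  rw [h2]
  exact tsum_congr fun n => norm_sq_weightedCoeff r u.1 n

/-- Composition with a linear map, on Sobolev spaces. -/
def Sobolev.map [CompleteSpace V] [CompleteSpace W] (r : ℝ) (L : V →L[ℝ] W) :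
    Sobolev r V →L[ℝ] Sobolev r W :=
  LinearMap.mkContinuous
    { toFun := fun u => (⟨compL L u.1, mem_sobolev_compL L u.2⟩ : sobolevSubmodule r W)
      map_add' := fun u v => by
        refine Subtype.ext (ContinuousMap.ext fun z => ?_)
        exact L.map_add (u.1 z) (v.1 z)
      map_smul' := fun c u => by
        refine Subtype.ext (ContinuousMap.ext fun z => ?_)
        exact L.map_smul c (u.1 z) } ‖L‖ fun u => by
    refine le_of_sq_le_sq ?_ (by positivity)
    rw [mul_pow, Sobolev.norm_sq, Sobolev.norm_sq u, ← tsum_mul_left]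
    have hu := mem_sobolev_iff.1 u.2
    refine Summable.tsum_le_tsum (fun n => ?_) (mem_sobolev_iff.1 (mem_sobolev_compL L u.2))
      (hu.mul_left _)
    change wt n ^ r * ‖realCoeff (compL L u.1) n‖ ^ 2 ≤ _
    rw [realCoeff_compL]
    have hw := wt_pos n
    calc wt n ^ r * ‖L (realCoeff u.1 n)‖ ^ 2 ≤ wt n ^ r * (‖L‖ * ‖realCoeff u.1 n‖) ^ 2 := by
          gcongr
          exact L.le_opNorm _
      _ = ‖L‖ ^ 2 * (wt n ^ r * ‖realCoeff u.1 n‖ ^ 2) := by ring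

lemma Sobolev.map_apply [CompleteSpace V] [CompleteSpace W] (r : ℝ) (L : V →L[ℝ] W)
    (u : Sobolev r V) (z : UnitAddCircle) : Sobolev.map r L u z = L (u z) := rfl

lemma Sobolev.ext {r : ℝ} {u v : Sobolev r V} (h : ∀ z, u z = v z) : u = v :=
  Subtype.ext (ContinuousMap.ext h)

lemma Sobolev.add_apply {r : ℝ} (u v : Sobolev r V) (z : UnitAddCircle) :
    (u + v) z = u z + v z := rfl

lemma Sobolev.sub_apply {r : ℝ} (u v : Sobolev r V) (z : UnitAddCircle) :
    (u - v) z = u z - v z := rfl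

lemma Sobolev.neg_apply {r : ℝ} (u : Sobolev r V) (z : UnitAddCircle) :
    (-u) z = -u z := rfl

lemma Sobolev.zero_apply {r : ℝ} (z : UnitAddCircle) : (0 : Sobolev r V) z = 0 := rfl

lemma Sobolev.smul_apply {r : ℝ} (c : ℝ) (u : Sobolev r V) (z : UnitAddCircle) :
    (c • u) z = c • u z := rfl

lemma Sobolev.continuous_real {r : ℝ} (u : Sobolev r V) :
    Continuous fun s : ℝ => u (s : UnitAddCircle) :=
  u.1.continuous.comp (AddCircle.continuous_mk' 1)

/-- A real function on the circle as a complex function. -/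
def toC (u : C(UnitAddCircle, ℝ)) : C(UnitAddCircle, ℂ) := ⟨fun z => (u z : ℂ), by fun_prop⟩

lemma fourierCoeff_toC (u : C(UnitAddCircle, ℝ)) (n : ℤ) :
    fourierCoeff (toC u) n =
      (∫ s in (0 : ℝ)..1, Real.cos (2 * Real.pi * n * s) * u (s : UnitAddCircle) : ℝ) -
      Complex.I * (∫ s in (0 : ℝ)..1, Real.sin (2 * Real.pi * n * s) * u (s : UnitAddCircle) : ℝ) := by
  rw [fourierCoeff_eq_intervalIntegral _ n 0]
  have hcont : Continuous fun s : ℝ => u (s : UnitAddCircle) :=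
    u.continuous.comp (AddCircle.continuous_mk' 1)
  have key : ∀ s : ℝ, fourier (-n) (s : UnitAddCircle) • toC u (s : UnitAddCircle) =
      ((Real.cos (2 * Real.pi * n * s) * u (s : UnitAddCircle) : ℝ) : ℂ) -
      Complex.I * ((Real.sin (2 * Real.pi * n * s) * u (s : UnitAddCircle) : ℝ) : ℂ) := by
    intro s
    rw [fourier_coe_apply]
    have : (2 * Real.pi * Complex.I * ((-n : ℤ) : ℂ) * (s : ℂ) / ((1 : ℝ) : ℂ)) =
        ((-(2 * Real.pi * n * s) : ℝ) : ℂ) * Complex.I := by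
      push_cast
      ring
    rw [this, Complex.exp_mul_I, ← Complex.ofReal_cos, ← Complex.ofReal_sin, Real.cos_neg,
      Real.sin_neg]
    simp only [toC, ContinuousMap.coe_mk, smul_eq_mul]
    push_cast
    ring
  simp only [key, zero_add]
  rw [intervalIntegral.integral_sub, intervalIntegral.integral_const_mul,
    intervalIntegral.integral_ofReal, intervalIntegral.integral_ofReal]
  · simp
  · exact (by fun_prop : Continuous _).intervalIntegrable _ _
  · exact (by fun_prop : Continuous _).intervalIntegrable _ _

lemma norm_sq_fourierCoeff_toC (u : C(UnitAddCircle, ℝ)) (n : ℤ) :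
    ‖realCoeff u n‖ ^ 2 ≤ ‖fourierCoeff (toC u) n‖ ^ 2 ∧
      ‖fourierCoeff (toC u) n‖ ^ 2 ≤ ‖realCoeff u n‖ ^ 2 + ‖realCoeff u (-n)‖ ^ 2 := by
  set C : ℤ → ℝ := fun n => ∫ s in (0 : ℝ)..1, Real.cos (2 * Real.pi * n * s) * u (s : UnitAddCircle) with hC
  set S : ℤ → ℝ := fun n => ∫ s in (0 : ℝ)..1, Real.sin (2 * Real.pi * n * s) * u (s : UnitAddCircle) with hS
  have hF : ‖fourierCoeff (toC u) n‖ ^ 2 = C n ^ 2 + S n ^ 2 := by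
    rw [fourierCoeff_toC, ← Complex.normSq_eq_norm_sq, Complex.normSq_apply]
    simp [hC, hS]
    ring
  have hCn : C (-n) = C n := by
    simp only [hC]
    congr 1
    funext s
    rw [← Real.cos_neg]
    push_cast
    ring_nf
  have hSn : S (-n) = -S n := by
    simp only [hS]
    rw [← intervalIntegral.integral_neg]
    congr 1
    funext s
    rw [← neg_mul, ← Real.sin_neg]
    push_cast
    ring_nf
  have hpos : ∀ m : ℤ, 0 ≤ m → realCoeff u m = C m := fun m hm => by
    simp [realCoeff, harmonic, hm, hC]
  have hneg : ∀ m : ℤ, m < 0 → realCoeff u m = S m := fun m hm => by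
    simp [realCoeff, harmonic, not_le.2 hm, hS]
  rw [hF]
  simp only [Real.norm_eq_abs, sq_abs]
  rcases lt_trichotomy n 0 with h | h | h
  · rw [hneg n h, hpos (-n) (by omega), hCn]
    exact ⟨by nlinarith [sq_nonneg (C n)], by linarith⟩
  · subst h
    have h0 : S 0 = 0 := by simp [hS]
    rw [h0, neg_zero, hpos 0 le_rfl]
    exact ⟨by simp, by nlinarith [sq_nonneg (C 0)]⟩
  · rw [hpos n h.le, hneg (-n) (by omega), hSn]
    exact ⟨by nlinarith [sq_nonneg (S n)], by linarith⟩

lemma wt_neg (n : ℤ) : wt (-n) = wt n := by simp [wt]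

lemma mem_sobolev_real_iff {p : ℝ} {u : C(UnitAddCircle, ℝ)} :
    u ∈ sobolevSubmodule p ℝ ↔ HC p (toC u) := by
  rw [mem_sobolev_iff]
  constructor
  · intro h
    have h' : Summable fun n : ℤ => wt n ^ p * ‖realCoeff u (-n)‖ ^ 2 := by
      have := (Equiv.neg ℤ).summable_iff.2 h
      refine this.congr fun n => ?_
      simp [wt_neg]
    refine Summable.of_nonneg_of_le (fun n => ?_) (fun n => ?_) (h.add h')
    · have := wt_pos n; positivity
    · have := wt_pos n
      rw [← mul_add]
      exact mul_le_mul_of_nonneg_left (norm_sq_fourierCoeff_toC u n).2 (by positivity)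
  · intro h
    refine Summable.of_nonneg_of_le (fun n => ?_) (fun n => ?_) h
    · have := wt_pos n; positivity
    · have := wt_pos n
      exact mul_le_mul_of_nonneg_left (norm_sq_fourierCoeff_toC u n).1 (by positivity)

/-- Functions of Sobolev class greater than `1/2` are bounded by their Sobolev norm. -/
lemma Sobolev.exists_norm_le [CompleteSpace V] {r : ℝ} (hr : 1 / 2 < r) :
    ∃ C : ℝ, 0 ≤ C ∧ ∀ (u : Sobolev r V) (z : UnitAddCircle), ‖u z‖ ≤ C * ‖u‖ := by
  set C₀ := ∑' n, wt n ^ (-r) with hC₀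
  have hC₀0 : 0 ≤ C₀ := tsum_nonneg fun n => Real.rpow_nonneg (wt_pos n).le _
  have hscal : ∀ (u : Sobolev r ℝ) (z : UnitAddCircle), |u z| ≤ C₀ + 2 * ‖u‖ ^ 2 := by
    intro u z
    have hH : HC r (toC u.1) := mem_sobolev_real_iff.1 u.2
    have h1 := hH.norm_le hr z
    have h2 : ‖toC u.1 z‖ = |u z| := by simp [toC]
    rw [h2] at h1
    refine h1.trans (add_le_add le_rfl ?_)
    have hs := mem_sobolev_iff.1 u.2
    have hs' : HasSum (fun n : ℤ => wt n ^ r * ‖realCoeff u.1 (-n)‖ ^ 2)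
        (∑' n, wt n ^ r * ‖realCoeff u.1 n‖ ^ 2) := by
      have e : (fun n : ℤ => wt n ^ r * ‖realCoeff u.1 (-n)‖ ^ 2) =
          (fun n : ℤ => wt n ^ r * ‖realCoeff u.1 n‖ ^ 2) ∘ Equiv.neg ℤ := by
        funext n
        simp [wt_neg]
      rw [e]
      exact (Equiv.neg ℤ).hasSum_iff.2 hs.hasSum
    rw [two_mul, Sobolev.norm_sq]
    refine hasSum_le (fun n => ?_) hH.hasSum (hs.hasSum.add hs')
    have := wt_pos n
    rw [← mul_add]
    exact mul_le_mul_of_nonneg_left (norm_sq_fourierCoeff_toC u.1 n).2 (by positivity)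
  have hunit : ∀ (u : Sobolev r V) (z : UnitAddCircle), ‖u‖ ≤ 1 → ‖u z‖ ≤ C₀ + 2 := by
    intro u z hu
    obtain ⟨φ, hφ1, hφ⟩ := exists_dual_vector'' ℝ (u z)
    have h1 := hscal (Sobolev.map r φ u) z
    rw [Sobolev.map_apply, hφ] at h1
    have h2 : ‖Sobolev.map r φ u‖ ≤ 1 := by
      have h3 : ‖Sobolev.map r φ u‖ ≤ ‖φ‖ * ‖u‖ := by
        refine ((Sobolev.map r φ).le_opNorm u).trans ?_
        gcongr
        exact LinearMap.mkContinuous_norm_le _ (norm_nonneg φ) _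
      exact h3.trans (mul_le_one₀ hφ1 (norm_nonneg u) hu)
    have h4 : ‖Sobolev.map r φ u‖ ^ 2 ≤ 1 := pow_le_one₀ (norm_nonneg _) h2
    simp only [RCLike.ofReal_real_eq_id, id_eq, abs_norm] at h1
    linarith
  refine ⟨C₀ + 2, by linarith, fun u z => ?_⟩
  rcases eq_or_ne u 0 with rfl | hu
  · simp [Sobolev.zero_apply]
  · have hn : 0 < ‖u‖ := norm_pos_iff.2 hu
    have h1 := hunit (‖u‖⁻¹ • u) z (by rw [norm_smul, norm_inv, norm_norm, inv_mul_cancel₀ hn.ne'])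
    rw [Sobolev.smul_apply, norm_smul, norm_inv, norm_norm, inv_mul_le_iff₀ hn] at h1
    linarith

end VectorSobolev

/-! ### Regularity of periodic functions -/

section Periodic

variable {V : Type*} [NormedAddCommGroup V] [NormedSpace ℝ V] [FiniteDimensional ℝ V]
  [CompleteSpace V]
  {W : Type*} [NormedAddCommGroup W] [NormedSpace ℝ W] [FiniteDimensional ℝ W] [CompleteSpace W]
  {Z : Type*} [NormedAddCommGroup Z] [NormedSpace ℝ Z] [FiniteDimensional ℝ Z] [CompleteSpace Z]

lemma mem_sobolev_of_dual {p : ℝ} {u : C(UnitAddCircle, V)}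
    (h : ∀ φ : V →L[ℝ] ℝ, compL φ u ∈ sobolevSubmodule p ℝ) : u ∈ sobolevSubmodule p V := by
  let b := Module.finBasis ℝ V
  let φ : Fin (Module.finrank ℝ V) → V →L[ℝ] ℝ := fun i => LinearMap.toContinuousLinearMap (b.coord i)
  let ψ : Fin (Module.finrank ℝ V) → ℝ →L[ℝ] V := fun i =>
    ContinuousLinearMap.smulRight (1 : ℝ →L[ℝ] ℝ) (b i)
  have hu : u = ∑ i, compL (ψ i) (compL (φ i) u) := by
    ext z
    rw [ContinuousMap.sum_apply]
    simp only [compL_apply, φ, ψ, LinearMap.coe_toContinuousLinearMap',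
      ContinuousLinearMap.smulRight_apply, one_apply_eq_self, Module.Basis.coord_apply]
    exact (b.sum_repr (u z)).symm
  rw [hu]
  exact Submodule.sum_mem _ fun i _ => mem_sobolev_compL _ (h (φ i))

/-- The periodic function `u` is of Sobolev class `p`. -/
def MemH (p : ℝ) (u : ℝ → V) : Prop :=
  ∃ U ∈ sobolevSubmodule p V, ∀ s : ℝ, U (s : UnitAddCircle) = u s

lemma MemH.mono {p q : ℝ} (hqp : q ≤ p) {u : ℝ → V} (h : MemH p u) : MemH q u := by
  obtain ⟨U, hU, hUu⟩ := h
  refine ⟨U, mem_sobolev_iff.2 ?_, hUu⟩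
  refine Summable.of_nonneg_of_le (fun n => ?_) (fun n => ?_) (mem_sobolev_iff.1 hU)
  · have := wt_pos n; positivity
  · gcongr
    exact one_le_wt n

/-- A continuous function on the circle from a periodic function. -/
lemma exists_circle_lift {X : Type*} [TopologicalSpace X] {u : ℝ → X} (hu : Continuous u)
    (hper : Function.Periodic u 1) :
    ∃ U : C(UnitAddCircle, X), ∀ s : ℝ, U (s : UnitAddCircle) = u s :=
  ⟨⟨hper.lift, hu.quotient_lift _⟩, fun s => hper.lift_coe s⟩

lemma memH_zero {u : ℝ → V} (hu : Continuous u) (hper : Function.Periodic u 1) : MemH 0 u := by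
  obtain ⟨U, hU⟩ := exists_circle_lift hu hper
  exact ⟨U, mem_sobolev_of_dual fun φ => mem_sobolev_real_iff.2 (hC_zero _), hU⟩

lemma MemH.map {p : ℝ} {u : ℝ → V} (h : MemH p u) (L : V →L[ℝ] W) : MemH p fun s => L (u s) := by
  obtain ⟨U, hU, hUu⟩ := h
  exact ⟨compL L U, mem_sobolev_compL L hU, fun s => by rw [compL_apply, hUu]⟩

lemma MemH.add {p : ℝ} {u v : ℝ → V} (hu : MemH p u) (hv : MemH p v) :
    MemH p fun s => u s + v s := by
  obtain ⟨U, hU, hUu⟩ := hu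
  obtain ⟨U', hU', hUu'⟩ := hv
  exact ⟨U + U', Submodule.add_mem _ hU hU', fun s => by rw [ContinuousMap.add_apply, hUu, hUu']⟩

/-- Products of functions of Sobolev class `p > 1/2` are of Sobolev class `p`. -/
lemma MemH.bilin {p : ℝ} (hp : 1 / 2 < p) (L : V →L[ℝ] W →L[ℝ] Z) {u : ℝ → V} {v : ℝ → W}
    (hu : MemH p u) (hv : MemH p v) : MemH p fun s => L (u s) (v s) := by
  obtain ⟨U, hU, hUu⟩ := hu
  obtain ⟨U', hU', hUu'⟩ := hv
  let b := Module.finBasis ℝ V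
  let φ : Fin (Module.finrank ℝ V) → V →L[ℝ] ℝ := fun i => LinearMap.toContinuousLinearMap (b.coord i)
  let P : C(UnitAddCircle, Z) := ⟨fun z => L (U z) (U' z), by fun_prop⟩
  refine ⟨P, mem_sobolev_of_dual fun ψ => ?_, fun s => by simp [P, hUu, hUu']⟩
  have key : compL ψ P = ∑ i, compL (φ i) U * compL (ψ.comp (L (b i))) U' := by
    ext z
    rw [ContinuousMap.sum_apply]
    simp only [compL_apply, ContinuousMap.mul_apply, P, ContinuousMap.coe_mk, φ,
      LinearMap.coe_toContinuousLinearMap', Module.Basis.coord_apply,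
      ContinuousLinearMap.comp_apply]
    have h1 : L (U z) (U' z) = ∑ i, b.repr (U z) i • L (b i) (U' z) := by
      conv_lhs => rw [← b.sum_repr (U z), map_sum]
      simp only [map_smul, sum_apply, smul_apply]
    rw [h1, map_sum]
    simp
  rw [key]
  refine Submodule.sum_mem _ fun i _ => mem_sobolev_real_iff.2 ?_
  have h1 := (mem_sobolev_real_iff.1 (mem_sobolev_compL (φ i) hU)).mul hp
    (mem_sobolev_real_iff.1 (mem_sobolev_compL (ψ.comp (L (b i))) hU'))
  convert h1 using 1
  ext z
  simp [toC]

lemma MemH.of_deriv {p : ℝ} {u u' : ℝ → V} (hper : Function.Periodic u 1)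
    (h : ∀ s, HasDerivAt u (u' s) s) (hu' : MemH p u') : MemH (p + 1) u := by
  obtain ⟨U', hU', hUu'⟩ := hu'
  obtain ⟨U, hU⟩ := exists_circle_lift
    (continuous_iff_continuousAt.2 fun s => (h s).continuousAt) hper
  refine ⟨U, mem_sobolev_of_dual fun φ => mem_sobolev_real_iff.2 ?_, hU⟩
  refine HC.of_deriv (w' := toC (compL φ U')) (fun s => ?_)
    (mem_sobolev_real_iff.1 (mem_sobolev_compL φ hU'))
  have h1 : HasDerivAt (fun s => ((φ (u s) : ℝ) : ℂ)) ((φ (u' s) : ℝ) : ℂ) s :=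
    ((φ.hasFDerivAt.comp_hasDerivAt s (h s))).ofReal_comp
  simpa [toC, compL_apply, hU, hUu'] using h1

lemma MemH.exists_deriv {p : ℝ} (hp : 1 / 2 < p) {u : ℝ → V} (hu : MemH (p + 1) u) :
    ∃ u' : ℝ → V, (∀ s, HasDerivAt u (u' s) s) ∧ MemH p u' := by
  obtain ⟨U, hU, hUu⟩ := hu
  let b := Module.finBasis ℝ V
  let φ : Fin (Module.finrank ℝ V) → V →L[ℝ] ℝ := fun i => LinearMap.toContinuousLinearMap (b.coord i)
  let ψ : Fin (Module.finrank ℝ V) → ℝ →L[ℝ] V := fun i =>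
    ContinuousLinearMap.smulRight (1 : ℝ →L[ℝ] ℝ) (b i)
  have hscal : ∀ i, ∃ g : C(UnitAddCircle, ℝ), g ∈ sobolevSubmodule p ℝ ∧
      ∀ s : ℝ, HasDerivAt (fun s => φ i (u s)) (g (s : UnitAddCircle)) s := by
    intro i
    obtain ⟨w', hw', hd⟩ := HC.exists_deriv hp (mem_sobolev_real_iff.1 (mem_sobolev_compL (φ i) hU))
    let g : C(UnitAddCircle, ℝ) := ⟨fun z => (w' z).re, by fun_prop⟩
    have hd1 : ∀ s : ℝ, HasDerivAt (fun s => φ i (u s)) (g (s : UnitAddCircle)) s := by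
      intro s
      have h1 := Complex.reCLM.hasFDerivAt.comp_hasDerivAt s (hd s)
      simpa [toC, compL_apply, hUu, g, Function.comp_def] using h1
    refine ⟨g, mem_sobolev_real_iff.2 ?_, hd1⟩
    have hg : toC g = w' := by
      ext z
      obtain ⟨s, rfl⟩ := QuotientAddGroup.mk_surjective z
      have h1 := (hd1 s).ofReal_comp
      have h2 := hd s
      have h3 : (fun s : ℝ => toC (compL (φ i) U) (s : UnitAddCircle)) =
          fun s => ((φ i (u s) : ℝ) : ℂ) := by
        funext s
        simp [toC, compL_apply, hUu]
      rw [h3] at h2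
      exact h1.unique h2
    rwa [hg]
  choose g hg hd using hscal
  refine ⟨fun s => ∑ i, ψ i (g i (s : UnitAddCircle)), fun s => ?_, ?_⟩
  · have h1 : u = fun s => ∑ i, ψ i (φ i (u s)) := by
      funext s
      simp only [φ, ψ, LinearMap.coe_toContinuousLinearMap',
        ContinuousLinearMap.smulRight_apply, one_apply_eq_self, Module.Basis.coord_apply]
      exact (b.sum_repr (u s)).symm
    rw [h1]
    exact HasDerivAt.fun_sum fun i _ => (ψ i).hasFDerivAt.comp_hasDerivAt s (hd i s)
  · refine ⟨∑ i, compL (ψ i) (g i), Submodule.sum_mem _ fun i _ => mem_sobolev_compL _ (hg i),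
      fun s => ?_⟩
    rw [ContinuousMap.sum_apply]
    rfl

/-- Solutions of linear differential equations with coefficients of Sobolev class `r` are of
Sobolev class `r`. -/
lemma memH_of_linear_ode {r : ℝ} (hr : 1 / 2 < r) {A : ℝ → V} {m : ℝ → W}
    (hper : Function.Periodic A 1) (L : V →L[ℝ] W →L[ℝ] V) (L' : V →L[ℝ] V) (hm : MemH r m)
    (hA : ∀ s, HasDerivAt A (L (A s) (m s) + L' (A s)) s) : MemH r A := by
  have hmc : Continuous m := by
    obtain ⟨U, -, hU⟩ := hm
    rw [← funext hU]
    exact U.continuous.comp (AddCircle.continuous_mk' 1)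
  have hmp : Function.Periodic m 1 := by
    obtain ⟨U, -, hU⟩ := hm
    intro s
    rw [← hU, ← hU]
    congr 1
    simp
  have hAc : Continuous A := continuous_iff_continuousAt.2 fun s => (hA s).continuousAt
  have h1 : MemH 1 A := by
    have h0 : MemH 0 fun s => L (A s) (m s) + L' (A s) := by
      refine memH_zero (by fun_prop) fun s => ?_
      simp only [hper s, hmp s]
    simpa using MemH.of_deriv hper hA h0
  have hn : ∀ n : ℕ, MemH (min (1 + n : ℝ) r) A := by
    intro n
    induction n with
    | zero => simpa using h1.mono (min_le_left 1 r)
    | succ n ih =>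
      have hp : 1 / 2 < min (1 + n : ℝ) r := by
        refine lt_min ?_ hr
        have : (0 : ℝ) ≤ n := n.cast_nonneg
        linarith
      have h2 : MemH (min (1 + n : ℝ) r) fun s => L (A s) (m s) + L' (A s) :=
        (ih.bilin hp L (hm.mono (min_le_right _ _))).add (ih.map L')
      refine (MemH.of_deriv hper hA h2).mono ?_
      rw [← min_add_add_right]
      refine min_le_min (le_of_eq ?_) (by linarith)
      push_cast
      ring
  obtain ⟨n, hn'⟩ := exists_nat_ge r
  refine (hn n).mono (le_min ?_ le_rfl)
  linarith

/-- The Sobolev function given by a periodic function of Sobolev class `r`. -/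
lemma MemH.exists_sobolev {r : ℝ} {u : ℝ → V} (h : MemH r u) :
    ∃ U : Sobolev r V, ∀ s : ℝ, U (s : UnitAddCircle) = u s := by
  obtain ⟨U, hU, hUu⟩ := h
  exact ⟨(⟨U, hU⟩ : sobolevSubmodule r V), hUu⟩

lemma Sobolev.memH {r : ℝ} (u : Sobolev r V) : MemH r fun s => u (s : UnitAddCircle) :=
  ⟨u.1, u.2, fun _ => rfl⟩

/-! ### Constants and means -/

/-- The mean of a function of Sobolev class `r`. -/
def Sobolev.mean {r : ℝ} (hr : 1 / 2 < r) : Sobolev r V →L[ℝ] V :=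
  LinearMap.mkContinuous
    { toFun := fun u => ∫ s in (0 : ℝ)..1, u (s : UnitAddCircle)
      map_add' := fun u v => intervalIntegral.integral_add
        (u.continuous_real.intervalIntegrable _ _) (v.continuous_real.intervalIntegrable _ _)
      map_smul' := fun c u => intervalIntegral.integral_smul c _ }
    (Classical.choose (Sobolev.exists_norm_le (V := V) hr)) fun u => by
    have h := (Classical.choose_spec (Sobolev.exists_norm_le (V := V) hr)).2 u
    have h1 := intervalIntegral.norm_integral_le_of_norm_le_const (a := 0) (b := 1)
      (f := fun s : ℝ => u (s : UnitAddCircle)) fun s _ => h (s : UnitAddCircle)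
    rw [sub_zero, abs_one, mul_one] at h1
    exact h1

lemma Sobolev.mean_apply {r : ℝ} (hr : 1 / 2 < r) (u : Sobolev r V) :
    Sobolev.mean hr u = ∫ s in (0 : ℝ)..1, u (s : UnitAddCircle) := rfl

lemma const_mem_sobolev (r : ℝ) (c : V) : ContinuousMap.const UnitAddCircle c ∈ sobolevSubmodule r V := by
  obtain ⟨n, hn⟩ := exists_nat_ge r
  have h : ∀ n : ℕ, MemH n fun _ : ℝ => c := by
    intro n
    induction n with
    | zero => simpa using memH_zero (u := fun _ : ℝ => c) continuous_const fun _ => rfl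
    | succ n ih =>
      push_cast
      refine MemH.of_deriv (u' := fun _ => (0 : V)) (fun _ => rfl) (fun s => hasDerivAt_const s c) ?_
      simpa using ih.map (0 : V →L[ℝ] V)
  obtain ⟨U, hU, hUc⟩ := (h n).mono hn
  have : U = ContinuousMap.const UnitAddCircle c := by
    ext z
    obtain ⟨s, rfl⟩ := QuotientAddGroup.mk_surjective z
    exact hUc s
  rwa [← this]

/-- Constant functions. -/
def Sobolev.const (r : ℝ) : V →L[ℝ] Sobolev r V :=
  LinearMap.toContinuousLinearMap
    { toFun := fun c => (⟨ContinuousMap.const UnitAddCircle c, const_mem_sobolev r c⟩ :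
        sobolevSubmodule r V)
      map_add' := fun _ _ => rfl
      map_smul' := fun _ _ => rfl }

lemma Sobolev.const_apply (r : ℝ) (c : V) (z : UnitAddCircle) : Sobolev.const r c z = c := rfl

lemma Sobolev.mean_const {r : ℝ} (hr : 1 / 2 < r) (c : V) :
    Sobolev.mean hr (Sobolev.const r c) = c := by
  rw [Sobolev.mean_apply]
  simp [Sobolev.const_apply]

end Periodic

/-! ### The Lie bracket of a Lie group in a chart -/

section Bracket

variable {E : Type*} [NormedAddCommGroup E] [NormedSpace ℝ E]
  {G : Type*} [TopologicalSpace G] [ChartedSpace E G] [Group G] [LieGroup 𝓘(ℝ, E) ∞ G]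

lemma hasD_extChartAt_of_mem {M : Type*} [TopologicalSpace M] [ChartedSpace E M]
    [IsManifold 𝓘(ℝ, E) ∞ M] {x y : M} (hy : y ∈ (extChartAt 𝓘(ℝ, E) x).source) :
    HasD 𝓘(ℝ, E) 𝓘(ℝ, E) (extChartAt 𝓘(ℝ, E) x) y
      (mD 𝓘(ℝ, E) 𝓘(ℝ, E) (extChartAt 𝓘(ℝ, E) x) y) :=
  (contMDiffAt_extChartAt' (by simpa using hy)).hasD

lemma hasD_extChartAt_symm_of_mem {M : Type*} [TopologicalSpace M] [ChartedSpace E M]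
    [IsManifold 𝓘(ℝ, E) ∞ M] {x : M} {y : E} (hy : y ∈ (extChartAt 𝓘(ℝ, E) x).target) :
    HasD 𝓘(ℝ, E) 𝓘(ℝ, E) (extChartAt 𝓘(ℝ, E) x).symm y
      (mD 𝓘(ℝ, E) 𝓘(ℝ, E) (extChartAt 𝓘(ℝ, E) x).symm y) :=
  ((contMDiffOn_extChartAt_symm (n := ∞) x).contMDiffAt
    ((isOpen_extChartAt_target (I := 𝓘(ℝ, E)) x).mem_nhds hy)).hasD

lemma mD_extChartAt_comp_symm {M : Type*} [TopologicalSpace M] [ChartedSpace E M]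
    [IsManifold 𝓘(ℝ, E) ∞ M] {x y : M} (hy : y ∈ (extChartAt 𝓘(ℝ, E) x).source) :
    (mD 𝓘(ℝ, E) 𝓘(ℝ, E) (extChartAt 𝓘(ℝ, E) x) y).comp
      (mD 𝓘(ℝ, E) 𝓘(ℝ, E) (extChartAt 𝓘(ℝ, E) x).symm (extChartAt 𝓘(ℝ, E) x y)) =
      ContinuousLinearMap.id ℝ E ∧
    (mD 𝓘(ℝ, E) 𝓘(ℝ, E) (extChartAt 𝓘(ℝ, E) x).symm (extChartAt 𝓘(ℝ, E) x y)).comp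
      (mD 𝓘(ℝ, E) 𝓘(ℝ, E) (extChartAt 𝓘(ℝ, E) x) y) = ContinuousLinearMap.id ℝ E := by
  have h1 := hasD_extChartAt_of_mem hy
  have h2 := hasD_extChartAt_symm_of_mem ((extChartAt 𝓘(ℝ, E) x).map_source hy)
  have hl := (extChartAt 𝓘(ℝ, E) x).left_inv hy
  constructor
  · refine (h1.comp h2 hl).unique ((hasD_id _).congr ?_)
    filter_upwards [(isOpen_extChartAt_target (I := 𝓘(ℝ, E)) x).mem_nhds
      ((extChartAt 𝓘(ℝ, E) x).map_source hy)] with z hz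
    exact (extChartAt 𝓘(ℝ, E) x).right_inv hz
  · refine (h2.comp h1 rfl).unique ((hasD_id _).congr ?_)
    filter_upwards [(isOpen_extChartAt_source (I := 𝓘(ℝ, E)) x).mem_nhds hy] with z hz
    exact (extChartAt 𝓘(ℝ, E) x).left_inv hz

/-- In the chart at `1` left multiplication by `g` is differentiated by `chartLeft`. -/
lemma mD_extChartAt_comp_leftL {g : G} (hg : g ∈ (extChartAt 𝓘(ℝ, E) (1 : G)).source) :
    (mD 𝓘(ℝ, E) 𝓘(ℝ, E) (extChartAt 𝓘(ℝ, E) (1 : G)) g).comp (leftL g) =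
      chartLeft G (extChartAt 𝓘(ℝ, E) (1 : G) g) := by
  have h := symm_comp_chartLeft (G := G) ((extChartAt 𝓘(ℝ, E) (1 : G)).map_source hg)
  rw [(extChartAt 𝓘(ℝ, E) (1 : G)).left_inv hg] at h
  rw [← h, ← ContinuousLinearMap.comp_assoc, (mD_extChartAt_comp_symm hg).1,
    ContinuousLinearMap.id_comp]

lemma lieBracket_eq_chartLeft (X Y : E) :
    lieBracket G X Y =
      fderiv ℝ (chartLeft G) (extChartAt 𝓘(ℝ, E) (1 : G) 1) X Y -
      fderiv ℝ (chartLeft G) (extChartAt 𝓘(ℝ, E) (1 : G) 1) Y X := by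
  set e := extChartAt 𝓘(ℝ, E) (1 : G) with he
  have he1 : e 1 ∈ e.target := mem_extChartAt_target (I := 𝓘(ℝ, E)) (1 : G)
  have hcl : HasFDerivAt (chartLeft G) (fderiv ℝ (chartLeft G) (e 1)) (e 1) :=
    ((contDiffAt_chartLeft (G := G) he1).differentiableAt (by simp)).hasFDerivAt
  have hV : ∀ Z : E, (VectorField.mpullbackWithin 𝓘(ℝ, E) 𝓘(ℝ, E) e.symm
      (mulInvariantVectorField (G := G) (I := 𝓘(ℝ, E)) Z) (range 𝓘(ℝ, E)) : E → E)
      =ᶠ[𝓝 (e 1)] fun y => chartLeft G y Z := by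
    intro Z
    filter_upwards [(isOpen_extChartAt_target (I := 𝓘(ℝ, E)) (1 : G)).mem_nhds he1] with y hy
    have hsrc : e.symm y ∈ e.source := e.map_target hy
    have h := (mD_extChartAt_comp_symm (x := (1 : G)) hsrc)
    rw [← he, e.right_inv hy] at h
    have hinv := ContinuousLinearMap.inverse_eq h.2 h.1
    have h1 : (mfderivWithin 𝓘(ℝ, E) 𝓘(ℝ, E) e.symm (range 𝓘(ℝ, E)) y) =
        mD 𝓘(ℝ, E) 𝓘(ℝ, E) e.symm y := by
      simp only [modelWithCornersSelf_coe, range_id, mfderivWithin_univ]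
      rfl
    have h2 := congrArg (fun L : E →L[ℝ] E => L Z) (mD_extChartAt_comp_leftL (G := G) hsrc)
    rw [← he, e.right_inv hy] at h2
    have key : ∀ L : E →L[ℝ] E, L = mD 𝓘(ℝ, E) 𝓘(ℝ, E) e.symm y →
        ContinuousLinearMap.inverse L (leftL (e.symm y) Z) = chartLeft G y Z := by
      rintro L rfl
      rw [hinv]
      exact h2
    exact key _ h1
  have hd : ∀ Z : E, HasFDerivAt (VectorField.mpullbackWithin 𝓘(ℝ, E) 𝓘(ℝ, E) e.symm
      (mulInvariantVectorField (G := G) (I := 𝓘(ℝ, E)) Z) (range 𝓘(ℝ, E)) : E → E)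
      ((fderiv ℝ (chartLeft G) (e 1)).flip Z) (e 1) := fun Z =>
    HasFDerivAt.congr_of_eventuallyEq (by
      have := hcl.clm_apply (hasFDerivAt_const Z (e 1))
      simpa using this) (hV Z)
  have hid : mfderiv 𝓘(ℝ, E) 𝓘(ℝ, E) e (1 : G) = ContinuousLinearMap.id ℝ E :=
    (hasD_extChartAt (1 : G)).mD_eq
  have hval : ∀ Z : E, (VectorField.mpullbackWithin 𝓘(ℝ, E) 𝓘(ℝ, E) e.symm
      (mulInvariantVectorField (G := G) (I := 𝓘(ℝ, E)) Z) (range 𝓘(ℝ, E)) : E → E) (e 1) = Z := by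
    intro Z
    rw [(hV Z).eq_of_nhds, chartLeft_one]
    rfl
  have key : ∀ (L : E →L[ℝ] E) (s : Set E) (V W : E → E), L = ContinuousLinearMap.id ℝ E →
      s = univ → ContinuousLinearMap.inverse L (VectorField.lieBracketWithin ℝ V W s (e 1)) =
        fderiv ℝ W (e 1) (V (e 1)) - fderiv ℝ V (e 1) (W (e 1)) := by
    rintro L s V W rfl rfl
    simp [VectorField.lieBracket]
  refine (key _ _ _ _ hid (by simp)).trans ?_
  rw [(hd X).fderiv, (hd Y).fderiv, hval X, hval Y]
  rfl

lemma lieBracket_eq_zero_of_hasD {W : Type*} [NormedAddCommGroup W] [NormedSpace ℝ W] {ε : W → G}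
    {i : W →L[ℝ] E} (h0 : ε 0 = 1)
    (hε : ∀ u, HasD 𝓘(ℝ, W) 𝓘(ℝ, E) ε u ((leftL (ε u)).comp i)) (X Y : W) :
    lieBracket G (i X) (i Y) = 0 := by
  set e := extChartAt 𝓘(ℝ, E) (1 : G) with he
  have he1 : e 1 ∈ e.target := mem_extChartAt_target (I := 𝓘(ℝ, E)) (1 : G)
  let β : W → E := fun u => e (ε u)
  have hβ0 : β 0 = e 1 := congrArg e h0
  have hev : ∀ᶠ u in 𝓝 (0 : W), HasFDerivAt β ((chartLeft G (β u)).comp i) u := by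
    have := (hε 0).continuousAt.preimage_mem_nhds (t := e.source) (by
      rw [h0]
      exact (isOpen_extChartAt_source (I := 𝓘(ℝ, E)) (1 : G)).mem_nhds
        (mem_extChartAt_source (I := 𝓘(ℝ, E)) (1 : G)))
    filter_upwards [this] with u hu
    have h := (hasD_extChartAt_of_mem hu).comp (hε u) rfl
    rw [← ContinuousLinearMap.comp_assoc, mD_extChartAt_comp_leftL hu] at h
    exact hasD_iff_hasFDerivAt.1 h
  have hcl : HasFDerivAt (chartLeft G) (fderiv ℝ (chartLeft G) (e 1)) (β 0) := by
    rw [hβ0]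
    exact ((contDiffAt_chartLeft (G := G) he1).differentiableAt (by simp)).hasFDerivAt
  have hβ' : HasFDerivAt β i 0 := by
    have := hev.self_of_nhds
    rw [hβ0, chartLeft_one] at this
    exact this
  let D := fderiv ℝ (chartLeft G) (e 1)
  have h2 : HasFDerivAt (fun u => (chartLeft G (β u)).comp i)
      (((ContinuousLinearMap.compL ℝ W E E).flip i).comp (D.comp i)) 0 :=
    ((ContinuousLinearMap.compL ℝ W E E).flip i).hasFDerivAt.comp (0 : W)
      (hcl.comp (0 : W) hβ')
  rw [lieBracket_eq_chartLeft, sub_eq_zero]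
  exact second_derivative_symmetric_of_eventually hev h2 X Y

end Bracket

/-! ### Lie subgroups -/

section Subgroup

variable {E : Type*} [NormedAddCommGroup E] [NormedSpace ℝ E]
  {G : Type*} [TopologicalSpace G] [ChartedSpace E G] [Group G] [LieGroup 𝓘(ℝ, E) ∞ G]
  {ET : Type*} [NormedAddCommGroup ET] [NormedSpace ℝ ET]
  {T : Subgroup G} [ChartedSpace ET T] [LieGroup 𝓘(ℝ, ET) ∞ T]

lemma lieInclusion_eq :
    lieInclusion E T = mD 𝓘(ℝ, ET) 𝓘(ℝ, E) (Subtype.val : T → G) 1 := rfl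

lemma hasD_val (hs : IsSplitEmbedding ET E (Subtype.val : T → G)) (g : T) :
    HasD 𝓘(ℝ, ET) 𝓘(ℝ, E) (Subtype.val : T → G) g
      (mD 𝓘(ℝ, ET) 𝓘(ℝ, E) (Subtype.val : T → G) g) :=
  hs.smooth.hasD g

lemma mD_val_comp_leftL (hs : IsSplitEmbedding ET E (Subtype.val : T → G)) (g : T) :
    (mD 𝓘(ℝ, ET) 𝓘(ℝ, E) (Subtype.val : T → G) g).comp (leftL g) =
      (leftL (g : G)).comp (lieInclusion E T) := by
  have h1 := (hasD_val hs g).comp (hasD_mul_left (E := ET) g (1 : T)) (mul_one g)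
  have h2 := (hasD_mul_left (E := E) (g : G) (1 : G)).comp (hasD_val hs 1) rfl
  exact h1.unique h2

lemma mD_val_leftL (hs : IsSplitEmbedding ET E (Subtype.val : T → G)) (g : T) (X : ET) :
    mD 𝓘(ℝ, ET) 𝓘(ℝ, E) (Subtype.val : T → G) g (leftL g X) =
      leftL (g : G) (lieInclusion E T X) :=
  congrArg (fun L : ET →L[ℝ] E => L X) (mD_val_comp_leftL hs g)

lemma mD_val_rightL (hs : IsSplitEmbedding ET E (Subtype.val : T → G)) (g : T) (X : ET) :
    mD 𝓘(ℝ, ET) 𝓘(ℝ, E) (Subtype.val : T → G) g (rightL g X) =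
      rightL (g : G) (lieInclusion E T X) := by
  have h1 := (hasD_val hs g).comp (hasD_mul_right (E := ET) g (1 : T)) (one_mul g)
  have h2 := (hasD_mul_right (E := E) (g : G) (1 : G)).comp (hasD_val hs 1) rfl
  exact congrArg (fun L : ET →L[ℝ] E => L X) (h1.unique h2)

lemma leftMCL_val (hs : IsSplitEmbedding ET E (Subtype.val : T → G)) (g : T) (v : ET) :
    leftMCL (g : G) (mD 𝓘(ℝ, ET) 𝓘(ℝ, E) (Subtype.val : T → G) g v) =
      lieInclusion E T (leftMCL g v) := by
  conv_lhs => rw [← leftL_leftMCL g v]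
  rw [mD_val_leftL hs, leftMCL_leftL]

lemma rightL_rightMCL (g : G) (v : E) : rightL g (rightMCL g v) = v := by
  have h1 := (hasD_mul_right (E := E) g (1 : G)).comp (hasD_mul_right (E := E) g⁻¹ g)
    (mul_inv_cancel g)
  have h2 : (fun y : G => y * g⁻¹ * g) = fun y => y := by funext y; simp
  rw [h2] at h1
  exact congrArg (fun L : E →L[ℝ] E => L v) (h1.unique (hasD_id g))

lemma rightMCL_val (hs : IsSplitEmbedding ET E (Subtype.val : T → G)) (g : T) (v : ET) :
    rightMCL (g : G) (mD 𝓘(ℝ, ET) 𝓘(ℝ, E) (Subtype.val : T → G) g v) =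
      lieInclusion E T (rightMCL g v) := by
  conv_lhs => rw [← rightL_rightMCL g v]
  rw [mD_val_rightL hs, rightMCL_rightL]

lemma lieInclusion_injective (hs : IsSplitEmbedding ET E (Subtype.val : T → G)) :
    Function.Injective (lieInclusion E T : ET → E) := hs.mD_injective 1

lemma AdL_val (hs : IsSplitEmbedding ET E (Subtype.val : T → G)) (g : T) (X : ET) :
    AdL (g : G) (lieInclusion E T X) = lieInclusion E T (AdL g X) := by
  have h1 := (hasD_conj (E := E) (g : G)).comp (hasD_val hs 1) rfl
  have h2 := (hasD_val hs 1).comp (hasD_conj (E := ET) g) (by simp)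
  exact congrArg (fun L : ET →L[ℝ] E => L X) (h1.unique h2)

lemma HasLD.val (hs : IsSplitEmbedding ET E (Subtype.val : T → G)) {h : ℝ → T} {s : ℝ} {X : ET}
    (hh : HasLD h s X) : HasLD (fun r => (h r : G)) s (lieInclusion E T X) := by
  have := (hasD_val hs (h s)).comp hh rfl
  rw [comp_smulRight_one, mD_val_leftL hs] at this
  exact this

lemma HasRD.val (hs : IsSplitEmbedding ET E (Subtype.val : T → G)) {h : ℝ → T} {s : ℝ} {X : ET}
    (hh : HasRD h s X) : HasRD (fun r => (h r : G)) s (lieInclusion E T X) := by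
  have := (hasD_val hs (h s)).comp hh rfl
  rw [comp_smulRight_one, mD_val_rightL hs] at this
  exact this

lemma HasLD.exists_of_val (hs : IsSplitEmbedding ET E (Subtype.val : T → G)) {h : ℝ → T} {s : ℝ}
    {Y : E} (hh : HasLD (fun r => (h r : G)) s Y) :
    ∃ X : ET, lieInclusion E T X = Y ∧ HasLD h s X := by
  obtain ⟨L', hL', hc⟩ := hs.exists_hasD hh
  refine ⟨leftMCL (h s) (L' 1), ?_, ?_⟩
  · rw [← leftMCL_val hs]
    have := congrArg (fun L : ℝ →L[ℝ] E => L 1) hc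
    simp only [ContinuousLinearMap.comp_apply, ContinuousLinearMap.smulRight_apply,
      one_apply_eq_self, one_smul] at this
    rw [this, leftMCL_leftL]
  · unfold HasLD
    rw [leftL_leftMCL]
    convert hL'
    ext
    simp

lemma isParallel_val (hs : IsSplitEmbedding ET E (Subtype.val : T → G)) {μ : ℝ → ET} {h : ℝ → T}
    (hh : IsParallel μ h) : IsParallel (fun s => lieInclusion E T (μ s)) fun s => (h s : G) := by
  rw [isParallel_iff] at hh ⊢
  exact ⟨by simp [hh.1], fun s => (hh.2 s).val hs⟩

variable [CompleteSpace E] [CompleteSpace ET] [T2Space G]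

lemma hol_val (hs : IsSplitEmbedding ET E (Subtype.val : T → G)) {μ : ℝ → ET} (hμ : Continuous μ)
    (s : ℝ) : Hol G (fun s => lieInclusion E T (μ s)) s = (Hol T μ s : G) := by
  rw [(isParallel_val hs (isParallel_hol (G := T) hμ)).hol_eq]

lemma lieExp_val (hs : IsSplitEmbedding ET E (Subtype.val : T → G)) (X : ET) :
    lieExp G (lieInclusion E T X) = (lieExp T X : G) :=
  hol_val hs continuous_const 1

/-- The Lie algebra of an abelian Lie subgroup is abelian. -/
lemma lieBracket_lieInclusion (hs : IsSplitEmbedding ET E (Subtype.val : T → G))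
    (hab : ∀ a b : T, a * b = b * a) (X Y : ET) :
    lieBracket G (lieInclusion E T X) (lieInclusion E T Y) = 0 := by
  refine lieBracket_eq_zero_of_hasD (ε := fun u : ET => (lieExp T u : G)) (i := lieInclusion E T)
    ?_ (fun u => ?_) X Y
  · rw [lieExp_zero (G := T) (E := ET)]
    rfl
  · rw [← mD_val_comp_leftL hs]
    exact (hasD_val hs _).comp (hasD_lieExp hab u) rfl

lemma lieBracket_of_comm (hab : ∀ a b : G, a * b = b * a) (X Y : E) : lieBracket G X Y = 0 :=
  lieBracket_eq_zero_of_hasD (ε := lieExp G) (i := ContinuousLinearMap.id ℝ E) lieExp_zero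
    (fun u => by rw [ContinuousLinearMap.comp_id]; exact hasD_lieExp hab u) X Y

end Subgroup


/-! ### Regular elements of a torus -/

section Regular

variable {E : Type*} [NormedAddCommGroup E] [NormedSpace ℝ E] [CompleteSpace E]
  {G : Type*} [TopologicalSpace G] [ChartedSpace E G] [Group G] [LieGroup 𝓘(ℝ, E) ∞ G] [T2Space G]
  {ET : Type*} [NormedAddCommGroup ET] [NormedSpace ℝ ET] [CompleteSpace ET]
  {T : Subgroup G} [ChartedSpace ET T] [LieGroup 𝓘(ℝ, ET) ∞ T]

lemma AdL_lieInclusion_of_comm (hs : IsSplitEmbedding ET E (Subtype.val : T → G))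
    (hab : ∀ a b : T, a * b = b * a) {g : G} (hg : g ∈ T) (X : ET) :
    AdL g (lieInclusion E T X) = lieInclusion E T X := by
  have := AdL_val hs ⟨g, hg⟩ X
  rwa [AdL_of_comm hab] at this

/-- The Lie algebra of the centralizer of `t` is the fixed point set of `Ad t`. -/
lemma exists_lieInclusion_eq (hs : IsSplitEmbedding ET E (Subtype.val : T → G)) {t : G}
    (hreg : Subgroup.centralizer {t} = T) {Y : E} (hY : AdL t Y = Y) :
    ∃ X : ET, lieInclusion E T X = Y := by
  have hmem : ∀ s : ℝ, lieExp G (s • Y) ∈ T := by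
    intro s
    rw [← hreg, Subgroup.mem_centralizer_singleton_iff]
    have h := conj_lieExp t (s • Y)
    rw [map_smul, hY, mul_inv_eq_iff_eq_mul] at h
    exact h.symm
  obtain ⟨X, hX, -⟩ := HasLD.exists_of_val hs (h := fun s => ⟨lieExp G (s • Y), hmem s⟩)
    (hasLD_lieExp_smul (G := G) Y 0)
  exact ⟨X, hX⟩

end Regular

/-! ### Loops in an abelian group -/

section AbelianLoops

variable {f : ℝ} {ET : Type*} [NormedAddCommGroup ET] [NormedSpace ℝ ET] [FiniteDimensional ℝ ET]
  [CompleteSpace ET]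
  {T : Type*} [TopologicalSpace T] [ChartedSpace ET T] [Group T] [LieGroup 𝓘(ℝ, ET) ∞ T]
  [T2Space T]

/-- The loop `s ↦ exp (∫₀ˢ b)`. -/
def expLoop (T : Type*) [TopologicalSpace T] [ChartedSpace ET T] [Group T]
    (b : Sobolev (f - 1 / 2) ET) : UnitAddCircle → T := fun z =>
  lieExp T (∫ r in (0 : ℝ)..(AddCircle.equivIco (1 : ℝ) 0 z : ℝ), b (r : UnitAddCircle))

lemma Sobolev.hasDerivAt_integral (b : Sobolev (f - 1 / 2) ET) (s : ℝ) :
    HasDerivAt (fun s => ∫ r in (0 : ℝ)..s, b (r : UnitAddCircle)) (b (s : UnitAddCircle)) s :=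
  intervalIntegral.integral_hasDerivAt_right (b.continuous_real.intervalIntegrable _ _)
    b.continuous_real.aestronglyMeasurable.stronglyMeasurableAtFilter b.continuous_real.continuousAt

lemma expLoop_coe (hab : ∀ a b : T, a * b = b * a) {b : Sobolev (f - 1 / 2) ET}
    (hb : lieExp T (∫ r in (0 : ℝ)..1, b (r : UnitAddCircle)) = 1) (s : ℝ) :
    expLoop T b (s : UnitAddCircle) = lieExp T (∫ r in (0 : ℝ)..s, b (r : UnitAddCircle)) := by
  have hi : ∀ x y : ℝ, IntervalIntegrable (fun r : ℝ => b (r : UnitAddCircle)) volume x y :=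
    fun x y => b.continuous_real.intervalIntegrable _ _
  have hper : Function.Periodic
      (fun s : ℝ => lieExp T (∫ r in (0 : ℝ)..s, b (r : UnitAddCircle))) 1 := by
    intro s
    have hp : Function.Periodic (fun r : ℝ => b (r : UnitAddCircle)) 1 := fun r => by simp
    have h1 := hp.intervalIntegral_add_eq s 0
    simp only [zero_add] at h1
    change lieExp T (∫ r in (0 : ℝ)..(s + 1), b (r : UnitAddCircle)) = _
    rw [← intervalIntegral.integral_add_adjacent_intervals (hi 0 s) (hi s (s + 1)), h1,
      lieExp_add hab, hb, mul_one]
  have h2 := hper.lift_coe s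
  rw [← h2]
  obtain ⟨s', hs', hss'⟩ : ∃ s' ∈ Ico (0 : ℝ) (0 + 1), (s' : UnitAddCircle) = s :=
    ⟨_, (AddCircle.equivIco (1 : ℝ) 0 (s : UnitAddCircle)).2, AddCircle.coe_equivIco⟩
  rw [← hss', hper.lift_coe]
  unfold expLoop
  rw [AddCircle.equivIco_coe_eq hs']

lemma expLoop_zero_apply (b : Sobolev (f - 1 / 2) ET) : expLoop T b 0 = 1 := by
  unfold expLoop
  have : (AddCircle.equivIco (1 : ℝ) 0 (0 : UnitAddCircle) : ℝ) = 0 := by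
    have h := AddCircle.equivIco_coe_eq (p := (1 : ℝ)) (a := 0) (x := 0) (by simp)
    exact congrArg Subtype.val h
  rw [this, intervalIntegral.integral_same, lieExp_zero]

lemma hasLogDeriv_expLoop (hab : ∀ a b : T, a * b = b * a) {b : Sobolev (f - 1 / 2) ET}
    (hb : lieExp T (∫ r in (0 : ℝ)..1, b (r : UnitAddCircle)) = 1) :
    HasLogDeriv (expLoop T b) b := by
  rw [hasLogDeriv_iff]
  intro s
  rw [hasRD_iff_of_comm hab]
  simp only [expLoop_coe hab hb]
  exact hasLD_lieExp_comp hab (b.hasDerivAt_integral s)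

lemma HasLogDeriv.eq_expLoop (hab : ∀ a b : T, a * b = b * a) {γ : UnitAddCircle → T}
    {b : Sobolev (f - 1 / 2) ET} (h : HasLogDeriv γ b) (hγ : γ 0 = 1) :
    lieExp T (∫ r in (0 : ℝ)..1, b (r : UnitAddCircle)) = 1 ∧ γ = expLoop T b := by
  have h1 : ∀ s : ℝ, γ (s : UnitAddCircle) =
      lieExp T (∫ r in (0 : ℝ)..s, b (r : UnitAddCircle)) := by
    intro s
    rw [hasLogDeriv_iff] at h
    refine eq_of_hasLD (E := ET) (h := fun s : ℝ => γ (s : UnitAddCircle))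
      (k := fun s => lieExp T (∫ r in (0 : ℝ)..s, b (r : UnitAddCircle)))
      (μ := fun s => b (s : UnitAddCircle)) isOpen_univ isPreconnected_univ
      (fun s _ => (hasRD_iff_of_comm hab).1 (h s))
      (fun s _ => hasLD_lieExp_comp hab (b.hasDerivAt_integral s)) (mem_univ 0) ?_ (mem_univ s)
    simp [hγ, lieExp_zero]
  have h2 : lieExp T (∫ r in (0 : ℝ)..1, b (r : UnitAddCircle)) = 1 := by
    rw [← h1 1, show ((1 : ℝ) : UnitAddCircle) = 0 from AddCircle.coe_period 1, hγ]
  refine ⟨h2, funext fun z => ?_⟩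
  obtain ⟨s, rfl⟩ := QuotientAddGroup.mk_surjective z
  exact (h1 s).trans (expLoop_coe hab h2 s).symm

lemma expLoop_add (hab : ∀ a b : T, a * b = b * a) (a b : Sobolev (f - 1 / 2) ET) :
    expLoop T (a + b) = expLoop T a * expLoop T b := by
  funext z
  simp only [expLoop, Pi.mul_apply]
  rw [← lieExp_add hab, ← intervalIntegral.integral_add
    (a.continuous_real.intervalIntegrable _ _) (b.continuous_real.intervalIntegrable _ _)]
  rfl

lemma expLoop_zero : expLoop T (0 : Sobolev (f - 1 / 2) ET) = 1 := by
  funext z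
  simp only [expLoop, Sobolev.zero_apply, intervalIntegral.integral_zero, Pi.one_apply, lieExp_zero]

lemma latticeLoop_eq_expLoop (X : ET) :
    latticeLoop T X = expLoop T (-(Sobolev.const (f - 1 / 2) X)) := by
  funext z
  simp [expLoop, latticeLoop, Sobolev.neg_apply, Sobolev.const_apply]

lemma integral_const_sobolev (X : ET) :
    ∫ r in (0 : ℝ)..1, (Sobolev.const (f - 1 / 2) X) (r : UnitAddCircle) = X := by
  simp [Sobolev.const_apply]

lemma hasLogDeriv_latticeLoop (hab : ∀ a b : T, a * b = b * a) {X : ET}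
    (hX : X ∈ integralLattice ET T) :
    HasLogDeriv (latticeLoop T X) (-(Sobolev.const (f - 1 / 2) X)) := by
  rw [latticeLoop_eq_expLoop (f := f)]
  refine hasLogDeriv_expLoop hab ?_
  simp only [Sobolev.neg_apply, intervalIntegral.integral_neg, integral_const_sobolev]
  rw [lieExp_neg hab, show lieExp T X = 1 from hX, inv_one]

lemma latticeLoop_zero_apply (X : ET) : latticeLoop T X 0 = 1 := by
  rw [latticeLoop_eq_expLoop (f := 0)]
  exact expLoop_zero_apply _

lemma eq_of_isPreconnected_integralLattice (hab : ∀ a b : T, a * b = b * a) {S : Set ET}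
    (hS : IsPreconnected S) (hS' : S ⊆ integralLattice ET T) {X Y : ET} (hX : X ∈ S) (hY : Y ∈ S) :
    X = Y := by
  obtain ⟨U, hU, hUo, h0⟩ := mem_nhds_iff.1 (eventually_lieExp_eq_one (E := ET) (G := T) hab)
  have hsub : Subsingleton S := by
    have : DiscreteTopology S := by
      rw [discreteTopology_subtype_iff']
      intro y hy
      refine ⟨(fun z => z - y) ⁻¹' U, hUo.preimage (by fun_prop), ?_⟩
      ext z
      constructor
      · rintro ⟨hz, hzS⟩
        have h1 : lieExp T (z - y) = 1 := by
          rw [sub_eq_add_neg, lieExp_add hab, lieExp_neg hab, show lieExp T z = 1 from hS' hzS,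
            show lieExp T y = 1 from hS' hy]
          simp
        exact sub_eq_zero.1 (hU hz h1)
      · rintro rfl
        exact ⟨by simpa using h0, hy⟩
    have : PreconnectedSpace S := isPreconnected_iff_preconnectedSpace.1 hS
    exact PreconnectedSpace.trivial_of_discrete
  exact congrArg Subtype.val (hsub.elim ⟨X, hX⟩ ⟨Y, hY⟩)

lemma mem_basedLoopGroupZero_iff (hab : ∀ a b : T, a * b = b * a) (hr : 1 / 2 < f - 1 / 2)
    {γ : UnitAddCircle → T} : γ ∈ basedLoopGroupZero f ET T ↔
      ∃ b : Sobolev (f - 1 / 2) ET, Sobolev.mean hr b = 0 ∧ γ = expLoop T b := by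
  set S := {b : Sobolev (f - 1 / 2) ET | ∃ η : UnitAddCircle → T, η 0 = 1 ∧ HasLogDeriv η b}
  have hSiff : ∀ b, b ∈ S ↔ Sobolev.mean hr b ∈ integralLattice ET T := by
    intro b
    rw [Sobolev.mean_apply]
    constructor
    · rintro ⟨η, h0, hη⟩
      exact (hη.eq_expLoop hab h0).1
    · intro hb
      exact ⟨_, expLoop_zero_apply b, hasLogDeriv_expLoop hab hb⟩
  have h0S : (0 : Sobolev (f - 1 / 2) ET) ∈ S := by
    rw [hSiff, map_zero]
    exact lieExp_zero
  have hcomp : connectedComponentIn S 0 = {b | Sobolev.mean hr b = 0} := by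
    apply Subset.antisymm
    · intro b hb
      have h1 : IsPreconnected (Sobolev.mean hr '' connectedComponentIn S 0) :=
        isPreconnected_connectedComponentIn.image _ (Sobolev.mean hr).continuous.continuousOn
      have h2 := eq_of_isPreconnected_integralLattice (T := T) hab h1 (by
        rintro _ ⟨c, hc, rfl⟩
        exact (hSiff c).1 (connectedComponentIn_subset _ _ hc)) ⟨b, hb, rfl⟩
        ⟨0, mem_connectedComponentIn h0S, rfl⟩
      rw [map_zero] at h2
      exact h2
    · have hconv : Convex ℝ {b : Sobolev (f - 1 / 2) ET | Sobolev.mean hr b = 0} := by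
        intro x hx y hy a b _ _ _
        change Sobolev.mean hr (a • x + b • y) = 0
        have hx' : Sobolev.mean hr x = 0 := hx
        have hy' : Sobolev.mean hr y = 0 := hy
        rw [map_add, map_smul, map_smul, hx', hy', smul_zero, smul_zero, add_zero]
      refine hconv.isPreconnected.subset_connectedComponentIn (map_zero _) fun b hb => ?_
      have hb' : Sobolev.mean hr b = 0 := hb
      rw [hSiff, hb']
      exact lieExp_zero
  constructor
  · rintro ⟨h0, b, hb, hbS⟩
    have hbS' : b ∈ connectedComponentIn S 0 := hbS
    rw [hcomp] at hbS'
    exact ⟨b, hbS', (hb.eq_expLoop hab h0).2⟩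
  · rintro ⟨b, hb, rfl⟩
    have hb1 : lieExp T (∫ r in (0 : ℝ)..1, b (r : UnitAddCircle)) = 1 := by
      rw [← Sobolev.mean_apply hr, hb]
      exact lieExp_zero
    refine ⟨expLoop_zero_apply b, b, hasLogDeriv_expLoop hab hb1, ?_⟩
    change b ∈ connectedComponentIn S 0
    rw [hcomp]
    exact hb

/-- A loop of Sobolev class `f + 1/2` in the Lie algebra exponentiates to a loop. -/
lemma exists_hasLogDeriv_lieExp (hab : ∀ a b : T, a * b = b * a) (hr : 1 / 2 < f - 1 / 2)
    (ξ : Sobolev (f + 1 / 2) ET) : ∃ a : Sobolev (f - 1 / 2) ET, ∀ τ : ℝ,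
      HasLogDeriv (fun z => lieExp T (-(τ • ξ z))) (-(τ • a)) := by
  have h1 : MemH (f - 1 / 2 + 1) fun s : ℝ => ξ (s : UnitAddCircle) := by
    rw [show f - 1 / 2 + 1 = f + 1 / 2 by ring]
    exact ξ.memH
  obtain ⟨u', hu', hm⟩ := h1.exists_deriv hr
  obtain ⟨a, ha⟩ := hm.exists_sobolev
  refine ⟨a, fun τ => hasLogDeriv_iff.2 fun s => (hasRD_iff_of_comm hab).2 ?_⟩
  refine hasLD_lieExp_comp hab (u := fun s : ℝ => -(τ • ξ (s : UnitAddCircle))) ?_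
  rw [Sobolev.neg_apply, Sobolev.smul_apply, ha]
  exact ((hu' s).const_smul τ).neg

end AbelianLoops


/-! ### Gauge transformations -/

section Gauge

variable {f : ℝ} {E : Type*} [NormedAddCommGroup E] [NormedSpace ℝ E] [CompleteSpace E]
  {G : Type*} [TopologicalSpace G] [ChartedSpace E G] [Group G] [LieGroup 𝓘(ℝ, E) ∞ G] [T2Space G]
  {ET : Type*} [NormedAddCommGroup ET] [NormedSpace ℝ ET] [CompleteSpace ET]
  {T : Subgroup G} [ChartedSpace ET T] [LieGroup 𝓘(ℝ, ET) ∞ T]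

lemma hasLogDeriv_const (g : G) :
    HasLogDeriv (fun _ => g) (0 : Sobolev (f - 1 / 2) E) := by
  rw [hasLogDeriv_iff]
  intro s
  rw [hasRD_iff, Sobolev.zero_apply, map_zero]
  exact hasLD_const g s

lemma HasLogDeriv.val (hs : IsSplitEmbedding ET E (Subtype.val : T → G)) {γ : UnitAddCircle → T}
    {b : Sobolev (f - 1 / 2) ET} (h : HasLogDeriv γ b) :
    HasLogDeriv (fun z => (γ z : G)) (Sobolev.map (f - 1 / 2) (lieInclusion E T) b) := by
  rw [hasLogDeriv_iff] at h ⊢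
  exact fun s => (h s).val hs

/-- The based gauge transformations act freely on connections. -/
lemma HasLogDeriv.eq_one {γ : UnitAddCircle → G} {a : Sobolev (f - 1 / 2) E}
    (h : HasLogDeriv γ a) (hγ : γ 0 = 1) {μ : Sobolev (f - 1 / 2) E}
    (hμ : ∀ z, μ z = Ad (γ z) (μ z) - a z) : γ = 1 := by
  funext z
  obtain ⟨s, rfl⟩ := QuotientAddGroup.mk_surjective z
  have h1 := gauge_hol (G := G) μ.continuous_real (ν := fun s : ℝ => μ (s : UnitAddCircle))
    (hasLogDeriv_iff.1 h) (fun s => hμ s) s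
  have h0 : γ ((0 : ℝ) : UnitAddCircle) = 1 := hγ
  rw [h0, one_mul, eq_comm, mul_eq_left, inv_eq_one] at h1
  exact h1

lemma hol_add_one {μ : ℝ → E} (hμ : Continuous μ) (hper : Function.Periodic μ 1) (s : ℝ) :
    Hol G μ (s + 1) = Hol G μ 1 * Hol G μ s := by
  have hp := isParallel_iff.1 (isParallel_hol (G := G) hμ)
  refine eq_of_hasLD (E := E) (h := fun s => Hol G μ (s + 1)) (k := fun s => Hol G μ 1 * Hol G μ s)
    (μ := μ) isOpen_univ isPreconnected_univ (fun s _ => ?_) (fun s _ => (hp.2 s).const_mul _)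
    (mem_univ 0) (by simp [hp.1]) (mem_univ s)
  have := (hp.2 (s + 1)).comp_real (u := fun r => r + 1) ((hasDerivAt_id s).add_const 1)
  rwa [one_smul, hper s] at this

/-- A connection with holonomy `exp X` is gauge equivalent to the constant connection `X`. -/
lemma exists_gauge_const [FiniteDimensional ℝ E] (hr : 1 / 2 < f - 1 / 2)
    (μ : Sobolev (f - 1 / 2) E) (X : E)
    (hX : Hol G (fun s => μ (s : UnitAddCircle)) 1 = lieExp G X) :
    ∃ (γ : UnitAddCircle → G) (a : Sobolev (f - 1 / 2) E), HasLogDeriv γ a ∧ γ 0 = 1 ∧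
      ∀ z, Ad (γ z) (μ z) - a z = X := by
  set m : ℝ → E := fun s => μ (s : UnitAddCircle) with hm
  have hmc : Continuous m := μ.continuous_real
  have hmper : Function.Periodic m 1 := fun s => by simp [hm]
  have hp := isParallel_iff.1 (isParallel_hol (G := G) hmc)
  let h : ℝ → G := fun s => lieExp G (s • (-X)) * Hol G m s
  have hcomm : ∀ s : ℝ, AdL (lieExp G (s • X)) X = X := by
    intro s
    have h1 := (hasLD_lieExp_smul (G := G) X 0).conj (lieExp G (s • X))
    have h2 : (fun r : ℝ => lieExp G (s • X) * lieExp G (r • X) * (lieExp G (s • X))⁻¹) =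
        fun r => lieExp G (r • X) := by
      funext r
      refine mul_inv_eq_of_eq_mul ?_
      have hadd : ∀ a b : ℝ, lieExp G (a • X) * lieExp G (b • X) = lieExp G ((b + a) • X) := by
        intro a b
        have hc := fun s => (hasLD_lieExp_smul (G := G) X s).const_mul (lieExp G (a • X))
        have hd := fun s => (hasLD_lieExp_smul (G := G) X (s + a)).comp_real
          (u := fun r => r + a) ((hasDerivAt_id s).add_const a)
        refine eq_of_hasLD (E := E) (h := fun s => lieExp G (a • X) * lieExp G (s • X))
          (k := fun s => lieExp G ((s + a) • X)) (μ := fun _ => X) isOpen_univ isPreconnected_univ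
          (fun s _ => hc s) (fun s _ => by simpa using hd s) (mem_univ 0)
          (by simp [lieExp_zero]) (mem_univ b)
      rw [hadd, hadd, add_comm]
    rw [h2] at h1
    exact h1.unique (hasLD_lieExp_smul (G := G) X 0)
  have hinv : ∀ s : ℝ, (lieExp G (s • (-X)))⁻¹ = lieExp G (s • X) := by
    intro s
    refine inv_eq_of_mul_eq_one_right ?_
    have h1 : ∀ r, HasLD (fun r : ℝ => lieExp G (r • (-X)) * lieExp G (r • X)) r (0 : E) := by
      intro r
      have hr2 := (hasLD_lieExp_smul (G := G) (-X) r).mul (hasLD_lieExp_smul (G := G) X r)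
      have h3 : AdL (lieExp G (r • X))⁻¹ (-X) = -X := by
        have h4 := AdL_inv_apply (lieExp G (r • X)) X
        rw [hcomm] at h4
        rw [map_neg, h4]
      rwa [h3, neg_add_cancel] at hr2
    have := eq_of_hasLD_zero isOpen_univ isPreconnected_univ (fun r _ => h1 r) (mem_univ 0)
      (mem_univ s)
    simpa [lieExp_zero] using this
  have hLD : ∀ s, HasLD h s (-(AdL (h s)⁻¹ X) + m s) := by
    intro s
    have h1 := (hasLD_lieExp_smul (G := G) (-X) s).mul (hp.2 s)
    have h2 : AdL (Hol G m s)⁻¹ (-X) = -(AdL (h s)⁻¹ X) := by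
      simp only [h, mul_inv_rev, hinv]
      rw [AdL_mul_apply, hcomm, map_neg]
    rwa [h2] at h1
  have hper : Function.Periodic h 1 := by
    intro s
    have hsplit : lieExp G ((s + 1) • (-X)) = lieExp G (s • (-X)) * lieExp G ((1 : ℝ) • (-X)) := by
      have h1 := hol_add_one (G := G) (μ := fun _ : ℝ => X) continuous_const (fun _ => rfl) s
      simp only [hol_const] at h1
      rw [← inv_inj, hinv, mul_inv_rev, hinv, hinv, h1]
    change lieExp G ((s + 1) • (-X)) * Hol G m (s + 1) = lieExp G (s • (-X)) * Hol G m s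
    rw [hol_add_one hmc hmper, hX, hsplit]
    have h4 := hinv 1
    rw [one_smul ℝ X, inv_eq_iff_eq_inv] at h4
    rw [h4]
    group
  have hcont : Continuous h := continuous_iff_continuousAt.2 fun s => (hLD s).continuousAt
  obtain ⟨γ, hγ⟩ := exists_circle_lift hcont hper
  have hAd : ∀ s, HasDerivAt (fun s => AdL (E := E) (h s))
      ((AdL (h s)).comp (adL G (m s)) - (adL G X).comp (AdL (h s))) s := by
    intro s
    have h1 := (hLD s).hasDerivAt_AdL
    have h2 : (AdL (E := E) (h s)).comp (adL G (-(AdL (h s)⁻¹ X) + m s)) =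
        (AdL (h s)).comp (adL G (m s)) - (adL G X).comp (AdL (h s)) := by
      have h3 : (AdL (E := E) (h s)).comp (adL G (AdL (h s)⁻¹ X)) = (adL G X).comp (AdL (h s)) := by
        have ha : HasDerivAt (fun r : ℝ => AdL (E := E) (h s * lieExp G (r • AdL (h s)⁻¹ X)))
            ((AdL (h s)).comp (adL G (AdL (h s)⁻¹ X))) 0 := by
          have := ((hasLD_lieExp_smul (G := G) (AdL (h s)⁻¹ X) 0).const_mul (h s)).hasDerivAt_AdL
          simpa [lieExp_zero] using this
        have hb : HasDerivAt (fun r : ℝ => AdL (E := E) (lieExp G (r • X) * h s))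
            ((adL G X).comp (AdL (h s))) 0 := by
          have h5 := (hasLD_lieExp_smul (G := G) X 0).hasDerivAt_AdL
          have h6 := h5.clm_comp (hasDerivAt_const (0 : ℝ) (AdL (E := E) (h s)))
          rw [show (fun r : ℝ => AdL (E := E) (lieExp G (r • X) * h s)) = fun r : ℝ =>
            (AdL (E := E) (lieExp G (r • X))).comp (AdL (E := E) (h s)) from
              funext fun r => AdL_mul _ _]
          simpa [lieExp_zero, AdL_one] using h6
        have hfe : (fun r : ℝ => AdL (E := E) (h s * lieExp G (r • AdL (h s)⁻¹ X))) =
            fun r : ℝ => AdL (E := E) (lieExp G (r • X) * h s) := by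
          funext r
          have := conj_lieExp (h s) (r • AdL (h s)⁻¹ X)
          rw [map_smul, AdL_apply_inv, mul_inv_eq_iff_eq_mul] at this
          rw [this]
        rw [hfe] at ha
        exact ha.unique hb
      rw [map_add, map_neg, ContinuousLinearMap.comp_add, ContinuousLinearMap.comp_neg, h3]
      abel
    rwa [h2] at h1
  have hA : MemH (f - 1 / 2) fun s => AdL (E := E) (h s) := by
    refine memH_of_linear_ode hr (m := m) (fun s => by rw [hper s])
      ((ContinuousLinearMap.compL ℝ E (E →L[ℝ] E) (E →L[ℝ] E)).flip (adL G) ∘L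
        (ContinuousLinearMap.compL ℝ E E E))
      (-(ContinuousLinearMap.compL ℝ E E E (adL G X))) μ.memH fun s => ?_
    have := hAd s
    rw [sub_eq_add_neg] at this
    exact this
  have hAm : MemH (f - 1 / 2) fun s => AdL (E := E) (h s) (m s) :=
    MemH.bilin hr (ContinuousLinearMap.id ℝ (E →L[ℝ] E)) hA μ.memH
  obtain ⟨b, hb⟩ := hAm.exists_sobolev
  refine ⟨γ, b - Sobolev.const _ X, ?_, ?_, ?_⟩
  · rw [hasLogDeriv_iff]
    intro s
    simp only [hγ]
    rw [hasRD_iff]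
    convert hLD s using 1
    rw [Sobolev.sub_apply, hb, Sobolev.const_apply, map_sub, AdL_inv_apply]
    abel
  · have h0 := hγ 0
    have : h 0 = 1 := by simp [h, hp.1, lieExp_zero]
    rw [this] at h0
    exact h0
  · intro z
    obtain ⟨s, rfl⟩ := QuotientAddGroup.mk_surjective z
    have h1 : (b - Sobolev.const (f - 1 / 2) X : Sobolev (f - 1 / 2) E) (s : UnitAddCircle) = AdL (h s) (m s) - X := by
      rw [Sobolev.sub_apply, hb, Sobolev.const_apply]
    have h2 : Ad (γ (s : UnitAddCircle)) (μ (s : UnitAddCircle)) = AdL (h s) (m s) := by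
      rw [hγ]; rfl
    change Ad (γ (s : UnitAddCircle)) (μ (s : UnitAddCircle)) -
      (b - Sobolev.const (f - 1 / 2) X : Sobolev (f - 1 / 2) E) (s : UnitAddCircle) = X
    rw [h1, h2]
    abel

end Gauge

/-! ### The holonomy form -/

section HolForm

variable {f : ℝ} {E : Type*} [NormedAddCommGroup E] [NormedSpace ℝ E] [CompleteSpace E]
  [FiniteDimensional ℝ E]
  {G : Type*} [TopologicalSpace G] [ChartedSpace E G] [Group G] [LieGroup 𝓘(ℝ, E) ∞ G] [T2Space G]
  {ET : Type*} [NormedAddCommGroup ET] [NormedSpace ℝ ET] [CompleteSpace ET]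
  [FiniteDimensional ℝ ET]

lemma Sobolev.exists_integral_clm {r : ℝ} (hr : 1 / 2 < r) {W : Type*} [NormedAddCommGroup W]
    [NormedSpace ℝ W] [CompleteSpace W] {A : ℝ → E →L[ℝ] W} (hA : Continuous A) (s : ℝ) :
    ∃ L : Sobolev r E →L[ℝ] W, ∀ a, L a = ∫ r in (0 : ℝ)..s, A r (a (r : UnitAddCircle)) := by
  obtain ⟨C, hC0, hC⟩ := Sobolev.exists_norm_le (V := E) hr
  obtain ⟨D, hD⟩ := (isCompact_uIcc (a := (0 : ℝ)) (b := s)).exists_bound_of_continuousOn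
    hA.continuousOn
  have hci : ∀ a : Sobolev r E, IntervalIntegrable (fun r : ℝ => A r (a (r : UnitAddCircle)))
      volume 0 s := fun a => (hA.clm_apply a.continuous_real).intervalIntegrable _ _
  refine ⟨LinearMap.mkContinuous
    { toFun := fun a : Sobolev r E => ∫ r in (0 : ℝ)..s, A r (a (r : UnitAddCircle))
      map_add' := fun a b => by
        simp only [Sobolev.add_apply, map_add]
        exact intervalIntegral.integral_add (hci a) (hci b)
      map_smul' := fun c a => by
        simp only [Sobolev.smul_apply, map_smul, RingHom.id_apply]
        exact intervalIntegral.integral_smul c _ } (C * |D| * |s - 0|) fun a => ?_, fun a => rfl⟩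
  refine (intervalIntegral.norm_integral_le_of_norm_le_const (C := C * |D| * ‖a‖) ?_).trans
    (le_of_eq (by ring))
  intro x hx
  have h1 := (A x).le_opNorm (a (x : UnitAddCircle))
  have h2 := (hD x (uIoc_subset_uIcc hx)).trans (le_abs_self D)
  calc ‖A x (a (x : UnitAddCircle))‖ ≤ |D| * (C * ‖a‖) :=
        h1.trans (mul_le_mul h2 (hC a _) (norm_nonneg _) (abs_nonneg D))
    _ = C * |D| * ‖a‖ := by ring

lemma holForm_eq (hr : 1 / 2 < f - 1 / 2) (μ a : Sobolev (f - 1 / 2) E) {s : ℝ}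
    (hs : s ∈ Ioo (-2 : ℝ) 2) :
    holForm G μ a s = ∫ r in (0 : ℝ)..s,
      AdL (Hol G (fun r => μ (r : UnitAddCircle)) r) (a (r : UnitAddCircle)) := by
  obtain ⟨C, hC0, hC⟩ := Sobolev.exists_norm_le (V := E) hr
  let J : Sobolev (f - 1 / 2) E →ₗ[ℝ] (ℝ → E) :=
    { toFun := fun a r => a (r : UnitAddCircle)
      map_add' := fun a b => funext fun r => Sobolev.add_apply a b _
      map_smul' := fun c a => funext fun r => Sobolev.smul_apply c a _ }
  have hcont : Continuous (Hol G (fun r => μ (r : UnitAddCircle))) :=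
    continuous_iff_continuousAt.2 fun s =>
      ((isParallel_iff.1 (isParallel_hol (G := G) μ.continuous_real)).2 s).continuousAt
  obtain ⟨L, hL⟩ := Sobolev.exists_integral_clm hr
    (A := fun r : ℝ => AdL (E := E) (Hol G (fun r => μ (r : UnitAddCircle)) r))
    (continuous_AdL.comp hcont) s
  have h := hasD_hol (G := G) J (fun a => a.continuous_real) (C := C) (fun a s _ => hC a s) μ hs
    (L := L) hL
  have h2 := h.mD_eq
  have h3 : holForm G μ a s = rightMCL (Hol G (fun r => μ (r : UnitAddCircle)) s)
      (mD 𝓘(ℝ, Sobolev (f - 1 / 2) E) 𝓘(ℝ, E) (fun ν => Hol G (J ν) s) μ a) := rfl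
  rw [h3, h2]
  refine (rightMCL_rightL _ _).trans (hL a)

lemma deriv_holForm (hr : 1 / 2 < f - 1 / 2) (μ a : Sobolev (f - 1 / 2) E) {s : ℝ}
    (hs : s ∈ Ioo (-2 : ℝ) 2) :
    deriv (holForm G μ a) s =
      AdL (Hol G (fun r => μ (r : UnitAddCircle)) s) (a (s : UnitAddCircle)) := by
  have hcont : Continuous (Hol G (fun r => μ (r : UnitAddCircle))) :=
    continuous_iff_continuousAt.2 fun s =>
      ((isParallel_iff.1 (isParallel_hol (G := G) μ.continuous_real)).2 s).continuousAt
  have hc : Continuous fun r : ℝ =>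
      AdL (Hol G (fun r => μ (r : UnitAddCircle)) r) (a (r : UnitAddCircle)) :=
    (continuous_AdL.comp hcont).clm_apply a.continuous_real
  have h1 : holForm G μ a =ᶠ[𝓝 s] fun s => ∫ r in (0 : ℝ)..s,
      AdL (Hol G (fun r => μ (r : UnitAddCircle)) r) (a (r : UnitAddCircle)) := by
    filter_upwards [isOpen_Ioo.mem_nhds hs] with r hr' using holForm_eq hr μ a hr'
  rw [h1.deriv_eq]
  exact (intervalIntegral.integral_hasDerivAt_right (hc.intervalIntegrable _ _)
    hc.aestronglyMeasurable.stronglyMeasurableAtFilter hc.continuousAt).deriv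

lemma varpi_lieInclusion {T : Subgroup G} [ChartedSpace ET T] [LieGroup 𝓘(ℝ, ET) ∞ T]
    (hs : IsSplitEmbedding ET E (Subtype.val : T → G)) (hr : 1 / 2 < f - 1 / 2)
    (B : E →L[ℝ] E →L[ℝ] ℝ) (μ a b : Sobolev (f - 1 / 2) ET) :
    varpi G B (Sobolev.map _ (lieInclusion E T) μ) (Sobolev.map _ (lieInclusion E T) a)
      (Sobolev.map _ (lieInclusion E T) b) = varpi T (restrictInner ET T B) μ a b := by
  have hhol : ∀ s, Hol G (fun r => (Sobolev.map _ (lieInclusion E T) μ) (r : UnitAddCircle)) s =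
      (Hol T (fun r => μ (r : UnitAddCircle)) s : G) := fun s => hol_val hs μ.continuous_real s
  have hcont : Continuous (Hol T (fun r => μ (r : UnitAddCircle))) :=
    continuous_iff_continuousAt.2 fun s =>
      ((isParallel_iff.1 (isParallel_hol (G := T) μ.continuous_real)).2 s).continuousAt
  have h1 : ∀ c : Sobolev (f - 1 / 2) ET, ∀ s ∈ Ioo (-2 : ℝ) 2,
      holForm G (Sobolev.map _ (lieInclusion E T) μ) (Sobolev.map _ (lieInclusion E T) c) s =
        lieInclusion E T (holForm T μ c s) := by
    intro c s hs'
    have hc : Continuous fun r : ℝ =>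
        AdL (Hol T (fun r => μ (r : UnitAddCircle)) r) (c (r : UnitAddCircle)) :=
      (continuous_AdL.comp hcont).clm_apply c.continuous_real
    rw [holForm_eq hr _ _ hs', holForm_eq hr _ _ hs',
      ← ContinuousLinearMap.intervalIntegral_comp_comm _ (hc.intervalIntegrable _ _)]
    refine intervalIntegral.integral_congr fun r _ => ?_
    change AdL (Hol G (fun r => (Sobolev.map _ (lieInclusion E T) μ) (r : UnitAddCircle)) r)
      (lieInclusion E T (c (r : UnitAddCircle))) = _
    rw [hhol, AdL_val hs]
  have h2 : ∀ c : Sobolev (f - 1 / 2) ET, ∀ s ∈ Ioo (-2 : ℝ) 2,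
      deriv (holForm G (Sobolev.map _ (lieInclusion E T) μ) (Sobolev.map _ (lieInclusion E T) c)) s =
        lieInclusion E T (deriv (holForm T μ c) s) := by
    intro c s hs'
    rw [deriv_holForm hr _ _ hs', deriv_holForm hr _ _ hs', hhol, Sobolev.map_apply, AdL_val hs]
  unfold varpi
  congr 1
  refine intervalIntegral.integral_congr fun s hs' => ?_
  rw [uIcc_of_le zero_le_one] at hs'
  have hs2 : s ∈ Ioo (-2 : ℝ) 2 := ⟨by linarith [hs'.1], by linarith [hs'.2]⟩
  simp only [h1 _ s hs2, h2 _ s hs2]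
  rfl

lemma varpi_const {T : Type*} [TopologicalSpace T] [ChartedSpace ET T] [Group T]
    [LieGroup 𝓘(ℝ, ET) ∞ T] [T2Space T] (hab : ∀ a b : T, a * b = b * a) (hr : 1 / 2 < f - 1 / 2)
    {B : ET →L[ℝ] ET →L[ℝ] ℝ} (hB : ∀ X Y, B X Y = B Y X) (μ : Sobolev (f - 1 / 2) ET) (X Y : ET) :
    varpi T B μ (Sobolev.const _ X) (Sobolev.const _ Y) = 0 := by
  unfold varpi
  rw [intervalIntegral.integral_congr (g := fun _ => (0 : ℝ)), intervalIntegral.integral_zero,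
    mul_zero]
  intro s hs'
  rw [uIcc_of_le zero_le_one] at hs'
  have hs2 : s ∈ Ioo (-2 : ℝ) 2 := ⟨by linarith [hs'.1], by linarith [hs'.2]⟩
  simp only [deriv_holForm hr _ _ hs2, holForm_eq hr _ _ hs2, AdL_of_comm hab,
    ContinuousLinearMap.id_apply, Sobolev.const_apply, intervalIntegral.integral_const, sub_zero,
    map_smul, smul_apply, smul_eq_mul]
  rw [hB X Y, sub_self]

end HolForm


/-! ### Fixed point sets as submanifolds -/

section FixedPoints

variable {E : Type*} [NormedAddCommGroup E] [NormedSpace ℝ E]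
  {G : Type*} [TopologicalSpace G] [ChartedSpace E G] [Group G]
  {EX : Type u} [NormedAddCommGroup EX] [NormedSpace ℝ EX]
  {X : Type*} [TopologicalSpace X] [ChartedSpace EX X]
  {V V' : Type*} [NormedAddCommGroup V] [NormedSpace ℝ V]
  [NormedAddCommGroup V'] [NormedSpace ℝ V']

lemma SliceAt.hasD_r {S : Set X} {x : S} (c : SliceAt V EX S x) {y : X} (hy : y ∈ c.U) :
    HasD 𝓘(ℝ, EX) 𝓘(ℝ, V) c.r y (mD 𝓘(ℝ, EX) 𝓘(ℝ, V) c.r y) :=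
  (c.smooth_r.contMDiffAt (c.isOpen_U.mem_nhds hy)).hasD

lemma SliceAt.hasD_i {S : Set X} {x : S} (c : SliceAt V EX S x) {w : V} (hw : w ∈ c.W) :
    HasD 𝓘(ℝ, V) 𝓘(ℝ, EX) c.i w (mD 𝓘(ℝ, V) 𝓘(ℝ, EX) c.i w) :=
  (c.smooth_i.contMDiffAt (c.isOpen_W.mem_nhds hw)).hasD

/-- Overlapping slices have isomorphic models. -/
lemma SliceAt.nonempty_equiv {S : Set X} {x x' : S} (c : SliceAt V EX S x)
    (c' : SliceAt V' EX S x') {y : X} (hyS : y ∈ S) (hy : y ∈ c.U) (hy' : y ∈ c'.U) :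
    Nonempty (V ≃L[ℝ] V') := by
  have hir := c.i_r y hyS hy
  have hir' := c'.i_r y hyS hy'
  have hW := c.r_mem y hyS hy
  have hW' := c'.r_mem y hyS hy'
  have h1 := (c'.hasD_r hy').comp (c.hasD_i hW) hir
  have h2 := (c.hasD_r hy).comp (c'.hasD_i hW') hir'
  have hc : ∀ᶠ w in 𝓝 (c.r y), w ∈ c.W ∧ c.i w ∈ c'.U := by
    refine Filter.Eventually.and (c.isOpen_W.mem_nhds hW) ?_
    exact (c.hasD_i hW).continuousAt.preimage_mem_nhds (c'.isOpen_U.mem_nhds (by rwa [hir]))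
  have hc' : ∀ᶠ w in 𝓝 (c'.r y), w ∈ c'.W ∧ c'.i w ∈ c.U := by
    refine Filter.Eventually.and (c'.isOpen_W.mem_nhds hW') ?_
    exact (c'.hasD_i hW').continuousAt.preimage_mem_nhds (c.isOpen_U.mem_nhds (by rwa [hir']))
  have h12 := (h2.comp h1 (by simp only [hir])).unique ((hasD_id (I := 𝓘(ℝ, V)) (c.r y)).congr (by
    filter_upwards [hc] with w hw
    have := c'.i_r (c.i w) (c.i_mem w hw.1) hw.2
    rw [this, c.r_i w hw.1]))
  have h21 := (h1.comp h2 (by simp only [hir'])).unique ((hasD_id (I := 𝓘(ℝ, V')) (c'.r y)).congr (by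
    filter_upwards [hc'] with w hw
    have := c.i_r (c'.i w) (c'.i_mem w hw.1) hw.2
    rw [this, c'.r_i w hw.1]))
  obtain ⟨Q, -⟩ := exists_equiv_of_inverse h12 h21
  exact ⟨Q⟩

variable [LieGroup 𝓘(ℝ, E) ∞ G] [CompactSpace G] [T2Space G] [CompleteSpace E]
  [FiniteDimensional ℝ E] [T2Space X]
  [IsManifold 𝓘(ℝ, EX) ∞ X] [CompleteSpace EX] {a : G → X → X} {t : G}

/-- `S` is a union of connected components of the fixed point set of `t`. -/
def IsFixedUnion (a : G → X → X) (t : G) (S : Set X) : Prop :=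
  S ⊆ {x | a t x = x} ∧ ∀ C ⊆ {x | a t x = x}, IsPreconnected C → (C ∩ S).Nonempty → C ⊆ S

lemma isFixedUnion_connectedComponentIn (x₀ : X) :
    IsFixedUnion a t (connectedComponentIn {x | a t x = x} x₀) := by
  refine ⟨connectedComponentIn_subset _ _, ?_⟩
  rintro C hC hpre ⟨x, hxC, hx⟩
  rw [connectedComponentIn_eq hx]
  exact hpre.subset_connectedComponentIn hxC hC

/-- The linearization at a fixed point, adapted to a union of components. -/
lemma IsFixedUnion.exists_linearization {S : Set X} (hS : IsFixedUnion a t S)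
    (ha : IsSmoothAction E EX a) {x₀ : X} (hx₀ : x₀ ∈ S) :
    ∃ (e : OpenPartialHomeomorph X EX) (P : EX →L[ℝ] EX) (ε : ℝ), 0 < ε ∧ x₀ ∈ e.source ∧
      Metric.ball 0 ε ⊆ e.target ∧
      ContMDiffOn 𝓘(ℝ, EX) 𝓘(ℝ, EX) ∞ e e.source ∧
      ContMDiffOn 𝓘(ℝ, EX) 𝓘(ℝ, EX) ∞ e.symm e.target ∧ e x₀ = 0 ∧
      HasD 𝓘(ℝ, EX) 𝓘(ℝ, EX) e x₀ (ContinuousLinearMap.id ℝ EX) ∧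
      HasD 𝓘(ℝ, EX) 𝓘(ℝ, EX) e.symm 0 (ContinuousLinearMap.id ℝ EX) ∧
      (∀ w, P (P w) = P w) ∧ (∀ x ∈ S, x ∈ e.source → P (e x) = e x) ∧
      (∀ w ∈ Metric.ball 0 ε, P w = w → e.symm w ∈ S) ∧
      ∀ (l : EX →L[ℝ] ℝ) (w : EX) (z : ℝ),
        (∀ n : ℤ, l (mD 𝓘(ℝ, EX) 𝓘(ℝ, EX) (a (t ^ n)) x₀ w) = z) → l (P w) = z := by
  obtain ⟨e, P, hxe, hes, hest, he0, heD, hP, hfix, hl⟩ := ha.exists_linearization (hS.1 hx₀)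
  have h0t : (0 : EX) ∈ e.target := by rw [← he0]; exact e.map_source hxe
  obtain ⟨ε, hε, hball⟩ := Metric.mem_nhds_iff.1 (e.open_target.mem_nhds h0t)
  have hsymm0 : e.symm 0 = x₀ := by rw [← he0]; exact e.left_inv hxe
  refine ⟨e, P, ε, hε, hxe, hball, hes, hest, he0, heD, ?_, hP,
    fun x hx hxs => (hfix x hxs).1 (hS.1 hx), ?_, hl⟩
  · have h1 := (hest.contMDiffAt (e.open_target.mem_nhds h0t)).hasD
    have h2 := (h1.comp heD he0).unique ((hasD_id (I := 𝓘(ℝ, EX)) x₀).congr (by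
      filter_upwards [e.open_source.mem_nhds hxe] with y hy using e.left_inv hy))
    rw [ContinuousLinearMap.comp_id] at h2
    rwa [h2] at h1
  · have hC : IsPreconnected (e.symm '' {w | w ∈ Metric.ball (0 : EX) ε ∧ P w = w}) := by
      refine IsPreconnected.image (Convex.isPreconnected ?_) _
        (e.continuousOn_symm.mono fun w hw => hball hw.1)
      refine (convex_ball (0 : EX) ε).inter ?_
      intro x hx y hy a b _ _ _
      change P (a • x + b • y) = a • x + b • y
      rw [map_add, map_smul, map_smul, show P x = x from hx, show P y = y from hy]
    intro w hw hPw
    refine hS.2 _ ?_ hC ⟨x₀, ⟨0, ⟨Metric.mem_ball_self hε, map_zero P⟩, hsymm0⟩, hx₀⟩ ⟨w, ⟨hw, hPw⟩, rfl⟩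
    rintro _ ⟨v, ⟨hv, hPv⟩, rfl⟩
    refine (hfix _ (e.map_target (hball hv))).2 ?_
    rw [e.right_inv (hball hv), hPv]

/-- Averages of tangent vectors over the closed subgroup generated by `t` are tangent to the fixed
point set. -/
lemma IsFixedUnion.exists_average {S : Set X} (hS : IsFixedUnion a t S)
    (ha : IsSmoothAction E EX a) [ChartedSpace V S]
    (hι : IsSplitEmbedding V EX (Subtype.val : S → X)) (x : S) (w : EX) :
    ∃ v : V, ∀ (l : EX →L[ℝ] ℝ) (z : ℝ),
      (∀ n : ℤ, l (mD 𝓘(ℝ, EX) 𝓘(ℝ, EX) (a (t ^ n)) x w) = z) →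
        l (mD 𝓘(ℝ, V) 𝓘(ℝ, EX) (Subtype.val : S → X) x v) = z := by
  obtain ⟨e, P, ε, hε, hxe, hball, hes, hest, he0, heD, hesD, hP, hfix, hmem, hl⟩ :=
    hS.exists_linearization ha x.2
  have hsymm0 : e.symm 0 = x := by rw [← he0]; exact e.left_inv hxe
  classical
  let g : ℝ → S := fun s => if h : e.symm (s • P w) ∈ S then ⟨e.symm (s • P w), h⟩ else x
  have hg0 : g 0 = x := by
    apply Subtype.ext
    simp [g, hsymm0]
  have hsm : HasD 𝓘(ℝ, ℝ) 𝓘(ℝ, EX) (fun s : ℝ => s • P w) 0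
      (ContinuousLinearMap.smulRight (1 : ℝ →L[ℝ] ℝ) (P w)) := by
    rw [hasD_iff_hasFDerivAt]
    exact (ContinuousLinearMap.smulRight (1 : ℝ →L[ℝ] ℝ) (P w)).hasFDerivAt
  have hgD : HasD 𝓘(ℝ, ℝ) 𝓘(ℝ, EX) (fun s => (g s : X)) 0
      (ContinuousLinearMap.smulRight (1 : ℝ →L[ℝ] ℝ) (P w)) := by
    refine ((hesD.comp hsm (by simp)).congr ?_)
    have : (fun s : ℝ => s • P w) ⁻¹' Metric.ball 0 ε ∈ 𝓝 (0 : ℝ) :=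
      hsm.continuousAt.preimage_mem_nhds (by simpa using Metric.ball_mem_nhds (0 : EX) hε)
    filter_upwards [this] with s hs
    have hm : e.symm (s • P w) ∈ S := hmem _ hs (by rw [map_smul, hP])
    simp [g, hm]
  obtain ⟨L', -, hL⟩ := hι.exists_hasD hgD
  refine ⟨L' 1, fun l z hz => ?_⟩
  have h1 := congrArg (fun L : ℝ →L[ℝ] EX => L 1) hL
  rw [hg0] at h1
  simp only [ContinuousLinearMap.comp_apply, ContinuousLinearMap.smulRight_apply,
    one_apply_eq_self, one_smul] at h1
  rw [h1]
  exact hl l w z hz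

/-- Near a fixed point, the fixed point set is a finite-dimensional slice. -/
lemma IsFixedUnion.exists_sliceAt {S : Set X} (hS : IsFixedUnion a t S)
    (ha : IsSmoothAction E EX a) [FiniteDimensional ℝ EX] (x : S) :
    ∃ k : ℕ, Nonempty (SliceAt (EuclideanSpace ℝ (Fin k)) EX S x) := by
  obtain ⟨e, P, ε, hε, hxe, hball, hes, hest, he0, heD, hesD, hP, hfix, hmem, hl⟩ :=
    hS.exists_linearization ha x.2
  let R := LinearMap.range (P : EX →ₗ[ℝ] EX)
  let φ : R ≃L[ℝ] EuclideanSpace ℝ (Fin (Module.finrank ℝ R)) :=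
    ContinuousLinearEquiv.ofFinrankEq (by simp)
  let P' : EX →L[ℝ] R := P.codRestrict R fun w => ⟨w, rfl⟩
  have hPR : ∀ v : R, P v = v := by
    rintro ⟨_, w, rfl⟩
    exact hP w
  let j : EuclideanSpace ℝ (Fin (Module.finrank ℝ R)) →L[ℝ] EX :=
    R.subtypeL.comp (φ.symm : _ →L[ℝ] R)
  let q : EX →L[ℝ] EuclideanSpace ℝ (Fin (Module.finrank ℝ R)) := (φ : R →L[ℝ] _).comp P'
  have hqj : ∀ w, q (j w) = w := by
    intro w
    have : P' (j w) = φ.symm w := Subtype.ext (hPR (φ.symm w))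
    change φ (P' (j w)) = w
    rw [this, φ.apply_symm_apply]
  have hjq : ∀ v, j (q v) = P v := by
    intro v
    change ((φ.symm (φ (P' v)) : R) : EX) = P v
    rw [φ.symm_apply_apply]
    rfl
  have hPj : ∀ w, P (j w) = j w := fun w => hPR _
  have hO : IsOpen (j ⁻¹' Metric.ball 0 ε) := Metric.isOpen_ball.preimage j.continuous
  obtain ⟨c, -⟩ := LoopGeometry.exists_sliceAt (V := EuclideanSpace ℝ (Fin (Module.finrank ℝ R)))
    (EN := EX) x (r := fun y => q (e y)) (i := fun w => e.symm (j w)) (U := e.source)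
    (W := j ⁻¹' Metric.ball 0 ε) e.open_source hO hxe
    (by simpa [he0] using hε) (q.contDiff.contMDiff.comp_contMDiffOn hes)
    (hest.comp j.contDiff.contMDiff.contMDiffOn fun w hw => hball hw)
    (fun w hw _ => hmem _ hw (hPj w))
    (fun w hw _ => by simp only [e.right_inv (hball hw), hqj])
    (fun y hyS hy _ => by simp only [hjq, hfix y hyS hy, e.left_inv hy])
  exact ⟨_, ⟨c⟩⟩

/-- A component of the fixed point set is a submanifold. -/
lemma exists_slices_connectedComponentIn (ha : IsSmoothAction E EX a) [FiniteDimensional ℝ EX]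
    (x₀ : X) : ∃ k : ℕ, Nonempty (∀ x : connectedComponentIn {x | a t x = x} x₀,
      SliceAt (EuclideanSpace ℝ (Fin k)) EX (connectedComponentIn {x | a t x = x} x₀) x) := by
  set S := connectedComponentIn {x | a t x = x} x₀
  have hS : IsFixedUnion a t S := isFixedUnion_connectedComponentIn x₀
  choose k c using fun x : S => hS.exists_sliceAt ha x
  have hpre : PreconnectedSpace S :=
    isPreconnected_iff_preconnectedSpace.1 isPreconnected_connectedComponentIn
  have hlc : IsLocallyConstant k := by
    rw [IsLocallyConstant.iff_eventually_eq]
    intro x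
    obtain ⟨cx⟩ := c x
    have : Subtype.val ⁻¹' cx.U ∈ 𝓝 x :=
      (cx.isOpen_U.preimage continuous_subtype_val).mem_nhds cx.mem_U
    filter_upwards [this] with y hy
    obtain ⟨cy⟩ := c y
    obtain ⟨Q⟩ := cy.nonempty_equiv cx y.2 cy.mem_U hy
    simpa using Q.toLinearEquiv.finrank_eq
  rcases isEmpty_or_nonempty S with hemp | ⟨⟨x⟩⟩
  · exact ⟨0, ⟨fun x => hemp.elim x⟩⟩
  · refine ⟨k x, ⟨fun y => ?_⟩⟩
    rw [← hlc.apply_eq_of_preconnectedSpace y x]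
    exact (c y).some

end FixedPoints


/-! ### Pull-backs of 2-forms -/

section TwoForms

variable {E : Type*} [NormedAddCommGroup E] [NormedSpace ℝ E]
  {M : Type*} [TopologicalSpace M] [ChartedSpace E M]
  {E' : Type*} [NormedAddCommGroup E'] [NormedSpace ℝ E']
  {N : Type*} [TopologicalSpace N] [ChartedSpace E' N]
  {E'' : Type*} [NormedAddCommGroup E''] [NormedSpace ℝ E'']
  {K : Type*} [TopologicalSpace K] [ChartedSpace E'' K]

lemma Form.pullback_apply₂ (φ : N → M) (σ : Form E M 2) (x : N) (u v : E') :
    Form.val (Form.pullback φ σ : Form E' N 2) x ![u, v] = Form.val σ (φ x)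
      ![mD 𝓘(ℝ, E') 𝓘(ℝ, E) φ x u, mD 𝓘(ℝ, E') 𝓘(ℝ, E) φ x v] := by
  rw [Form.val_pullback, ContinuousAlternatingMap.compContinuousLinearMap_apply]
  congr 1
  funext i
  fin_cases i <;> rfl

lemma Form.ext₂ {σ τ : Form E M 2} (h : ∀ x u v, σ.val x ![u, v] = τ.val x ![u, v]) : σ = τ := by
  funext x
  refine ContinuousAlternatingMap.ext fun w => ?_
  have hw : w = ![w 0, w 1] := by
    funext i
    fin_cases i <;> rfl
  rw [hw]
  exact h x _ _

lemma Form.pullback_pullback {φ : N → M} {ψ : K → N} (hφ : ContMDiff 𝓘(ℝ, E') 𝓘(ℝ, E) ∞ φ)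
    (hψ : ContMDiff 𝓘(ℝ, E'') 𝓘(ℝ, E') ∞ ψ) (σ : Form E M 2) :
    (Form.pullback ψ (Form.pullback φ σ : Form E' N 2) : Form E'' K 2) =
      Form.pullback (fun x => φ (ψ x)) σ := by
  refine Form.ext₂ fun x u v => ?_
  rw [Form.pullback_apply₂, Form.pullback_apply₂, Form.pullback_apply₂,
    ((hφ.hasD (ψ x)).comp (hψ.hasD x) rfl).mD_eq]
  rfl

lemma exists_contract (κ : E [⋀^Fin 2]→L[ℝ] ℝ) (u : E) :
    ∃ l : E →L[ℝ] ℝ, ∀ w, l w = κ ![u, w] := by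
  refine ⟨κ.toContinuousMultilinearMap.toContinuousLinearMap ![u, 0] 1, fun w => ?_⟩
  change κ (Function.update ![u, 0] 1 w) = _
  congr 1
  funext i
  fin_cases i <;> rfl

end TwoForms

/-! ### Fixed point sets and invariant forms -/

section FixedForms

variable {E : Type*} [NormedAddCommGroup E] [NormedSpace ℝ E] [CompleteSpace E]
  [FiniteDimensional ℝ E]
  {G : Type*} [TopologicalSpace G] [ChartedSpace E G] [Group G] [LieGroup 𝓘(ℝ, E) ∞ G]
  [CompactSpace G] [T2Space G]
  {EX : Type u} [NormedAddCommGroup EX] [NormedSpace ℝ EX] [CompleteSpace EX]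
  {X : Type*} [TopologicalSpace X] [ChartedSpace EX X] [T2Space X] [IsManifold 𝓘(ℝ, EX) ∞ X]
  {V : Type*} [NormedAddCommGroup V] [NormedSpace ℝ V]
  {a : G → X → X} {t : G}

lemma IsSmoothAction.zpow_fixed (ha : IsSmoothAction E EX a) {x : X} (hx : a t x = x) (n : ℤ) :
    a (t ^ n) x = x := by
  have hnat : ∀ n : ℕ, a (t ^ n) x = x := by
    intro n
    induction n with
    | zero => rw [pow_zero]; exact ha.one x
    | succ n ih => rw [pow_succ, ha.mul, hx, ih]
  rcases n with n | n
  · simpa using hnat n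
  · rw [zpow_negSucc]
    exact ha.inv_fixed (hnat _)

/-- A vector tangent to the fixed point set which annihilates the fixed point set annihilates
everything, for an invariant form. -/
lemma IsFixedUnion.form_eq_zero {S : Set X} (hS : IsFixedUnion a t S)
    (ha : IsSmoothAction E EX a) [ChartedSpace V S]
    (hι : IsSplitEmbedding V EX (Subtype.val : S → X)) {σ : Form EX X 2}
    (hσ : ∀ g, Form.pullback (a g) σ = σ) (x : S) (v : V)
    (hv : ∀ w : V, σ.val x ![mD 𝓘(ℝ, V) 𝓘(ℝ, EX) (Subtype.val : S → X) x v,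
      mD 𝓘(ℝ, V) 𝓘(ℝ, EX) (Subtype.val : S → X) x w] = 0) (w : EX) :
    σ.val x ![mD 𝓘(ℝ, V) 𝓘(ℝ, EX) (Subtype.val : S → X) x v, w] = 0 := by
  obtain ⟨l, hl⟩ := exists_contract (σ.val x) (mD 𝓘(ℝ, V) 𝓘(ℝ, EX) (Subtype.val : S → X) x v)
  obtain ⟨w', hw'⟩ := hS.exists_average ha hι x w
  have hfix : ∀ (n : ℤ) (y : S), a (t ^ n) y = y := fun n y => ha.zpow_fixed (hS.1 y.2) n
  have hv' : ∀ n : ℤ, mD 𝓘(ℝ, EX) 𝓘(ℝ, EX) (a (t ^ n)) x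
      (mD 𝓘(ℝ, V) 𝓘(ℝ, EX) (Subtype.val : S → X) x v) =
      mD 𝓘(ℝ, V) 𝓘(ℝ, EX) (Subtype.val : S → X) x v := by
    intro n
    have h1 := ((ha.smooth_apply (t ^ n)).hasD (x : X)).comp (hι.smooth.hasD x) rfl
    simp only [hfix n] at h1
    exact congrArg (fun L : V →L[ℝ] EX => L v) (h1.unique (hι.smooth.hasD x))
  have h := hw' l (l w) fun n => by
    rw [hl, hl]
    have h2 := congrArg (fun τ : Form EX X 2 => τ.val x
      ![mD 𝓘(ℝ, V) 𝓘(ℝ, EX) (Subtype.val : S → X) x v, w]) (hσ (t ^ n))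
    simp only [Form.pullback_apply₂, hv', hfix n x] at h2
    exact h2
  rw [hl, hv, hl] at h
  exact h.symm

end FixedForms

/-! ### Fixed point components of group-valued Hamiltonian spaces -/

section GroupHamiltonian

variable {E : Type*} [NormedAddCommGroup E] [NormedSpace ℝ E] [CompleteSpace E]
  [FiniteDimensional ℝ E]
  {G : Type*} [TopologicalSpace G] [ChartedSpace E G] [Group G] [LieGroup 𝓘(ℝ, E) ∞ G]
  [T2Space G]
  {ET : Type*} [NormedAddCommGroup ET] [NormedSpace ℝ ET] [CompleteSpace ET]
  [FiniteDimensional ℝ ET]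
  {T : Subgroup G} [ChartedSpace ET T] [LieGroup 𝓘(ℝ, ET) ∞ T]
  {EM : Type u} [NormedAddCommGroup EM] [NormedSpace ℝ EM]
  {M : Type*} [TopologicalSpace M] [ChartedSpace EM M] [MulAction G M]
  {B : E →L[ℝ] E →L[ℝ] ℝ} {σ : Form EM M 2} {Φ : M → G}

lemma exists_fixed_sub {B : E →L[ℝ] E →L[ℝ] ℝ} (hsymm : ∀ X Y, B X Y = B Y X)
    (hpos : ∀ X, X ≠ 0 → 0 < B X X) {A : E →L[ℝ] E} (hinv : ∀ X Y, B (A X) (A Y) = B X Y)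
    {W : Submodule ℝ E} (hW : ∀ X ∈ W, ∃ Y ∈ W, A Y = X) (hW' : ∀ X ∈ W, A X ∈ W) {X : E}
    (hX : A X - X ∈ W) : ∃ Y ∈ W, A (X - Y) = X - Y := by
  let B' : LinearMap.BilinForm ℝ E := LinearMap.mk₂ ℝ (fun X Y => B X Y)
    (by simp) (by simp) (by simp) (by simp)
  have hrefl : B'.IsRefl := fun x y h => by
    change B y x = 0
    rw [hsymm]
    exact h
  have hnd : (B'.restrict W).Nondegenerate := by
    have hs : ∀ m : W, (∀ n : W, B' m n = 0) → m = 0 := by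
      intro m hm
      by_contra h
      exact (hpos m fun h0 => h (Subtype.ext h0)).ne' (hm m)
    refine ⟨hs, fun m hm => hs m fun n => ?_⟩
    change B m n = 0
    rw [hsymm]
    exact hm n
  have hc := LinearMap.BilinForm.isCompl_orthogonal_of_restrict_nondegenerate hrefl hnd
  obtain ⟨Y, hY, Z, hZ, hYZ⟩ := Submodule.mem_sup.1
    (show X ∈ W ⊔ B'.orthogonal W by rw [hc.sup_eq_top]; trivial)
  refine ⟨Y, hY, ?_⟩
  have hXY : X - Y = Z := by rw [← hYZ]; abel
  rw [hXY]
  have hZ' : ∀ w ∈ W, B w Z = 0 := fun w hw => hZ w hw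
  have hmem : A Z - Z ∈ W := by
    have : A Z - Z = (A X - X) - (A Y - Y) := by rw [← hYZ, map_add]; abel
    rw [this]
    exact W.sub_mem hX (W.sub_mem (hW' Y hY) hY)
  obtain ⟨Y', hY', hAY'⟩ := hW _ hmem
  have h0 : B (A Z - Z) (A Z - Z) = 0 := by
    rw [map_sub, hZ' _ hmem, sub_zero, ← hAY', hinv, hZ' _ hY']
  by_contra hne
  exact (hpos _ fun h => hne (sub_eq_zero.1 h)).ne' h0

lemma eq_zero_of_eq_neg {X : E} (h : X = -X) : X = 0 := by
  have h2 : (2 : ℝ) • X = 0 := by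
    rw [two_smul]
    nth_rewrite 2 [h]
    exact add_neg_cancel X
  exact (smul_eq_zero.1 h2).resolve_left two_ne_zero

/-- The generating vector field as a linear map. -/
def genFieldL (E EM : Type*) [NormedAddCommGroup E] [NormedSpace ℝ E] [NormedAddCommGroup EM]
    [NormedSpace ℝ EM] (G : Type*) [TopologicalSpace G] [ChartedSpace E G] [Group G] {M : Type*}
    [TopologicalSpace M] [ChartedSpace EM M] [MulAction G M] (m : M) : E →L[ℝ] EM :=
  -mD 𝓘(ℝ, E) 𝓘(ℝ, EM) (fun g : G => g • m) 1

lemma genField_eq (ξ : E) (m : M) :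
    (genField G ξ m : TangentSpace 𝓘(ℝ, EM) m) = genFieldL E EM G m ξ :=
  map_neg (mD 𝓘(ℝ, E) 𝓘(ℝ, EM) (fun g : G => g • m) 1) ξ

lemma hasD_smul (hM : ContMDiff (𝓘(ℝ, E).prod 𝓘(ℝ, EM)) 𝓘(ℝ, EM) ∞ fun p : G × M => p.1 • p.2)
    (m : M) : HasD 𝓘(ℝ, E) 𝓘(ℝ, EM) (fun g : G => g • m) 1 (-genFieldL E EM G m) := by
  have := (hM.comp (contMDiff_id.prodMk (contMDiff_const (c := m)))).hasD (1 : G)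
  rwa [genFieldL, neg_neg]

lemma isSmoothAction_smul
    (hM : ContMDiff (𝓘(ℝ, E).prod 𝓘(ℝ, EM)) 𝓘(ℝ, EM) ∞ fun p : G × M => p.1 • p.2) :
    IsSmoothAction E EM fun (g : G) (m : M) => g • m :=
  ⟨one_smul G, mul_smul, hM⟩

lemma mD_smul_genFieldL
    (hM : ContMDiff (𝓘(ℝ, E).prod 𝓘(ℝ, EM)) 𝓘(ℝ, EM) ∞ fun p : G × M => p.1 • p.2) {g : G} {m : M}
    (hg : g • m = m) (ξ : E) :
    mD 𝓘(ℝ, EM) 𝓘(ℝ, EM) (fun x : M => g • x) m (genFieldL E EM G m ξ) =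
      genFieldL E EM G m (AdL g ξ) := by
  have h1 := (((isSmoothAction_smul hM).smooth_apply g).hasD m).comp (hasD_smul hM m) (one_smul G m)
  have h2 := (hasD_smul hM m).comp (hasD_conj (E := E) g) (by simp)
  have h3 : (fun h : G => g • h • m) = fun h : G => (g * h * g⁻¹) • m := by
    funext h
    have hi : g⁻¹ • m = m := by rw [inv_smul_eq_iff, hg]
    rw [mul_smul, hi, mul_smul]
  rw [h3] at h1
  have h4 := congrArg (fun L : E →L[ℝ] EM => -L ξ) (h1.unique h2)
  simpa using h4

lemma genFieldL_restrict (hs : IsSplitEmbedding ET E (Subtype.val : T → G))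
    (hM : ContMDiff (𝓘(ℝ, E).prod 𝓘(ℝ, EM)) 𝓘(ℝ, EM) ∞ fun p : G × M => p.1 • p.2)
    {V : Type*} [NormedAddCommGroup V] [NormedSpace ℝ V] {F : Type*} [TopologicalSpace F]
    [ChartedSpace V F] [MulAction T F] {ι : F → M} (hι : IsSplitEmbedding V EM ι)
    (hact : ∀ (τ : T) (x : F), ι (τ • x) = (τ : G) • ι x) (x : F) (ξ : ET) :
    mD 𝓘(ℝ, V) 𝓘(ℝ, EM) ι x (genFieldL ET V T x ξ) =
      genFieldL E EM G (ι x) (lieInclusion E T ξ) := by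
  have h1 := (hasD_smul hM (ι x)).comp (hasD_val hs 1) rfl
  have h1' : HasD 𝓘(ℝ, ET) 𝓘(ℝ, EM) (fun τ : T => ι (τ • x)) 1
      ((-genFieldL E EM G (ι x)).comp (mD 𝓘(ℝ, ET) 𝓘(ℝ, E) (Subtype.val : T → G) 1)) := by
    simp only [hact]
    exact h1
  obtain ⟨L, hL, hLc⟩ := hι.exists_hasD h1'
  rw [one_smul] at hLc
  have h2 := congrArg (fun L : ET →L[ℝ] EM => -L ξ) hLc
  have h3 : genFieldL ET V T x = -L := congrArg Neg.neg hL.mD_eq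
  rw [h3, lieInclusion_eq]
  simpa using h2

variable [CompactSpace G]
  {V : Type*} [NormedAddCommGroup V] [NormedSpace ℝ V] [FiniteDimensional ℝ V]
  {F : Set M} [ChartedSpace V F] [IsManifold 𝓘(ℝ, V) ∞ F] [MulAction T F] {ΦF : F → T} {t : G}

theorem IsGroupHamiltonian.restrict_fixed (hM : IsGroupHamiltonian B σ Φ)
    (hB : IsInvariantInner G B) (hs : IsSplitEmbedding ET E (Subtype.val : T → G))
    (hab : ∀ a b : T, a * b = b * a) (hreg : Subgroup.centralizer {t} = T)
    (hF : IsFixedUnion (fun (g : G) (m : M) => g • m) t F) (hFc : IsClosed F)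
    (hι : IsSplitEmbedding V EM (Subtype.val : F → M))
    (hact : ∀ (τ : T) (x : F), ((τ • x : F) : M) = (τ : G) • (x : M))
    (hΦF : ∀ x : F, (ΦF x : G) = Φ x) :
    IsGroupHamiltonian (restrictInner ET T B) (σ.restrict V F) ΦF := by
  have := hM.finiteDimensional
  have := hM.isManifold
  have := hM.t2
  have := hM.compact
  have : CompleteSpace EM := FiniteDimensional.complete ℝ EM
  have ha := isSmoothAction_smul hM.smooth_action
  have hΦD : ∀ (x : F) (v : V), mD 𝓘(ℝ, EM) 𝓘(ℝ, E) Φ x (mD 𝓘(ℝ, V) 𝓘(ℝ, EM) Subtype.val x v) =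
      mD 𝓘(ℝ, ET) 𝓘(ℝ, E) (Subtype.val : T → G) (ΦF x) (mD 𝓘(ℝ, V) 𝓘(ℝ, ET) ΦF x v) := by
    intro x v
    have h1 := (hM.smooth_moment.hasD (x : M)).comp (hι.smooth.hasD x) rfl
    simp only [← hΦF] at h1
    obtain ⟨L, hL, hLc⟩ := hs.exists_hasD h1
    rw [hL.mD_eq]
    exact (congrArg (fun L : V →L[ℝ] E => L v) hLc).symm
  have hleft : ∀ (x : F) (v : V), leftMCL (Φ x) (mD 𝓘(ℝ, EM) 𝓘(ℝ, E) Φ x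
      (mD 𝓘(ℝ, V) 𝓘(ℝ, EM) Subtype.val x v)) =
      lieInclusion E T (leftMCL (ΦF x) (mD 𝓘(ℝ, V) 𝓘(ℝ, ET) ΦF x v)) := fun x v => by
    rw [hΦD, ← leftMCL_val hs, hΦF]
  have hright : ∀ (x : F) (v : V), rightMCL (Φ x) (mD 𝓘(ℝ, EM) 𝓘(ℝ, E) Φ x
      (mD 𝓘(ℝ, V) 𝓘(ℝ, EM) Subtype.val x v)) =
      lieInclusion E T (rightMCL (ΦF x) (mD 𝓘(ℝ, V) 𝓘(ℝ, ET) ΦF x v)) := fun x v => by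
    rw [hΦD, ← rightMCL_val hs, hΦF]
  have hsmooth_act : ContMDiff (𝓘(ℝ, ET).prod 𝓘(ℝ, V)) 𝓘(ℝ, V) ∞ fun p : T × F => p.1 • p.2 := by
    refine hι.contMDiff ?_
    simp only [hact]
    exact hM.smooth_action.comp ((hs.smooth.comp contMDiff_fst).prodMk
      (hι.smooth.comp contMDiff_snd))
  refine
    { finiteDimensional := inferInstance
      isManifold := inferInstance
      t2 := inferInstance
      compact := isCompact_iff_compactSpace.1 hFc.isCompact
      smooth_action := hsmooth_act
      smooth_form := hM.smooth_form.pullback hι.smooth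
      invariant := fun τ => ?_
      smooth_moment := hs.contMDiff (by simp only [hΦF]; exact hM.smooth_moment.comp hι.smooth)
      equivariant := fun τ x => Subtype.ext (by simp [hΦF, hact, hM.equivariant])
      d_form := fun x u v w => ?_
      moment := fun ξ x v => ?_
      kernel := fun x v => ?_ }
  · have hτ := (isSmoothAction_smul hsmooth_act).smooth_apply τ
    unfold Form.restrict
    rw [Form.pullback_pullback hι.smooth hτ]
    simp only [hact]
    rw [← Form.pullback_pullback (ha.smooth_apply (τ : G)) hι.smooth]
    rw [hM.invariant]
  · have h1 := Form.d_pullback hι.smooth hM.smooth_form x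
    have h2 := congrArg (fun κ : V [⋀^Fin 3]→L[ℝ] ℝ => κ ![u, v, w]) h1
    have h3 : (fun i => mD 𝓘(ℝ, V) 𝓘(ℝ, EM) (Subtype.val : F → M) x ((![u, v, w] : Fin 3 → V) i)) =
        ![mD 𝓘(ℝ, V) 𝓘(ℝ, EM) (Subtype.val : F → M) x u,
          mD 𝓘(ℝ, V) 𝓘(ℝ, EM) (Subtype.val : F → M) x v,
          mD 𝓘(ℝ, V) 𝓘(ℝ, EM) (Subtype.val : F → M) x w] := by
      funext i
      fin_cases i <;> rfl
    have h4 := hM.d_form x (mD 𝓘(ℝ, V) 𝓘(ℝ, EM) (Subtype.val : F → M) x u)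
      (mD 𝓘(ℝ, V) 𝓘(ℝ, EM) (Subtype.val : F → M) x v)
      (mD 𝓘(ℝ, V) 𝓘(ℝ, EM) (Subtype.val : F → M) x w)
    have h5 : ∀ v w : V, lieBracket G (leftMCL (Φ x) (mD 𝓘(ℝ, EM) 𝓘(ℝ, E) Φ x
        (mD 𝓘(ℝ, V) 𝓘(ℝ, EM) Subtype.val x v))) (leftMCL (Φ x) (mD 𝓘(ℝ, EM) 𝓘(ℝ, E) Φ x
        (mD 𝓘(ℝ, V) 𝓘(ℝ, EM) Subtype.val x w))) = 0 := fun v w => by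
      rw [hleft, hleft, lieBracket_lieInclusion hs hab]
    have h6 : ∀ Y : E, Y = 0 → ∀ X : E, (1 / 2 : ℝ) * B X Y = 0 := by
      rintro _ rfl X
      simp
    have h7 : ∀ Y : ET, Y = 0 → ∀ X : ET, (1 / 2 : ℝ) * restrictInner ET T B X Y = 0 := by
      rintro _ rfl X
      simp
    refine Eq.trans ?_ (h7 _ (lieBracket_of_comm hab _ _) _).symm
    refine Eq.trans ?_ (h4.trans (h6 _ (h5 v w) _))
    refine h2.trans ?_
    exact congrArg (σ.d.val x) h3
  · have h1 := hM.moment (lieInclusion E T ξ) x (mD 𝓘(ℝ, V) 𝓘(ℝ, EM) (Subtype.val : F → M) x v)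
    have h2 := Form.pullback_apply₂ (Subtype.val : F → M) σ x (genFieldL ET V T x ξ) v
    rw [genFieldL_restrict hs hM.smooth_action hι hact] at h2
    refine Eq.trans ?_ (h2.trans (Eq.trans ?_ (h1.trans ?_)))
    · rw [genField_eq]; rfl
    · rw [genField_eq]; rfl
    · have h3 : ∀ v : V, (1 / 2 : ℝ) * B (leftMCL (Φ x) (mD 𝓘(ℝ, EM) 𝓘(ℝ, E) Φ x
          (mD 𝓘(ℝ, V) 𝓘(ℝ, EM) Subtype.val x v)) + rightMCL (Φ x) (mD 𝓘(ℝ, EM) 𝓘(ℝ, E) Φ x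
          (mD 𝓘(ℝ, V) 𝓘(ℝ, EM) Subtype.val x v))) (lieInclusion E T ξ) =
          (1 / 2 : ℝ) * B (lieInclusion E T (leftMCL (ΦF x) (mD 𝓘(ℝ, V) 𝓘(ℝ, ET) ΦF x v) +
            rightMCL (ΦF x) (mD 𝓘(ℝ, V) 𝓘(ℝ, ET) ΦF x v))) (lieInclusion E T ξ) := by
        intro v
        rw [hleft, hright, map_add (lieInclusion E T)]
      exact h3 v
  · have hAd : ∀ ξ : ET, Ad (ΦF x) ξ = ξ := fun ξ => by rw [Ad_eq, AdL_of_comm hab]; rfl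
    constructor
    · intro hv
      have hv1 : ∀ w : V, σ.val x ![mD 𝓘(ℝ, V) 𝓘(ℝ, EM) (Subtype.val : F → M) x v,
          mD 𝓘(ℝ, V) 𝓘(ℝ, EM) (Subtype.val : F → M) x w] = 0 := fun w =>
        (Form.pullback_apply₂ (E' := V) (Subtype.val : F → M) σ x v w).symm.trans (hv w)
      have hv2 := hF.form_eq_zero ha hι hM.invariant x v hv1
      obtain ⟨ξ, hξ, hvξ⟩ := (hM.kernel x _).1 hv2
      rw [genField_eq] at hvξ
      rw [Ad_eq] at hξ
      have htx : t • (x : M) = x := hF.1 x.2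
      let W : Submodule ℝ E :=
        LinearMap.ker ((AdL (Φ x) + ContinuousLinearMap.id ℝ E : E →L[ℝ] E) : E →ₗ[ℝ] E) ⊓
        LinearMap.ker ((genFieldL E EM G (x : M) : E →L[ℝ] EM) : E →ₗ[ℝ] EM)
      have hWmem : ∀ X, X ∈ W ↔ AdL (Φ x) X = -X ∧ genFieldL E EM G (x : M) X = 0 := by
        intro X
        simp [W, Submodule.mem_inf, eq_neg_iff_add_eq_zero]
      have hcomm : ∀ g : G, g • (x : M) = x → ∀ X : E, AdL (Φ x) (AdL g X) = AdL g (AdL (Φ x) X) := by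
        intro g hg X
        have h1 := hM.equivariant g x
        rw [hg, eq_mul_inv_iff_mul_eq] at h1
        rw [← AdL_mul_apply, ← AdL_mul_apply, h1]
      have hWg : ∀ g : G, g • (x : M) = x → ∀ X ∈ W, AdL g X ∈ W := by
        intro g hg X hX
        rw [hWmem] at hX ⊢
        refine ⟨by rw [hcomm g hg, hX.1, map_neg], ?_⟩
        rw [← mD_smul_genFieldL hM.smooth_action hg, hX.2, map_zero]
      have hti : t⁻¹ • (x : M) = x := by rw [inv_smul_eq_iff, htx]
      obtain ⟨Y, hY, hfix⟩ := exists_fixed_sub hB.symm hB.pos (A := AdL t) (hB.invariant t)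
        (W := W) (fun X hX => ⟨AdL t⁻¹ X, hWg _ hti X hX, AdL_apply_inv t X⟩) (hWg t htx)
        (X := ξ) (by
          rw [hWmem]
          refine ⟨?_, ?_⟩
          · rw [map_sub, hcomm t htx, hξ, map_neg]
            abel
          · rw [map_sub, ← mD_smul_genFieldL hM.smooth_action htx, ← hvξ, sub_eq_zero]
            have h1 := ((ha.smooth_apply t).hasD (x : M)).comp (hι.smooth.hasD x) rfl
            have h2 : (fun z : F => t • (z : M)) = Subtype.val := funext fun z => hF.1 z.2
            rw [h2] at h1
            exact congrArg (fun L : V →L[ℝ] EM => L v) (h1.unique (hι.smooth.hasD x)))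
      obtain ⟨η, hη⟩ := exists_lieInclusion_eq hs hreg hfix
      rw [hWmem] at hY
      have h1 : AdL (Φ x) (ξ - Y) = -(ξ - Y) := by
        rw [map_sub, hξ, hY.1]
        abel
      have h2 : AdL (Φ x) (ξ - Y) = ξ - Y := by
        rw [← hη, ← hΦF]
        exact AdL_lieInclusion_of_comm hs hab (ΦF x).2 η
      have h3 : ξ - Y = 0 := eq_zero_of_eq_neg (h2.symm.trans h1)
      have h4 : mD 𝓘(ℝ, V) 𝓘(ℝ, EM) (Subtype.val : F → M) x v = 0 := by
        have : genFieldL E EM G (x : M) (ξ - Y) = 0 := by rw [h3, map_zero]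
        rw [map_sub, hY.2, sub_zero] at this
        exact hvξ.trans this
      have h5 : v = 0 := hι.mD_injective x (by rw [h4]; exact (map_zero _).symm)
      refine ⟨0, ?_, ?_⟩
      · rw [hAd, neg_zero]
      · rw [genField_eq, map_zero]
        exact h5
    · rintro ⟨ξ, hξ, rfl⟩ w
      rw [hAd] at hξ
      have h0 : ξ = 0 := eq_zero_of_eq_neg hξ
      subst h0
      have h1 : (genField T (0 : ET) x : TangentSpace 𝓘(ℝ, V) x) = (0 : V) := by
        rw [genField_eq, map_zero]
      have h2 : ∀ (κ : V [⋀^Fin 2]→L[ℝ] ℝ) (v : V), v = 0 → κ ![v, w] = 0 := by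
        rintro κ _ rfl
        exact κ.map_coord_zero 0 rfl
      exact h2 _ _ h1

end GroupHamiltonian


/-! ### Loops of a torus acting on a Hamiltonian loop group manifold -/

section TorusLoops

variable {E : Type*} [NormedAddCommGroup E] [NormedSpace ℝ E] [FiniteDimensional ℝ E]
  [CompleteSpace E]
  {G : Type*} [TopologicalSpace G] [ChartedSpace E G] [Group G] [LieGroup 𝓘(ℝ, E) ∞ G]
  [T2Space G]
  {ET : Type*} [NormedAddCommGroup ET] [NormedSpace ℝ ET] [FiniteDimensional ℝ ET]
  [CompleteSpace ET]
  {EM : Type*} [NormedAddCommGroup EM] [NormedSpace ℝ EM]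
  {M : Type*} [TopologicalSpace M] [ChartedSpace EM M] [MulAction G M]
  {EN : Type u} [NormedAddCommGroup EN] [NormedSpace ℝ EN]
  {N : Type*} [TopologicalSpace N] [ChartedSpace EN N]

/-- A Hamiltonian loop group manifold with its holonomy manifold, an abelian Lie subgroup `T` which
is the centralizer of its element `t`, and a projection `R` of the Lie algebra onto that of `T`. -/
structure RegularData (f : ℝ) (B : E →L[ℝ] E →L[ℝ] ℝ) (T : Subgroup G) [ChartedSpace ET T]
    [LieGroup 𝓘(ℝ, ET) ∞ T] (act : (UnitAddCircle → G) → N → N) (σN : Form EN N 2)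
    (ΦN : N → Sobolev (f - 1 / 2) E) (π : N → M) (σ : Form EM M 2) (Φ : M → G) (t : G)
    (R : E →L[ℝ] ET) : Prop where
  exponent : 1 / 2 < f - 1 / 2
  inner : IsInvariantInner G B
  split : IsSplitEmbedding ET E (Subtype.val : T → G)
  comm : ∀ a b : T, a * b = b * a
  connected : ConnectedSpace T
  regular : Subgroup.centralizer {t} = T
  retract : ∀ X : ET, R (lieInclusion E T X) = X
  group : IsGroupHamiltonian B σ Φ
  loop : IsLoopHamiltonian f B act σN ΦN
  holonomy : IsHolonomyManifold f B act σN ΦN π σ Φ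

/-- The action of loops in a subgroup. -/
def torusAct (T : Subgroup G) (act : (UnitAddCircle → G) → N → N) (γ : UnitAddCircle → T) (x : N) :
    N := act (fun z => (γ z : G)) x

/-- The projection of the moment map to the loops in the Lie algebra of the torus. -/
def torusMoment {f : ℝ} (R : E →L[ℝ] ET) (ΦN : N → Sobolev (f - 1 / 2) E) (x : N) :
    Sobolev (f - 1 / 2) ET := Sobolev.map (f - 1 / 2) R (ΦN x)

variable {f : ℝ} {B : E →L[ℝ] E →L[ℝ] ℝ} {T : Subgroup G} [ChartedSpace ET T]
  [LieGroup 𝓘(ℝ, ET) ∞ T] {act : (UnitAddCircle → G) → N → N} {σN : Form EN N 2}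
  {ΦN : N → Sobolev (f - 1 / 2) E} {π : N → M} {σ : Form EM M 2} {Φ : M → G} {t : G}
  {R : E →L[ℝ] ET}

namespace RegularData


lemma isSmoothAction_const (h : RegularData f B T act σN ΦN π σ Φ t R) :
    IsSmoothAction E EN fun (g : G) (x : N) => act (fun _ => g) x := by
  refine ⟨fun x => h.loop.act_one x, fun g k x => h.loop.act_mul (fun _ => g)
    ⟨0, hasLogDeriv_const g⟩ (fun _ => k) ⟨0, hasLogDeriv_const k⟩ x, ?_⟩
  obtain ⟨Ψ, hΨ, hsm⟩ := h.loop.smooth_action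
  have h1 : (fun p : G × N => act (fun _ => p.1) p.2) = fun p => Ψ ((p.1, 0), p.2) :=
    funext fun p => (hΨ (fun _ => p.1) 0 (hasLogDeriv_const p.1) p.2).symm
  rw [h1, ← contMDiffOn_univ]
  refine hsm.comp (f := fun p : G × N => ((p.1, (0 : Sobolev (f - 1 / 2) E)), p.2))
    ((contMDiff_fst.prodMk contMDiff_const).prodMk contMDiff_snd).contMDiffOn fun p _ => ?_
  exact ⟨fun _ => p.1, rfl, hasLogDeriv_const p.1⟩

lemma torusAct_one (h : RegularData f B T act σN ΦN π σ Φ t R) (x : N) : torusAct T act 1 x = x :=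
  h.loop.act_one x

lemma torusAct_mul (h : RegularData f B T act σN ΦN π σ Φ t R) {γ δ : UnitAddCircle → T}
    {b c : Sobolev (f - 1 / 2) ET} (hγ : HasLogDeriv γ b) (hδ : HasLogDeriv δ c) (x : N) :
    torusAct T act (γ * δ) x = torusAct T act γ (torusAct T act δ x) :=
  h.loop.act_mul (fun z => (γ z : G)) ⟨_, hγ.val h.split⟩ (fun z => (δ z : G))
    ⟨_, hδ.val h.split⟩ x

lemma contMDiff_torusAct (h : RegularData f B T act σN ΦN π σ Φ t R) {γ : UnitAddCircle → T}
    {b : Sobolev (f - 1 / 2) ET} (hγ : HasLogDeriv γ b) :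
    ContMDiff 𝓘(ℝ, EN) 𝓘(ℝ, EN) ∞ (torusAct T act γ) := by
  obtain ⟨Ψ, hΨ, hsm⟩ := h.loop.smooth_action
  have h1 : torusAct T act γ = fun x => Ψ (((γ 0 : G), Sobolev.map _ (lieInclusion E T) b), x) :=
    funext fun x => (hΨ _ _ (hγ.val h.split) x).symm
  rw [h1, ← contMDiffOn_univ]
  exact hsm.comp (f := fun x : N => (((γ 0 : G), Sobolev.map _ (lieInclusion E T) b), x))
    (contMDiff_const.prodMk contMDiff_id).contMDiffOn
    fun x _ => ⟨_, rfl, hγ.val h.split⟩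

/-- The action of exponentiated loops of mean zero is smooth in all variables. -/
lemma contMDiffOn_torusAct_expLoop (h : RegularData f B T act σN ΦN π σ Φ t R) {Z H : Type*}
    [NormedAddCommGroup Z] [NormedSpace ℝ Z] [TopologicalSpace H] {I : ModelWithCorners ℝ Z H}
    {K : Type*} [TopologicalSpace K] [ChartedSpace H K] {s : Set K}
    {b : K → Sobolev (f - 1 / 2) ET} {y : K → N}
    (hb : ContMDiffOn I 𝓘(ℝ, Sobolev (f - 1 / 2) ET) ∞ b s) (hy : ContMDiffOn I 𝓘(ℝ, EN) ∞ y s)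
    (hb0 : ∀ z ∈ s, Sobolev.mean h.exponent (b z) = 0) :
    ContMDiffOn I 𝓘(ℝ, EN) ∞ (fun z => torusAct T act (expLoop T (b z)) (y z)) s := by
  obtain ⟨Ψ, hΨ, hsm⟩ := h.loop.smooth_action
  have hlog : ∀ z ∈ s, HasLogDeriv (expLoop T (b z)) (b z) := fun z hz => by
    refine hasLogDeriv_expLoop h.comm ?_
    rw [← Sobolev.mean_apply h.exponent, hb0 z hz]
    exact lieExp_zero
  have h1 : ContMDiffOn I 𝓘(ℝ, EN) ∞
      (fun z => Ψ (((1 : G), Sobolev.map _ (lieInclusion E T) (b z)), y z)) s := by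
    refine hsm.comp (f := fun z => (((1 : G), Sobolev.map _ (lieInclusion E T) (b z)), y z))
      ((contMDiffOn_const.prodMk
        ((Sobolev.map _ (lieInclusion E T)).contDiff.contMDiff.comp_contMDiffOn hb)).prodMk hy)
      fun z hz => ⟨_, ?_, (hlog z hz).val h.split⟩
    exact congrArg Subtype.val (expLoop_zero_apply (b z))
  refine h1.congr fun z hz => ?_
  have h2 := hΨ _ _ ((hlog z hz).val h.split) (y z)
  rw [expLoop_zero_apply] at h2
  exact h2.symm

/-- A point is determined by its projection and its moment. -/
lemma ext_point (h : RegularData f B T act σN ΦN π σ Φ t R) {x y : N} (hπ : π x = π y)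
    (hΦ : ΦN x = ΦN y) : x = y := by
  obtain ⟨γ, ⟨⟨a, ha⟩, hγ0⟩, hγ⟩ := (h.holonomy.fibres x y).1 hπ
  have h1 : γ = 1 := ha.eq_one hγ0 (μ := ΦN x) fun z => by
    rw [← h.loop.equivariant γ a ha x z, hγ, hΦ]
  rw [h1] at hγ
  rw [← hγ, h.loop.act_one]

lemma moment_torusAct (h : RegularData f B T act σN ΦN π σ Φ t R) {γ : UnitAddCircle → T}
    {b μ : Sobolev (f - 1 / 2) ET} (hγ : HasLogDeriv γ b) {x : N}
    (hx : Sobolev.map _ (lieInclusion E T) μ = ΦN x) :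
    Sobolev.map _ (lieInclusion E T) (μ - b) = ΦN (torusAct T act γ x) := by
  refine Sobolev.ext fun z => ?_
  have h1 := h.loop.equivariant _ _ (hγ.val h.split) x z
  refine Eq.trans ?_ h1.symm
  rw [← hx, Sobolev.map_apply, Sobolev.map_apply, Sobolev.map_apply, Sobolev.sub_apply, map_sub,
    Ad_eq, AdL_lieInclusion_of_comm h.split h.comm (γ z).2]

lemma proj_torusAct (h : RegularData f B T act σN ΦN π σ Φ t R) {γ : UnitAddCircle → T}
    {b : Sobolev (f - 1 / 2) ET} (hγ : HasLogDeriv γ b) (x : N) :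
    π (torusAct T act γ x) = (γ 0 : G) • π x :=
  h.holonomy.equivariant _ ⟨_, hγ.val h.split⟩ x

lemma torusMoment_map (h : RegularData f B T act σN ΦN π σ Φ t R) {μ : Sobolev (f - 1 / 2) ET}
    {x : N} (hx : Sobolev.map _ (lieInclusion E T) μ = ΦN x) : torusMoment R ΦN x = μ := by
  refine Sobolev.ext fun z => ?_
  rw [torusMoment, ← hx, Sobolev.map_apply, Sobolev.map_apply, h.retract]

lemma map_torusMoment (h : RegularData f B T act σN ΦN π σ Φ t R)
    {x : N} (hx : ∀ z, AdL t (ΦN x z) = ΦN x z) :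
    Sobolev.map _ (lieInclusion E T) (torusMoment R ΦN x) = ΦN x := by
  refine Sobolev.ext fun z => ?_
  obtain ⟨X, hX⟩ := exists_lieInclusion_eq h.split h.regular (hx z)
  rw [Sobolev.map_apply, torusMoment, Sobolev.map_apply, ← hX, h.retract]

lemma mem_t (h : RegularData f B T act σN ΦN π σ Φ t R) : t ∈ T := by
  rw [← h.regular, Subgroup.mem_centralizer_singleton_iff]

lemma fixed_iff (h : RegularData f B T act σN ΦN π σ Φ t R) (x : N) :
    act (fun _ => t) x = x ↔ t • π x = π x ∧
      Sobolev.map _ (lieInclusion E T) (torusMoment R ΦN x) = ΦN x := by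
  have hlog : HasLogDeriv (fun _ => t) (0 : Sobolev (f - 1 / 2) E) := hasLogDeriv_const t
  have hΦ := h.loop.equivariant _ _ hlog x
  have hπ := h.holonomy.equivariant _ ⟨0, hlog⟩ x
  constructor
  · intro hx
    rw [hx] at hπ hΦ
    refine ⟨hπ.symm, h.map_torusMoment fun z => ?_⟩
    have := hΦ z
    rw [Sobolev.zero_apply, sub_zero] at this
    exact this.symm
  · rintro ⟨h1, h2⟩
    refine h.ext_point (hπ.trans h1) (Sobolev.ext fun z => ?_)
    rw [hΦ z, Sobolev.zero_apply, sub_zero, ← h2, Sobolev.map_apply, Ad_eq,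
      AdL_lieInclusion_of_comm h.split h.comm h.mem_t]

lemma mem_hatSet_iff (h : RegularData f B T act σN ΦN π σ Φ t R) {F : Set M}
    (hF : IsFixedUnion (fun (g : G) (m : M) => g • m) t F) {x : N} :
    x ∈ hatSet act π t F ↔ π x ∈ F ∧
      Sobolev.map _ (lieInclusion E T) (torusMoment R ΦN x) = ΦN x := by
  constructor
  · rintro ⟨h1, h2⟩
    exact ⟨h2, ((h.fixed_iff x).1 h1).2⟩
  · rintro ⟨h1, h2⟩
    exact ⟨(h.fixed_iff x).2 ⟨hF.1 h1, h2⟩, h1⟩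

lemma map_const (X : ET) : Sobolev.map (f - 1 / 2) (lieInclusion E T) (Sobolev.const _ X) =
    Sobolev.const _ (lieInclusion E T X) := Sobolev.ext fun z => by
  rw [Sobolev.map_apply, Sobolev.const_apply, Sobolev.const_apply]

lemma mem_tildeSet_iff (h : RegularData f B T act σN ΦN π σ Φ t R) {F : Set M}
    (hF : IsFixedUnion (fun (g : G) (m : M) => g • m) t F) {x : N} :
    x ∈ tildeSet ET T ΦN (hatSet act π t F) ↔ π x ∈ F ∧ Sobolev.map _ (lieInclusion E T)
      (Sobolev.const _ (Sobolev.mean h.exponent (torusMoment R ΦN x))) = ΦN x := by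
  constructor
  · rintro ⟨hx, ξ, hξ⟩
    have h1 : Sobolev.map _ (lieInclusion E T) (Sobolev.const _ ξ) = ΦN x :=
      Sobolev.ext fun z => by rw [hξ z, map_const, Sobolev.const_apply]
    refine ⟨hx.2, ?_⟩
    rw [h.torusMoment_map h1, Sobolev.mean_const, h1]
  · rintro ⟨h1, h2⟩
    refine ⟨(h.mem_hatSet_iff hF).2 ⟨h1, ?_⟩,
      Sobolev.mean h.exponent (torusMoment R ΦN x), fun z => ?_⟩
    · rw [h.torusMoment_map h2, h2]
    · rw [← h2, map_const, Sobolev.const_apply]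

lemma lieExp_mean (h : RegularData f B T act σN ΦN π σ Φ t R) {μ : Sobolev (f - 1 / 2) ET} {x : N}
    (hx : Sobolev.map _ (lieInclusion E T) μ = ΦN x) :
    (lieExp T (Sobolev.mean h.exponent μ) : G) = Φ (π x) := by
  rw [← h.holonomy.holonomy x, ← hx, Sobolev.mean_apply, ← hol_of_comm h.comm μ.continuous_real]
  exact (hol_val h.split μ.continuous_real 1).symm

/-- Two points in the same fibre with moments in the loops of the torus differ by a based loop of
the torus. -/
lemma exists_torusAct_eq (h : RegularData f B T act σN ΦN π σ Φ t R)
    {μ μ' : Sobolev (f - 1 / 2) ET} {x y : N}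
    (hx : Sobolev.map _ (lieInclusion E T) μ = ΦN x)
    (hy : Sobolev.map _ (lieInclusion E T) μ' = ΦN y) (hπ : π x = π y) :
    lieExp T (∫ s in (0 : ℝ)..1, (μ - μ' : Sobolev (f - 1 / 2) ET) (s : UnitAddCircle)) = 1 ∧
      HasLogDeriv (expLoop T (μ - μ')) (μ - μ') ∧
      torusAct T act (expLoop T (μ - μ')) x = y := by
  have h1 : lieExp T (∫ s in (0 : ℝ)..1, (μ - μ' : Sobolev (f - 1 / 2) ET) (s : UnitAddCircle)) =
      1 := by
    rw [← Sobolev.mean_apply h.exponent, map_sub, sub_eq_add_neg, lieExp_add h.comm,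
      lieExp_neg h.comm, mul_inv_eq_one]
    exact Subtype.ext (by rw [h.lieExp_mean hx, h.lieExp_mean hy, hπ])
  have hlog := hasLogDeriv_expLoop h.comm h1
  refine ⟨h1, hlog, h.ext_point ?_ ?_⟩
  · rw [h.proj_torusAct hlog, expLoop_zero_apply, OneMemClass.coe_one, one_smul, hπ]
  · rw [← h.moment_torusAct hlog hx, sub_sub_cancel, hy]

lemma smul_mem (h : RegularData f B T act σN ΦN π σ Φ t R) {F : Set M}
    (hF : IsFixedUnion (fun (g : G) (m : M) => g • m) t F) (τ : T) {m : M} (hm : m ∈ F) :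
    (τ : G) • m ∈ F := by
  have := h.connected
  have hc : Continuous fun τ : T => (τ : G) • m :=
    (h.group.smooth_action.continuous.comp (Continuous.prodMk continuous_subtype_val
      continuous_const))
  refine hF.2 (range fun τ : T => (τ : G) • m) ?_ (isPreconnected_range hc)
    ⟨m, ⟨1, by simp⟩, hm⟩ ⟨τ, rfl⟩
  rintro _ ⟨τ', rfl⟩
  change t • (τ' : G) • m = (τ' : G) • m
  have h2 : t * (τ' : G) = τ' * t := congrArg Subtype.val (h.comm ⟨t, h.mem_t⟩ τ')
  rw [← mul_smul, h2, mul_smul, show t • m = m from hF.1 hm]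

lemma moment_mem (h : RegularData f B T act σN ΦN π σ Φ t R) {m : M} (hm : t • m = m) :
    Φ m ∈ T := by
  rw [← h.regular, Subgroup.mem_centralizer_singleton_iff]
  have h1 := h.group.equivariant t m
  rw [hm, eq_mul_inv_iff_mul_eq] at h1
  exact h1

lemma torusAct_mem_hatSet (h : RegularData f B T act σN ΦN π σ Φ t R) {F : Set M}
    (hF : IsFixedUnion (fun (g : G) (m : M) => g • m) t F) {γ : UnitAddCircle → T}
    {b : Sobolev (f - 1 / 2) ET} (hγ : HasLogDeriv γ b) {x : N} (hx : x ∈ hatSet act π t F) :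
    torusAct T act γ x ∈ hatSet act π t F := by
  rw [h.mem_hatSet_iff hF] at hx ⊢
  have h1 := h.moment_torusAct hγ hx.2
  refine ⟨?_, ?_⟩
  · rw [h.proj_torusAct hγ]
    exact h.smul_mem hF (γ 0) hx.1
  · rw [h.torusMoment_map h1, h1]

/-- The part of mean zero of the moment. -/
def zeroMean (h : RegularData f B T act σN ΦN π σ Φ t R) :
    Sobolev (f - 1 / 2) ET →L[ℝ] Sobolev (f - 1 / 2) ET :=
  ContinuousLinearMap.id ℝ _ - (Sobolev.const (f - 1 / 2)).comp (Sobolev.mean h.exponent)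

lemma zeroMean_apply (h : RegularData f B T act σN ΦN π σ Φ t R) (μ : Sobolev (f - 1 / 2) ET) :
    h.zeroMean μ = μ - Sobolev.const _ (Sobolev.mean h.exponent μ) := rfl

lemma mean_zeroMean (h : RegularData f B T act σN ΦN π σ Φ t R) (μ : Sobolev (f - 1 / 2) ET) :
    Sobolev.mean h.exponent (h.zeroMean μ) = 0 := by
  rw [zeroMean_apply, map_sub, Sobolev.mean_const, sub_self]

lemma hasLogDeriv_of_mean (h : RegularData f B T act σN ΦN π σ Φ t R)
    {b : Sobolev (f - 1 / 2) ET} (hb : Sobolev.mean h.exponent b = 0) :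
    HasLogDeriv (expLoop T b) b := by
  refine hasLogDeriv_expLoop h.comm ?_
  rw [← Sobolev.mean_apply h.exponent, hb]
  exact lieExp_zero

/-- The gauge transformation making the moment constant. -/
def straighten (h : RegularData f B T act σN ΦN π σ Φ t R) (x : N) : N :=
  torusAct T act (expLoop T (h.zeroMean (torusMoment R ΦN x))) x

lemma contMDiff_torusMoment (h : RegularData f B T act σN ΦN π σ Φ t R) :
    ContMDiff 𝓘(ℝ, EN) 𝓘(ℝ, Sobolev (f - 1 / 2) ET) ∞ (torusMoment R ΦN) :=
  (Sobolev.map (f - 1 / 2) R).contDiff.contMDiff.comp h.loop.smooth_moment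

lemma contMDiff_straighten (h : RegularData f B T act σN ΦN π σ Φ t R) :
    ContMDiff 𝓘(ℝ, EN) 𝓘(ℝ, EN) ∞ h.straighten := by
  rw [← contMDiffOn_univ]
  exact h.contMDiffOn_torusAct_expLoop
    (h.zeroMean.contDiff.contMDiff.comp h.contMDiff_torusMoment).contMDiffOn contMDiffOn_id
    fun z _ => h.mean_zeroMean _

lemma proj_straighten (h : RegularData f B T act σN ΦN π σ Φ t R) (x : N) :
    π (h.straighten x) = π x := by
  rw [straighten, h.proj_torusAct (h.hasLogDeriv_of_mean (h.mean_zeroMean _)), expLoop_zero_apply,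
    OneMemClass.coe_one, one_smul]

lemma moment_straighten (h : RegularData f B T act σN ΦN π σ Φ t R) {x : N}
    (hx : Sobolev.map _ (lieInclusion E T) (torusMoment R ΦN x) = ΦN x) :
    Sobolev.map _ (lieInclusion E T)
      (Sobolev.const _ (Sobolev.mean h.exponent (torusMoment R ΦN x))) =
      ΦN (h.straighten x) := by
  rw [straighten, ← h.moment_torusAct (h.hasLogDeriv_of_mean (h.mean_zeroMean _)) hx,
    zeroMean_apply, sub_sub_cancel]

lemma mean_torusMoment_straighten (h : RegularData f B T act σN ΦN π σ Φ t R) {x : N}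
    (hx : Sobolev.map _ (lieInclusion E T) (torusMoment R ΦN x) = ΦN x) :
    Sobolev.mean h.exponent (torusMoment R ΦN (h.straighten x)) =
      Sobolev.mean h.exponent (torusMoment R ΦN x) := by
  rw [h.torusMoment_map (h.moment_straighten hx), Sobolev.mean_const]

lemma straighten_mem (h : RegularData f B T act σN ΦN π σ Φ t R) {F : Set M}
    (hF : IsFixedUnion (fun (g : G) (m : M) => g • m) t F) {x : N} (hx : x ∈ hatSet act π t F) :
    h.straighten x ∈ tildeSet ET T ΦN (hatSet act π t F) := by
  rw [h.mem_hatSet_iff hF] at hx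
  rw [h.mem_tildeSet_iff hF, h.proj_straighten, h.mean_torusMoment_straighten hx.2]
  exact ⟨hx.1, h.moment_straighten hx.2⟩

lemma straighten_of_mem (h : RegularData f B T act σN ΦN π σ Φ t R) {F : Set M}
    (hF : IsFixedUnion (fun (g : G) (m : M) => g • m) t F) {x : N}
    (hx : x ∈ tildeSet ET T ΦN (hatSet act π t F)) : h.straighten x = x := by
  have h1 := hx.1
  rw [h.mem_hatSet_iff hF] at h1
  rw [h.mem_tildeSet_iff hF] at hx
  exact h.ext_point (h.proj_straighten x) (by rw [← h.moment_straighten h1.2, hx.2])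

/-- Every point of the fixed point set is the projection of a point with constant moment. -/
lemma exists_mem_tildeSet (h : RegularData f B T act σN ΦN π σ Φ t R) {F : Set M}
    (hF : IsFixedUnion (fun (g : G) (m : M) => g • m) t F) {m : M} (hm : m ∈ F) :
    ∃ x ∈ tildeSet ET T ΦN (hatSet act π t F), π x = m := by
  have := h.connected
  obtain ⟨y, hy⟩ := h.holonomy.surjective m
  obtain ⟨X, hX⟩ := lieExp_surjective (E := ET) h.comm ⟨Φ m, h.moment_mem (hF.1 hm)⟩
  have hhol : Hol G (fun s => ΦN y (s : UnitAddCircle)) 1 = lieExp G (lieInclusion E T X) := by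
    rw [h.holonomy.holonomy, hy, lieExp_val h.split, hX]
  obtain ⟨γ, a, ha, hγ0, hγ⟩ := exists_gauge_const h.exponent (ΦN y) _ hhol
  have hπ : π (act γ y) = m := by
    rw [h.holonomy.equivariant γ ⟨a, ha⟩, hγ0, one_smul, hy]
  have hΦ : Sobolev.map _ (lieInclusion E T) (Sobolev.const _ X) = ΦN (act γ y) :=
    Sobolev.ext fun z => by
      rw [h.loop.equivariant γ a ha, hγ z, map_const, Sobolev.const_apply]
  refine ⟨act γ y, (h.mem_tildeSet_iff hF).2 ⟨by rwa [hπ], ?_⟩, hπ⟩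
  rw [h.torusMoment_map hΦ, Sobolev.mean_const, hΦ]

lemma isFixedUnion_hatSet (h : RegularData f B T act σN ΦN π σ Φ t R) {F : Set M}
    (hF : IsFixedUnion (fun (g : G) (m : M) => g • m) t F) :
    IsFixedUnion (fun (g : G) (x : N) => act (fun _ => g) x) t (hatSet act π t F) := by
  refine ⟨fun x hx => hx.1, ?_⟩
  rintro C hC hpre ⟨x, hxC, hx⟩ y hy
  refine ⟨hC hy, ?_⟩
  have hπc : Continuous π := h.holonomy.submersion.contMDiff.continuous
  refine hF.2 (π '' C) ?_ (hpre.image _ hπc.continuousOn) ⟨π x, ⟨x, hxC, rfl⟩, hx.2⟩ ⟨y, hy, rfl⟩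
  rintro _ ⟨z, hz, rfl⟩
  exact ((h.fixed_iff z).1 (hC hz)).1

lemma isClosed_hatSet (h : RegularData f B T act σN ΦN π σ Φ t R) {F : Set M} (hF : IsClosed F) :
    IsClosed (hatSet act π t F) := by
  have := h.loop.t2
  have hπc : Continuous π := h.holonomy.submersion.contMDiff.continuous
  exact (isClosed_eq (h.isSmoothAction_const.smooth_apply t).continuous continuous_id).inter
    (hF.preimage hπc)

end RegularData

end TorusLoops


/-! ### Local sections -/

section Sections

lemma exists_local_section {EN : Type u} [NormedAddCommGroup EN] [NormedSpace ℝ EN]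
    {N : Type*} [TopologicalSpace N] [ChartedSpace EN N] [IsManifold 𝓘(ℝ, EN) ∞ N]
    {EM : Type*} [NormedAddCommGroup EM] [NormedSpace ℝ EM]
    {M : Type*} [TopologicalSpace M] [ChartedSpace EM M] [IsManifold 𝓘(ℝ, EM) ∞ M] {π : N → M}
    {x : N} (h : Manifold.IsSubmersionAt 𝓘(ℝ, EN) 𝓘(ℝ, EM) ∞ π x) :
    ∃ (s : M → N) (O : Set M), IsOpen O ∧ π x ∈ O ∧ ContMDiffOn 𝓘(ℝ, EM) 𝓘(ℝ, EN) ∞ s O ∧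
      s (π x) = x ∧ ∀ m ∈ O, π (s m) = m := by
  set φ := h.domChart
  set ψ := h.codChart
  let Q := h.equiv
  have hxφ : x ∈ φ.source := h.mem_domChart_source
  have hxψ : π x ∈ ψ.source := h.source_subset_preimage_source hxφ
  have hwr : ∀ y ∈ φ.target, ψ (π (φ.symm y)) = (Q y).1 := fun y hy =>
    h.writtenInCharts (show y ∈ (φ.extend 𝓘(ℝ, EN)).target by simpa using hy)
  have hQx : (Q (φ x)).1 = ψ (π x) := by
    rw [← hwr _ (φ.map_source hxφ), φ.left_inv hxφ]
  let k : EM → EN := fun w => Q.symm (w, (Q (φ x)).2)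
  have hk : ContDiff ℝ ∞ k := Q.symm.contDiff.comp (contDiff_id.prodMk contDiff_const)
  have hψs : ContMDiffOn 𝓘(ℝ, EM) 𝓘(ℝ, EM) ∞ ψ ψ.source :=
    contMDiffOn_of_mem_maximalAtlas h.codChart_mem_maximalAtlas
  have hφs : ContMDiffOn 𝓘(ℝ, EN) 𝓘(ℝ, EN) ∞ φ.symm φ.target :=
    contMDiffOn_symm_of_mem_maximalAtlas h.domChart_mem_maximalAtlas
  have hkψ : ContMDiffOn 𝓘(ℝ, EM) 𝓘(ℝ, EN) ∞ (fun m => k (ψ m)) ψ.source :=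
    hk.contMDiff.comp_contMDiffOn hψs
  have hkx : k (ψ (π x)) = φ x := by
    simp only [k]
    rw [← hQx]
    exact Q.symm_apply_apply _
  refine ⟨fun m => φ.symm (k (ψ m)), ψ.source ∩ (fun m => k (ψ m)) ⁻¹' φ.target,
    hkψ.continuousOn.isOpen_inter_preimage ψ.open_source φ.open_target, ⟨hxψ, ?_⟩,
    hφs.comp (hkψ.mono inter_subset_left) fun m hm => hm.2, ?_, ?_⟩
  · change k (ψ (π x)) ∈ φ.target
    rw [hkx]
    exact φ.map_source hxφ
  · simp only [hkx, φ.left_inv hxφ]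
  · rintro m ⟨hm, hmt⟩
    have h1 := hwr _ hmt
    have h2 : (Q (k (ψ m))).1 = ψ m := by simp [k]
    rw [h2] at h1
    have h3 : π (φ.symm (k (ψ m))) ∈ ψ.source :=
      h.source_subset_preimage_source (φ.map_target hmt)
    exact ψ.injOn h3 hm h1

variable {E : Type*} [NormedAddCommGroup E] [NormedSpace ℝ E] [FiniteDimensional ℝ E]
  [CompleteSpace E]
  {G : Type*} [TopologicalSpace G] [ChartedSpace E G] [Group G] [LieGroup 𝓘(ℝ, E) ∞ G]
  [T2Space G] [CompactSpace G]
  {ET : Type*} [NormedAddCommGroup ET] [NormedSpace ℝ ET] [FiniteDimensional ℝ ET]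
  [CompleteSpace ET]
  {EM : Type*} [NormedAddCommGroup EM] [NormedSpace ℝ EM]
  {M : Type*} [TopologicalSpace M] [ChartedSpace EM M] [MulAction G M]
  {EN : Type u} [NormedAddCommGroup EN] [NormedSpace ℝ EN]
  {N : Type*} [TopologicalSpace N] [ChartedSpace EN N]
  {f : ℝ} {B : E →L[ℝ] E →L[ℝ] ℝ} {T : Subgroup G} [ChartedSpace ET T]
  [LieGroup 𝓘(ℝ, ET) ∞ T] {act : (UnitAddCircle → G) → N → N} {σN : Form EN N 2}
  {ΦN : N → Sobolev (f - 1 / 2) E} {π : N → M} {σ : Form EM M 2} {Φ : M → G} {t : G}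
  {R : E →L[ℝ] ET}
  {V : Type*} [NormedAddCommGroup V] [NormedSpace ℝ V] [FiniteDimensional ℝ V]

namespace RegularData

lemma contMDiff_proj (h : RegularData f B T act σN ΦN π σ Φ t R) :
    ContMDiff 𝓘(ℝ, EN) 𝓘(ℝ, EM) ∞ π := h.holonomy.submersion.contMDiff

/-- The projection from the points with constant moment to the fixed point set has local
sections. -/
lemma exists_section (h : RegularData f B T act σN ΦN π σ Φ t R) {F : Set M}
    (hF : IsFixedUnion (fun (g : G) (m : M) => g • m) t F) {x : N}
    (hx : x ∈ tildeSet ET T ΦN (hatSet act π t F)) {m : F} (c : SliceAt V EM F m)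
    (hm : (m : M) = π x) :
    ∃ (j : V → N) (W : Set V), IsOpen W ∧ c.r (π x) ∈ W ∧ ContMDiffOn 𝓘(ℝ, V) 𝓘(ℝ, EN) ∞ j W ∧
      (∀ w ∈ W, w ∈ c.W ∧ j w ∈ tildeSet ET T ΦN (hatSet act π t F) ∧ π (j w) = c.i w) ∧
      j (c.r (π x)) = x := by
  have := h.loop.isManifold
  have := h.loop.t2
  have := h.loop.complete
  have := h.group.isManifold
  have := h.group.t2
  have := h.group.finiteDimensional
  have : CompleteSpace EM := FiniteDimensional.complete ℝ EM
  have : CompleteSpace V := FiniteDimensional.complete ℝ V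
  have hxU : π x ∈ c.U := by rw [← hm]; exact c.mem_U
  have hxF : π x ∈ F := by rw [← hm]; exact m.2
  have hsub : Manifold.IsSubmersionAt 𝓘(ℝ, EN) 𝓘(ℝ, EM) ∞ π x := h.holonomy.submersion.isSubmersionAt x
  obtain ⟨s, O, hO, hxO, hsO, hsx, hπs⟩ := exists_local_section hsub
  have hS := h.isFixedUnion_hatSet hF
  have ha := h.isSmoothAction_const
  obtain ⟨e, P, ε, hε, hxe, hball, hes, hest, he0, heD, hesD, hP, hfix, hmem, hl⟩ :=
    hS.exists_linearization ha hx.1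
  have hsymm0 : e.symm 0 = x := by rw [← he0]; exact e.left_inv hxe
  set w₀ := c.r (π x) with hw₀
  have hw₀W : w₀ ∈ c.W := c.r_mem _ hxF hxU
  have hiw₀ : c.i w₀ = π x := c.i_r _ hxF hxU
  have hc2 : IsOpen (c.W ∩ c.i ⁻¹' O) :=
    c.smooth_i.continuousOn.isOpen_inter_preimage c.isOpen_W hO
  have hsi : ContMDiffOn 𝓘(ℝ, V) 𝓘(ℝ, EN) ∞ (fun w => s (c.i w)) (c.W ∩ c.i ⁻¹' O) :=
    hsO.comp (c.smooth_i.mono inter_subset_left) fun w hw => hw.2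
  set O₃ := (c.W ∩ c.i ⁻¹' O) ∩ (fun w => s (c.i w)) ⁻¹' e.source
  have hO₃ : IsOpen O₃ := hsi.continuousOn.isOpen_inter_preimage hc2 e.open_source
  let v : V → EN := fun w => P (e (s (c.i w)))
  have hv : ContMDiffOn 𝓘(ℝ, V) 𝓘(ℝ, EN) ∞ v O₃ :=
    P.contDiff.contMDiff.comp_contMDiffOn
      (hes.comp (hsi.mono inter_subset_left) fun w hw => hw.2)
  set O₄ := O₃ ∩ v ⁻¹' Metric.ball 0 ε
  have hO₄ : IsOpen O₄ := hv.continuousOn.isOpen_inter_preimage hO₃ Metric.isOpen_ball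
  let y : V → N := fun w => e.symm (v w)
  have hy : ContMDiffOn 𝓘(ℝ, V) 𝓘(ℝ, EN) ∞ y O₄ :=
    hest.comp (hv.mono inter_subset_left) fun w hw => hball hw.2
  have hπy : ContMDiffOn 𝓘(ℝ, V) 𝓘(ℝ, EM) ∞ (fun w => π (y w)) O₄ :=
    h.contMDiff_proj.comp_contMDiffOn hy
  set O₅ := O₄ ∩ (fun w => π (y w)) ⁻¹' c.U
  have hO₅ : IsOpen O₅ := hπy.continuousOn.isOpen_inter_preimage hO₄ c.isOpen_U
  let g : V → V := fun w => c.r (π (y w))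
  have hg : ContMDiffOn 𝓘(ℝ, V) 𝓘(ℝ, V) ∞ g O₅ :=
    c.smooth_r.comp (hπy.mono inter_subset_left) fun w hw => hw.2
  have hswx : s (c.i w₀) = x := by rw [hiw₀, hsx]
  have hvw₀ : v w₀ = 0 := by simp only [v, hswx, he0, map_zero]
  have hyw₀ : y w₀ = x := by simp only [y, hvw₀, hsymm0]
  have hw₀5 : w₀ ∈ O₅ := by
    refine ⟨⟨⟨⟨hw₀W, ?_⟩, ?_⟩, ?_⟩, ?_⟩
    · rw [mem_preimage, hiw₀]; exact hxO
    · rw [mem_preimage, hswx]; exact hxe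
    · rw [mem_preimage, hvw₀]; exact Metric.mem_ball_self hε
    · rw [mem_preimage, hyw₀]; exact hxU
  have hgw₀ : g w₀ = w₀ := by simp only [g, hyw₀]; rfl
  have hyhat : ∀ w ∈ O₄, y w ∈ hatSet act π t F := fun w hw => hmem _ hw.2 (hP _)
  -- the derivative of `g`
  have hsD : HasD 𝓘(ℝ, EM) 𝓘(ℝ, EN) s (π x) (mD 𝓘(ℝ, EM) 𝓘(ℝ, EN) s (π x)) :=
    (hsO.contMDiffAt (hO.mem_nhds hxO)).hasD
  have hπD := h.contMDiff_proj.hasD x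
  have hiD := c.hasD_i hw₀W
  have hrD := c.hasD_r hxU
  set s' := mD 𝓘(ℝ, EM) 𝓘(ℝ, EN) s (π x)
  set π' := mD 𝓘(ℝ, EN) 𝓘(ℝ, EM) π x
  set i' := mD 𝓘(ℝ, V) 𝓘(ℝ, EM) c.i w₀
  set r' := mD 𝓘(ℝ, EM) 𝓘(ℝ, V) c.r (π x)
  have hPD : HasD 𝓘(ℝ, EN) 𝓘(ℝ, EN) P (0 : EN) P := hasD_iff_hasFDerivAt.2 P.hasFDerivAt
  have hgD : HasD 𝓘(ℝ, V) 𝓘(ℝ, V) g w₀ (r'.comp (π'.comp ((ContinuousLinearMap.id ℝ EN).comp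
      (P.comp ((ContinuousLinearMap.id ℝ EN).comp (s'.comp i')))))) :=
    hrD.comp (hπD.comp (hesD.comp (hPD.comp (heD.comp (hsD.comp hiD hiw₀) hswx)
      (by rw [hswx, he0])) hvw₀) hyw₀) (by rw [hyw₀])
  have hπs' : π'.comp s' = ContinuousLinearMap.id ℝ EM :=
    (hπD.comp hsD hsx).unique ((hasD_id _).congr (by
      filter_upwards [hO.mem_nhds hxO] with z hz using hπs z hz))
  have hri' : r'.comp i' = ContinuousLinearMap.id ℝ V :=
    (hrD.comp hiD hiw₀).unique ((hasD_id _).congr (by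
      filter_upwards [c.isOpen_W.mem_nhds hw₀W] with w hw using c.r_i w hw))
  have hkey : ∀ w : V, π' (P (s' (i' w))) = i' w := by
    intro w
    rw [← sub_eq_zero]
    refine (SeparatingDual.eq_zero_iff_forall_dual_eq_zero (R := ℝ) _).2 fun l => ?_
    rw [map_sub, sub_eq_zero]
    refine hl (l.comp π') (s' (i' w)) (l (i' w)) fun n => ?_
    have h1 := hπD.comp ((ha.smooth_apply (t ^ n)).hasD x) (ha.zpow_fixed hx.1.1 n)
    have h2 := (((isSmoothAction_smul h.group.smooth_action).smooth_apply (t ^ n)).hasD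
      (π x)).comp hπD rfl
    have h3 : (fun z : N => π (act (fun _ => t ^ n) z)) = fun z => (t ^ n) • π z :=
      funext fun z => h.holonomy.equivariant _ ⟨0, hasLogDeriv_const _⟩ z
    rw [h3] at h1
    have h4 := congrArg (fun L : EN →L[ℝ] EM => L (s' (i' w))) (h1.unique h2)
    have h5 := (((isSmoothAction_smul h.group.smooth_action).smooth_apply (t ^ n)).hasD
      (π x)).comp hiD hiw₀
    have h6 := h5.unique (hiD.congr (by
      filter_upwards [c.isOpen_W.mem_nhds hw₀W] with z hz
      exact (isSmoothAction_smul h.group.smooth_action).zpow_fixed (hF.1 (c.i_mem z hz)) n))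
    have h7 := congrArg (fun L : V →L[ℝ] EM => L w) h6
    have h8 := congrArg (fun L : EM →L[ℝ] EM => L (i' w)) hπs'
    simp only [ContinuousLinearMap.comp_apply, ContinuousLinearMap.id_apply] at h4 h7 h8 ⊢
    rw [h4, h8, h7]
  have hgD' : HasFDerivAt g ((ContinuousLinearEquiv.refl ℝ V : V ≃L[ℝ] V) : V →L[ℝ] V) w₀ := by
    rw [← hasD_iff_hasFDerivAt]
    convert hgD
    ext w
    have := congrArg (fun L : V →L[ℝ] V => L w) hri'
    simp only [ContinuousLinearMap.comp_apply, ContinuousLinearMap.id_apply] at this ⊢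
    rw [hkey w, this]
    rfl
  obtain ⟨θ, hθ0, hθs, hθg, hθsm⟩ := exists_openPartialHomeomorph hO₅
    (contMDiffOn_iff_contDiffOn.1 hg) hw₀5 hgD'
  have hθw₀ : θ w₀ = w₀ := by rw [hθg, hgw₀]
  refine ⟨fun w => h.straighten (y (θ.symm w)), θ.target, θ.open_target, ?_, ?_, ?_, ?_⟩
  · rw [← hθw₀]; exact θ.map_source hθ0
  · exact h.contMDiff_straighten.comp_contMDiffOn
      (hy.comp (contMDiffOn_iff_contDiffOn.2 hθsm) fun w hw => (hθs (θ.map_target hw)).1)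
  · intro w hw
    have hw5 : θ.symm w ∈ O₅ := hθs (θ.map_target hw)
    have h1 : g (θ.symm w) = w := by rw [← hθg]; exact θ.right_inv hw
    have h2 := hyhat _ hw5.1
    have h3 : c.r (π (y (θ.symm w))) = w := h1
    refine ⟨?_, h.straighten_mem hF h2, ?_⟩
    · rw [← h3]; exact c.r_mem _ h2.2 hw5.2
    · rw [h.proj_straighten]
      have := c.i_r _ h2.2 hw5.2
      rw [h3] at this
      exact this.symm
  · have h1 : θ.symm w₀ = w₀ := by
      have := θ.left_inv hθ0
      rwa [hθw₀] at this
    simp only [h1, hyw₀]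
    exact h.straighten_of_mem hF hx

end RegularData

end Sections


/-! ### Maps in slice charts -/

section SliceMaps

variable {V : Type*} [NormedAddCommGroup V] [NormedSpace ℝ V]
  {V' : Type*} [NormedAddCommGroup V'] [NormedSpace ℝ V']
  {C : Type*} [NormedAddCommGroup C] [NormedSpace ℝ C]
  {EN : Type*} [NormedAddCommGroup EN] [NormedSpace ℝ EN]
  {N : Type*} [TopologicalSpace N] [ChartedSpace EN N]
  {EM : Type*} [NormedAddCommGroup EM] [NormedSpace ℝ EM]
  {M : Type*} [TopologicalSpace M] [ChartedSpace EM M]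
  {S : Set N} {F : Set M}

/-- A slice with respect to an isomorphic model. -/
def SliceAt.transport {x : S} (c : SliceAt V EN S x) (Q : V ≃L[ℝ] V') : SliceAt V' EN S x where
  r := fun y => Q (c.r y)
  i := fun w => c.i (Q.symm w)
  U := c.U
  W := Q.symm ⁻¹' c.W
  isOpen_U := c.isOpen_U
  isOpen_W := c.isOpen_W.preimage Q.symm.continuous
  mem_U := c.mem_U
  smooth_r := Q.contDiff.contMDiff.comp_contMDiffOn c.smooth_r
  smooth_i := c.smooth_i.comp Q.symm.contDiff.contMDiff.contMDiffOn fun w hw => hw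
  i_mem := fun w hw => c.i_mem _ hw
  i_mem_U := fun w hw => c.i_mem_U _ hw
  r_mem := fun y hy hyU => by simpa using c.r_mem y hy hyU
  r_i := fun w hw => by rw [c.r_i _ hw]; exact Q.apply_symm_apply w
  i_r := fun y hy hyU => by rw [Q.symm_apply_apply]; exact c.i_r y hy hyU

lemma SliceAt.hasD_leftInverse {x : S} (c : SliceAt V EN S x) :
    (mD 𝓘(ℝ, EN) 𝓘(ℝ, V) c.r x).comp (mD 𝓘(ℝ, V) 𝓘(ℝ, EN) c.i (c.r x)) =
      ContinuousLinearMap.id ℝ V := by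
  have hW := c.r_mem x x.2 c.mem_U
  refine ((c.hasD_r c.mem_U).comp (c.hasD_i hW) (c.i_r x x.2 c.mem_U)).unique
    ((hasD_id _).congr ?_)
  filter_upwards [c.isOpen_W.mem_nhds hW] with w hw using c.r_i w hw

/-- The model of a slice is isomorphic to a complete subspace of the model of the manifold. -/
lemma SliceAt.exists_submodule [CompleteSpace EN] {x : S} (c : SliceAt V EN S x) :
    ∃ K : Submodule ℝ EN, CompleteSpace K ∧ Nonempty (V ≃L[ℝ] K) := by
  set r' := mD 𝓘(ℝ, EN) 𝓘(ℝ, V) c.r x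
  set i' := mD 𝓘(ℝ, V) 𝓘(ℝ, EN) c.i (c.r x)
  have hri : ∀ w, r' (i' w) = w := fun w =>
    congrArg (fun L : V →L[ℝ] V => L w) c.hasD_leftInverse
  let K : Submodule ℝ EN := LinearMap.range (i' : V →ₗ[ℝ] EN)
  have hK : (K : Set EN) = {v | i' (r' v) = v} := by
    ext v
    constructor
    · rintro ⟨w, rfl⟩
      change i' (r' (i' w)) = i' w
      rw [hri]
    · intro hv
      exact ⟨r' v, hv⟩
  have hclosed : IsClosed (K : Set EN) := by
    rw [hK]
    exact isClosed_eq (i'.comp r').continuous continuous_id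
  refine ⟨K, hclosed.completeSpace_coe, ?_⟩
  let L : V →L[ℝ] K := i'.codRestrict K fun w => ⟨w, rfl⟩
  have h1 : (r'.comp K.subtypeL).comp L = ContinuousLinearMap.id ℝ V := by
    ext w
    exact hri w
  have h2 : L.comp (r'.comp K.subtypeL) = ContinuousLinearMap.id ℝ K := by
    ext ⟨_, w, rfl⟩
    change i' (r' (i' w)) = i' w
    rw [hri]
  obtain ⟨Q, -⟩ := exists_equiv_of_inverse h1 h2
  exact ⟨Q⟩

variable [IsManifold 𝓘(ℝ, EN) ∞ N] [IsManifold 𝓘(ℝ, EM) ∞ M]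
  (d : ∀ x : S, SliceAt V EN S x) (c : ∀ m : F, SliceAt V' EM F m) {p : S → F}

/-- A map which is a projection in slice charts is an open submersion. -/
lemma isSubmersion_slices (Q : V ≃L[ℝ] (V' × C)) (hp : Continuous p)
    (hpU : ∀ x y : S, (y : N) ∈ (d x).U → (p y : M) ∈ (c (p x)).U)
    (hpr : ∀ x y : S, (y : N) ∈ (d x).U → (c (p x)).r (p y) = (Q ((d x).r y)).1) :
    letI := sliceChartedSpace d
    letI := sliceChartedSpace c
    Manifold.IsSubmersion 𝓘(ℝ, V) 𝓘(ℝ, V') ∞ p ∧ IsOpenMap p := by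
  let _ := sliceChartedSpace d
  let _ := sliceChartedSpace c
  have := isManifold_sliceChartedSpace d
  have := isManifold_sliceChartedSpace c
  constructor
  · refine Manifold.IsSubmersionOfComplement.isSubmersion (F := C) fun x => ?_
    refine Manifold.IsSubmersionAtOfComplement.mk_of_continuousAt hp.continuousAt Q (d x).chart
      (c (p x)).chart (d x).mem_U (c (p x)).mem_U (IsManifold.chart_mem_maximalAtlas x)
      (IsManifold.chart_mem_maximalAtlas (p x)) ?_
    intro w hw
    have hw' : w ∈ (d x).chart.target := by simpa using hw
    have h1 : ((d x).chart.symm w : N) ∈ (d x).U := (d x).chart.map_target hw'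
    have h2 := hpr x _ h1
    have h3 : (d x).r ((d x).chart.symm w : N) = w := (d x).chart.right_inv hw'
    rw [h3] at h2
    simpa [SliceAt.chart_apply] using h2
  · rw [isOpenMap_iff_nhds_le]
    intro x
    have hxs : x ∈ (d x).chart.source := (d x).mem_U
    have hpxs : p x ∈ (c (p x)).chart.source := (c (p x)).mem_U
    have h1 : Filter.map (fun y => (c (p x)).chart (p y)) (𝓝 x) = 𝓝 ((c (p x)).chart (p x)) := by
      have h2 : (fun y => (c (p x)).chart (p y)) =ᶠ[𝓝 x] fun y => (Q ((d x).chart y)).1 := by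
        filter_upwards [(d x).chart.open_source.mem_nhds hxs] with y hy using hpr x y hy
      rw [Filter.map_congr h2]
      have h3 : Filter.map (fun y => (Q ((d x).chart y)).1) (𝓝 x) =
          Filter.map Prod.fst (Filter.map Q (Filter.map (d x).chart (𝓝 x))) := by
        rw [Filter.map_map, Filter.map_map]
        rfl
      have h5 : ∀ w, Filter.map Q (𝓝 w) = 𝓝 (Q w) := fun w => Q.toHomeomorph.map_nhds_eq w
      rw [h3, (d x).chart.map_nhds_eq hxs, h5, map_fst_nhds, h2.eq_of_nhds]
    have h4 : 𝓝 (p x) = Filter.map (c (p x)).chart.symm (𝓝 ((c (p x)).chart (p x))) :=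
      ((c (p x)).chart.symm_map_nhds_eq hpxs).symm
    rw [h4, ← h1, Filter.map_map]
    refine le_of_eq (Filter.map_congr ?_)
    filter_upwards [(d x).chart.open_source.mem_nhds hxs] with y hy
    exact (c (p x)).chart.left_inv (hpU x y hy)

/-- A map which is the identity in slice charts is a local diffeomorphism. -/
lemma isLocalDiffeomorph_slices (d : ∀ x : S, SliceAt V' EN S x)
    (hpU : ∀ x y : S, (y : N) ∈ (d x).U → (p y : M) ∈ (c (p x)).U)
    (hpr : ∀ x y : S, (y : N) ∈ (d x).U → (c (p x)).r (p y) = (d x).r y) :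
    letI := sliceChartedSpace d
    letI := sliceChartedSpace c
    IsLocalDiffeomorph 𝓘(ℝ, V') 𝓘(ℝ, V') ∞ p := by
  let _ := sliceChartedSpace d
  let _ := sliceChartedSpace c
  have := isManifold_sliceChartedSpace d
  have := isManifold_sliceChartedSpace c
  intro x
  let Θ : OpenPartialHomeomorph S F := (d x).chart.trans (c (p x)).chart.symm
  have hΘs : Θ.source ⊆ (d x).chart.source := fun y hy => by
    rw [OpenPartialHomeomorph.trans_source] at hy
    exact hy.1
  have hΘt : Θ.target ⊆ (c (p x)).chart.source := fun y hy => by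
    rw [OpenPartialHomeomorph.trans_target] at hy
    exact hy.1
  have hds : ContMDiffOn 𝓘(ℝ, V') 𝓘(ℝ, V') ∞ (d x).chart (d x).chart.source :=
    contMDiffOn_of_mem_maximalAtlas (IsManifold.chart_mem_maximalAtlas x)
  have hds' : ContMDiffOn 𝓘(ℝ, V') 𝓘(ℝ, V') ∞ (d x).chart.symm (d x).chart.target :=
    contMDiffOn_symm_of_mem_maximalAtlas (IsManifold.chart_mem_maximalAtlas x)
  have hcs : ContMDiffOn 𝓘(ℝ, V') 𝓘(ℝ, V') ∞ (c (p x)).chart (c (p x)).chart.source :=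
    contMDiffOn_of_mem_maximalAtlas (IsManifold.chart_mem_maximalAtlas (p x))
  have hcs' : ContMDiffOn 𝓘(ℝ, V') 𝓘(ℝ, V') ∞ (c (p x)).chart.symm (c (p x)).chart.target :=
    contMDiffOn_symm_of_mem_maximalAtlas (IsManifold.chart_mem_maximalAtlas (p x))
  refine ⟨{ toPartialEquiv := Θ.toPartialEquiv
            open_source := Θ.open_source
            open_target := Θ.open_target
            contMDiffOn_toFun := hcs'.comp (hds.mono hΘs) fun y hy => ?_
            contMDiffOn_invFun := hds'.comp (hcs.mono hΘt) fun y hy => ?_ }, ?_, ?_⟩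
  · have : y ∈ Θ.source := hy
    rw [OpenPartialHomeomorph.trans_source] at this
    exact this.2
  · have : y ∈ Θ.target := hy
    rw [OpenPartialHomeomorph.trans_target] at this
    exact this.2
  · change x ∈ Θ.source
    rw [OpenPartialHomeomorph.trans_source]
    refine ⟨(d x).mem_U, ?_⟩
    change (d x).r x ∈ (c (p x)).W
    rw [← hpr x x (d x).mem_U]
    exact (c (p x)).r_mem _ (p x).2 (c (p x)).mem_U
  · intro y hy
    have hyU : (y : N) ∈ (d x).U := hΘs hy
    have h1 := (c (p x)).chart.left_inv (x := p y) (hpU x y hyU)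
    have h2 : (c (p x)).chart (p y) = (d x).chart y := hpr x y hyU
    rw [h2] at h1
    exact h1.symm

end SliceMaps

/-! ### Slices of the fixed point sets -/

section FixedSlices

variable {E : Type*} [NormedAddCommGroup E] [NormedSpace ℝ E] [FiniteDimensional ℝ E]
  [CompleteSpace E]
  {G : Type*} [TopologicalSpace G] [ChartedSpace E G] [Group G] [LieGroup 𝓘(ℝ, E) ∞ G]
  [T2Space G] [CompactSpace G]
  {ET : Type*} [NormedAddCommGroup ET] [NormedSpace ℝ ET] [FiniteDimensional ℝ ET]
  [CompleteSpace ET]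
  {EM : Type*} [NormedAddCommGroup EM] [NormedSpace ℝ EM]
  {M : Type*} [TopologicalSpace M] [ChartedSpace EM M] [MulAction G M]
  {EN : Type u} [NormedAddCommGroup EN] [NormedSpace ℝ EN]
  {N : Type*} [TopologicalSpace N] [ChartedSpace EN N]
  {f : ℝ} {B : E →L[ℝ] E →L[ℝ] ℝ} {T : Subgroup G} [ChartedSpace ET T]
  [LieGroup 𝓘(ℝ, ET) ∞ T] {act : (UnitAddCircle → G) → N → N} {σN : Form EN N 2}
  {ΦN : N → Sobolev (f - 1 / 2) E} {π : N → M} {σ : Form EM M 2} {Φ : M → G} {t : G}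
  {R : E →L[ℝ] ET}
  {V : Type*} [NormedAddCommGroup V] [NormedSpace ℝ V] [FiniteDimensional ℝ V]

namespace RegularData

/-- The mean of the moment. -/
def meanMoment (h : RegularData f B T act σN ΦN π σ Φ t R) (x : N) : ET :=
  Sobolev.mean h.exponent (torusMoment R ΦN x)

lemma contMDiff_meanMoment (h : RegularData f B T act σN ΦN π σ Φ t R) :
    ContMDiff 𝓘(ℝ, EN) 𝓘(ℝ, ET) ∞ h.meanMoment :=
  (Sobolev.mean h.exponent).contDiff.contMDiff.comp h.contMDiff_torusMoment

/-- Local sections are unique near a given moment. -/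
lemma exists_unique_section (h : RegularData f B T act σN ΦN π σ Φ t R) {F : Set M}
    (hF : IsFixedUnion (fun (g : G) (m : M) => g • m) t F) {x : N}
    (hx : x ∈ tildeSet ET T ΦN (hatSet act π t F)) {m : F} (c : SliceAt V EM F m)
    (hm : (m : M) = π x) :
    ∃ (j : V → N) (W : Set V) (δ : ℝ), 0 < δ ∧ IsOpen W ∧ c.r (π x) ∈ W ∧
      ContMDiffOn 𝓘(ℝ, V) 𝓘(ℝ, EN) ∞ j W ∧
      (∀ w ∈ W, w ∈ c.W ∧ j w ∈ tildeSet ET T ΦN (hatSet act π t F) ∧ π (j w) = c.i w ∧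
        ‖h.meanMoment (j w) - h.meanMoment x‖ < δ) ∧
      ∀ y ∈ tildeSet ET T ΦN (hatSet act π t F), π y ∈ c.U → c.r (π y) ∈ W →
        ‖h.meanMoment y - h.meanMoment x‖ < δ → j (c.r (π y)) = y := by
  obtain ⟨j, W, hW, hxW, hj, hjW, hjx⟩ := h.exists_section hF hx c hm
  obtain ⟨ε, hε, hball⟩ := Metric.mem_nhds_iff.1
    (eventually_lieExp_eq_one (E := ET) (G := T) h.comm)
  have hcont : ContinuousOn (fun w => h.meanMoment (j w)) W :=
    h.contMDiff_meanMoment.continuous.comp_continuousOn hj.continuousOn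
  refine ⟨j, W ∩ (fun w => h.meanMoment (j w)) ⁻¹' Metric.ball (h.meanMoment x) (ε / 2), ε / 2,
    by positivity, hcont.isOpen_inter_preimage hW Metric.isOpen_ball, ⟨hxW, ?_⟩,
    hj.mono inter_subset_left, ?_, ?_⟩
  · change h.meanMoment (j (c.r (π x))) ∈ Metric.ball (h.meanMoment x) (ε / 2)
    rw [hjx]
    exact Metric.mem_ball_self (by positivity)
  · rintro w ⟨hw, hw'⟩
    obtain ⟨h1, h2, h3⟩ := hjW w hw
    exact ⟨h1, h2, h3, by rw [← dist_eq_norm]; exact hw'⟩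
  · rintro y hy hyU ⟨hyW, hyb⟩ hyδ
    obtain ⟨h1, h2, h3⟩ := hjW _ hyW
    have hy' := (h.mem_tildeSet_iff hF).1 hy
    have h2' := (h.mem_tildeSet_iff hF).1 h2
    have hπ : π (j (c.r (π y))) = π y := by rw [h3]; exact c.i_r _ hy'.1 hyU
    have hexp := (h.exists_torusAct_eq h2'.2 hy'.2 hπ).1
    rw [← Sobolev.mean_apply h.exponent, map_sub, Sobolev.mean_const, Sobolev.mean_const] at hexp
    have h0 : h.meanMoment (j (c.r (π y))) - h.meanMoment y = 0 := by
      refine hball ?_ hexp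
      rw [Metric.mem_ball, dist_zero_right]
      have hb' : ‖h.meanMoment (j (c.r (π y))) - h.meanMoment x‖ < ε / 2 := by
        rw [← dist_eq_norm]; exact hyb
      calc ‖h.meanMoment (j (c.r (π y))) - h.meanMoment y‖
          = ‖(h.meanMoment (j (c.r (π y))) - h.meanMoment x) -
              (h.meanMoment y - h.meanMoment x)‖ := by congr 1; abel
        _ ≤ _ := norm_sub_le _ _
        _ < ε := by linarith
    refine h.ext_point hπ ?_
    rw [← h2'.2, ← hy'.2]
    have h4 : Sobolev.mean h.exponent (torusMoment R ΦN (j (c.r (π y)))) =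
      Sobolev.mean h.exponent (torusMoment R ΦN y) := sub_eq_zero.1 h0
    rw [h4]

lemma isOpen_meanMoment_ball (h : RegularData f B T act σN ΦN π σ Φ t R) (x : N) (δ : ℝ)
    {U : Set M} (hU : IsOpen U) :
    IsOpen (π ⁻¹' U ∩ {y | ‖h.meanMoment y - h.meanMoment x‖ < δ}) :=
  (hU.preimage h.contMDiff_proj.continuous).inter
    (isOpen_lt ((h.contMDiff_meanMoment.continuous.sub continuous_const).norm) continuous_const)

/-- Slices of the set of points with constant moment. -/
lemma exists_slice_tilde (h : RegularData f B T act σN ΦN π σ Φ t R) {F : Set M}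
    (hF : IsFixedUnion (fun (g : G) (m : M) => g • m) t F)
    (x : tildeSet ET T ΦN (hatSet act π t F)) {m : F} (c : SliceAt V EM F m)
    (hm : (m : M) = π x) :
    ∃ d : SliceAt V EN (tildeSet ET T ΦN (hatSet act π t F)) x, (d.r = fun y => c.r (π y)) ∧
      d.U ⊆ π ⁻¹' c.U := by
  obtain ⟨j, W, δ, hδ, hW, hxW, hj, hjW, huniq⟩ := h.exists_unique_section hF x.2 c hm
  have hxU : π x ∈ c.U := by rw [← hm]; exact c.mem_U
  obtain ⟨d, hdr, -, hdU, -⟩ := exists_sliceAt x (r := fun y => c.r (π y)) (i := j)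
    (U := π ⁻¹' c.U ∩ {y | ‖h.meanMoment y - h.meanMoment x‖ < δ}) (W := W)
    (h.isOpen_meanMoment_ball x δ c.isOpen_U) hW ⟨hxU, by simpa using hδ⟩ hxW
    (c.smooth_r.comp h.contMDiff_proj.contMDiffOn fun y hy => hy.1) hj
    (fun w hw _ => (hjW w hw).2.1)
    (fun w hw _ => by simp only [(hjW w hw).2.2.1, c.r_i w (hjW w hw).1])
    (fun y hy hyU hyW => huniq y hy hyU.1 hyW hyU.2)
  exact ⟨d, hdr, hdU.trans inter_subset_left⟩

/-- The connections of mean zero. -/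
abbrev meanZero (h : RegularData f B T act σN ΦN π σ Φ t R) :
    Submodule ℝ (Sobolev (f - 1 / 2) ET) :=
  LinearMap.ker ((Sobolev.mean h.exponent : Sobolev (f - 1 / 2) ET →L[ℝ] ET) :
    Sobolev (f - 1 / 2) ET →ₗ[ℝ] ET)

/-- Slices of the fixed point set. -/
lemma exists_slice_hat (h : RegularData f B T act σN ΦN π σ Φ t R) {F : Set M}
    (hF : IsFixedUnion (fun (g : G) (m : M) => g • m) t F)
    (x : hatSet act π t F) {m : F} (c : SliceAt V EM F m) (hm : (m : M) = π x)
    {O : Set N} (hO : IsOpen O) (hxO : (x : N) ∈ O) :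
    ∃ d : SliceAt (V × h.meanZero) EN (hatSet act π t F) x, (∀ y, (d.r y).1 = c.r (π y)) ∧
      d.U ⊆ π ⁻¹' c.U ∧ d.U ⊆ O := by
  have hx' := (h.mem_hatSet_iff hF).1 x.2
  obtain ⟨j, W, δ, hδ, hW, hxW, hj, hjW, huniq⟩ := h.exists_unique_section hF
    (h.straighten_mem hF x.2) c (hm.trans (h.proj_straighten x).symm)
  have hxU : π x ∈ c.U := by rw [← hm]; exact c.mem_U
  rw [h.proj_straighten] at hxW
  have hmx : h.meanMoment (h.straighten x) = h.meanMoment x :=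
    h.mean_torusMoment_straighten hx'.2
  rw [hmx] at huniq hjW
  let Z : Sobolev (f - 1 / 2) ET →L[ℝ] h.meanZero :=
    h.zeroMean.codRestrict h.meanZero fun μ => h.mean_zeroMean μ
  have hmean : ∀ b : h.meanZero, Sobolev.mean h.exponent (b : Sobolev (f - 1 / 2) ET) = 0 :=
    fun b => b.2
  have hlog := fun b : h.meanZero => h.hasLogDeriv_of_mean (hmean b)
  have hπj : ∀ w ∈ W, ∀ b : h.meanZero, π (torusAct T act (expLoop T b.1) (j w)) = c.i w := by
    intro w hw b
    rw [h.proj_torusAct (hlog b), expLoop_zero_apply, OneMemClass.coe_one, one_smul,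
      (hjW w hw).2.2.1]
  have hmom : ∀ w ∈ W, ∀ b : h.meanZero,
      torusMoment R ΦN (torusAct T act (expLoop T b.1) (j w)) =
        Sobolev.const _ (h.meanMoment (j w)) - b.1 := by
    intro w hw b
    exact h.torusMoment_map (h.moment_torusAct (hlog b)
      ((h.mem_tildeSet_iff hF).1 (hjW w hw).2.1).2)
  obtain ⟨d, hdr, -, hdU, -⟩ := exists_sliceAt (V := V × h.meanZero) x
    (r := fun y => (c.r (π y), -Z (torusMoment R ΦN y)))
    (i := fun w => torusAct T act (expLoop T w.2.1) (j w.1))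
    (U := π ⁻¹' c.U ∩ {y | ‖h.meanMoment y - h.meanMoment x‖ < δ} ∩ O) (W := W ×ˢ univ)
    ((h.isOpen_meanMoment_ball x δ c.isOpen_U).inter hO) (hW.prod isOpen_univ)
    ⟨⟨hxU, by simpa using hδ⟩, hxO⟩
    ⟨hxW, mem_univ _⟩
    ((c.smooth_r.comp h.contMDiff_proj.contMDiffOn fun y hy => hy.1.1).prodMk_space
      ((-Z).contDiff.contMDiff.comp h.contMDiff_torusMoment).contMDiffOn)
    (h.contMDiffOn_torusAct_expLoop
      ((h.meanZero.subtypeL.comp (ContinuousLinearMap.snd ℝ V h.meanZero)).contDiff.contMDiff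
        ).contMDiffOn
      (hj.comp (ContinuousLinearMap.fst ℝ V h.meanZero).contDiff.contMDiff.contMDiffOn
        fun w hw => hw.1) fun w _ => hmean w.2)
    (fun w hw _ => h.torusAct_mem_hatSet hF (hlog w.2) (hjW w.1 hw.1).2.1.1)
    (fun w hw _ => by
      refine Prod.ext ?_ ?_
      · simp only [hπj w.1 hw.1, c.r_i w.1 (hjW w.1 hw.1).1]
      · simp only [hmom w.1 hw.1]
        refine Subtype.ext ?_
        change -(h.zeroMean (Sobolev.const _ (h.meanMoment (j w.1)) - w.2.1)) = w.2.1
        rw [zeroMean_apply, map_sub, Sobolev.mean_const, hmean w.2, sub_zero]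
        abel)
    (fun y hy hyU hyW => by
      have hy' := (h.mem_hatSet_iff hF).1 hy
      have h1 := huniq (h.straighten y) (h.straighten_mem hF hy)
      have h2 : h.meanMoment (h.straighten y) = h.meanMoment y :=
        h.mean_torusMoment_straighten hy'.2
      rw [h.proj_straighten, h2] at h1
      have h3 := h1 hyU.1.1 hyW.1 hyU.1.2
      simp only [h3]
      change torusAct T act (expLoop T (-(h.zeroMean (torusMoment R ΦN y))))
        (torusAct T act (expLoop T (h.zeroMean (torusMoment R ΦN y))) y) = y
      have hm1 := h.mean_zeroMean (torusMoment R ΦN y)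
      have hm2 : Sobolev.mean h.exponent (-(h.zeroMean (torusMoment R ΦN y))) = 0 := by
        rw [map_neg, hm1, neg_zero]
      rw [← h.torusAct_mul (h.hasLogDeriv_of_mean hm2) (h.hasLogDeriv_of_mean hm1),
        ← expLoop_add h.comm, neg_add_cancel, expLoop_zero, h.torusAct_one])
  refine ⟨d, fun y => ?_, hdU.trans fun y hy => hy.1.1, hdU.trans inter_subset_right⟩
  rw [hdr]

end RegularData

end FixedSlices


/-! ### The Hamiltonian loop group manifold of the torus -/

section CommLoops

variable {E : Type*} [NormedAddCommGroup E] [NormedSpace ℝ E] [CompleteSpace E]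
  {T : Type*} [TopologicalSpace T] [ChartedSpace E T] [Group T] [LieGroup 𝓘(ℝ, E) ∞ T]
  [T2Space T] {f : ℝ} {γ δ : UnitAddCircle → T} {a b : Sobolev (f - 1 / 2) E}

lemma HasLogDeriv.mul_of_comm (hab : ∀ a b : T, a * b = b * a) (hγ : HasLogDeriv γ a)
    (hδ : HasLogDeriv δ b) : HasLogDeriv (γ * δ) (a + b) := by
  rw [hasLogDeriv_iff] at hγ hδ ⊢
  intro s
  rw [hasRD_iff_of_comm hab, Sobolev.add_apply]
  have h1 := ((hasRD_iff_of_comm hab).1 (hγ s)).mul ((hasRD_iff_of_comm hab).1 (hδ s))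
  rw [AdL_of_comm hab] at h1
  exact h1

lemma HasLogDeriv.inv_of_comm (hab : ∀ a b : T, a * b = b * a) (hγ : HasLogDeriv γ a) :
    HasLogDeriv γ⁻¹ (-a) := by
  rw [hasLogDeriv_iff] at hγ ⊢
  intro s
  rw [hasRD_iff_of_comm hab, Sobolev.neg_apply]
  have h1 := ((hasRD_iff_of_comm hab).1 (hγ s)).inv
  rw [AdL_of_comm hab] at h1
  exact h1

end CommLoops

section Transitive

variable {V : Type*} [NormedAddCommGroup V] [NormedSpace ℝ V]
  {EN : Type*} [NormedAddCommGroup EN] [NormedSpace ℝ EN]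
  {N : Type*} [TopologicalSpace N] [ChartedSpace EN N]
  {S : Type*} [TopologicalSpace S] [ChartedSpace V S] {ι : S → N}

/-- Points related by a diffeomorphism of the ambient manifold preserving the submanifold. -/
lemma IsSplitEmbedding.sameType (h : IsSplitEmbedding V EN ι) {A A' : N → N}
    (hA : ContMDiff 𝓘(ℝ, EN) 𝓘(ℝ, EN) ∞ A) (hA' : ContMDiff 𝓘(ℝ, EN) 𝓘(ℝ, EN) ∞ A')
    (h1 : ∀ y, A' (A y) = y) (h2 : ∀ y, A (A' y) = y) {a a' : S → S}
    (ha : ∀ x, ι (a x) = A (ι x)) (ha' : ∀ x, ι (a' x) = A' (ι x)) {x y : S} (hxy : a x = y) :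
    SameType V EN ι x y := by
  have hsa : ContMDiff 𝓘(ℝ, V) 𝓘(ℝ, V) ∞ a :=
    h.contMDiff (by simp only [ha]; exact hA.comp h.smooth)
  have hsa' : ContMDiff 𝓘(ℝ, V) 𝓘(ℝ, V) ∞ a' :=
    h.contMDiff (by simp only [ha']; exact hA'.comp h.smooth)
  have h3 : ∀ z, a' (a z) = z := fun z => h.injective (by rw [ha', ha, h1])
  have h4 : ∀ z, a (a' z) = z := fun z => h.injective (by rw [ha, ha', h2])
  subst hxy
  obtain ⟨Q, hQ⟩ := exists_equiv_of_inverse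
    (L := mD 𝓘(ℝ, V) 𝓘(ℝ, V) a x) (L' := mD 𝓘(ℝ, V) 𝓘(ℝ, V) a' (a x))
    ((((hsa'.hasD (a x)).comp (hsa.hasD x) rfl).congr
      (Filter.Eventually.of_forall fun z => (h3 z).symm)).unique (hasD_id x))
    ((((hsa.hasD x).comp (hsa'.hasD (a x)) (h3 x)).congr
      (Filter.Eventually.of_forall fun z => (h4 z).symm)).unique (hasD_id (a x)))
  obtain ⟨P, hP⟩ := exists_equiv_of_inverse
    (L := mD 𝓘(ℝ, EN) 𝓘(ℝ, EN) A (ι x)) (L' := mD 𝓘(ℝ, EN) 𝓘(ℝ, EN) A' (A (ι x)))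
    ((((hA'.hasD (A (ι x))).comp (hA.hasD (ι x)) rfl).congr
      (Filter.Eventually.of_forall fun z => (h1 z).symm)).unique (hasD_id (ι x)))
    ((((hA.hasD (ι x)).comp (hA'.hasD (A (ι x))) (h1 _)).congr
      (Filter.Eventually.of_forall fun z => (h2 z).symm)).unique (hasD_id (A (ι x))))
  have h5 := (hA.hasD (ι x)).comp (h.smooth.hasD x) rfl
  have h6 := (h.smooth.hasD (a x)).comp (hsa.hasD x) rfl
  simp only [ha] at h6
  have h7 := h5.unique h6
  rw [← hQ, ← hP] at h7
  exact ⟨P, Q, fun v => congrArg (fun L : V →L[ℝ] EN => L v) h7⟩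

end Transitive

section FixedHamiltonian

variable {E : Type*} [NormedAddCommGroup E] [NormedSpace ℝ E] [FiniteDimensional ℝ E]
  [CompleteSpace E]
  {G : Type*} [TopologicalSpace G] [ChartedSpace E G] [Group G] [LieGroup 𝓘(ℝ, E) ∞ G]
  [T2Space G] [CompactSpace G]
  {ET : Type*} [NormedAddCommGroup ET] [NormedSpace ℝ ET] [FiniteDimensional ℝ ET]
  [CompleteSpace ET]
  {EM : Type*} [NormedAddCommGroup EM] [NormedSpace ℝ EM]
  {M : Type*} [TopologicalSpace M] [ChartedSpace EM M] [MulAction G M]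
  {EN : Type u} [NormedAddCommGroup EN] [NormedSpace ℝ EN]
  {N : Type*} [TopologicalSpace N] [ChartedSpace EN N]
  {f : ℝ} {B : E →L[ℝ] E →L[ℝ] ℝ} {T : Subgroup G} [ChartedSpace ET T]
  [LieGroup 𝓘(ℝ, ET) ∞ T] {act : (UnitAddCircle → G) → N → N} {σN : Form EN N 2}
  {ΦN : N → Sobolev (f - 1 / 2) E} {π : N → M} {σ : Form EM M 2} {Φ : M → G} {t : G}
  {R : E →L[ℝ] ET} {F : Set M}
  {EF : Type*} [NormedAddCommGroup EF] [NormedSpace ℝ EF] [ChartedSpace EF (hatSet act π t F)]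
  {actT : (UnitAddCircle → T) → hatSet act π t F → hatSet act π t F}

namespace RegularData

/-- The generating vector fields of the torus are tangent to the fixed point set. -/
lemma loopGenField_hat (h : RegularData f B T act σN ΦN π σ Φ t R)
    (hι : IsSplitEmbedding EF EN (Subtype.val : hatSet act π t F → N))
    (hactT : ∀ γ ∈ loopGroup f ET T, ∀ x, (actT γ x : N) = torusAct T act γ x)
    (ξ : Sobolev (f + 1 / 2) ET) (x : hatSet act π t F) :
    mD 𝓘(ℝ, EF) 𝓘(ℝ, EN) (Subtype.val : hatSet act π t F → N) x
        (loopGenField (E' := EF) actT ξ x : EF) =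
      (loopGenField act (Sobolev.map _ (lieInclusion E T) ξ) (x : N) : EN) := by
  obtain ⟨a, ha⟩ := exists_hasLogDeriv_lieExp h.comm h.exponent ξ
  set c : ℝ → hatSet act π t F := fun τ => actT (fun z => lieExp T (-(τ • ξ z))) x with hc
  set C : ℝ → N := fun τ =>
    act (fun z => lieExp G (-(τ • Sobolev.map _ (lieInclusion E T) ξ z))) x with hC
  have hcC : (fun τ => (c τ : N)) = C := by
    funext τ
    simp only [hc, hC]
    rw [hactT _ ⟨_, ha τ⟩]
    unfold torusAct
    congr 1
    funext z
    rw [Sobolev.map_apply, ← lieExp_val h.split, map_neg, map_smul]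
  have hc0 : c 0 = x := by
    refine Subtype.ext ?_
    have h1 : (c 0 : N) = C 0 := congrFun hcC 0
    rw [h1]
    simp only [hC, zero_smul, neg_zero, lieExp_zero]
    exact h.loop.act_one x
  change mD 𝓘(ℝ, EF) 𝓘(ℝ, EN) (Subtype.val : hatSet act π t F → N) x
    (mD 𝓘(ℝ, ℝ) 𝓘(ℝ, EF) c 0 1) = mD 𝓘(ℝ, ℝ) 𝓘(ℝ, EN) C 0 1
  by_cases hd : MDifferentiableAt 𝓘(ℝ, ℝ) 𝓘(ℝ, EN) C 0
  · have h1 := hd.hasD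
    have h2 : HasD 𝓘(ℝ, ℝ) 𝓘(ℝ, EN) (fun τ => (c τ : N)) 0 (mD 𝓘(ℝ, ℝ) 𝓘(ℝ, EN) C 0) := by
      rw [hcC]
      exact h1
    obtain ⟨L, hL, hLc⟩ := hι.exists_hasD h2
    rw [hc0] at hLc
    rw [hL.mD_eq, ← hLc]
    rfl
  · have hd' : ¬ MDifferentiableAt 𝓘(ℝ, ℝ) 𝓘(ℝ, EF) c 0 := by
      intro h1
      have h2 := (hι.smooth.hasD (c 0)).comp h1.hasD rfl
      rw [hcC] at h2
      exact hd h2.mdiff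
    have h1 : mD 𝓘(ℝ, ℝ) 𝓘(ℝ, EN) C 0 = 0 := mfderiv_zero_of_not_mdifferentiableAt hd
    have h2 : mD 𝓘(ℝ, ℝ) 𝓘(ℝ, EF) c 0 = 0 := mfderiv_zero_of_not_mdifferentiableAt hd'
    rw [h1, h2]
    simp

lemma torusMoment_torusAct (h : RegularData f B T act σN ΦN π σ Φ t R)
    (hF : IsFixedUnion (fun (g : G) (m : M) => g • m) t F) {γ : UnitAddCircle → T}
    {b : Sobolev (f - 1 / 2) ET} (hγ : HasLogDeriv γ b) {x : N} (hx : x ∈ hatSet act π t F) :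
    torusMoment R ΦN (torusAct T act γ x) = torusMoment R ΦN x - b :=
  h.torusMoment_map (h.moment_torusAct hγ ((h.mem_hatSet_iff hF).1 hx).2)

/-- The pairing of the moment map with an element of the loop algebra is differentiable. -/
lemma hasD_pairing (h : RegularData f B T act σN ΦN π σ Φ t R) (ξ : Sobolev (f + 1 / 2) E) (x : N) :
    ∃ L : EN →L[ℝ] ℝ, HasD 𝓘(ℝ, EN) 𝓘(ℝ, ℝ)
      (fun y => ∫ s in (0 : ℝ)..1, B (ΦN y (s : UnitAddCircle)) (ξ (s : UnitAddCircle))) x L := by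
  obtain ⟨L, hL⟩ := Sobolev.exists_integral_clm h.exponent
    (A := fun s => B.flip (ξ (s : UnitAddCircle))) (B.flip.continuous.comp ξ.continuous_real) 1
  have h1 : (fun y => ∫ s in (0 : ℝ)..1, B (ΦN y (s : UnitAddCircle)) (ξ (s : UnitAddCircle))) =
      fun y => L (ΦN y) := funext fun y => (hL (ΦN y)).symm
  rw [h1]
  exact ⟨_, ((L.contDiff.contMDiff (n := ∞)).comp h.loop.smooth_moment).hasD x⟩

theorem isLoopHamiltonian_hat (h : RegularData f B T act σN ΦN π σ Φ t R)
    (hF : IsFixedUnion (fun (g : G) (m : M) => g • m) t F)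
    [CompleteSpace EF] [IsManifold 𝓘(ℝ, EF) ∞ (hatSet act π t F)]
    (hι : IsSplitEmbedding EF EN (Subtype.val : hatSet act π t F → N))
    (hactT : ∀ γ ∈ loopGroup f ET T, ∀ x, (actT γ x : N) = torusAct T act γ x) :
    IsLoopHamiltonian f (restrictInner ET T B) actT (σN.restrict EF (hatSet act π t F))
      (fun x => torusMoment R ΦN (x : N)) := by
  have := h.loop.isManifold
  have := h.loop.t2
  have := h.loop.complete
  have hone : (1 : UnitAddCircle → T) ∈ loopGroup f ET T := ⟨0, hasLogDeriv_const (1 : T)⟩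
  have hmul : ∀ γ ∈ loopGroup f ET T, ∀ δ ∈ loopGroup f ET T, γ * δ ∈ loopGroup f ET T := by
    rintro γ ⟨a, ha⟩ δ ⟨b, hb⟩
    exact ⟨_, ha.mul_of_comm h.comm hb⟩
  have hact_smooth : ∀ γ ∈ loopGroup f ET T, ContMDiff 𝓘(ℝ, EF) 𝓘(ℝ, EF) ∞ (actT γ) := by
    intro γ hγ
    refine hι.contMDiff ?_
    simp only [hactT γ hγ]
    obtain ⟨b, hb⟩ := hγ
    exact (h.contMDiff_torusAct hb).comp hι.smooth
  refine
    { complete := inferInstance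
      isManifold := inferInstance
      t2 := inferInstance
      act_one := fun x => Subtype.ext (by rw [hactT _ hone, h.torusAct_one])
      act_mul := fun γ hγ δ hδ x => Subtype.ext ?_
      smooth_action := ?_
      smooth_form := h.loop.smooth_form.pullback hι.smooth
      closed := fun x => ?_
      nondegenerate := fun x v hv => ?_
      invariant := fun γ hγ => ?_
      smooth_moment := h.contMDiff_torusMoment.comp hι.smooth
      equivariant := fun γ b hb x z => ?_
      moment := fun ξ x v => ?_ }
  · rw [hactT _ (hmul γ hγ δ hδ), hactT γ hγ, hactT δ hδ]
    obtain ⟨a, ha⟩ := hγ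
    obtain ⟨b, hb⟩ := hδ
    exact h.torusAct_mul ha hb x
  · obtain ⟨Ψ, hΨ, hsm⟩ := h.loop.smooth_action
    classical
    let Ψ' : (T × Sobolev (f - 1 / 2) ET) × hatSet act π t F → hatSet act π t F := fun p =>
      if hp : ∃ γ : UnitAddCircle → T, γ 0 = p.1.1 ∧ HasLogDeriv γ p.1.2 then actT hp.choose p.2
      else p.2
    have hΨ' : ∀ p : (T × Sobolev (f - 1 / 2) ET) × hatSet act π t F,
        (∃ γ : UnitAddCircle → T, γ 0 = p.1.1 ∧ HasLogDeriv γ p.1.2) →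
        (Ψ' p : N) = Ψ (((p.1.1 : G), Sobolev.map _ (lieInclusion E T) p.1.2), (p.2 : N)) := by
      intro p hp
      simp only [Ψ', dif_pos hp]
      obtain ⟨h1, h2⟩ := hp.choose_spec
      rw [hactT _ ⟨_, h2⟩]
      have h3 := hΨ _ _ (h2.val h.split) (p.2 : N)
      simp only [h1] at h3
      exact h3.symm
    refine ⟨Ψ', fun γ b hb x => Subtype.ext ?_, fun p hp => hι.contMDiffWithinAt ?_⟩
    · rw [hΨ' _ ⟨γ, rfl, hb⟩, hactT γ ⟨b, hb⟩]
      exact hΨ _ _ (hb.val h.split) _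
    · have h1 : ContMDiff ((𝓘(ℝ, ET).prod 𝓘(ℝ, Sobolev (f - 1 / 2) ET)).prod 𝓘(ℝ, EF))
          ((𝓘(ℝ, E).prod 𝓘(ℝ, Sobolev (f - 1 / 2) E)).prod 𝓘(ℝ, EN)) ∞
          (fun p : (T × Sobolev (f - 1 / 2) ET) × hatSet act π t F =>
            (((p.1.1 : G), Sobolev.map _ (lieInclusion E T) p.1.2), (p.2 : N))) :=
        ((h.split.smooth.comp (contMDiff_fst.comp contMDiff_fst)).prodMk
          ((Sobolev.map (f - 1 / 2) (lieInclusion E T)).contDiff.contMDiff.comp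
            (contMDiff_snd.comp contMDiff_fst))).prodMk (hι.smooth.comp contMDiff_snd)
      have h2 := hsm.comp h1.contMDiffOn (s := {p | ∃ γ : UnitAddCircle → T, γ 0 = p.1.1 ∧
        HasLogDeriv γ p.1.2}) (by
          rintro q ⟨γ, hγ, hb⟩
          exact ⟨fun z => (γ z : G), by simp [hγ], hb.val h.split⟩)
      exact (h2 p hp).congr (fun q hq => hΨ' q hq) (hΨ' p hp)
  · have h1 := Form.d_pullback hι.smooth h.loop.smooth_form x
    refine h1.trans ?_
    have h2 : σN.d.val (x : N) = 0 := h.loop.closed x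
    rw [h2]
    exact ContinuousAlternatingMap.ext fun w => rfl
  · have hv1 : ∀ w : EF, σN.val x ![mD 𝓘(ℝ, EF) 𝓘(ℝ, EN) (Subtype.val : hatSet act π t F → N) x v,
        mD 𝓘(ℝ, EF) 𝓘(ℝ, EN) (Subtype.val : hatSet act π t F → N) x w] = 0 := fun w =>
      (Form.pullback_apply₂ (E' := EF) (Subtype.val : hatSet act π t F → N) σN x v w).symm.trans
        (hv w)
    have hv2 := (h.isFixedUnion_hatSet hF).form_eq_zero h.isSmoothAction_const hι
      (fun g => h.loop.invariant (fun _ => g) ⟨0, hasLogDeriv_const g⟩) x v hv1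
    have hv3 := h.loop.nondegenerate x _ hv2
    exact hι.mD_injective x (hv3.trans (map_zero _).symm)
  · unfold Form.restrict
    rw [Form.pullback_pullback hι.smooth (hact_smooth γ hγ)]
    simp only [hactT γ hγ]
    obtain ⟨b, hb⟩ := hγ
    rw [← Form.pullback_pullback (h.contMDiff_torusAct hb) hι.smooth]
    have h1 : Form.pullback (torusAct T act γ) σN = σN :=
      h.loop.invariant _ ⟨_, hb.val h.split⟩
    rw [h1]
  · simp only [hactT γ ⟨b, hb⟩]
    rw [h.torusMoment_torusAct hF hb x.2, Ad_eq, AdL_of_comm h.comm, Sobolev.sub_apply]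
    rfl
  · have h1 := h.loop.moment (Sobolev.map _ (lieInclusion E T) ξ) x
      (mD 𝓘(ℝ, EF) 𝓘(ℝ, EN) (Subtype.val : hatSet act π t F → N) x v)
    have h2 := Form.pullback_apply₂ (E' := EF) (Subtype.val : hatSet act π t F → N) σN x
      (loopGenField (E' := EF) actT ξ x) v
    rw [h.loopGenField_hat hι hactT] at h2
    refine h2.trans (h1.trans ?_)
    obtain ⟨L, hL⟩ := h.hasD_pairing (Sobolev.map _ (lieInclusion E T) ξ) x
    have h3 := hL.comp (hι.smooth.hasD x) rfl
    have h4 : (fun y : hatSet act π t F => ∫ s in (0 : ℝ)..1, B (ΦN y (s : UnitAddCircle))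
        (Sobolev.map _ (lieInclusion E T) ξ (s : UnitAddCircle))) =
        fun y : hatSet act π t F => ∫ s in (0 : ℝ)..1, restrictInner ET T B
          (torusMoment R ΦN (y : N) (s : UnitAddCircle)) (ξ (s : UnitAddCircle)) := by
      funext y
      have h5 := ((h.mem_hatSet_iff hF).1 y.2).2
      conv_lhs => rw [← h5]
      simp only [Sobolev.map_apply]
      rfl
    rw [h4] at h3
    have h6 := h3.mD_eq
    have h7 := hL.mD_eq
    exact (congrArg (fun A : EN →L[ℝ] ℝ => A (mD 𝓘(ℝ, EF) 𝓘(ℝ, EN)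
      (Subtype.val : hatSet act π t F → N) x v)) h7).trans
      (congrArg (fun A : EF →L[ℝ] ℝ => A v) h6).symm

lemma mD_moment_hat (h : RegularData f B T act σN ΦN π σ Φ t R)
    (hF : IsFixedUnion (fun (g : G) (m : M) => g • m) t F) {S : Set N}
    (hS : S ⊆ hatSet act π t F) {V : Type*} [NormedAddCommGroup V] [NormedSpace ℝ V]
    [ChartedSpace V S] (hι : IsSplitEmbedding V EN (Subtype.val : S → N)) (x : S) (v : V) :
    Sobolev.map _ (lieInclusion E T) (mD 𝓘(ℝ, V) 𝓘(ℝ, Sobolev (f - 1 / 2) ET)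
      (fun y : S => torusMoment R ΦN (y : N)) x v) =
      mD 𝓘(ℝ, EN) 𝓘(ℝ, Sobolev (f - 1 / 2) E) ΦN x
        (mD 𝓘(ℝ, V) 𝓘(ℝ, EN) (Subtype.val : S → N) x v) := by
  have h1 := (h.loop.smooth_moment.hasD (x : N)).comp (hι.smooth.hasD x) rfl
  have h2 : HasD 𝓘(ℝ, V) 𝓘(ℝ, Sobolev (f - 1 / 2) ET) (fun y : S => torusMoment R ΦN (y : N)) x _ :=
    (h.contMDiff_torusMoment.comp hι.smooth).hasD x
  have h3 := (hasD_iff_hasFDerivAt.2 (Sobolev.map (f - 1 / 2) (lieInclusion E T)).hasFDerivAt).comp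
    h2 rfl
  have h4 : (fun y : S => Sobolev.map _ (lieInclusion E T) (torusMoment R ΦN (y : N))) =
      fun y : S => ΦN y := funext fun y => ((h.mem_hatSet_iff hF).1 (hS y.2)).2
  rw [h4] at h3
  exact congrArg (fun A : V →L[ℝ] Sobolev (f - 1 / 2) E => A v) (h3.unique h1)

theorem isHolonomyManifold_hat (h : RegularData f B T act σN ΦN π σ Φ t R)
    (hF : IsFixedUnion (fun (g : G) (m : M) => g • m) t F) (hFc : IsClosed F)
    (hι : IsSplitEmbedding EF EN (Subtype.val : hatSet act π t F → N))
    (hactT : ∀ γ ∈ loopGroup f ET T, ∀ x, (actT γ x : N) = torusAct T act γ x)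
    {V : Type*} [NormedAddCommGroup V] [NormedSpace ℝ V] [ChartedSpace V F] [MulAction T F]
    (hιF : IsSplitEmbedding V EM (Subtype.val : F → M))
    (hact : ∀ (τ : T) (m : F), ((τ • m : F) : M) = (τ : G) • (m : M)) {ΦF : F → T}
    (hΦF : ∀ m : F, (ΦF m : G) = Φ m) {πF : hatSet act π t F → F}
    (hπF : ∀ x, (πF x : M) = π x) (hsub : Manifold.IsSubmersion 𝓘(ℝ, EF) 𝓘(ℝ, V) ∞ πF) :
    IsHolonomyManifold f (restrictInner ET T B) actT (σN.restrict EF (hatSet act π t F))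
      (fun x => torusMoment R ΦN (x : N)) πF (σ.restrict V F) ΦF := by
  have hmap : ∀ x : hatSet act π t F,
      Sobolev.map _ (lieInclusion E T) (torusMoment R ΦN (x : N)) = ΦN x :=
    fun x => ((h.mem_hatSet_iff hF).1 x.2).2
  refine
    { proper := ?_
      surjective := fun m => ?_
      submersion := hsub
      fibres := fun x y => ⟨fun hxy => ?_, ?_⟩
      equivariant := fun γ hγ x => Subtype.ext ?_
      holonomy := fun x => Subtype.ext ?_
      form := fun x v w => ?_ }
  · have h1 : IsProperMap (fun x : hatSet act π t F => ΦN x) :=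
      h.holonomy.proper.comp (h.isClosed_hatSet hFc).isClosedEmbedding_subtypeVal.isProperMap
    refine isProperMap_of_comp_of_inj (h.contMDiff_torusMoment.comp hι.smooth).continuous
      (Sobolev.map (f - 1 / 2) (lieInclusion E T)).continuous ?_ ?_
    · exact (funext hmap : (Sobolev.map _ (lieInclusion E T) ∘
        fun x : hatSet act π t F => torusMoment R ΦN (x : N)) = _) ▸ h1
    · intro μ ν hμν
      refine Sobolev.ext fun z => lieInclusion_injective h.split ?_
      rw [← Sobolev.map_apply, ← Sobolev.map_apply, hμν]
  · obtain ⟨x, hx, hxm⟩ := h.exists_mem_tildeSet hF m.2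
    exact ⟨⟨x, hx.1⟩, Subtype.ext ((hπF _).trans hxm)⟩
  · have hπ : π x = π y := by rw [← hπF, ← hπF, hxy]
    obtain ⟨-, h2, h3⟩ := h.exists_torusAct_eq (hmap x) (hmap y) hπ
    exact ⟨_, ⟨⟨_, h2⟩, expLoop_zero_apply _⟩, Subtype.ext ((hactT _ ⟨_, h2⟩ x).trans h3)⟩
  · rintro ⟨γ, ⟨⟨b, hb⟩, hγ⟩, rfl⟩
    refine Subtype.ext ?_
    rw [hπF, hπF, hactT _ ⟨_, hb⟩, h.proj_torusAct hb, hγ]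
    simp
  · rw [hπF, hactT γ hγ, hact, hπF]
    obtain ⟨b, hb⟩ := hγ
    exact h.proj_torusAct hb x
  · rw [hΦF, hπF, ← h.holonomy.holonomy, ← hol_val h.split (Sobolev.continuous_real _)]
    congr 1
    funext s
    rw [← hmap x, Sobolev.map_apply]
  · have h1 := h.holonomy.form x (mD 𝓘(ℝ, EF) 𝓘(ℝ, EN) (Subtype.val : hatSet act π t F → N) x v)
      (mD 𝓘(ℝ, EF) 𝓘(ℝ, EN) (Subtype.val : hatSet act π t F → N) x w)
    have h2 := Form.pullback_apply₂ (E' := EF) (Subtype.val : hatSet act π t F → N) σN x v w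
    have hπD : ∀ v : EF, mD 𝓘(ℝ, EN) 𝓘(ℝ, EM) π x
        (mD 𝓘(ℝ, EF) 𝓘(ℝ, EN) (Subtype.val : hatSet act π t F → N) x v) =
        mD 𝓘(ℝ, V) 𝓘(ℝ, EM) (Subtype.val : F → M) (πF x) (mD 𝓘(ℝ, EF) 𝓘(ℝ, V) πF x v) := by
      intro v
      have h3 := (h.contMDiff_proj.hasD (x : N)).comp (hι.smooth.hasD x) rfl
      simp only [← hπF] at h3
      obtain ⟨L, hL, hLc⟩ := hιF.exists_hasD h3
      rw [hL.mD_eq]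
      exact (congrArg (fun L : EF →L[ℝ] EM => L v) hLc).symm
    have h6 : ∀ v w : EF, (Form.pullback π σ : Form EN N 2).val (x : N)
        ![mD 𝓘(ℝ, EF) 𝓘(ℝ, EN) (Subtype.val : hatSet act π t F → N) x v,
          mD 𝓘(ℝ, EF) 𝓘(ℝ, EN) (Subtype.val : hatSet act π t F → N) x w] =
        (Form.pullback πF (σ.restrict V F) : Form EF _ 2).val x ![v, w] := by
      intro v w
      rw [Form.pullback_apply₂, Form.pullback_apply₂, hπD, hπD, ← hπF]
      exact (Form.pullback_apply₂ (E' := V) (Subtype.val : F → M) σ (πF x) _ _).symm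
    refine Eq.trans ?_ (h1.trans (h6 v w))
    refine congrArg₂ (· - ·) h2 ?_
    have h7 : ∀ v w : EF, varpi T (restrictInner ET T B) (torusMoment R ΦN (x : N))
        (mD 𝓘(ℝ, EF) 𝓘(ℝ, Sobolev (f - 1 / 2) ET)
          (fun y : hatSet act π t F => torusMoment R ΦN (y : N)) x v)
        (mD 𝓘(ℝ, EF) 𝓘(ℝ, Sobolev (f - 1 / 2) ET)
          (fun y : hatSet act π t F => torusMoment R ΦN (y : N)) x w) =
        varpi G B (ΦN x) (mD 𝓘(ℝ, EN) 𝓘(ℝ, Sobolev (f - 1 / 2) E) ΦN x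
          (mD 𝓘(ℝ, EF) 𝓘(ℝ, EN) (Subtype.val : hatSet act π t F → N) x v))
          (mD 𝓘(ℝ, EN) 𝓘(ℝ, Sobolev (f - 1 / 2) E) ΦN x
          (mD 𝓘(ℝ, EF) 𝓘(ℝ, EN) (Subtype.val : hatSet act π t F → N) x w)) := by
      intro v w
      rw [← varpi_lieInclusion h.split h.exponent B, h.mD_moment_hat hF subset_rfl hι,
        h.mD_moment_hat hF subset_rfl hι, hmap]
    exact h7 v w

/-- Two points of an invariant subset in the same orbit of loops. -/
lemma sameType_torusAct (h : RegularData f B T act σN ΦN π σ Φ t R) {S : Set N} {V : Type*}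
    [NormedAddCommGroup V] [NormedSpace ℝ V] [ChartedSpace V S]
    (hι : IsSplitEmbedding V EN (Subtype.val : S → N)) {γ : UnitAddCircle → T}
    {b : Sobolev (f - 1 / 2) ET} (hγ : HasLogDeriv γ b) (hS : ∀ x ∈ S, torusAct T act γ x ∈ S)
    (hS' : ∀ x ∈ S, torusAct T act γ⁻¹ x ∈ S) {x y : S} (hxy : torusAct T act γ x = y) :
    IsSplitEmbedding.SameType V EN (Subtype.val : S → N) x y := by
  have hγ' := hγ.inv_of_comm h.comm
  have h1 : ∀ x, torusAct T act γ⁻¹ (torusAct T act γ x) = x := fun x => by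
    rw [← h.torusAct_mul hγ' hγ, inv_mul_cancel, h.torusAct_one]
  have h2 : ∀ x, torusAct T act γ (torusAct T act γ⁻¹ x) = x := fun x => by
    rw [← h.torusAct_mul hγ hγ', mul_inv_cancel, h.torusAct_one]
  exact hι.sameType (h.contMDiff_torusAct hγ) (h.contMDiff_torusAct hγ') h1 h2
    (a := fun x => ⟨_, hS x x.2⟩) (a' := fun x => ⟨_, hS' x x.2⟩) (fun _ => rfl) (fun _ => rfl)
    (Subtype.ext hxy)

end RegularData

end FixedHamiltonian


/-! ### Group-valued Hamiltonian spaces of an abelian group -/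

section AbelianGroupHamiltonian

variable {E : Type*} [NormedAddCommGroup E] [NormedSpace ℝ E] [FiniteDimensional ℝ E]
  [CompleteSpace E]
  {T : Type*} [TopologicalSpace T] [ChartedSpace E T] [Group T] [LieGroup 𝓘(ℝ, E) ∞ T] [T2Space T]
  {V : Type*} [NormedAddCommGroup V] [NormedSpace ℝ V]
  {F : Type*} [TopologicalSpace F] [ChartedSpace V F] [MulAction T F]
  {B : E →L[ℝ] E →L[ℝ] ℝ} {σ : Form V F 2} {Φ : F → T}

lemma IsGroupHamiltonian.d_eq_zero_of_comm (h : IsGroupHamiltonian B σ Φ)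
    (hab : ∀ a b : T, a * b = b * a) (m : F) : σ.d.val m = 0 := by
  refine ContinuousAlternatingMap.ext fun w => ?_
  have h1 : w = ![w 0, w 1, w 2] := by
    funext i
    fin_cases i <;> rfl
  have h2 : ∀ Y : E, Y = 0 → ∀ X : E, (1 / 2 : ℝ) * B X Y = 0 := by
    rintro _ rfl X
    simp
  rw [h1]
  exact (h.d_form m (w 0) (w 1) (w 2)).trans (h2 _ (lieBracket_of_comm hab _ _) _)

lemma IsGroupHamiltonian.nondegenerate_of_comm (h : IsGroupHamiltonian B σ Φ)
    (hab : ∀ a b : T, a * b = b * a) (m : F) (v : V) (hv : ∀ w : V, σ.val m ![v, w] = 0) :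
    v = 0 := by
  obtain ⟨ξ, hξ, hvξ⟩ := (h.kernel m v).1 hv
  rw [Ad_eq, AdL_of_comm hab] at hξ
  have h0 : ξ = 0 := eq_zero_of_eq_neg hξ
  rw [h0, genField_eq, map_zero] at hvξ
  exact hvξ

lemma rightMCL_of_comm (hab : ∀ a b : T, a * b = b * a) (g : T) :
    rightMCL (E := E) g = leftMCL g := by
  have h1 : (fun x : T => x * g⁻¹) = fun x => g⁻¹ * x := funext fun x => hab x g⁻¹
  unfold rightMCL leftMCL
  rw [h1]

/-- A moment map which lifts to the Lie algebra is a moment map in the usual sense. -/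
lemma IsGroupHamiltonian.moment_of_comm (h : IsGroupHamiltonian B σ Φ)
    (hab : ∀ a b : T, a * b = b * a)
    {V' : Type*} [NormedAddCommGroup V'] [NormedSpace ℝ V'] {S : Type*} [TopologicalSpace S]
    [ChartedSpace V' S] {p : S → F} (hp : ContMDiff 𝓘(ℝ, V') 𝓘(ℝ, V) ∞ p) {ψ : S → E}
    (hψ : ContMDiff 𝓘(ℝ, V') 𝓘(ℝ, E) ∞ ψ) (hΦ : ∀ x, Φ (p x) = lieExp T (ψ x)) (ξ : E) (x : S)
    (v : V') :
    σ.val (p x) ![genFieldL E V T (p x) ξ, mD 𝓘(ℝ, V') 𝓘(ℝ, V) p x v] =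
      mD 𝓘(ℝ, V') 𝓘(ℝ, ℝ) (fun y => B (ψ y) ξ) x v := by
  have h1 := h.moment ξ (p x) (mD 𝓘(ℝ, V') 𝓘(ℝ, V) p x v)
  rw [genField_eq] at h1
  refine Eq.trans h1 ?_
  have h2 := (h.smooth_moment.hasD (p x)).comp (hp.hasD x) rfl
  simp only [hΦ] at h2
  have h3 := (hasD_lieExp hab (ψ x)).comp (hψ.hasD x) rfl
  have h4 : mD 𝓘(ℝ, V) 𝓘(ℝ, E) Φ (p x) (mD 𝓘(ℝ, V') 𝓘(ℝ, V) p x v) =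
      leftL (lieExp T (ψ x)) (mD 𝓘(ℝ, V') 𝓘(ℝ, E) ψ x v) :=
    congrArg (fun L : V' →L[ℝ] E => L v) (h2.unique h3)
  have h5 : leftMCL (Φ (p x)) (mD 𝓘(ℝ, V) 𝓘(ℝ, E) Φ (p x) (mD 𝓘(ℝ, V') 𝓘(ℝ, V) p x v)) =
      mD 𝓘(ℝ, V') 𝓘(ℝ, E) ψ x v := by
    rw [h4, hΦ, leftMCL_leftL]
  have h6 : (1 / 2 : ℝ) * B (leftMCL (Φ (p x)) (mD 𝓘(ℝ, V) 𝓘(ℝ, E) Φ (p x)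
      (mD 𝓘(ℝ, V') 𝓘(ℝ, V) p x v)) + rightMCL (Φ (p x)) (mD 𝓘(ℝ, V) 𝓘(ℝ, E) Φ (p x)
      (mD 𝓘(ℝ, V') 𝓘(ℝ, V) p x v))) ξ = B (mD 𝓘(ℝ, V') 𝓘(ℝ, E) ψ x v) ξ := by
    rw [rightMCL_of_comm hab, h5, map_add, add_apply]
    ring
  refine h6.trans ?_
  have h7 := (hasD_iff_hasFDerivAt.2 (B.flip ξ).hasFDerivAt).comp (hψ.hasD x) rfl
  exact (congrArg (fun L : V' →L[ℝ] ℝ => L v) h7.mD_eq).symm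

end AbelianGroupHamiltonian

/-- The source of a proper map to a finite-dimensional space is `σ`-compact. -/
lemma _root_.IsProperMap.sigmaCompactSpace {X Y : Type*} [TopologicalSpace X] [TopologicalSpace Y]
    [SigmaCompactSpace Y] {g : X → Y} (hg : IsProperMap g) : SigmaCompactSpace X := by
  refine ⟨⟨fun n => g ⁻¹' compactCovering Y n,
    fun n => hg.isCompact_preimage (isCompact_compactCovering Y n), ?_⟩⟩
  rw [← preimage_iUnion, iUnion_compactCovering, preimage_univ]

/-! ### The Hamiltonian manifold of points with constant moment -/

section ConstantMoment

variable {E : Type*} [NormedAddCommGroup E] [NormedSpace ℝ E] [FiniteDimensional ℝ E]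
  [CompleteSpace E]
  {G : Type*} [TopologicalSpace G] [ChartedSpace E G] [Group G] [LieGroup 𝓘(ℝ, E) ∞ G]
  [T2Space G] [CompactSpace G]
  {ET : Type*} [NormedAddCommGroup ET] [NormedSpace ℝ ET] [FiniteDimensional ℝ ET]
  [CompleteSpace ET]
  {EM : Type*} [NormedAddCommGroup EM] [NormedSpace ℝ EM]
  {M : Type*} [TopologicalSpace M] [ChartedSpace EM M] [MulAction G M]
  {EN : Type u} [NormedAddCommGroup EN] [NormedSpace ℝ EN]
  {N : Type*} [TopologicalSpace N] [ChartedSpace EN N]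
  {f : ℝ} {B : E →L[ℝ] E →L[ℝ] ℝ} {T : Subgroup G} [ChartedSpace ET T]
  [LieGroup 𝓘(ℝ, ET) ∞ T] {act : (UnitAddCircle → G) → N → N} {σN : Form EN N 2}
  {ΦN : N → Sobolev (f - 1 / 2) E} {π : N → M} {σ : Form EM M 2} {Φ : M → G} {t : G}
  {R : E →L[ℝ] ET} {F : Set M} {S : Set N}
  {V : Type*} [NormedAddCommGroup V] [NormedSpace ℝ V] [ChartedSpace V F] [ChartedSpace V S]
  {p : S → F}

namespace RegularData

lemma torusMoment_tilde (h : RegularData f B T act σN ΦN π σ Φ t R)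
    (hF : IsFixedUnion (fun (g : G) (m : M) => g • m) t F)
    (hS : S = tildeSet ET T ΦN (hatSet act π t F)) {x : N} (hx : x ∈ S) :
    torusMoment R ΦN x = Sobolev.const _ (h.meanMoment x) := by
  rw [hS, h.mem_tildeSet_iff hF] at hx
  exact h.torusMoment_map hx.2

lemma map_const_meanMoment (h : RegularData f B T act σN ΦN π σ Φ t R)
    (hF : IsFixedUnion (fun (g : G) (m : M) => g • m) t F)
    (hS : S = tildeSet ET T ΦN (hatSet act π t F)) {x : N} (hx : x ∈ S) :
    Sobolev.map _ (lieInclusion E T) (Sobolev.const _ (h.meanMoment x)) = ΦN x := by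
  rw [hS, h.mem_tildeSet_iff hF] at hx
  exact hx.2

lemma mem_tilde_of_moment (h : RegularData f B T act σN ΦN π σ Φ t R)
    (hF : IsFixedUnion (fun (g : G) (m : M) => g • m) t F)
    (hS : S = tildeSet ET T ΦN (hatSet act π t F)) {x : N} {X : ET} (hπ : π x ∈ F)
    (hx : Sobolev.map _ (lieInclusion E T) (Sobolev.const _ X) = ΦN x) :
    x ∈ S ∧ h.meanMoment x = X := by
  have h1 : h.meanMoment x = X := by
    rw [meanMoment, h.torusMoment_map hx, Sobolev.mean_const]
  refine ⟨?_, h1⟩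
  rw [hS, h.mem_tildeSet_iff hF]
  exact ⟨hπ, by rw [← hx]; exact congrArg _ (congrArg _ h1)⟩

/-- Loops whose logarithmic derivative is constant preserve the points with constant moment. -/
lemma torusAct_mem_tilde (h : RegularData f B T act σN ΦN π σ Φ t R)
    (hF : IsFixedUnion (fun (g : G) (m : M) => g • m) t F)
    (hS : S = tildeSet ET T ΦN (hatSet act π t F)) {γ : UnitAddCircle → T} {X : ET}
    (hγ : HasLogDeriv γ (Sobolev.const (f - 1 / 2) X)) {x : N} (hx : x ∈ S) :
    torusAct T act γ x ∈ S ∧ h.meanMoment (torusAct T act γ x) = h.meanMoment x - X := by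
  have h1 := h.moment_torusAct hγ (h.map_const_meanMoment hF hS hx)
  rw [← map_sub] at h1
  refine h.mem_tilde_of_moment hF hS ?_ h1
  rw [h.proj_torusAct hγ]
  rw [hS, h.mem_tildeSet_iff hF] at hx
  exact h.smul_mem hF _ hx.1

lemma isClosed_tilde (h : RegularData f B T act σN ΦN π σ Φ t R)
    (hF : IsFixedUnion (fun (g : G) (m : M) => g • m) t F) (hFc : IsClosed F)
    (hS : S = tildeSet ET T ΦN (hatSet act π t F)) : IsClosed S := by
  have h1 : S = π ⁻¹' F ∩ {x | Sobolev.map _ (lieInclusion E T)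
      (Sobolev.const _ (h.meanMoment x)) = ΦN x} := by
    ext x
    rw [hS, h.mem_tildeSet_iff hF]
    rfl
  rw [h1]
  exact (hFc.preimage h.contMDiff_proj.continuous).inter
    (isClosed_eq ((Sobolev.map (f - 1 / 2) (lieInclusion E T)).continuous.comp
      ((Sobolev.const (f - 1 / 2)).continuous.comp h.contMDiff_meanMoment.continuous))
      h.loop.smooth_moment.continuous)

lemma isProperMap_meanMoment (h : RegularData f B T act σN ΦN π σ Φ t R)
    (hF : IsFixedUnion (fun (g : G) (m : M) => g • m) t F) (hFc : IsClosed F)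
    (hS : S = tildeSet ET T ΦN (hatSet act π t F)) :
    IsProperMap fun x : S => h.meanMoment (x : N) := by
  have h1 : IsProperMap (fun x : S => ΦN x) :=
    h.holonomy.proper.comp (h.isClosed_tilde hF hFc hS).isClosedEmbedding_subtypeVal.isProperMap
  refine isProperMap_of_comp_of_inj
    (g := fun X => Sobolev.map (f - 1 / 2) (lieInclusion E T) (Sobolev.const _ X))
    (h.contMDiff_meanMoment.continuous.comp continuous_subtype_val)
    ((Sobolev.map (f - 1 / 2) (lieInclusion E T)).continuous.comp
      (Sobolev.const (f - 1 / 2)).continuous) ?_ ?_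
  · have h2 : ((fun X => Sobolev.map (f - 1 / 2) (lieInclusion E T) (Sobolev.const _ X)) ∘
        fun x : S => h.meanMoment (x : N)) = fun x : S => ΦN x :=
      funext fun x => h.map_const_meanMoment hF hS x.2
    rw [h2]
    exact h1
  · intro X Y hXY
    refine lieInclusion_injective h.split ?_
    have h3 := congrArg (fun u : Sobolev (f - 1 / 2) E => u 0) hXY
    simpa [Sobolev.map_apply, Sobolev.const_apply] using h3

/-- The symplectic form on the points with constant moment is pulled back from the quotient. -/
lemma form_tilde (h : RegularData f B T act σN ΦN π σ Φ t R)
    (hF : IsFixedUnion (fun (g : G) (m : M) => g • m) t F)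
    (hS : S = tildeSet ET T ΦN (hatSet act π t F))
    (hι : IsSplitEmbedding V EN (Subtype.val : S → N))
    (hιF : IsSplitEmbedding V EM (Subtype.val : F → M)) (hp : ∀ x, (p x : M) = π x) :
    Form.pullback p (σ.restrict V F) = σN.restrict V S := by
  refine Form.ext₂ fun x v w => ?_
  have hπD : ∀ v : V, mD 𝓘(ℝ, EN) 𝓘(ℝ, EM) π x
      (mD 𝓘(ℝ, V) 𝓘(ℝ, EN) (Subtype.val : S → N) x v) =
      mD 𝓘(ℝ, V) 𝓘(ℝ, EM) (Subtype.val : F → M) (p x) (mD 𝓘(ℝ, V) 𝓘(ℝ, V) p x v) := by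
    intro v
    have h3 := (h.contMDiff_proj.hasD (x : N)).comp (hι.smooth.hasD x) rfl
    simp only [← hp] at h3
    obtain ⟨L, hL, hLc⟩ := hιF.exists_hasD h3
    rw [hL.mD_eq]
    exact (congrArg (fun L : V →L[ℝ] EM => L v) hLc).symm
  have hmomD : ∀ v : V, mD 𝓘(ℝ, EN) 𝓘(ℝ, Sobolev (f - 1 / 2) E) ΦN x
      (mD 𝓘(ℝ, V) 𝓘(ℝ, EN) (Subtype.val : S → N) x v) = Sobolev.map _ (lieInclusion E T)
      (Sobolev.const _ (mD 𝓘(ℝ, V) 𝓘(ℝ, ET) (fun y : S => h.meanMoment (y : N)) x v)) := by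
    intro v
    rw [← h.mD_moment_hat hF (S := S) (fun y hy => by rw [hS] at hy; exact hy.1) hι]
    congr 1
    have h1 : HasD 𝓘(ℝ, V) 𝓘(ℝ, ET) (fun y : S => h.meanMoment (y : N)) x _ :=
      (h.contMDiff_meanMoment.comp hι.smooth).hasD x
    have h2 := (hasD_iff_hasFDerivAt.2 (Sobolev.const (V := ET) (f - 1 / 2)).hasFDerivAt).comp h1 rfl
    have h3 : (fun y : S => torusMoment R ΦN (y : N)) =
        fun y : S => Sobolev.const _ (h.meanMoment (y : N)) :=
      funext fun y => h.torusMoment_tilde hF hS y.2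
    rw [h3, h2.mD_eq]
    rfl
  have h1 : ∀ v w : EN, σN.val x ![v, w] = varpi G B (ΦN x)
      (mD 𝓘(ℝ, EN) 𝓘(ℝ, Sobolev (f - 1 / 2) E) ΦN x v)
      (mD 𝓘(ℝ, EN) 𝓘(ℝ, Sobolev (f - 1 / 2) E) ΦN x w) +
      (Form.pullback π σ : Form EN N 2).val x ![v, w] := fun v w =>
    eq_add_of_sub_eq' (h.holonomy.form x v w)
  have hsymm : ∀ X Y, restrictInner ET T B X Y = restrictInner ET T B Y X := fun X Y =>
    h.inner.symm _ _
  have h2 := Form.pullback_apply₂ (E' := V) (Subtype.val : S → N) σN x v w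
  rw [h1, hmomD, hmomD, ← h.map_const_meanMoment hF hS x.2,
    varpi_lieInclusion h.split h.exponent, varpi_const h.comm h.exponent hsymm, zero_add, Form.pullback_apply₂ π, hπD, hπD, ← hp] at h2
  rw [Form.pullback_apply₂]
  exact (Form.pullback_apply₂ (E' := V) (Subtype.val : F → M) σ (p x) _ _).trans h2.symm

theorem isHamiltonian_tilde (h : RegularData f B T act σN ΦN π σ Φ t R)
    (hF : IsFixedUnion (fun (g : G) (m : M) => g • m) t F) (hFc : IsClosed F)
    (hS : S = tildeSet ET T ΦN (hatSet act π t F)) [FiniteDimensional ℝ V]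
    [IsManifold 𝓘(ℝ, V) ∞ S] [IsManifold 𝓘(ℝ, V) ∞ F]
    (hι : IsSplitEmbedding V EN (Subtype.val : S → N))
    (hιF : IsSplitEmbedding V EM (Subtype.val : F → M)) (hp : ∀ x, (p x : M) = π x)
    (hpd : IsLocalDiffeomorph 𝓘(ℝ, V) 𝓘(ℝ, V) ∞ p) [MulAction T F] [MulAction T S]
    (hactF : ∀ (τ : T) (m : F), ((τ • m : F) : M) = (τ : G) • (m : M))
    (hactS : ∀ (τ : T) (x : S), ((τ • x : S) : N) = act (fun _ => (τ : G)) x) {ΦF : F → T}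
    (hΦF : ∀ m : F, (ΦF m : G) = Φ m)
    (hGF : IsGroupHamiltonian (restrictInner ET T B) (σ.restrict V F) ΦF) :
    IsHamiltonian T (restrictInner ET T B) (σN.restrict V S) fun x => h.meanMoment (x : N) := by
  have := h.loop.isManifold
  have := h.loop.t2
  have hlog : ∀ τ : T, HasLogDeriv (fun _ => τ) (Sobolev.const (f - 1 / 2) (0 : ET)) := fun τ => by
    rw [map_zero]
    exact hasLogDeriv_const τ
  have hsmooth_act : ContMDiff (𝓘(ℝ, ET).prod 𝓘(ℝ, V)) 𝓘(ℝ, V) ∞ fun q : T × S => q.1 • q.2 := by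
    refine hι.contMDiff ?_
    simp only [hactS]
    exact h.isSmoothAction_const.smooth.comp ((h.split.smooth.comp contMDiff_fst).prodMk
      (hι.smooth.comp contMDiff_snd))
  have hps := hpd.contMDiff
  have hequiv : ∀ (τ : T) (x : S), p (τ • x) = τ • p x := fun τ x => Subtype.ext (by
    rw [hp, hactS, hactF, hp]
    exact h.proj_torusAct (hlog τ) x)
  have hform := h.form_tilde hF hS hι hιF hp
  have hΦp : ∀ x, ΦF (p x) = lieExp T (h.meanMoment (x : N)) := fun x => Subtype.ext (by
    have h1 := h.lieExp_mean (h.map_const_meanMoment hF hS x.2)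
    rw [Sobolev.mean_const] at h1
    rw [hΦF, hp, h1])
  have hψ : ContMDiff 𝓘(ℝ, V) 𝓘(ℝ, ET) ∞ fun x : S => h.meanMoment (x : N) :=
    h.contMDiff_meanMoment.comp hι.smooth
  refine
    { finiteDimensional := inferInstance
      isManifold := inferInstance
      t2 := inferInstance
      secondCountable := ?_
      smooth_action := hsmooth_act
      smooth_form := h.loop.smooth_form.pullback hι.smooth
      closed := fun x => ?_
      nondegenerate := fun x v hv => ?_
      invariant := fun τ => ?_
      smooth_moment := hψ
      equivariant := fun τ x => ?_
      moment := fun ξ x v => ?_ }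
  · have := (h.isProperMap_meanMoment hF hFc hS).sigmaCompactSpace
    exact ChartedSpace.secondCountable_of_sigmaCompact V S
  · rw [← hform]
    refine (Form.d_pullback hps hGF.smooth_form x).trans ?_
    rw [hGF.d_eq_zero_of_comm h.comm]
    exact ContinuousAlternatingMap.ext fun w => rfl
  · let Q : V ≃L[ℝ] V := hpd.mfderivToContinuousLinearEquiv (by simp) x
    have hQ : ∀ v : V, Q v = mD 𝓘(ℝ, V) 𝓘(ℝ, V) p x v := fun v => rfl
    have h1 : ∀ w : V, (σ.restrict V F).val (p x) ![Q v, w] = 0 := by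
      intro w
      have h2 := hv (Q.symm w)
      rw [← hform] at h2
      have h3 := (Form.pullback_apply₂ (E' := V) p (σ.restrict V F) x v (Q.symm w)).symm.trans h2
      rw [← hQ (Q.symm w), Q.apply_symm_apply] at h3
      exact h3
    have h4 := hGF.nondegenerate_of_comm h.comm (p x) (Q v) h1
    exact Q.injective (h4.trans (map_zero Q).symm)
  · have hτ := (isSmoothAction_smul hsmooth_act).smooth_apply τ
    unfold Form.restrict
    rw [Form.pullback_pullback hι.smooth hτ]
    simp only [hactS]
    rw [← Form.pullback_pullback (h.isSmoothAction_const.smooth_apply (τ : G)) hι.smooth]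
    have h1 : Form.pullback (act fun _ => (τ : G)) σN = σN :=
      h.loop.invariant _ ⟨_, hasLogDeriv_const (τ : G)⟩
    exact congrArg _ h1
  · rw [Ad_eq, AdL_of_comm h.comm, hactS]
    have h1 := (h.torusAct_mem_tilde hF hS (hlog τ) x.2).2
    rw [sub_zero] at h1
    exact h1
  · have h1 := hGF.moment_of_comm h.comm hps hψ hΦp ξ x v
    refine Eq.trans ?_ h1
    rw [← hform, genField_eq]
    refine (Form.pullback_apply₂ (E' := V) p (σ.restrict V F) x (genFieldL ET V T x ξ) v).trans ?_
    have h2 := (hps.hasD x).comp (hasD_smul hsmooth_act x) (one_smul T x)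
    simp only [hequiv] at h2
    have h3 := h2.unique (hasD_smul hGF.smooth_action (p x))
    have h4 : mD 𝓘(ℝ, V) 𝓘(ℝ, V) p x (genFieldL ET V T x ξ) = genFieldL ET V T (p x) ξ := by
      have h5 := congrArg (fun L : ET →L[ℝ] V => L ξ) h3
      simpa using h5
    have h6 : ∀ v : V, (σ.restrict V F).val (p x) ![mD 𝓘(ℝ, V) 𝓘(ℝ, V) p x (genFieldL ET V T x ξ),
        mD 𝓘(ℝ, V) 𝓘(ℝ, V) p x v] = (σ.restrict V F).val (p x) ![genFieldL ET V T (p x) ξ,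
        mD 𝓘(ℝ, V) 𝓘(ℝ, V) p x v] := fun v => by rw [h4]
    exact h6 v

lemma hasLogDeriv_lattice (h : RegularData f B T act σN ΦN π σ Φ t R) {X : ET}
    (hX : X ∈ integralLattice ET T) :
    HasLogDeriv (latticeLoop T X) (Sobolev.const (f - 1 / 2) (-X)) := by
  rw [map_neg]
  exact hasLogDeriv_latticeLoop h.comm hX

lemma torusAct_lattice_mem (h : RegularData f B T act σN ΦN π σ Φ t R)
    (hF : IsFixedUnion (fun (g : G) (m : M) => g • m) t F)
    (hS : S = tildeSet ET T ΦN (hatSet act π t F)) {X : ET} (hX : X ∈ integralLattice ET T) {x : N}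
    (hx : x ∈ S) : torusAct T act (latticeLoop T X) x ∈ S ∧
      h.meanMoment (torusAct T act (latticeLoop T X) x) = h.meanMoment x + X := by
  have h1 := h.torusAct_mem_tilde hF hS (h.hasLogDeriv_lattice hX) hx
  rwa [sub_neg_eq_add] at h1

lemma zero_mem_lattice : (0 : ET) ∈ integralLattice ET T := lieExp_zero

lemma torusAct_lattice_zero (h : RegularData f B T act σN ΦN π σ Φ t R) (x : N) :
    torusAct T act (latticeLoop T (0 : ET)) x = x := by
  rw [latticeLoop_eq_expLoop (f := f), map_zero, neg_zero, expLoop_zero, h.torusAct_one]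

lemma add_mem_lattice (h : RegularData f B T act σN ΦN π σ Φ t R) {X Y : ET}
    (hX : X ∈ integralLattice ET T) (hY : Y ∈ integralLattice ET T) :
    X + Y ∈ integralLattice ET T := by
  have hX' : lieExp T X = 1 := hX
  have hY' : lieExp T Y = 1 := hY
  change lieExp T (X + Y) = 1
  rw [lieExp_add h.comm, hX', hY', one_mul]

lemma torusAct_lattice_add (h : RegularData f B T act σN ΦN π σ Φ t R) {X Y : ET}
    (hX : X ∈ integralLattice ET T) (hY : Y ∈ integralLattice ET T) (x : N) :
    torusAct T act (latticeLoop T (X + Y)) x =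
      torusAct T act (latticeLoop T X) (torusAct T act (latticeLoop T Y) x) := by
  rw [← h.torusAct_mul (h.hasLogDeriv_lattice hX) (h.hasLogDeriv_lattice hY),
    latticeLoop_eq_expLoop (f := f), latticeLoop_eq_expLoop (f := f) X,
    latticeLoop_eq_expLoop (f := f) Y, ← expLoop_add h.comm, map_add, neg_add]

lemma torusAct_comm (h : RegularData f B T act σN ΦN π σ Φ t R) {γ δ : UnitAddCircle → T}
    {b c : Sobolev (f - 1 / 2) ET} (hγ : HasLogDeriv γ b) (hδ : HasLogDeriv δ c) (x : N) :
    torusAct T act γ (torusAct T act δ x) = torusAct T act δ (torusAct T act γ x) := by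
  rw [← h.torusAct_mul hγ hδ, ← h.torusAct_mul hδ hγ]
  congr 1
  funext z
  exact h.comm _ _

/-- The fibres of the projection from the points with constant moment are lattice orbits. -/
lemma proj_eq_iff_lattice (h : RegularData f B T act σN ΦN π σ Φ t R)
    (hF : IsFixedUnion (fun (g : G) (m : M) => g • m) t F)
    (hS : S = tildeSet ET T ΦN (hatSet act π t F)) {x y : N} (hx : x ∈ S) (hy : y ∈ S) :
    π x = π y ↔ ∃ X ∈ integralLattice ET T, torusAct T act (latticeLoop T X) x = y := by
  constructor
  · intro hxy
    obtain ⟨h1, -, h3⟩ := h.exists_torusAct_eq (h.map_const_meanMoment hF hS hx)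
      (h.map_const_meanMoment hF hS hy) hxy
    rw [← map_sub] at h1 h3
    rw [integral_const_sobolev] at h1
    refine ⟨h.meanMoment y - h.meanMoment x, ?_, ?_⟩
    · change lieExp T _ = 1
      rw [← neg_sub, lieExp_neg h.comm, h1, inv_one]
    · rw [latticeLoop_eq_expLoop (f := f), ← map_neg, neg_sub]
      exact h3
  · rintro ⟨X, hX, rfl⟩
    rw [h.proj_torusAct (h.hasLogDeriv_lattice hX), latticeLoop_zero_apply]
    simp

/-- The fibres of the straightening are the orbits of loops of mean zero. -/
lemma straighten_eq_iff (h : RegularData f B T act σN ΦN π σ Φ t R)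
    (hF : IsFixedUnion (fun (g : G) (m : M) => g • m) t F) {x y : N} (hx : x ∈ hatSet act π t F)
    (hy : y ∈ hatSet act π t F) : h.straighten x = h.straighten y ↔
      ∃ γ ∈ basedLoopGroupZero f ET T, torusAct T act γ x = y := by
  have hx' := ((h.mem_hatSet_iff hF).1 hx).2
  have hy' := ((h.mem_hatSet_iff hF).1 hy).2
  constructor
  · intro hxy
    have hπ : π x = π y := by rw [← h.proj_straighten, hxy, h.proj_straighten]
    obtain ⟨-, -, h3⟩ := h.exists_torusAct_eq hx' hy' hπ
    refine ⟨_, (mem_basedLoopGroupZero_iff h.comm h.exponent).2 ⟨_, ?_, rfl⟩, h3⟩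
    rw [map_sub, ← h.mean_torusMoment_straighten hx', hxy, h.mean_torusMoment_straighten hy',
      sub_self]
  · rintro ⟨γ, hγ, rfl⟩
    obtain ⟨b, hb, rfl⟩ := (mem_basedLoopGroupZero_iff h.comm h.exponent).1 hγ
    have hlog := h.hasLogDeriv_of_mean hb
    refine h.ext_point ?_ ?_
    · rw [h.proj_straighten, h.proj_straighten, h.proj_torusAct hlog, expLoop_zero_apply]
      simp
    · rw [← h.moment_straighten hx', ← h.moment_straighten hy', h.torusMoment_torusAct hF hlog hx,
        map_sub, hb, sub_zero]

end RegularData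

end ConstantMoment


/-! ### Compatible slices of the fixed point sets -/

section CompatibleSlices

variable {E : Type*} [NormedAddCommGroup E] [NormedSpace ℝ E] [FiniteDimensional ℝ E]
  [CompleteSpace E]
  {G : Type*} [TopologicalSpace G] [ChartedSpace E G] [Group G] [LieGroup 𝓘(ℝ, E) ∞ G]
  [T2Space G] [CompactSpace G]
  {ET : Type*} [NormedAddCommGroup ET] [NormedSpace ℝ ET] [FiniteDimensional ℝ ET]
  [CompleteSpace ET]
  {EM : Type*} [NormedAddCommGroup EM] [NormedSpace ℝ EM]
  {M : Type*} [TopologicalSpace M] [ChartedSpace EM M] [MulAction G M]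
  {EN : Type u} [NormedAddCommGroup EN] [NormedSpace ℝ EN]
  {N : Type*} [TopologicalSpace N] [ChartedSpace EN N]
  {f : ℝ} {B : E →L[ℝ] E →L[ℝ] ℝ} {T : Subgroup G} [ChartedSpace ET T]
  [LieGroup 𝓘(ℝ, ET) ∞ T] {act : (UnitAddCircle → G) → N → N} {σN : Form EN N 2}
  {ΦN : N → Sobolev (f - 1 / 2) E} {π : N → M} {σ : Form EM M 2} {Φ : M → G} {t : G}
  {R : E →L[ℝ] ET} {F : Set M} {S : Set N}
  {V : Type*} [NormedAddCommGroup V] [NormedSpace ℝ V] [FiniteDimensional ℝ V]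
  {p : S → F} {q : hatSet act π t F → S} {πF : hatSet act π t F → F}

namespace RegularData

lemma exists_slices_tilde (h : RegularData f B T act σN ΦN π σ Φ t R)
    (hF : IsFixedUnion (fun (g : G) (m : M) => g • m) t F)
    (hS : S = tildeSet ET T ΦN (hatSet act π t F)) (hp : ∀ x, (p x : M) = π x)
    (c : ∀ m : F, SliceAt V EM F m) :
    ∃ d : ∀ x : S, SliceAt V EN S x, (∀ (x : S) (y : N), (d x).r y = (c (p x)).r (π y)) ∧
      ∀ x : S, (d x).U ⊆ π ⁻¹' (c (p x)).U := by
  subst hS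
  choose d hd hdU using fun x => h.exists_slice_tilde hF x (c (p x)) (hp x)
  exact ⟨d, fun x y => by rw [hd], hdU⟩

lemma exists_slices_hat (h : RegularData f B T act σN ΦN π σ Φ t R)
    (hF : IsFixedUnion (fun (g : G) (m : M) => g • m) t F) (hπF : ∀ x, (πF x : M) = π x)
    (hq : ∀ x, (q x : N) = h.straighten x) (c : ∀ m : F, SliceAt V EM F m)
    (d : ∀ x : S, SliceAt V EN S x) (x₀ : hatSet act π t F) [CompleteSpace EN] :
    ∃ K : Submodule ℝ EN, CompleteSpace K ∧ ∃ (Q : K ≃L[ℝ] V × h.meanZero)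
      (b : ∀ x : hatSet act π t F, SliceAt K EN (hatSet act π t F) x),
      (∀ (x : hatSet act π t F) (y : N), (Q ((b x).r y)).1 = (c (πF x)).r (π y)) ∧
      (∀ x : hatSet act π t F, (b x).U ⊆ π ⁻¹' (c (πF x)).U) ∧
      ∀ x : hatSet act π t F, (b x).U ⊆ h.straighten ⁻¹' (d (q x)).U := by
  choose b hb hbU hbO using fun x : hatSet act π t F =>
    h.exists_slice_hat hF x (c (πF x)) (hπF x)
      ((d (q x)).isOpen_U.preimage h.contMDiff_straighten.continuous)
      (by
        change h.straighten x ∈ (d (q x)).U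
        rw [← hq]
        exact (d (q x)).mem_U)
  obtain ⟨K, hK, ⟨Q⟩⟩ := (b x₀).exists_submodule
  refine ⟨K, hK, Q.symm, fun x => (b x).transport Q, fun x y => ?_, hbU, hbO⟩
  rw [← hb x y]
  exact congrArg Prod.fst (Q.symm_apply_apply _)

open Classical in
/-- The action of the loop group of the torus on the fixed point set. -/
def hatAct (h : RegularData f B T act σN ΦN π σ Φ t R)
    (hF : IsFixedUnion (fun (g : G) (m : M) => g • m) t F) (γ : UnitAddCircle → T)
    (x : hatSet act π t F) : hatSet act π t F :=
  if hγ : γ ∈ loopGroup f ET T then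
    ⟨torusAct T act γ x, h.torusAct_mem_hatSet hF hγ.choose_spec x.2⟩ else x

lemma coe_hatAct (h : RegularData f B T act σN ΦN π σ Φ t R)
    (hF : IsFixedUnion (fun (g : G) (m : M) => g • m) t F) {γ : UnitAddCircle → T}
    (hγ : γ ∈ loopGroup f ET T) (x : hatSet act π t F) :
    (h.hatAct hF γ x : N) = torusAct T act γ x := by
  rw [hatAct, dif_pos hγ]

/-- The action of the torus on the fixed point set of the holonomy manifold. -/
abbrev mulActionFixed (h : RegularData f B T act σN ΦN π σ Φ t R)
    (hF : IsFixedUnion (fun (g : G) (m : M) => g • m) t F) : MulAction T F where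
  smul τ m := ⟨(τ : G) • (m : M), h.smul_mem hF τ m.2⟩
  one_smul m := Subtype.ext (one_smul G (m : M))
  mul_smul τ τ' m := Subtype.ext (mul_smul (τ : G) (τ' : G) (m : M))

lemma act_const_mem_tilde (h : RegularData f B T act σN ΦN π σ Φ t R)
    (hF : IsFixedUnion (fun (g : G) (m : M) => g • m) t F)
    (hS : S = tildeSet ET T ΦN (hatSet act π t F)) (τ : T) {x : N} (hx : x ∈ S) :
    act (fun _ => (τ : G)) x ∈ S :=
  (h.torusAct_mem_tilde hF hS (γ := fun _ => τ) (X := 0)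
    (by rw [map_zero]; exact hasLogDeriv_const τ) hx).1

/-- The action of the torus on the points with constant moment. -/
abbrev mulActionTilde (h : RegularData f B T act σN ΦN π σ Φ t R)
    (hF : IsFixedUnion (fun (g : G) (m : M) => g • m) t F)
    (hS : S = tildeSet ET T ΦN (hatSet act π t F)) : MulAction T S where
  smul τ x := ⟨act (fun _ => (τ : G)) x, h.act_const_mem_tilde hF hS τ x.2⟩
  one_smul x := Subtype.ext (h.isSmoothAction_const.one (x : N))
  mul_smul τ τ' x := Subtype.ext (h.isSmoothAction_const.mul (τ : G) (τ' : G) (x : N))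

open Classical in
/-- The action of the integral lattice on the points with constant moment. -/
def latticeAct (h : RegularData f B T act σN ΦN π σ Φ t R)
    (hF : IsFixedUnion (fun (g : G) (m : M) => g • m) t F)
    (hS : S = tildeSet ET T ΦN (hatSet act π t F)) (X : ET) (x : S) : S :=
  if hX : X ∈ integralLattice ET T then
    ⟨torusAct T act (latticeLoop T X) x, (h.torusAct_lattice_mem hF hS hX x.2).1⟩ else x

lemma coe_latticeAct (h : RegularData f B T act σN ΦN π σ Φ t R)
    (hF : IsFixedUnion (fun (g : G) (m : M) => g • m) t F)
    (hS : S = tildeSet ET T ΦN (hatSet act π t F)) {X : ET} (hX : X ∈ integralLattice ET T)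
    (x : S) : (h.latticeAct hF hS X x : N) = torusAct T act (latticeLoop T X) x := by
  rw [latticeAct, dif_pos hX]

lemma isImmersion_hat (h : RegularData f B T act σN ΦN π σ Φ t R)
    (hF : IsFixedUnion (fun (g : G) (m : M) => g • m) t F) (hFp : IsPreconnected F)
    {K : Type*} [NormedAddCommGroup K] [NormedSpace ℝ K] [ChartedSpace K (hatSet act π t F)]
    [IsManifold 𝓘(ℝ, K) ∞ (hatSet act π t F)]
    (hι : IsSplitEmbedding K EN (Subtype.val : hatSet act π t F → N))
    (hπF : ∀ x, (πF x : M) = π x) (hopen : IsOpenMap πF) (x₀ : hatSet act π t F) :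
    Manifold.IsImmersion 𝓘(ℝ, K) 𝓘(ℝ, EN) ∞ (Subtype.val : hatSet act π t F → N) := by
  have := h.loop.isManifold
  have := h.loop.complete
  have := Subtype.preconnectedSpace hFp
  refine hι.isImmersion hopen (fun m => ?_) x₀ fun x y hxy => ?_
  · obtain ⟨x, hx, hxm⟩ := h.exists_mem_tildeSet hF m.2
    exact ⟨⟨x, hx.1⟩, Subtype.ext ((hπF _).trans hxm)⟩
  · have hπ : π x = π y := by rw [← hπF, ← hπF, hxy]
    obtain ⟨-, h2, h3⟩ := h.exists_torusAct_eq ((h.mem_hatSet_iff hF).1 x.2).2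
      ((h.mem_hatSet_iff hF).1 y.2).2 hπ
    exact h.sameType_torusAct hι h2 (fun x hx => h.torusAct_mem_hatSet hF h2 hx)
      (fun x hx => h.torusAct_mem_hatSet hF (h2.inv_of_comm h.comm) hx) h3

lemma isImmersion_tilde (h : RegularData f B T act σN ΦN π σ Φ t R)
    (hF : IsFixedUnion (fun (g : G) (m : M) => g • m) t F) (hFp : IsPreconnected F)
    (hS : S = tildeSet ET T ΦN (hatSet act π t F)) [ChartedSpace V S] [IsManifold 𝓘(ℝ, V) ∞ S]
    (hι : IsSplitEmbedding V EN (Subtype.val : S → N)) (hp : ∀ x, (p x : M) = π x)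
    (hsurj : Function.Surjective p) (hopen : IsOpenMap p) (x₀ : S) :
    Manifold.IsImmersion 𝓘(ℝ, V) 𝓘(ℝ, EN) ∞ (Subtype.val : S → N) := by
  have := h.loop.isManifold
  have := h.loop.complete
  have := Subtype.preconnectedSpace hFp
  refine hι.isImmersion hopen hsurj x₀ fun x y hxy => ?_
  have hπ : π x = π y := by rw [← hp, ← hp, hxy]
  obtain ⟨X, hX, h1⟩ := (h.proj_eq_iff_lattice hF hS x.2 y.2).1 hπ
  have h2 := h.hasLogDeriv_lattice hX
  have h3 := h2.inv_of_comm h.comm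
  rw [← map_neg] at h3
  exact h.sameType_torusAct hι h2 (fun x hx => (h.torusAct_mem_tilde hF hS h2 hx).1)
    (fun x hx => (h.torusAct_mem_tilde hF hS h3 hx).1) h1

lemma pullback_latticeAct (h : RegularData f B T act σN ΦN π σ Φ t R)
    (hF : IsFixedUnion (fun (g : G) (m : M) => g • m) t F)
    (hS : S = tildeSet ET T ΦN (hatSet act π t F)) [ChartedSpace V S]
    (hι : IsSplitEmbedding V EN (Subtype.val : S → N)) {X : ET} (hX : X ∈ integralLattice ET T) :
    ContMDiff 𝓘(ℝ, V) 𝓘(ℝ, V) ∞ (h.latticeAct hF hS X) ∧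
      Form.pullback (h.latticeAct hF hS X) (σN.restrict V S) = σN.restrict V S := by
  have hlog := h.hasLogDeriv_lattice hX
  have hsm : ContMDiff 𝓘(ℝ, V) 𝓘(ℝ, V) ∞ (h.latticeAct hF hS X) := by
    refine hι.contMDiff ?_
    simp only [h.coe_latticeAct hF hS hX]
    exact (h.contMDiff_torusAct hlog).comp hι.smooth
  refine ⟨hsm, ?_⟩
  unfold Form.restrict
  rw [Form.pullback_pullback hι.smooth hsm]
  simp only [h.coe_latticeAct hF hS hX]
  rw [← Form.pullback_pullback (h.contMDiff_torusAct hlog) hι.smooth]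
  have h1 : Form.pullback (torusAct T act (latticeLoop T X)) σN = σN :=
    h.loop.invariant _ ⟨_, hlog.val h.split⟩
  rw [h1]

end RegularData

end CompatibleSlices

end LoopGeometry
end

open LoopGeometry in
theorem proposition4p3
    -- a compact connected Lie group `G`, an invariant inner product `B`, a maximal torus `T`
    {E : Type*} [NormedAddCommGroup E] [NormedSpace ℝ E] [FiniteDimensional ℝ E] [CompleteSpace E]
    {G : Type*} [TopologicalSpace G] [ChartedSpace E G] [Group G] [LieGroup 𝓘(ℝ, E) ∞ G]
    [T2Space G] [CompactSpace G] [ConnectedSpace G]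
    (B : E →L[ℝ] E →L[ℝ] ℝ) (hB : IsInvariantInner G B)
    {ET : Type*} [NormedAddCommGroup ET] [NormedSpace ℝ ET] [FiniteDimensional ℝ ET]
    [CompleteSpace ET]
    (T : Subgroup G) [ChartedSpace ET T] [LieGroup 𝓘(ℝ, ET) ∞ T]
    (hTG : Manifold.IsSmoothEmbedding 𝓘(ℝ, ET) 𝓘(ℝ, E) ∞ (Subtype.val : T → G))
    (hT : IsMaximalTorus T)
    -- the Sobolev level
    (f : ℝ) (hf : 1 < f)
    -- a group-valued Hamiltonian `G`-space `(M, σ, Φ)`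
    {EM : Type*} [NormedAddCommGroup EM] [NormedSpace ℝ EM]
    {M : Type*} [TopologicalSpace M] [ChartedSpace EM M] [MulAction G M]
    (σ : Form EM M 2) (Φ : M → G) (hM : IsGroupHamiltonian B σ Φ)
    -- the corresponding Hamiltonian `LG`-manifold `(N, σN, ΦN)`
    {EN : Type u} [NormedAddCommGroup EN] [NormedSpace ℝ EN]
    {N : Type*} [TopologicalSpace N] [ChartedSpace EN N]
    (act : (UnitAddCircle → G) → N → N) (σN : Form EN N 2) (ΦN : N → Sobolev (f - 1 / 2) E)
    (π : N → M) (hN : IsLoopHamiltonian f B act σN ΦN)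
    (hNM : IsHolonomyManifold f B act σN ΦN π σ Φ)
    -- a regular element `t` of `T` and the component `F` of `m₀` in `M^t`
    (t : G) (ht : t ∈ T) (hreg : Subgroup.centralizer {t} = T)
    (m₀ : M) (hm₀ : t • m₀ = m₀)
    (F : Set M) (hF : F = fixedComponent t m₀)
    (Fhat : Set N) (hFhat : Fhat = hatSet act π t F)
    (Ftilde : Set N) (hFtilde : Ftilde = tildeSet ET T ΦN Fhat) :
    -- (a)
    ∃ (k : ℕ) (_ : ChartedSpace (EuclideanSpace ℝ (Fin k)) F) (_ : MulAction T F) (ΦF : F → T),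
      Manifold.IsSmoothEmbedding 𝓘(ℝ, EuclideanSpace ℝ (Fin k)) 𝓘(ℝ, EM) ∞
        (Subtype.val : F → M) ∧
      (∀ (τ : T) (x : F), ((τ • x : F) : M) = (τ : G) • (x : M)) ∧
      (∀ x : F, (ΦF x : G) = Φ x) ∧
      IsGroupHamiltonian (restrictInner ET T B) (σ.restrict (EuclideanSpace ℝ (Fin k)) F) ΦF ∧
    -- (b)
    ∃ (EF : Type u) (_ : NormedAddCommGroup EF) (_ : NormedSpace ℝ EF) (_ : ChartedSpace EF Fhat)
      (actT : (UnitAddCircle → T) → Fhat → Fhat) (ΦFhat : Fhat → Sobolev (f - 1 / 2) ET)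
      (πF : Fhat → F),
      Manifold.IsSmoothEmbedding 𝓘(ℝ, EF) 𝓘(ℝ, EN) ∞ (Subtype.val : Fhat → N) ∧
      (∀ γ ∈ loopGroup f ET T, ∀ x : Fhat, (actT γ x : N) = act (fun z => (γ z : G)) x) ∧
      (∀ (x : Fhat) (z : UnitAddCircle), lieInclusion E T (ΦFhat x z) = ΦN x z) ∧
      (∀ x : Fhat, (πF x : M) = π x) ∧
      IsLoopHamiltonian f (restrictInner ET T B) actT
        (σN.restrict EF Fhat) ΦFhat ∧
      IsHolonomyManifold f (restrictInner ET T B) actT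
        (σN.restrict EF Fhat) ΦFhat
        πF (σ.restrict (EuclideanSpace ℝ (Fin k)) F) ΦF ∧
    -- (c)
    ∃ (l : ℕ) (_ : ChartedSpace (EuclideanSpace ℝ (Fin l)) Ftilde) (_ : MulAction T Ftilde)
      (ΦFtilde : Ftilde → ET) (lat : ET → Ftilde → Ftilde) (p : Ftilde → F) (q : Fhat → Ftilde),
      Manifold.IsSmoothEmbedding 𝓘(ℝ, EuclideanSpace ℝ (Fin l)) 𝓘(ℝ, EN) ∞
        (Subtype.val : Ftilde → N) ∧
      (∀ (τ : T) (x : Ftilde), ((τ • x : Ftilde) : N) = act (fun _ => (τ : G)) x) ∧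
      (∀ (x : Ftilde) (z : UnitAddCircle), lieInclusion E T (ΦFtilde x) = ΦN x z) ∧
      IsHamiltonian T (restrictInner ET T B) (σN.restrict (EuclideanSpace ℝ (Fin l)) Ftilde) ΦFtilde ∧
      -- the free symplectic action of `Λ ⊆ LT`, commuting with `T`
      (∀ X ∈ integralLattice ET T, ∀ x : Ftilde,
        (lat X x : N) = act (fun z => (latticeLoop T X z : G)) x) ∧
      (∀ x, lat 0 x = x) ∧
      (∀ X ∈ integralLattice ET T, ∀ Y ∈ integralLattice ET T, ∀ x,
        lat (X + Y) x = lat X (lat Y x)) ∧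
      (∀ X ∈ integralLattice ET T, ∀ x, lat X x = x → X = 0) ∧
      (∀ X ∈ integralLattice ET T,
        ContMDiff 𝓘(ℝ, EuclideanSpace ℝ (Fin l)) 𝓘(ℝ, EuclideanSpace ℝ (Fin l)) ∞ (lat X)) ∧
      (∀ X ∈ integralLattice ET T,
        Form.pullback (lat X) (σN.restrict (EuclideanSpace ℝ (Fin l)) Ftilde) =
          σN.restrict (EuclideanSpace ℝ (Fin l)) Ftilde) ∧
      (∀ X ∈ integralLattice ET T, ∀ (τ : T) (x : Ftilde), lat X (τ • x) = τ • lat X x) ∧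
      -- `F = Ftilde / Λ` as a symplectic `T`-manifold
      (∀ x : Ftilde, (p x : M) = π x) ∧
      Function.Surjective p ∧
      IsLocalDiffeomorph 𝓘(ℝ, EuclideanSpace ℝ (Fin l)) 𝓘(ℝ, EuclideanSpace ℝ (Fin k)) ∞ p ∧
      (∀ x y, p x = p y ↔ ∃ X ∈ integralLattice ET T, lat X x = y) ∧
      (∀ (τ : T) (x : Ftilde), p (τ • x) = τ • p x) ∧
      Form.pullback p (σ.restrict (EuclideanSpace ℝ (Fin k)) F) =
        σN.restrict (EuclideanSpace ℝ (Fin l)) Ftilde ∧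
      -- `Ftilde = Fhat / Ω₀T`
      Manifold.IsSubmersion 𝓘(ℝ, EF) 𝓘(ℝ, EuclideanSpace ℝ (Fin l)) ∞ q ∧
      (∀ (x : Fhat) (y : Ftilde), (x : N) = y → q x = y) ∧
      (∀ x y, q x = q y ↔ ∃ γ ∈ basedLoopGroupZero f ET T, actT γ x = y) := by
  have hs := isSplitEmbedding_of_isSmoothEmbedding hTG
  obtain ⟨R, hR⟩ := hs.exists_leftInverse 1
  have h : RegularData f B T act σN ΦN π σ Φ t R :=
    { exponent := by linarith
      inner := hB
      split := hs
      comm := fun a b => Subtype.ext (hT.1.2.2 a a.2 b b.2)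
      connected := isConnected_iff_connectedSpace.1 hT.1.2.1
      regular := hreg
      retract := fun X => congrArg (fun L : ET →L[ℝ] ET => L X) hR
      group := hM
      loop := hN
      holonomy := hNM }
  have := hM.finiteDimensional
  have := hM.isManifold
  have := hM.t2
  have := hN.isManifold
  have := hN.complete
  have : CompleteSpace EM := FiniteDimensional.complete ℝ EM
  have hsmul := isSmoothAction_smul hM.smooth_action
  have hFU : IsFixedUnion (fun (g : G) (m : M) => g • m) t F := by
    rw [hF]
    exact isFixedUnion_connectedComponentIn m₀
  have hFp : IsPreconnected F := by
    rw [hF]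
    exact isPreconnected_connectedComponentIn
  have hmF : m₀ ∈ F := by
    rw [hF]
    exact mem_connectedComponentIn hm₀
  have hFc : IsClosed F := by
    refine isClosed_of_closure_subset (hFU.2 _ ?_ hFp.closure ⟨m₀, subset_closure hmF, hmF⟩)
    exact closure_minimal hFU.1
      (isClosed_eq (hsmul.smooth_apply t).continuous continuous_id)
  obtain ⟨k, ⟨c⟩⟩ : ∃ k : ℕ, Nonempty (∀ m : F, SliceAt (EuclideanSpace ℝ (Fin k)) EM F m) := by
    rw [hF]
    exact exists_slices_connectedComponentIn hsmul m₀
  subst hFhat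
  obtain ⟨x₁, hx₁, -⟩ := h.exists_mem_tildeSet hFU hmF
  let x₀ : hatSet act π t F := ⟨x₁, hx₁.1⟩
  let y₀ : Ftilde := ⟨x₁, hFtilde.superset hx₁⟩
  let πF : hatSet act π t F → F := fun x => ⟨π x, x.2.2⟩
  have hSF : ∀ x : Ftilde, (x : N) ∈ hatSet act π t F := fun x =>
    (hFtilde.subset x.2).1
  let p : Ftilde → F := fun x => ⟨π x, (hSF x).2⟩
  let q : hatSet act π t F → Ftilde := fun x => ⟨h.straighten x,
    hFtilde.superset (h.straighten_mem hFU x.2)⟩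
  obtain ⟨d, hdr, hdU⟩ := h.exists_slices_tilde hFU hFtilde (p := p) (fun _ => rfl) c
  obtain ⟨K, hK, Q, b, hbr, hbU, hbO⟩ :=
    h.exists_slices_hat hFU (πF := πF) (q := q) (fun _ => rfl) (fun _ => rfl) c d x₀
  let instF := sliceChartedSpace c
  let instS := sliceChartedSpace d
  let instH := sliceChartedSpace b
  have := isManifold_sliceChartedSpace c
  have := isManifold_sliceChartedSpace d
  have := isManifold_sliceChartedSpace b
  have hιF := isSplitEmbedding_sliceChartedSpace c
  have hιS := isSplitEmbedding_sliceChartedSpace d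
  have hιH := isSplitEmbedding_sliceChartedSpace b
  let actF := h.mulActionFixed hFU
  let actS := h.mulActionTilde hFU hFtilde
  let ΦF : F → T := fun m => ⟨Φ m, h.moment_mem (hFU.1 m.2)⟩
  have hqs : Continuous q :=
    (h.contMDiff_straighten.continuous.comp continuous_subtype_val).subtype_mk _
  have hπFs : Continuous πF :=
    (h.contMDiff_proj.continuous.comp continuous_subtype_val).subtype_mk _
  obtain ⟨hπsub, hπopen⟩ := isSubmersion_slices b c Q hπFs (fun x y hy => hbU x hy)
    (fun x y _ => (hbr x y).symm)
  have hpq : ∀ x, p (q x) = πF x := fun x => Subtype.ext (h.proj_straighten x)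
  obtain ⟨hqsub, -⟩ := isSubmersion_slices b d Q hqs (fun x y hy => hbO x hy) fun x y _ => by
    rw [hdr, hbr, hpq]
    exact congrArg _ (h.proj_straighten y)
  have hpd := isLocalDiffeomorph_slices c (p := p) d (fun x y hy => hdU x hy)
    (fun x y _ => (hdr x y).symm)
  have hpsurj : Function.Surjective p := fun m => by
    obtain ⟨x, hx, hxm⟩ := h.exists_mem_tildeSet hFU m.2
    exact ⟨⟨x, hFtilde.superset hx⟩, Subtype.ext hxm⟩
  have hGF : IsGroupHamiltonian (restrictInner ET T B)
      (σ.restrict (EuclideanSpace ℝ (Fin k)) F) ΦF :=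
    hM.restrict_fixed hB hs h.comm hreg hFU hFc hιF (fun _ _ => rfl) fun _ => rfl
  have hlat : ∀ X ∈ integralLattice ET T, ∀ x : Ftilde,
      (h.latticeAct hFU hFtilde X x : N) = torusAct T act (latticeLoop T X) x :=
    fun X hX x => h.coe_latticeAct hFU hFtilde hX x
  refine ⟨k, instF, actF, ΦF, ⟨?_, hιF.isEmbedding⟩, fun _ _ => rfl, fun _ => rfl, hGF,
    K, inferInstance, inferInstance, instH, h.hatAct hFU, fun x => torusMoment R ΦN (x : N), πF,
    ⟨h.isImmersion_hat hFU hFp hιH (πF := πF) (fun _ => rfl) hπopen x₀, hιH.isEmbedding⟩,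
    fun γ hγ x => h.coe_hatAct hFU hγ x, fun x z => ?_, fun _ => rfl,
    h.isLoopHamiltonian_hat hFU hιH fun γ hγ x => h.coe_hatAct hFU hγ x,
    h.isHolonomyManifold_hat hFU hFc hιH (fun γ hγ x => h.coe_hatAct hFU hγ x) hιF
      (fun _ _ => rfl) (fun _ => rfl) (fun _ => rfl) hπsub,
    k, instS, actS, fun x => h.meanMoment (x : N), h.latticeAct hFU hFtilde, p, q,
    ⟨h.isImmersion_tilde hFU hFp hFtilde hιS (p := p) (fun _ => rfl) hpsurj
      hpd.isLocalHomeomorph.isOpenMap y₀, hιS.isEmbedding⟩,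
    fun _ _ => rfl, fun x z => ?_,
    h.isHamiltonian_tilde hFU hFc hFtilde hιS hιF (p := p) (fun _ => rfl) hpd (fun _ _ => rfl)
      (fun _ _ => rfl) (fun _ => rfl) hGF,
    hlat, fun x => ?_, fun X hX Y hY x => ?_, fun X hX x hx => ?_,
    fun X hX => (h.pullback_latticeAct hFU hFtilde hιS hX).1,
    fun X hX => (h.pullback_latticeAct hFU hFtilde hιS hX).2, fun X hX τ x => ?_, fun _ => rfl, hpsurj,
    hpd, fun x y => ?_, fun τ x => ?_, h.form_tilde hFU hFtilde hιS hιF fun _ => rfl, hqsub,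
    fun x y hxy => ?_, fun x y => ?_⟩
  · have := Subtype.preconnectedSpace hFp
    refine hιF.isImmersion IsOpenMap.id Function.surjective_id ⟨m₀, hmF⟩ fun x y hxy => ?_
    obtain rfl : x = y := hxy
    exact ⟨ContinuousLinearEquiv.refl ℝ EM, ContinuousLinearEquiv.refl ℝ _, fun v => rfl⟩
  · rw [← ((h.mem_hatSet_iff hFU).1 x.2).2, Sobolev.map_apply]
  · rw [← h.map_const_meanMoment hFU hFtilde x.2, Sobolev.map_apply, Sobolev.const_apply]
  · refine Subtype.ext ?_
    rw [hlat 0 RegularData.zero_mem_lattice, h.torusAct_lattice_zero]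
  · refine Subtype.ext ?_
    rw [hlat _ (h.add_mem_lattice hX hY), hlat X hX, hlat Y hY, h.torusAct_lattice_add hX hY]
  · have h1 := (h.torusAct_lattice_mem hFU hFtilde hX x.2).2
    rw [← hlat X hX, hx] at h1
    exact left_eq_add.1 h1
  · refine Subtype.ext ?_
    rw [hlat X hX]
    change torusAct T act (latticeLoop T X) (torusAct T act (fun _ => τ) x) =
      torusAct T act (fun _ => τ) (h.latticeAct hFU hFtilde X x)
    rw [hlat X hX]
    exact h.torusAct_comm (h.hasLogDeriv_lattice hX) (hasLogDeriv_const τ) x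
  · rw [Subtype.ext_iff]
    refine (h.proj_eq_iff_lattice hFU hFtilde x.2 y.2).trans ?_
    refine exists_congr fun X => and_congr_right fun hX => ?_
    rw [Subtype.ext_iff, hlat X hX]
  · exact Subtype.ext (h.proj_torusAct (hasLogDeriv_const τ) (x : N))
  · refine Subtype.ext ?_
    change h.straighten (x : N) = y
    rw [hxy]
    exact h.straighten_of_mem hFU (hFtilde.subset y.2)
  · rw [Subtype.ext_iff]
    refine (h.straighten_eq_iff hFU x.2 y.2).trans ?_
    refine exists_congr fun γ => and_congr_right fun hγ => ?_
    obtain ⟨-, a, ha, -⟩ := hγ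
    rw [Subtype.ext_iff, h.coe_hatAct hFU ⟨a, ha⟩]
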